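/- Let $T=(O,M,\mathrm{dom},\mathrm{cod})$ be a monoidal signature: sets $O$ (objects) and $M$ (morphisms) with functions $\mathrm{dom},\mathrm{cod}\colon M\to w(O)$ into the set of finite words over $O$. A *string graph* over $T$ is a finite directed multigraph whose vertices are wire-vertices (typed by elements of $O$) or box-vertices (typed by elements of $M$) and whose edges are of the following types: $\mathrm{mid}_X$, from an $X$-vertex to an $X$-vertex; $\mathrm{in}_{f,i}$, from a $\mathrm{dom}(f)_i$-vertex to an $f$-vertex; $\mathrm{out}_{f,j}$, from an $f$-vertex to a $\mathrm{cod}(f)_j$-vertex. Every wire-vertex has at most one in-edge and at most one out-edge, and every $f$-box-vertex has exactly one adjacent edge of each type $\mathrm{in}_{f,i}$, $\mathrm{out}_{f,j}$ and no other. Inputs (outputs) are the wire-vertices without in-edge (out-edge); a wire-vertex that is both is isolated. A *positive framed point graph* is a finite totally ordered set of isolated wire-vertices, all with sign $+$; it is identified, through its unique isomorphism, with the word of its types. A *positive framed cospan* $X\xrightarrow{d}G\xleftarrow{c}Y$ is a string graph $G$ without isolated wire-vertices with type-preserving maps $d,c$ that identify $X$ with the set of inputs of $G$ and $Y$ with the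 set of outputs of $G$. Two such cospans are *wire-homeomorphic* if they are related by the equivalence relation generated by isomorphism of cospans and by the insertion of one new wire-vertex into the middle of an edge, typed by the object carried by that edge. Let $\mathrm{FCsp}^+(\mathbb H,T)$ have the positive framed point graphs as objects and the wire-homeomorphism classes $|G|$ of positive framed cospans as morphisms; composition is by pushout over the common point graph, the identity of $X$ is represented by one edge per point of $X$, the monoidal product is disjoint union (concatenation on objects), the symmetry is represented by crossing edges, and $\mathrm{Tr}^X$ joins each output in $X$ to the corresponding input in $X$ by a wire. Let $E\colon T\to \mathrm{FCsp}^+(\mathbb H,T)$ send $Z\in O$ to the single point of type $Z$ and $m\in M$ to the class of the cospan with one box-vertex of type $m$, its inputs and its outputs. **Theorem.** $\mathrm{FCsp}^+(\mathbb H,T)$ is the free strict symmetric traced category on $T$. That is, it is a strict symmetric traced category, and for every strict symmetric traced category $\mathcal V$ and every homomorphism of monoidal signatures $F$ from $T$ to the underlying signature of $\mathcal V$ (whose morphisms are the morphisms $X_1\otimes\dots\otimes X_m\to Y_1\otimes\dots\otimes Y_n$ of $\mathcal V$ between products of words) there is exactly one strict symmetric traced functor $\widehat F\colon \mathrm{FCsp}^+(\mathbb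 H,T)\to\mathcal V$ with $\widehat F\circ E=F$. Moreover, $\widehat F$ is given by contraction normal forms. Let $X\xrightarrow{d}G\xleftarrow{c}Y$ be a positive framed cospan, let $x_1<\dots<x_k$ and $y_1<\dots<y_l$ be the images of the points of $X$ and of $Y$, and let $z_1,\dots,z_r$ be any enumeration of the other vertices of $G$. Put $F'(v)=F(m)$ for a box-vertex $v$ of type $m$ and $F'(v)=1_{F(Z)}$ for a wire-vertex $v$ of type $Z$. Then $\widehat F(|G|)$ is obtained from $$F'(x_1)\otimes\dots\otimes F'(x_k)\otimes F'(y_1)\otimes\dots\otimes F'(y_l)\otimes F'(z_1)\otimes\dots\otimes F'(z_r)$$ by contracting, for every edge $e$ of $G$ (in any order), the output of the factor of the source of $e$ with the input of the factor of the target of $e$ that $e$ connects. If $e$ has type $\mathrm{out}_{f,j}$ this is the $j$-th output of the source, and if $e$ has type $\mathrm{in}_{f,i}$ it is the $i$-th input of the target; otherwise it is the only output or the only input of an identity. Contracting an output and an input that carry the same object $A$ means moving both to the last position by symmetries and applying $\mathrm{Tr}^A$. -/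

import Mathlib

universe u v u₁ v₁ u₂ v₂ u₃ v₃

/-! ## Monoidal signatures -/

/-- A (strict) monoidal signature: objects, morphisms, and for each morphism its domain and codomain,
which are words (lists) of objects. -/
structure MonoidalSignature where
  Obj : Type u
  Mor : Type v
  dom : Mor → List Obj
  cod : Mor → List Obj

/-- A homomorphism of monoidal signatures. -/
structure MonoidalSignature.Hom (S : MonoidalSignature.{u₁, v₁}) (T : MonoidalSignature.{u₂, v₂}) where
  obj : S.Obj → T.Obj
  mor : S.Mor → T.Mor
  dom_mor : ∀ m, T.dom (mor m) = (S.dom m).map obj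
  cod_mor : ∀ m, T.cod (mor m) = (S.cod m).map obj

/-- Composition of homomorphisms of signatures (first `f`, then `g`). -/
def MonoidalSignature.Hom.comp {S : MonoidalSignature.{u₁, v₁}} {T : MonoidalSignature.{u₂, v₂}}
    {U : MonoidalSignature.{u₃, v₃}} (f : S.Hom T) (g : T.Hom U) : S.Hom U where
  obj := g.obj ∘ f.obj
  mor := g.mor ∘ f.mor
  dom_mor m := by simp [g.dom_mor, f.dom_mor]
  cod_mor m := by simp [g.cod_mor, f.cod_mor]

/-! ## Strict symmetric traced categories -/

open CategoryTheory

/-- The operations of a strict symmetric traced category, without their laws.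
`trace X f` is `Tr^X(f)`; composition `f ≫ g` is in diagrammatic order. -/
class TracedStruct (C : Type u) extends CategoryStruct.{v} C where
  unit : C
  tensor : C → C → C
  tensorHom : ∀ {A B A' B' : C}, (A ⟶ B) → (A' ⟶ B') → (tensor A A' ⟶ tensor B B')
  braid : ∀ A B : C, tensor A B ⟶ tensor B A
  trace : ∀ {A B : C} (X : C), (tensor A X ⟶ tensor B X) → (A ⟶ B)

infixr:70 " ⊙ " => TracedStruct.tensor
infixr:70 " ⊙ₘ " => TracedStruct.tensorHom

open TracedStruct in
/-- The laws of a strict symmetric traced category. The associativity and unit isomorphisms are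
identities: the tensor product is strictly associative and unital on objects, and also on morphisms,
where `Quiver.Hom.cast` only moves a morphism along equalities of its source and target. -/
class IsStrictSymmetricTraced (C : Type u) [TracedStruct.{u, v} C] : Prop where
  id_comp : ∀ {A B : C} (f : A ⟶ B), 𝟙 A ≫ f = f
  comp_id : ∀ {A B : C} (f : A ⟶ B), f ≫ 𝟙 B = f
  assoc : ∀ {A B D E : C} (f : A ⟶ B) (g : B ⟶ D) (h : D ⟶ E), (f ≫ g) ≫ h = f ≫ (g ≫ h)
  tensor_assoc : ∀ A B D : C, (A ⊙ B) ⊙ D = A ⊙ (B ⊙ D)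
  unit_tensor : ∀ A : C, unit ⊙ A = A
  tensor_unit : ∀ A : C, A ⊙ unit = A
  id_tensorHom_id : ∀ A B : C, 𝟙 A ⊙ₘ 𝟙 B = 𝟙 (A ⊙ B)
  comp_tensorHom_comp : ∀ {A B D A' B' D' : C} (f : A ⟶ B) (g : B ⟶ D) (f' : A' ⟶ B') (g' : B' ⟶ D'),
    (f ≫ g) ⊙ₘ (f' ≫ g') = (f ⊙ₘ f') ≫ (g ⊙ₘ g')
  tensorHom_assoc : ∀ {A B A' B' A'' B'' : C} (f : A ⟶ B) (g : A' ⟶ B') (h : A'' ⟶ B''),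
    ((f ⊙ₘ g) ⊙ₘ h).cast (tensor_assoc A A' A'') (tensor_assoc B B' B'') = f ⊙ₘ (g ⊙ₘ h)
  unit_tensorHom : ∀ {A B : C} (f : A ⟶ B),
    (𝟙 (unit : C) ⊙ₘ f).cast (unit_tensor A) (unit_tensor B) = f
  tensorHom_unit : ∀ {A B : C} (f : A ⟶ B),
    (f ⊙ₘ 𝟙 (unit : C)).cast (tensor_unit A) (tensor_unit B) = f
  braid_naturality : ∀ {A B A' B' : C} (f : A ⟶ B) (g : A' ⟶ B'),
    (f ⊙ₘ g) ≫ braid B B' = braid A A' ≫ (g ⊙ₘ f)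
  braid_braid : ∀ A B : C, braid A B ≫ braid B A = 𝟙 (A ⊙ B)
  hexagon : ∀ A B D : C,
    (braid A (B ⊙ D)).cast rfl (tensor_assoc B D A) =
      (braid A B ⊙ₘ 𝟙 D).cast (tensor_assoc A B D) (tensor_assoc B A D) ≫ (𝟙 B ⊙ₘ braid A D)
  trace_naturality : ∀ {A A' B B' : C} (X : C) (h : A' ⟶ A) (f : A ⊙ X ⟶ B ⊙ X) (g : B ⟶ B'),
    trace X ((h ⊙ₘ 𝟙 X) ≫ f ≫ (g ⊙ₘ 𝟙 X)) = h ≫ trace X f ≫ g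
  trace_sliding : ∀ {A B X Y : C} (f : A ⊙ X ⟶ B ⊙ Y) (g : Y ⟶ X),
    trace Y ((𝟙 A ⊙ₘ g) ≫ f) = trace X (f ≫ (𝟙 B ⊙ₘ g))
  trace_unit : ∀ {A B : C} (f : A ⊙ unit ⟶ B ⊙ unit),
    trace unit f = f.cast (tensor_unit A) (tensor_unit B)
  trace_tensor : ∀ {A B : C} (X Y : C) (f : A ⊙ (X ⊙ Y) ⟶ B ⊙ (X ⊙ Y)),
    trace (X ⊙ Y) f =
      trace X (trace Y (f.cast (tensor_assoc A X Y).symm (tensor_assoc B X Y).symm))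
  trace_superposing : ∀ {A B A' B' : C} (X : C) (g : A' ⟶ B') (f : A ⊙ X ⟶ B ⊙ X),
    trace X ((g ⊙ₘ f).cast (tensor_assoc A' A X).symm (tensor_assoc B' B X).symm) = g ⊙ₘ trace X f
  trace_yanking : ∀ X : C, trace X (braid X X) = 𝟙 X

/-- A strict symmetric traced functor: all of the structure is preserved strictly. -/
@[ext]
structure StrictTracedFunctor (C : Type u₁) [TracedStruct.{u₁, v₁} C] (D : Type u₂) [TracedStruct.{u₂, v₂} D]
    extends C ⥤q D where
  map_id : ∀ A : C, map (𝟙 A) = 𝟙 (obj A)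
  map_comp : ∀ {A B E : C} (f : A ⟶ B) (g : B ⟶ E), map (f ≫ g) = map f ≫ map g
  obj_unit : obj TracedStruct.unit = TracedStruct.unit
  obj_tensor : ∀ A B : C, obj (A ⊙ B) = obj A ⊙ obj B
  map_tensorHom : ∀ {A B A' B' : C} (f : A ⟶ B) (g : A' ⟶ B'),
    (map (f ⊙ₘ g)).cast (obj_tensor A A') (obj_tensor B B') = map f ⊙ₘ map g
  map_braid : ∀ A B : C,
    (map (TracedStruct.braid A B)).cast (obj_tensor A B) (obj_tensor B A) =
      TracedStruct.braid (obj A) (obj B)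
  map_trace : ∀ {A B : C} (X : C) (f : A ⊙ X ⟶ B ⊙ X),
    map (TracedStruct.trace X f) =
      TracedStruct.trace (obj X) ((map f).cast (obj_tensor A X) (obj_tensor B X))

/-- The monoidal product of a word of objects. -/
def tensorList {C : Type u} [TracedStruct.{u, v} C] (L : List C) : C :=
  L.foldr TracedStruct.tensor TracedStruct.unit

theorem StrictTracedFunctor.obj_tensorList {C : Type u₁} [TracedStruct.{u₁, v₁} C] {D : Type u₂}
    [TracedStruct.{u₂, v₂} D] (F : StrictTracedFunctor C D) (L : List C) :
    F.obj (tensorList L) = tensorList (L.map F.obj) := by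
  induction L with
  | nil => exact F.obj_unit
  | cons A L ih => exact (F.obj_tensor A (tensorList L)).trans (congrArg (F.obj A ⊙ ·) ih)

theorem tensorList_append {C : Type u} [TracedStruct.{u, v} C] [IsStrictSymmetricTraced C]
    (L M : List C) : tensorList (L ++ M) = tensorList L ⊙ tensorList M := by
  induction L with
  | nil => exact (IsStrictSymmetricTraced.unit_tensor _).symm
  | cons A L ih =>
    exact (congrArg (A ⊙ ·) ih).trans (IsStrictSymmetricTraced.tensor_assoc A _ _).symm

/-- A morphism of the underlying signature: words `src`, `tgt` and a morphism between their
monoidal products. -/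
structure UnderlyingMor (C : Type u) [TracedStruct.{u, v} C] where
  src : List C
  tgt : List C
  hom : tensorList src ⟶ tensorList tgt

/-- The underlying monoidal signature of a strict symmetric traced category. -/
abbrev underlyingSignature (C : Type u) [TracedStruct.{u, v} C] : MonoidalSignature.{u, max u v} where
  Obj := C
  Mor := UnderlyingMor C
  dom := UnderlyingMor.src
  cod := UnderlyingMor.tgt

/-- The homomorphism of underlying signatures given by a functor. -/
def StrictTracedFunctor.underlying {C : Type u₁} [TracedStruct.{u₁, v₁} C] {D : Type u₂}
    [TracedStruct.{u₂, v₂} D] (F : StrictTracedFunctor C D) :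
    (underlyingSignature C).Hom (underlyingSignature D) where
  obj := F.obj
  mor m := ⟨m.src.map F.obj, m.tgt.map F.obj,
    (F.map m.hom).cast (F.obj_tensorList m.src) (F.obj_tensorList m.tgt)⟩
  dom_mor _ := rfl
  cod_mor _ := rfl

/-! ## Graphs, typed graphs, string graphs -/

/-- A directed multigraph. -/
structure DirGraph where
  V : Type u
  E : Type v
  src : E → V
  tgt : E → V

/-- A homomorphism of directed multigraphs. -/
structure DirGraph.Hom (G : DirGraph.{u₁, v₁}) (H : DirGraph.{u₂, v₂}) where
  v : G.V → H.V
  e : G.E → H.E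
  src_e : ∀ x, H.src (e x) = v (G.src x)
  tgt_e : ∀ x, H.tgt (e x) = v (G.tgt x)

/-- The edge neighbourhood of a vertex. -/
def DirGraph.nbhd (G : DirGraph.{u, v}) (x : G.V) : Set G.E := {e | G.src e = x ∨ G.tgt e = x}

/-- The edges of the derived typegraph. -/
inductive TypeEdge (T : MonoidalSignature.{u, v}) : Type (max u v)
  | mid (X : T.Obj)
  | inp (f : T.Mor) (i : Fin (T.dom f).length)
  | out (f : T.Mor) (j : Fin (T.cod f).length)

/-- The object carried by an edge of the derived typegraph. -/
def TypeEdge.wire {T : MonoidalSignature.{u, v}} : TypeEdge T → T.Obj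
  | mid X => X
  | inp f i => (T.dom f).get i
  | out f j => (T.cod f).get j

/-- The derived typegraph of a signature: its vertices are the objects and the morphisms. -/
def typegraph (T : MonoidalSignature.{u, v}) : DirGraph.{max u v, max u v} where
  V := T.Obj ⊕ T.Mor
  E := TypeEdge T
  src
    | .mid X => Sum.inl X
    | .inp f i => Sum.inl ((T.dom f).get i)
    | .out f _ => Sum.inr f
  tgt
    | .mid X => Sum.inl X
    | .inp f _ => Sum.inr f
    | .out f j => Sum.inl ((T.cod f).get j)

/-- A graph typed over the derived typegraph. -/
structure TypedGraph (T : MonoidalSignature.{u, v}) extends DirGraph.{0, 0} where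
  τ : toDirGraph.Hom (typegraph T)

namespace TypedGraph

variable {T : MonoidalSignature.{u, v}}

/-- A homomorphism of typed graphs. -/
structure Hom (G H : TypedGraph T) extends DirGraph.Hom G.toDirGraph H.toDirGraph where
  τ_v : ∀ x, H.τ.v (v x) = G.τ.v x
  τ_e : ∀ x, H.τ.e (e x) = G.τ.e x

/-- Wire-vertices are the vertices typed by an object. -/
def IsWire (G : TypedGraph T) (x : G.V) : Prop := ∃ X, G.τ.v x = Sum.inl X

/-- Box-vertices are the vertices typed by a morphism. -/
def IsBox (G : TypedGraph T) (x : G.V) : Prop := ∃ f, G.τ.v x = Sum.inr f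

/-- The inputs: wire-vertices without in-edges. -/
def inputs (G : TypedGraph T) : Set G.V := {x | G.IsWire x ∧ ∀ e, G.tgt e ≠ x}

/-- The outputs: wire-vertices without out-edges. -/
def outputs (G : TypedGraph T) : Set G.V := {x | G.IsWire x ∧ ∀ e, G.src e ≠ x}

/-- The boundary: the inputs and the outputs. -/
def boundary (G : TypedGraph T) : Set G.V := G.inputs ∪ G.outputs

/-- An isolated wire-vertex is both an input and an output. -/
def IsIsolated (G : TypedGraph T) (x : G.V) : Prop := x ∈ G.inputs ∧ x ∈ G.outputs

end TypedGraph

/-- A (finite) string graph: the typing map is a local isomorphism, that is, a bijection on the edge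
neighbourhood of every box-vertex, and every wire-vertex has at most one in-edge and at most one
out-edge. -/
structure StringGraph (T : MonoidalSignature.{u, v}) extends TypedGraph T where
  finite_V : Finite V
  finite_E : Finite E
  local_iso : ∀ x, toTypedGraph.IsBox x →
    Set.BijOn τ.e (toDirGraph.nbhd x) ((typegraph T).nbhd (τ.v x))
  out_unique : ∀ e e', toTypedGraph.IsWire (src e) → src e = src e' → e = e'
  in_unique : ∀ e e', toTypedGraph.IsWire (tgt e) → tgt e = tgt e' → e = e'

/-! ## Framed point graphs and framed cospans -/

/-- The polarity of a point. -/
inductive Polarity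
  | pos
  | neg

/-- A framed point graph: a string graph consisting of isolated wire-vertices only, with a total
order and a signing map on its vertices. -/
structure FramedPointGraph (T : MonoidalSignature.{u, v}) extends StringGraph T where
  isolated : ∀ x, toTypedGraph.IsIsolated x
  order : LinearOrder V
  sgn : V → Polarity

/-- A framed point graph is positive if all of its points are. -/
def FramedPointGraph.IsPositive {T : MonoidalSignature.{u, v}} (X : FramedPointGraph T) : Prop :=
  ∀ x, X.sgn x = Polarity.pos

/-- An isomorphism of framed point graphs. -/
@[ext]
structure FramedPointGraph.Iso {T : MonoidalSignature.{u, v}} (X Y : FramedPointGraph T) where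
  v : X.V ≃ Y.V
  τ_v : ∀ x, Y.τ.v (v x) = X.τ.v x
  order_v : ∀ x x', Y.order.le (v x) (v x') ↔ X.order.le x x'
  sgn_v : ∀ x, Y.sgn (v x) = X.sgn x

/-- The standard positive framed point graph of a word of objects: its points are the positions of
the word, in their usual order, typed by the letters. -/
def wordGraph {T : MonoidalSignature.{u, v}} (L : List T.Obj) : FramedPointGraph T where
  V := Fin L.length
  E := Empty
  src := Empty.elim
  tgt := Empty.elim
  τ := ⟨fun i => Sum.inl (L.get i), Empty.elim, fun e => e.elim, fun e => e.elim⟩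
  finite_V := inferInstance
  finite_E := inferInstance
  local_iso := by
    rintro x ⟨f, hf⟩
    cases hf
  out_unique e := e.elim
  in_unique e := e.elim
  isolated x := ⟨⟨⟨_, rfl⟩, fun e => e.elim⟩, ⟨⟨_, rfl⟩, fun e => e.elim⟩⟩
  order := inferInstance
  sgn _ := Polarity.pos

/-- A framed cospan `X ⟶ G ⟵ Y` of string graphs. -/
structure FramedCospan {T : MonoidalSignature.{u, v}} (X Y : FramedPointGraph T) extends
    StringGraph T where
  d : X.toTypedGraph.Hom toTypedGraph
  c : Y.toTypedGraph.Hom toTypedGraph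
  no_isolated : ∀ x, ¬ toTypedGraph.IsIsolated x
  injective : Function.Injective (Sum.elim d.v c.v)
  range : Set.range (Sum.elim d.v c.v) = toTypedGraph.boundary
  d_in : ∀ x, d.v x ∈ toTypedGraph.inputs ↔ X.sgn x = Polarity.pos
  c_out : ∀ y, c.v y ∈ toTypedGraph.outputs ↔ Y.sgn y = Polarity.pos

/-! ## Wire-homeomorphism -/

/-- The first half of a subdivided edge. -/
def TypeEdge.firstHalf {T : MonoidalSignature.{u, v}} : TypeEdge T → TypeEdge T
  | mid X => mid X
  | inp f i => mid ((T.dom f).get i)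
  | out f j => out f j

/-- The second half of a subdivided edge. -/
def TypeEdge.secondHalf {T : MonoidalSignature.{u, v}} : TypeEdge T → TypeEdge T
  | mid X => mid X
  | inp f i => inp f i
  | out f j => mid ((T.cod f).get j)

/-- An isomorphism of framed cospans. -/
structure CospanIso {T : MonoidalSignature.{u, v}} {X Y : FramedPointGraph T}
    (G H : FramedCospan X Y) where
  v : G.V ≃ H.V
  e : G.E ≃ H.E
  src_e : ∀ x, H.src (e x) = v (G.src x)
  tgt_e : ∀ x, H.tgt (e x) = v (G.tgt x)
  τ_v : ∀ x, H.τ.v (v x) = G.τ.v x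
  τ_e : ∀ x, H.τ.e (e x) = G.τ.e x
  d_v : ∀ x, H.d.v x = v (G.d.v x)
  c_v : ∀ y, H.c.v y = v (G.c.v y)

/-- `H` arises from `G` by lengthening one wire by one wire-vertex: the edge `e₀` of `G` is replaced
by two edges (called `e e₀` and `e₁` in `H`) through a new wire-vertex `w` in the middle, which carries
the object of the wire; everything else is unchanged. Read backwards, these steps are the
contractions that shorten a loop, a bare wire, an input wire of a box, or an output wire of a box. -/
structure Subdivision {T : MonoidalSignature.{u, v}} {X Y : FramedPointGraph T}
    (G H : FramedCospan X Y) where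
  e₀ : G.E
  v : G.V → H.V
  w : H.V
  v_bijective : Function.Bijective (fun o : Option G.V => o.elim w v)
  e : G.E → H.E
  e₁ : H.E
  e_bijective : Function.Bijective (fun o : Option G.E => o.elim e₁ e)
  src_e : ∀ x, H.src (e x) = v (G.src x)
  tgt_e : ∀ x, x ≠ e₀ → H.tgt (e x) = v (G.tgt x)
  tgt_e₀ : H.tgt (e e₀) = w
  src_e₁ : H.src e₁ = w
  tgt_e₁ : H.tgt e₁ = v (G.tgt e₀)
  τ_v : ∀ x, H.τ.v (v x) = G.τ.v x
  τ_w : H.τ.v w = Sum.inl (G.τ.e e₀).wire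
  τ_e : ∀ x, x ≠ e₀ → H.τ.e (e x) = G.τ.e x
  τ_e₀ : H.τ.e (e e₀) = (G.τ.e e₀).firstHalf
  τ_e₁ : H.τ.e e₁ = (G.τ.e e₀).secondHalf
  d_v : ∀ x, H.d.v x = v (G.d.v x)
  c_v : ∀ y, H.c.v y = v (G.c.v y)

/-- One step of wire-homeomorphism between framed cospans. -/
inductive WireStep {T : MonoidalSignature.{u, v}} {X Y : FramedPointGraph T}
    (G H : FramedCospan X Y) : Prop
  | iso (α : CospanIso G H)
  | subdivide (σ : Subdivision G H)

/-- Framed cospans up to wire-homeomorphism, which is the equivalence relation generated by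
the steps (`Quot` identifies along the generated equivalence relation). -/
def CospanClass {T : MonoidalSignature.{u, v}} (X Y : FramedPointGraph T) :
    Type (max 1 u v) :=
  Quot (WireStep (X := X) (Y := Y))

/-! ## Composition by pushout -/

section Pushout

variable {A B C : Type}

/-- The relation identifying `f a` with `g a`. -/
inductive Glue (f : A → B) (g : A → C) : B ⊕ C → B ⊕ C → Prop
  | mk (a : A) : Glue f g (Sum.inl (f a)) (Sum.inr (g a))

/-- The pushout of two functions. -/
def Pushout (f : A → B) (g : A → C) : Type := Quot (Glue f g)

namespace Pushout

variable {f : A → B} {g : A → C}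

/-- The first coprojection. -/
def in₁ (b : B) : Pushout f g := Quot.mk _ (Sum.inl b)

/-- The second coprojection. -/
def in₂ (c : C) : Pushout f g := Quot.mk _ (Sum.inr c)

/-- The map out of a pushout induced by a commuting square. -/
def desc {D : Type u} (p : B → D) (q : C → D) (h : ∀ a, p (f a) = q (g a)) :
    Pushout f g → D :=
  Quot.lift (Sum.elim p q) (by rintro _ _ ⟨a⟩; exact h a)

theorem glue (a : A) : (in₁ (f a) : Pushout f g) = in₂ (g a) := Quot.sound ⟨a⟩

theorem cases (x : Pushout f g) : (∃ b, x = in₁ b) ∨ (∃ c, x = in₂ c) := by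
  rcases x with ⟨b | c⟩
  · exact Or.inl ⟨b, rfl⟩
  · exact Or.inr ⟨c, rfl⟩

open Classical in
theorem in₁_eq (hg : Function.Injective g) (b : B) (y : Pushout f g) (h : in₁ b = y) :
    (∀ b', y = in₁ b' → b = b') ∧ (∀ c, y = in₂ c → ∃ a, f a = b ∧ g a = c) := by
  have key := congrArg (desc (f := f) (g := g) (fun b => some b)
    (fun c => if h : ∃ a, g a = c then some (f h.choose) else none) (by
      intro a
      have h : ∃ a', g a' = g a := ⟨a, rfl⟩
      simp only [dif_pos h]
      rw [hg h.choose_spec])) h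
  constructor
  · rintro b' rfl
    simpa [desc, in₁] using key
  · rintro c rfl
    simp only [desc, in₁, in₂, Sum.elim_inl, Sum.elim_inr] at key
    split_ifs at key with h'
    exact ⟨h'.choose, (Option.some.inj key).symm, h'.choose_spec⟩

theorem in₁_inj (hg : Function.Injective g) {b b' : B} (h : (in₁ b : Pushout f g) = in₁ b') :
    b = b' := (in₁_eq hg b _ h).1 b' rfl

theorem in₁_eq_in₂ (hg : Function.Injective g) {b : B} {c : C}
    (h : (in₁ b : Pushout f g) = in₂ c) : ∃ a, f a = b ∧ g a = c := (in₁_eq hg b _ h).2 c rfl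

open Classical in
theorem in₂_inj (hf : Function.Injective f) {c c' : C} (h : (in₂ c : Pushout f g) = in₂ c') :
    c = c' := by
  have key := congrArg (desc (f := f) (g := g)
    (fun b => if h : ∃ a, f a = b then some (g h.choose) else none) (fun c => some c) (by
      intro a
      have h : ∃ a', f a' = f a := ⟨a, rfl⟩
      simp only [dif_pos h]
      rw [hf h.choose_spec])) h
  simpa [desc, in₂] using key

instance [Finite B] [Finite C] : Finite (Pushout f g) := Quot.finite _

end Pushout

end Pushout

theorem Set.BijOn.of_image {A B C : Type*} {ι : A → B} {p : A → C} {q : B → C} {s : Set A} {t : Set B}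
    {r : Set C} (h : Set.BijOn p s r) (hq : ∀ a, q (ι a) = p a) (ht : t = ι '' s) :
    Set.BijOn q t r := by
  subst ht
  refine ⟨?_, ?_, ?_⟩
  · rintro _ ⟨a, ha, rfl⟩
    rw [hq]; exact h.mapsTo ha
  · rintro _ ⟨a, ha, rfl⟩ _ ⟨a', ha', rfl⟩ e
    rw [hq, hq] at e
    rw [h.injOn ha ha' e]
  · intro c hc
    obtain ⟨a, ha, rfl⟩ := h.surjOn hc
    exact ⟨ι a, ⟨a, ha, rfl⟩, hq a⟩

namespace FramedCospan

variable {T : MonoidalSignature.{u, v}} {X Y Z : FramedPointGraph T}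

theorem d_mem (G : FramedCospan X Y) (x : X.V) : G.d.v x ∈ G.boundary := by
  rw [← G.range]; exact ⟨Sum.inl x, rfl⟩

theorem c_mem (G : FramedCospan X Y) (y : Y.V) : G.c.v y ∈ G.boundary := by
  rw [← G.range]; exact ⟨Sum.inr y, rfl⟩

theorem d_wire (G : FramedCospan X Y) (x : X.V) : G.IsWire (G.d.v x) := by
  rcases G.d_mem x with h | h <;> exact h.1

theorem c_wire (G : FramedCospan X Y) (y : Y.V) : G.IsWire (G.c.v y) := by
  rcases G.c_mem y with h | h <;> exact h.1

theorem d_injective (G : FramedCospan X Y) : Function.Injective G.d.v := fun a b h =>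
  Sum.inl_injective (G.injective (a₁ := Sum.inl a) (a₂ := Sum.inl b) h)

theorem c_injective (G : FramedCospan X Y) : Function.Injective G.c.v := fun a b h =>
  Sum.inr_injective (G.injective (a₁ := Sum.inr a) (a₂ := Sum.inr b) h)

theorem d_ne_c (G : FramedCospan X Y) (x : X.V) (y : Y.V) : G.d.v x ≠ G.c.v y := fun h => by
  simpa using G.injective (a₁ := Sum.inl x) (a₂ := Sum.inr y) h

theorem d_pos (G : FramedCospan X Y) (x : X.V) (h : X.sgn x = Polarity.pos) :
    (¬ ∃ e, G.tgt e = G.d.v x) ∧ ∃ e, G.src e = G.d.v x := by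
  have h1 := (G.d_in x).2 h
  refine ⟨fun ⟨e, he⟩ => h1.2 e he, ?_⟩
  by_contra h2
  exact G.no_isolated _ ⟨h1, h1.1, fun e he => h2 ⟨e, he⟩⟩

theorem d_neg (G : FramedCospan X Y) (x : X.V) (h : X.sgn x = Polarity.neg) :
    (∃ e, G.tgt e = G.d.v x) ∧ ¬ ∃ e, G.src e = G.d.v x := by
  have h0 : G.d.v x ∉ G.inputs := fun h' => by simp [(G.d_in x).1 h'] at h
  have h1 := (G.d_mem x).resolve_left h0
  refine ⟨?_, fun ⟨e, he⟩ => h1.2 e he⟩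
  by_contra h2
  exact h0 ⟨h1.1, fun e he => h2 ⟨e, he⟩⟩

theorem c_pos (G : FramedCospan X Y) (y : Y.V) (h : Y.sgn y = Polarity.pos) :
    (∃ e, G.tgt e = G.c.v y) ∧ ¬ ∃ e, G.src e = G.c.v y := by
  have h1 := (G.c_out y).2 h
  refine ⟨?_, fun ⟨e, he⟩ => h1.2 e he⟩
  by_contra h2
  exact G.no_isolated _ ⟨⟨h1.1, fun e he => h2 ⟨e, he⟩⟩, h1⟩

theorem c_neg (G : FramedCospan X Y) (y : Y.V) (h : Y.sgn y = Polarity.neg) :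
    (¬ ∃ e, G.tgt e = G.c.v y) ∧ ∃ e, G.src e = G.c.v y := by
  have h0 : G.c.v y ∉ G.outputs := fun h' => by simp [(G.c_out y).1 h'] at h
  have h1 := (G.c_mem y).resolve_right h0
  refine ⟨fun ⟨e, he⟩ => h1.2 e he, ?_⟩
  by_contra h2
  exact h0 ⟨h1.1, fun e he => h2 ⟨e, he⟩⟩

theorem plug_in (G : FramedCospan X Y) (H : FramedCospan Y Z) (y : Y.V) :
    (∃ e, G.tgt e = G.c.v y) ↔ ¬ ∃ e, H.tgt e = H.d.v y := by
  cases h : Y.sgn y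
  · have h1 := G.c_pos y h; have h2 := H.d_pos y h; tauto
  · have h1 := G.c_neg y h; have h2 := H.d_neg y h; tauto

theorem plug_out (G : FramedCospan X Y) (H : FramedCospan Y Z) (y : Y.V) :
    (∃ e, G.src e = G.c.v y) ↔ ¬ ∃ e, H.src e = H.d.v y := by
  cases h : Y.sgn y
  · have h1 := G.c_pos y h; have h2 := H.d_pos y h; tauto
  · have h1 := G.c_neg y h; have h2 := H.d_neg y h; tauto

/-- The typed graph obtained by plugging two framed cospans together: the pushout over the common
framed point graph (which has no edges). -/
abbrev compGraph (G : FramedCospan X Y) (H : FramedCospan Y Z) : TypedGraph T where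
  V := Pushout G.c.v H.d.v
  E := G.E ⊕ H.E
  src := Sum.elim (fun e => Pushout.in₁ (G.src e)) (fun e => Pushout.in₂ (H.src e))
  tgt := Sum.elim (fun e => Pushout.in₁ (G.tgt e)) (fun e => Pushout.in₂ (H.tgt e))
  τ :=
    { v := Pushout.desc G.τ.v H.τ.v (fun y => by rw [G.c.τ_v, H.d.τ_v])
      e := Sum.elim G.τ.e H.τ.e
      src_e := by rintro (e | e); exacts [G.τ.src_e e, H.τ.src_e e]
      tgt_e := by rintro (e | e); exacts [G.τ.tgt_e e, H.τ.tgt_e e] }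

section comp

variable (G : FramedCospan X Y) (H : FramedCospan Y Z)

theorem comp_wire₁ (a : G.V) : (compGraph G H).IsWire (Pushout.in₁ a) ↔ G.IsWire a := Iff.rfl

theorem comp_wire₂ (a : H.V) : (compGraph G H).IsWire (Pushout.in₂ a) ↔ H.IsWire a := Iff.rfl

theorem comp_tgt₁ (a : G.V) : (∃ e, (compGraph G H).tgt e = Pushout.in₁ a) ↔
    (∃ e, G.tgt e = a) ∨ ∃ y, G.c.v y = a ∧ ∃ e, H.tgt e = H.d.v y := by
  constructor
  · rintro ⟨e | e, he⟩
    · exact Or.inl ⟨e, Pushout.in₁_inj H.d_injective he⟩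
    · obtain ⟨y, rfl, hy⟩ := Pushout.in₁_eq_in₂ H.d_injective he.symm
      exact Or.inr ⟨y, rfl, e, hy.symm⟩
  · rintro (⟨e, rfl⟩ | ⟨y, rfl, e, he⟩)
    · exact ⟨Sum.inl e, rfl⟩
    · exact ⟨Sum.inr e, (congrArg Pushout.in₂ he).trans (Pushout.glue y).symm⟩

theorem comp_src₁ (a : G.V) : (∃ e, (compGraph G H).src e = Pushout.in₁ a) ↔
    (∃ e, G.src e = a) ∨ ∃ y, G.c.v y = a ∧ ∃ e, H.src e = H.d.v y := by
  constructor
  · rintro ⟨e | e, he⟩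
    · exact Or.inl ⟨e, Pushout.in₁_inj H.d_injective he⟩
    · obtain ⟨y, rfl, hy⟩ := Pushout.in₁_eq_in₂ H.d_injective he.symm
      exact Or.inr ⟨y, rfl, e, hy.symm⟩
  · rintro (⟨e, rfl⟩ | ⟨y, rfl, e, he⟩)
    · exact ⟨Sum.inl e, rfl⟩
    · exact ⟨Sum.inr e, (congrArg Pushout.in₂ he).trans (Pushout.glue y).symm⟩

theorem comp_tgt₂ (a : H.V) : (∃ e, (compGraph G H).tgt e = Pushout.in₂ a) ↔
    (∃ e, H.tgt e = a) ∨ ∃ y, H.d.v y = a ∧ ∃ e, G.tgt e = G.c.v y := by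
  constructor
  · rintro ⟨e | e, he⟩
    · obtain ⟨y, hy, rfl⟩ := Pushout.in₁_eq_in₂ H.d_injective he
      exact Or.inr ⟨y, rfl, e, hy.symm⟩
    · exact Or.inl ⟨e, Pushout.in₂_inj G.c_injective he⟩
  · rintro (⟨e, rfl⟩ | ⟨y, rfl, e, he⟩)
    · exact ⟨Sum.inr e, rfl⟩
    · exact ⟨Sum.inl e, (congrArg Pushout.in₁ he).trans (Pushout.glue y)⟩

theorem comp_src₂ (a : H.V) : (∃ e, (compGraph G H).src e = Pushout.in₂ a) ↔
    (∃ e, H.src e = a) ∨ ∃ y, H.d.v y = a ∧ ∃ e, G.src e = G.c.v y := by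
  constructor
  · rintro ⟨e | e, he⟩
    · obtain ⟨y, hy, rfl⟩ := Pushout.in₁_eq_in₂ H.d_injective he
      exact Or.inr ⟨y, rfl, e, hy.symm⟩
    · exact Or.inl ⟨e, Pushout.in₂_inj G.c_injective he⟩
  · rintro (⟨e, rfl⟩ | ⟨y, rfl, e, he⟩)
    · exact ⟨Sum.inr e, rfl⟩
    · exact ⟨Sum.inl e, (congrArg Pushout.in₁ he).trans (Pushout.glue y)⟩

theorem mem_inputs_iff (K : TypedGraph T) (a : K.V) :
    a ∈ K.inputs ↔ K.IsWire a ∧ ¬ ∃ e, K.tgt e = a := by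
  simp [TypedGraph.inputs]

theorem mem_outputs_iff (K : TypedGraph T) (a : K.V) :
    a ∈ K.outputs ↔ K.IsWire a ∧ ¬ ∃ e, K.src e = a := by
  simp [TypedGraph.outputs]

theorem comp_inputs₁ (a : G.V) (ha : ∀ y, G.c.v y ≠ a) :
    Pushout.in₁ a ∈ (compGraph G H).inputs ↔ a ∈ G.inputs := by
  rw [mem_inputs_iff, mem_inputs_iff, comp_wire₁, comp_tgt₁]
  have : ¬ ∃ y, G.c.v y = a ∧ ∃ e, H.tgt e = H.d.v y := fun ⟨y, hy, _⟩ => ha y hy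
  tauto

theorem comp_outputs₁ (a : G.V) (ha : ∀ y, G.c.v y ≠ a) :
    Pushout.in₁ a ∈ (compGraph G H).outputs ↔ a ∈ G.outputs := by
  rw [mem_outputs_iff, mem_outputs_iff, comp_wire₁, comp_src₁]
  have : ¬ ∃ y, G.c.v y = a ∧ ∃ e, H.src e = H.d.v y := fun ⟨y, hy, _⟩ => ha y hy
  tauto

theorem comp_inputs₂ (a : H.V) (ha : ∀ y, H.d.v y ≠ a) :
    Pushout.in₂ a ∈ (compGraph G H).inputs ↔ a ∈ H.inputs := by
  rw [mem_inputs_iff, mem_inputs_iff, comp_wire₂, comp_tgt₂]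
  have : ¬ ∃ y, H.d.v y = a ∧ ∃ e, G.tgt e = G.c.v y := fun ⟨y, hy, _⟩ => ha y hy
  tauto

theorem comp_outputs₂ (a : H.V) (ha : ∀ y, H.d.v y ≠ a) :
    Pushout.in₂ a ∈ (compGraph G H).outputs ↔ a ∈ H.outputs := by
  rw [mem_outputs_iff, mem_outputs_iff, comp_wire₂, comp_src₂]
  have : ¬ ∃ y, H.d.v y = a ∧ ∃ e, G.src e = G.c.v y := fun ⟨y, hy, _⟩ => ha y hy
  tauto

theorem comp_glued (y : Y.V) : Pushout.in₁ (G.c.v y) ∉ (compGraph G H).boundary := by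
  have h1 := plug_in G H y
  have h2 := plug_out G H y
  rintro (h | h)
  · rw [mem_inputs_iff, comp_tgt₁] at h
    by_cases h3 : ∃ e, G.tgt e = G.c.v y
    · exact h.2 (Or.inl h3)
    · exact h.2 (Or.inr ⟨y, rfl, by
        by_contra h4
        exact h3 ((plug_in G H y).2 h4)⟩)
  · rw [mem_outputs_iff, comp_src₁] at h
    by_cases h3 : ∃ e, G.src e = G.c.v y
    · exact h.2 (Or.inl h3)
    · exact h.2 (Or.inr ⟨y, rfl, by
        by_contra h4
        exact h3 ((plug_out G H y).2 h4)⟩)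

theorem comp_boundary : Set.range (Sum.elim (fun x => Pushout.in₁ (G.d.v x))
    (fun z => Pushout.in₂ (H.c.v z))) = (compGraph G H).boundary := by
  ext k
  constructor
  · rintro ⟨x | z, rfl⟩
    · have hne : ∀ y, G.c.v y ≠ G.d.v x := fun y h => G.d_ne_c x y h.symm
      exact (G.d_mem x).imp (comp_inputs₁ G H _ hne).2 (comp_outputs₁ G H _ hne).2
    · have hne : ∀ y, H.d.v y ≠ H.c.v z := fun y => H.d_ne_c y z
      exact (H.c_mem z).imp (comp_inputs₂ G H _ hne).2 (comp_outputs₂ G H _ hne).2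
  · intro hk
    rcases Pushout.cases k with ⟨a, rfl⟩ | ⟨a, rfl⟩
    · have hne : ∀ y, G.c.v y ≠ a := fun y h => comp_glued G H y (h ▸ hk)
      have : a ∈ G.boundary := hk.imp (comp_inputs₁ G H _ hne).1 (comp_outputs₁ G H _ hne).1
      rw [← G.range] at this
      obtain ⟨x | y, rfl⟩ := this
      · exact ⟨Sum.inl x, rfl⟩
      · exact absurd rfl (hne y)
    · have hne : ∀ y, H.d.v y ≠ a := fun y h => comp_glued G H y (by
        rw [Pushout.glue, h]; exact hk)
      have : a ∈ H.boundary := hk.imp (comp_inputs₂ G H _ hne).1 (comp_outputs₂ G H _ hne).1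
      rw [← H.range] at this
      obtain ⟨y | z, rfl⟩ := this
      · exact absurd rfl (hne y)
      · exact ⟨Sum.inr z, rfl⟩

theorem not_box_and_wire (K : TypedGraph T) {a : K.V} (h : K.IsBox a) (h' : K.IsWire a) : False := by
  obtain ⟨f, hf⟩ := h
  obtain ⟨o, ho⟩ := h'
  rw [hf] at ho
  cases ho

/-- Composition of framed cospans. -/
abbrev comp : FramedCospan X Z where
  toTypedGraph := compGraph G H
  finite_V := by
    have := G.finite_V
    have := H.finite_V
    exact inferInstanceAs (Finite (Pushout G.c.v H.d.v))
  finite_E := by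
    have := G.finite_E
    have := H.finite_E
    exact inferInstanceAs (Finite (G.E ⊕ H.E))
  local_iso k hk := by
    rcases Pushout.cases k with ⟨a, rfl⟩ | ⟨a, rfl⟩
    · have hne : ∀ y, G.c.v y ≠ a := fun y h => not_box_and_wire G.toTypedGraph hk (h ▸ G.c_wire y)
      refine (G.local_iso a hk).of_image (ι := Sum.inl) (fun _ => rfl) ?_
      ext (e | e)
      · simp only [Set.mem_image, Sum.inl.injEq, exists_eq_right]
        exact ⟨Or.imp (Pushout.in₁_inj H.d_injective) (Pushout.in₁_inj H.d_injective),
          Or.imp (congrArg Pushout.in₁) (congrArg Pushout.in₁)⟩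
      · simp only [Set.mem_image, reduceCtorEq, and_false, exists_false, iff_false]
        rintro (h | h) <;> obtain ⟨y, hy, -⟩ := Pushout.in₁_eq_in₂ H.d_injective h.symm <;>
          exact hne y hy
    · have hne : ∀ y, H.d.v y ≠ a := fun y h => not_box_and_wire H.toTypedGraph hk (h ▸ H.d_wire y)
      refine (H.local_iso a hk).of_image (ι := Sum.inr) (fun _ => rfl) ?_
      ext (e | e)
      · simp only [Set.mem_image, reduceCtorEq, and_false, exists_false, iff_false]
        rintro (h | h) <;> obtain ⟨y, -, hy⟩ := Pushout.in₁_eq_in₂ H.d_injective h <;>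
          exact hne y hy
      · simp only [Set.mem_image, Sum.inr.injEq, exists_eq_right]
        exact ⟨Or.imp (Pushout.in₂_inj G.c_injective) (Pushout.in₂_inj G.c_injective),
          Or.imp (congrArg Pushout.in₂) (congrArg Pushout.in₂)⟩
  out_unique := by
    rintro (e | e) (e' | e') hw h
    · exact congrArg _ (G.out_unique e e' hw (Pushout.in₁_inj H.d_injective h))
    · obtain ⟨y, h1, h2⟩ := Pushout.in₁_eq_in₂ H.d_injective h
      exact absurd ⟨e', h2.symm⟩ ((plug_out G H y).1 ⟨e, h1.symm⟩)
    · obtain ⟨y, h1, h2⟩ := Pushout.in₁_eq_in₂ H.d_injective h.symm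
      exact absurd ⟨e, h2.symm⟩ ((plug_out G H y).1 ⟨e', h1.symm⟩)
    · exact congrArg _ (H.out_unique e e' hw (Pushout.in₂_inj G.c_injective h))
  in_unique := by
    rintro (e | e) (e' | e') hw h
    · exact congrArg _ (G.in_unique e e' hw (Pushout.in₁_inj H.d_injective h))
    · obtain ⟨y, h1, h2⟩ := Pushout.in₁_eq_in₂ H.d_injective h
      exact absurd ⟨e', h2.symm⟩ ((plug_in G H y).1 ⟨e, h1.symm⟩)
    · obtain ⟨y, h1, h2⟩ := Pushout.in₁_eq_in₂ H.d_injective h.symm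
      exact absurd ⟨e, h2.symm⟩ ((plug_in G H y).1 ⟨e', h1.symm⟩)
    · exact congrArg _ (H.in_unique e e' hw (Pushout.in₂_inj G.c_injective h))
  d :=
    { v := fun x => Pushout.in₁ (G.d.v x)
      e := fun e => Sum.inl (G.d.e e)
      src_e := fun e => congrArg Pushout.in₁ (G.d.src_e e)
      tgt_e := fun e => congrArg Pushout.in₁ (G.d.tgt_e e)
      τ_v := G.d.τ_v
      τ_e := G.d.τ_e }
  c :=
    { v := fun z => Pushout.in₂ (H.c.v z)
      e := fun e => Sum.inr (H.c.e e)
      src_e := fun e => congrArg Pushout.in₂ (H.c.src_e e)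
      tgt_e := fun e => congrArg Pushout.in₂ (H.c.tgt_e e)
      τ_v := H.c.τ_v
      τ_e := H.c.τ_e }
  no_isolated k := by
    rintro ⟨h1, h2⟩
    rcases Pushout.cases k with ⟨a, rfl⟩ | ⟨a, rfl⟩
    · have hne : ∀ y, G.c.v y ≠ a := fun y h => comp_glued G H y (h ▸ Or.inl h1)
      exact G.no_isolated a ⟨(comp_inputs₁ G H a hne).1 h1, (comp_outputs₁ G H a hne).1 h2⟩
    · have hne : ∀ y, H.d.v y ≠ a := fun y h => comp_glued G H y (by
        rw [Pushout.glue, h]; exact Or.inl h1)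
      exact H.no_isolated a ⟨(comp_inputs₂ G H a hne).1 h1, (comp_outputs₂ G H a hne).1 h2⟩
  injective := by
    rintro (x | z) (x' | z') h
    · exact congrArg _ (G.d_injective (Pushout.in₁_inj H.d_injective h))
    · obtain ⟨y, h1, -⟩ := Pushout.in₁_eq_in₂ H.d_injective h
      exact absurd h1.symm (G.d_ne_c x y)
    · obtain ⟨y, h1, -⟩ := Pushout.in₁_eq_in₂ H.d_injective h.symm
      exact absurd h1.symm (G.d_ne_c x' y)
    · exact congrArg _ (H.c_injective (Pushout.in₂_inj G.c_injective h))
  range := comp_boundary G H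
  d_in x := (comp_inputs₁ G H _ (fun y h => G.d_ne_c x y h.symm)).trans (G.d_in x)
  c_out z := (comp_outputs₂ G H _ (fun y => H.d_ne_c y z)).trans (H.c_out z)

end comp

end FramedCospan

/-! ## Framed cospans between words -/

/-- Splitting the positions of a concatenation. -/
def splitFin {α : Type u} (A B : List α) : Fin (A ++ B).length ≃ Fin A.length ⊕ Fin B.length :=
  (finCongr List.length_append).trans finSumFinEquiv.symm

theorem get_splitFin_symm {α : Type u} (A B : List α) (s : Fin A.length ⊕ Fin B.length) :
    (A ++ B).get ((splitFin A B).symm s) = Sum.elim A.get B.get s := by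
  rcases s with i | i <;> simp [splitFin]

theorem get_splitFin {α : Type u} (A B : List α) (i : Fin (A ++ B).length) :
    (A ++ B).get i = Sum.elim A.get B.get (splitFin A B i) := by
  rw [← get_splitFin_symm, Equiv.symm_apply_apply]

namespace FramedCospan

variable {T : MonoidalSignature.{u, v}}

/-- A framed cospan between words from a string graph without isolated wire-vertices whose inputs
are enumerated by `d` and whose outputs are enumerated by `c`. -/
abbrev ofWords {A B : List T.Obj} (G : StringGraph T) (d : Fin A.length → G.V)
    (c : Fin B.length → G.V) (hd : ∀ i, G.τ.v (d i) = Sum.inl (A.get i))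
    (hc : ∀ i, G.τ.v (c i) = Sum.inl (B.get i)) (hdi : Function.Injective d)
    (hci : Function.Injective c) (hdr : Set.range d = G.inputs) (hcr : Set.range c = G.outputs)
    (hiso : ∀ x, ¬ G.IsIsolated x) : FramedCospan (wordGraph A) (wordGraph B) where
  toStringGraph := G
  d := ⟨⟨d, Empty.elim, fun e => e.elim, fun e => e.elim⟩, hd, fun e => e.elim⟩
  c := ⟨⟨c, Empty.elim, fun e => e.elim, fun e => e.elim⟩, hc, fun e => e.elim⟩
  no_isolated := hiso
  injective := by
    have hd' : ∀ i, d i ∈ G.inputs := fun i => hdr ▸ ⟨i, rfl⟩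
    have hc' : ∀ i, c i ∈ G.outputs := fun i => hcr ▸ ⟨i, rfl⟩
    rintro (i | i) (j | j) h
    · exact congrArg _ (hdi h)
    · change d i = c j at h
      exact absurd ⟨hd' i, h ▸ hc' j⟩ (hiso (d i))
    · change c i = d j at h
      exact absurd ⟨hd' j, h ▸ hc' i⟩ (hiso (d j))
    · exact congrArg _ (hci h)
  range := by rw [Set.Sum.elim_range]; exact congrArg₂ _ hdr hcr
  d_in i := ⟨fun _ => rfl, fun _ => hdr ▸ ⟨i, rfl⟩⟩
  c_out i := ⟨fun _ => rfl, fun _ => hcr ▸ ⟨i, rfl⟩⟩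

variable {A B A' B' X : List T.Obj}

theorem range_d (G : FramedCospan (wordGraph A) (wordGraph B)) : Set.range G.d.v = G.inputs := by
  ext x
  constructor
  · rintro ⟨i, rfl⟩
    exact (G.d_in i).2 rfl
  · intro h
    have h' : x ∈ G.boundary := Or.inl h
    rw [← G.range] at h'
    obtain ⟨i | j, rfl⟩ := h'
    · exact ⟨i, rfl⟩
    · exact absurd ⟨h, (G.c_out j).2 rfl⟩ (G.no_isolated _)

theorem range_c (G : FramedCospan (wordGraph A) (wordGraph B)) : Set.range G.c.v = G.outputs := by
  ext x
  constructor
  · rintro ⟨i, rfl⟩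
    exact (G.c_out i).2 rfl
  · intro h
    have h' : x ∈ G.boundary := Or.inr h
    rw [← G.range] at h'
    obtain ⟨i | j, rfl⟩ := h'
    · exact absurd ⟨(G.d_in i).2 rfl, h⟩ (G.no_isolated _)
    · exact ⟨j, rfl⟩

/-! ### Monoidal product -/

/-- The disjoint union of two string graphs. -/
abbrev sumGraph (G H : StringGraph T) : StringGraph T where
  V := G.V ⊕ H.V
  E := G.E ⊕ H.E
  src := Sum.map G.src H.src
  tgt := Sum.map G.tgt H.tgt
  τ :=
    { v := Sum.elim G.τ.v H.τ.v
      e := Sum.elim G.τ.e H.τ.e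
      src_e := by rintro (e | e); exacts [G.τ.src_e e, H.τ.src_e e]
      tgt_e := by rintro (e | e); exacts [G.τ.tgt_e e, H.τ.tgt_e e] }
  finite_V := by
    have := G.finite_V
    have := H.finite_V
    infer_instance
  finite_E := by
    have := G.finite_E
    have := H.finite_E
    infer_instance
  local_iso := by
    rintro (a | a) ha
    · refine (G.local_iso a ha).of_image (ι := Sum.inl) (fun _ => rfl) ?_
      ext (e | e) <;> simp [DirGraph.nbhd]
    · refine (H.local_iso a ha).of_image (ι := Sum.inr) (fun _ => rfl) ?_
      ext (e | e) <;> simp [DirGraph.nbhd]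
  out_unique := by
    rintro (e | e) (e' | e') hw h
    · exact congrArg _ (G.out_unique e e' hw (Sum.inl_injective h))
    · cases h
    · cases h
    · exact congrArg _ (H.out_unique e e' hw (Sum.inr_injective h))
  in_unique := by
    rintro (e | e) (e' | e') hw h
    · exact congrArg _ (G.in_unique e e' hw (Sum.inl_injective h))
    · cases h
    · cases h
    · exact congrArg _ (H.in_unique e e' hw (Sum.inr_injective h))

theorem sumGraph_inputs (G H : StringGraph T) (x : G.V ⊕ H.V) :
    x ∈ (sumGraph G H).inputs ↔ Sum.elim (· ∈ G.inputs) (· ∈ H.inputs) x := by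
  rcases x with x | x <;> simp [TypedGraph.inputs, TypedGraph.IsWire]

theorem sumGraph_outputs (G H : StringGraph T) (x : G.V ⊕ H.V) :
    x ∈ (sumGraph G H).outputs ↔ Sum.elim (· ∈ G.outputs) (· ∈ H.outputs) x := by
  rcases x with x | x <;> simp [TypedGraph.outputs, TypedGraph.IsWire]

theorem mem_range_sumMap {α β γ δ : Type} (f : α → γ) (g : β → δ) (x : γ ⊕ δ) :
    x ∈ Set.range (Sum.map f g) ↔ Sum.elim (· ∈ Set.range f) (· ∈ Set.range g) x := by
  rcases x with x | x <;> simp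

/-- The monoidal product of framed cospans: disjoint union. -/
abbrev tensor (G : FramedCospan (wordGraph A) (wordGraph B))
    (H : FramedCospan (wordGraph A') (wordGraph B')) :
    FramedCospan (wordGraph (A ++ A')) (wordGraph (B ++ B')) :=
  ofWords (sumGraph G.toStringGraph H.toStringGraph)
    (fun i => Sum.map G.d.v H.d.v (splitFin A A' i))
    (fun i => Sum.map G.c.v H.c.v (splitFin B B' i))
    (fun i => by
      rw [get_splitFin]
      rcases splitFin A A' i with j | j
      exacts [G.d.τ_v j, H.d.τ_v j])
    (fun i => by
      rw [get_splitFin]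
      rcases splitFin B B' i with j | j
      exacts [G.c.τ_v j, H.c.τ_v j])
    ((Sum.map_injective.2 ⟨G.d_injective, H.d_injective⟩).comp (splitFin A A').injective)
    ((Sum.map_injective.2 ⟨G.c_injective, H.c_injective⟩).comp (splitFin B B').injective)
    (by
      refine ((splitFin A A').surjective.range_comp (Sum.map G.d.v H.d.v)).trans ?_
      ext x
      refine (mem_range_sumMap G.d.v H.d.v x).trans ?_
      rw [sumGraph_inputs, range_d, range_d])
    (by
      refine ((splitFin B B').surjective.range_comp (Sum.map G.c.v H.c.v)).trans ?_
      ext x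
      refine (mem_range_sumMap G.c.v H.c.v x).trans ?_
      rw [sumGraph_outputs, range_c, range_c])
    (by
      rintro (x | x) ⟨h1, h2⟩ <;> rw [sumGraph_inputs] at h1 <;> rw [sumGraph_outputs] at h2
      exacts [G.no_isolated x ⟨h1, h2⟩, H.no_isolated x ⟨h1, h2⟩])

/-! ### Bare wires: identities and symmetries -/

/-- Parallel bare wires, one from each position `i` of `A` to the position `π i` of `B`. -/
abbrev wires (π : Fin A.length ≃ Fin B.length) (hπ : ∀ i, B.get (π i) = A.get i) :
    FramedCospan (wordGraph A) (wordGraph B) :=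
  ofWords
    { V := Fin A.length ⊕ Fin B.length
      E := Fin A.length
      src := Sum.inl
      tgt := fun i => Sum.inr (π i)
      τ := ⟨Sum.elim (fun i => Sum.inl (A.get i)) (fun i => Sum.inl (B.get i)),
        fun i => TypeEdge.mid (A.get i), fun _ => rfl, fun i => congrArg Sum.inl (hπ i).symm⟩
      finite_V := inferInstance
      finite_E := inferInstance
      local_iso := by rintro (x | x) ⟨f, hf⟩ <;> cases hf
      out_unique := fun _ _ _ h => Sum.inl_injective h
      in_unique := fun _ _ _ h => π.injective (Sum.inr_injective h) }
    Sum.inl Sum.inr (fun _ => rfl) (fun _ => rfl) Sum.inl_injective Sum.inr_injective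
    (by
      ext (x | x)
      · exact ⟨fun _ => ⟨⟨_, rfl⟩, fun _ h => Sum.inr_ne_inl h⟩, fun _ => ⟨x, rfl⟩⟩
      · exact ⟨fun ⟨_, h⟩ => absurd h Sum.inl_ne_inr, fun h =>
          absurd (congrArg Sum.inr (π.apply_symm_apply x)) (h.2 (π.symm x))⟩)
    (by
      ext (x | x)
      · exact ⟨fun ⟨_, h⟩ => absurd h Sum.inr_ne_inl, fun h => absurd rfl (h.2 x)⟩
      · exact ⟨fun _ => ⟨⟨_, rfl⟩, fun _ h => Sum.inl_ne_inr h⟩, fun _ => ⟨x, rfl⟩⟩)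
    (by
      rintro (x | x) ⟨h1, h2⟩
      · exact h2.2 x rfl
      · exact h1.2 (π.symm x) (congrArg Sum.inr (π.apply_symm_apply x)))

/-- The pseudo-identity. -/
abbrev pseudoId (A : List T.Obj) : FramedCospan (wordGraph A) (wordGraph A) :=
  wires (Equiv.refl _) (fun _ => rfl)

/-- The symmetry: the wires of `A` cross the wires of `B`. -/
abbrev swap (A B : List T.Obj) : FramedCospan (wordGraph (A ++ B)) (wordGraph (B ++ A)) :=
  wires ((splitFin A B).trans ((Equiv.sumComm _ _).trans (splitFin B A).symm)) (fun i => by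
    rw [get_splitFin A B i]
    refine (get_splitFin_symm B A _).trans ?_
    rcases splitFin A B i with j | j <;> simp)

/-! ### Trace -/

section trace

variable (G : FramedCospan (wordGraph (A ++ X)) (wordGraph (B ++ X)))

/-- The input of `G` at position `k` of the traced word. -/
abbrev traceIn (k : Fin X.length) : G.V := G.d.v ((splitFin A X).symm (Sum.inr k))

/-- The output of `G` at position `k` of the traced word. -/
abbrev traceOut (k : Fin X.length) : G.V := G.c.v ((splitFin B X).symm (Sum.inr k))

theorem traceIn_inputs (k : Fin X.length) : traceIn G k ∈ G.inputs := (G.d_in _).2 rfl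

theorem traceOut_outputs (k : Fin X.length) : traceOut G k ∈ G.outputs := (G.c_out _).2 rfl

theorem traceIn_injective : Function.Injective (traceIn G) := fun _ _ h =>
  Sum.inr_injective ((splitFin A X).symm.injective (G.d_injective h))

theorem traceOut_injective : Function.Injective (traceOut G) := fun _ _ h =>
  Sum.inr_injective ((splitFin B X).symm.injective (G.c_injective h))

/-- The graph `G` with, for every position `k` of the traced word, an extra edge from the output
at `k` to the input at `k`. -/
abbrev traceGraph : StringGraph T where
  V := G.V
  E := G.E ⊕ Fin X.length
  src := Sum.elim G.src (traceOut G)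
  tgt := Sum.elim G.tgt (traceIn G)
  τ :=
    { v := G.τ.v
      e := Sum.elim G.τ.e (fun k => TypeEdge.mid (X.get k))
      src_e := by
        rintro (e | k)
        · exact G.τ.src_e e
        · exact (congrArg Sum.inl (get_splitFin_symm B X (Sum.inr k)).symm).trans
            (G.c.τ_v _).symm
      tgt_e := by
        rintro (e | k)
        · exact G.τ.tgt_e e
        · exact (congrArg Sum.inl (get_splitFin_symm A X (Sum.inr k)).symm).trans
            (G.d.τ_v _).symm }
  finite_V := G.finite_V
  finite_E := by
    have := G.finite_E
    infer_instance
  local_iso a ha := by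
    refine (G.local_iso a ha).of_image (ι := Sum.inl) (fun _ => rfl) ?_
    ext (e | k)
    · simp [DirGraph.nbhd]
    · simp only [Set.mem_image, reduceCtorEq, and_false, exists_false, iff_false]
      rintro (h | h)
      · exact not_box_and_wire G.toTypedGraph ha (h ▸ (traceOut_outputs G k).1)
      · exact not_box_and_wire G.toTypedGraph ha (h ▸ (traceIn_inputs G k).1)
  out_unique := by
    rintro (e | k) (e' | k') hw h
    · exact congrArg _ (G.out_unique e e' hw h)
    · exact absurd h ((traceOut_outputs G k').2 e)
    · exact absurd h.symm ((traceOut_outputs G k).2 e')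
    · exact congrArg _ (traceOut_injective G h)
  in_unique := by
    rintro (e | k) (e' | k') hw h
    · exact congrArg _ (G.in_unique e e' hw h)
    · exact absurd h ((traceIn_inputs G k').2 e)
    · exact absurd h.symm ((traceIn_inputs G k).2 e')
    · exact congrArg _ (traceIn_injective G h)

/-- The trace: every traced output is connected to the corresponding traced input by a wire (up to
wire-homeomorphism, this is the plugging with a cap and a cup around the traced word). -/
abbrev trace : FramedCospan (wordGraph A) (wordGraph B) :=
  ofWords (traceGraph G)
    (fun i => G.d.v ((splitFin A X).symm (Sum.inl i)))
    (fun i => G.c.v ((splitFin B X).symm (Sum.inl i)))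
    (fun i => (G.d.τ_v _).trans (congrArg Sum.inl (get_splitFin_symm A X (Sum.inl i))))
    (fun i => (G.c.τ_v _).trans (congrArg Sum.inl (get_splitFin_symm B X (Sum.inl i))))
    (fun _ _ h => Sum.inl_injective ((splitFin A X).symm.injective (G.d_injective h)))
    (fun _ _ h => Sum.inl_injective ((splitFin B X).symm.injective (G.c_injective h)))
    (by
      ext x
      constructor
      · rintro ⟨i, rfl⟩
        have h := (G.d_in ((splitFin A X).symm (Sum.inl i))).2 rfl
        refine ⟨h.1, ?_⟩
        rintro (e | k) he
        · exact h.2 e he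
        · have := (splitFin A X).symm.injective (G.d_injective he)
          cases this
      · intro h
        have h' : x ∈ G.inputs := ⟨h.1, fun e => h.2 (Sum.inl e)⟩
        rw [← range_d] at h'
        obtain ⟨i, rfl⟩ := h'
        obtain ⟨s, rfl⟩ := (splitFin A X).symm.surjective i
        rcases s with s | s
        · exact ⟨s, rfl⟩
        · exact absurd rfl (h.2 (Sum.inr s)))
    (by
      ext x
      constructor
      · rintro ⟨i, rfl⟩
        have h := (G.c_out ((splitFin B X).symm (Sum.inl i))).2 rfl
        refine ⟨h.1, ?_⟩
        rintro (e | k) he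
        · exact h.2 e he
        · have := (splitFin B X).symm.injective (G.c_injective he)
          cases this
      · intro h
        have h' : x ∈ G.outputs := ⟨h.1, fun e => h.2 (Sum.inl e)⟩
        rw [← range_c] at h'
        obtain ⟨i, rfl⟩ := h'
        obtain ⟨s, rfl⟩ := (splitFin B X).symm.surjective i
        rcases s with s | s
        · exact ⟨s, rfl⟩
        · exact absurd rfl (h.2 (Sum.inr s)))
    (fun x h => G.no_isolated x
      ⟨⟨h.1.1, fun e => h.1.2 (Sum.inl e)⟩, ⟨h.2.1, fun e => h.2.2 (Sum.inl e)⟩⟩)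

end trace

/-! ### Generators -/

/-- The graph with one box-vertex of type `m` together with its inputs and outputs. -/
abbrev boxGraph (m : T.Mor) : StringGraph T where
  V := Unit ⊕ (Fin (T.dom m).length ⊕ Fin (T.cod m).length)
  E := Fin (T.dom m).length ⊕ Fin (T.cod m).length
  src := Sum.elim (fun i => Sum.inr (Sum.inl i)) (fun _ => Sum.inl ())
  tgt := Sum.elim (fun _ => Sum.inl ()) (fun j => Sum.inr (Sum.inr j))
  τ :=
    { v := Sum.elim (fun _ => Sum.inr m)
        (Sum.elim (fun i => Sum.inl ((T.dom m).get i)) (fun j => Sum.inl ((T.cod m).get j)))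
      e := Sum.elim (TypeEdge.inp m) (TypeEdge.out m)
      src_e := by rintro (e | e) <;> rfl
      tgt_e := by rintro (e | e) <;> rfl }
  finite_V := inferInstance
  finite_E := inferInstance
  local_iso := by
    rintro (_ | x | x) ⟨f, hf⟩
    · refine ⟨?_, ?_, ?_⟩
      · rintro (e | e) -
        · exact Or.inr rfl
        · exact Or.inl rfl
      · rintro (e | e) - (e' | e') - h <;> cases h <;> rfl
      · rintro (Z | ⟨f, i⟩ | ⟨f, j⟩) h
        · rcases h with h | h <;> cases h
        · rcases h with h | h <;> cases h
          exact ⟨Sum.inl i, Or.inr rfl, rfl⟩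
        · rcases h with h | h <;> cases h
          exact ⟨Sum.inr j, Or.inl rfl, rfl⟩
    · cases hf
    · cases hf
  out_unique := by
    rintro (e | e) (e' | e') ⟨Z, hZ⟩ h
    · simpa using h
    · cases h
    · cases h
    · cases hZ
  in_unique := by
    rintro (e | e) (e' | e') ⟨Z, hZ⟩ h
    · cases hZ
    · cases h
    · cases h
    · simpa using h

/-- The framed cospan of a generator. -/
abbrev box (m : T.Mor) : FramedCospan (wordGraph (T.dom m)) (wordGraph (T.cod m)) :=
  ofWords (boxGraph m) (fun i => Sum.inr (Sum.inl i)) (fun j => Sum.inr (Sum.inr j))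
    (fun _ => rfl) (fun _ => rfl)
    (Sum.inr_injective.comp Sum.inl_injective) (Sum.inr_injective.comp Sum.inr_injective)
    (by
      ext (x | x | x)
      · exact ⟨fun ⟨_, h⟩ => (by cases h), fun ⟨⟨_, h⟩, _⟩ => (by cases h)⟩
      · exact ⟨fun _ => ⟨⟨_, rfl⟩, by rintro (e | e) h <;> cases h⟩, fun _ => ⟨x, rfl⟩⟩
      · exact ⟨fun ⟨_, h⟩ => (by cases h), fun h => absurd rfl (h.2 (Sum.inr x))⟩)
    (by
      ext (x | x | x)
      · exact ⟨fun ⟨_, h⟩ => (by cases h), fun ⟨⟨_, h⟩, _⟩ => (by cases h)⟩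
      · exact ⟨fun ⟨_, h⟩ => (by cases h), fun h => absurd rfl (h.2 (Sum.inl x))⟩
      · exact ⟨fun _ => ⟨⟨_, rfl⟩, by rintro (e | e) h <;> cases h⟩, fun _ => ⟨x, rfl⟩⟩)
    (by
      rintro (x | x | x) ⟨h1, h2⟩
      · obtain ⟨Z, hZ⟩ := h1.1
        cases hZ
      · exact h2.2 (Sum.inl x) rfl
      · exact h1.2 (Sum.inr x) rfl)

end FramedCospan

/-! ## The operations respect wire-homeomorphism -/

theorem bijective_elim {α β : Type} {w : β} {f : α → β} :
    Function.Bijective (fun o : Option α => o.elim w f) ↔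
      Function.Injective f ∧ (∀ a, f a ≠ w) ∧ ∀ b, b = w ∨ ∃ a, f a = b := by
  constructor
  · rintro ⟨h1, h2⟩
    refine ⟨fun a a' h => Option.some.inj (h1 (a₁ := some a) (a₂ := some a') h), fun a h => ?_, fun b => ?_⟩
    · have := h1 (a₁ := some a) (a₂ := none) h
      cases this
    · obtain ⟨o | a, rfl⟩ := h2 b
      exacts [Or.inl rfl, Or.inr ⟨_, rfl⟩]
  · rintro ⟨h1, h2, h3⟩
    refine ⟨?_, fun b => ?_⟩
    · rintro (_ | a) (_ | a') h
      · rfl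
      · exact absurd h.symm (h2 a')
      · exact absurd h (h2 a)
      · exact congrArg some (h1 h)
    · rcases h3 b with rfl | ⟨a, rfl⟩
      exacts [⟨none, rfl⟩, ⟨some a, rfl⟩]

theorem bijective_elim_inl {α β γ : Type} {w : β} {f : α → β}
    (h : Function.Bijective (fun o : Option α => o.elim w f)) :
    Function.Bijective (fun o : Option (α ⊕ γ) => o.elim (Sum.inl w) (Sum.map f id)) := by
  rw [bijective_elim] at h ⊢
  refine ⟨Sum.map_injective.2 ⟨h.1, Function.injective_id⟩, ?_, ?_⟩
  · rintro (a | c) e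
    · exact h.2.1 a (Sum.inl_injective e)
    · cases e
  · rintro (b | c)
    · rcases h.2.2 b with rfl | ⟨a, rfl⟩
      exacts [Or.inl rfl, Or.inr ⟨Sum.inl a, rfl⟩]
    · exact Or.inr ⟨Sum.inr c, rfl⟩

theorem bijective_elim_inr {α β γ : Type} {w : β} {f : α → β}
    (h : Function.Bijective (fun o : Option α => o.elim w f)) :
    Function.Bijective (fun o : Option (γ ⊕ α) => o.elim (Sum.inr w) (Sum.map id f)) := by
  rw [bijective_elim] at h ⊢
  refine ⟨Sum.map_injective.2 ⟨Function.injective_id, h.1⟩, ?_, ?_⟩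
  · rintro (c | a) e
    · cases e
    · exact h.2.1 a (Sum.inr_injective e)
  · rintro (c | b)
    · exact Or.inr ⟨Sum.inl c, rfl⟩
    · rcases h.2.2 b with rfl | ⟨a, rfl⟩
      exacts [Or.inl rfl, Or.inr ⟨Sum.inr a, rfl⟩]

namespace WireStep

open FramedCospan

variable {T : MonoidalSignature.{u, v}} {X Y Z : FramedPointGraph T}

theorem comp_left {G G' : FramedCospan X Y} (h : WireStep G G') (H : FramedCospan Y Z) :
    WireStep (G.comp H) (G'.comp H) := by
  rcases h with α | σ
  · have hv : ∀ y, (Pushout.in₁ (α.v (G.c.v y)) : Pushout G'.c.v H.d.v) = Pushout.in₂ (H.d.v y) :=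
      fun y => by rw [← α.c_v]; exact Pushout.glue y
    refine .iso
      { v := Equiv.ofBijective (Pushout.desc (fun a => Pushout.in₁ (α.v a)) Pushout.in₂ hv) ⟨?_, ?_⟩
        e := Equiv.sumCongr α.e (Equiv.refl _)
        src_e := ?_, tgt_e := ?_, τ_v := ?_, τ_e := ?_, d_v := ?_, c_v := fun _ => rfl }
    · intro x y hxy
      rcases Pushout.cases x with ⟨a, rfl⟩ | ⟨b, rfl⟩ <;>
        rcases Pushout.cases y with ⟨a', rfl⟩ | ⟨b', rfl⟩
      · exact congrArg _ (α.v.injective (Pushout.in₁_inj H.d_injective hxy))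
      · obtain ⟨y, h1, rfl⟩ := Pushout.in₁_eq_in₂ H.d_injective hxy
        rw [α.c_v] at h1
        rw [← α.v.injective h1]
        exact Pushout.glue y
      · obtain ⟨y, h1, rfl⟩ := Pushout.in₁_eq_in₂ H.d_injective hxy.symm
        rw [α.c_v] at h1
        rw [← α.v.injective h1]
        exact (Pushout.glue y).symm
      · exact congrArg _ (Pushout.in₂_inj G'.c_injective hxy)
    · intro k
      rcases Pushout.cases k with ⟨a, rfl⟩ | ⟨b, rfl⟩
      · exact ⟨Pushout.in₁ (α.v.symm a), congrArg Pushout.in₁ (α.v.apply_symm_apply a)⟩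
      · exact ⟨Pushout.in₂ b, rfl⟩
    · rintro (e | e)
      exacts [congrArg Pushout.in₁ (α.src_e e), rfl]
    · rintro (e | e)
      exacts [congrArg Pushout.in₁ (α.tgt_e e), rfl]
    · intro x
      rcases Pushout.cases x with ⟨a, rfl⟩ | ⟨b, rfl⟩
      exacts [α.τ_v a, rfl]
    · rintro (e | e)
      exacts [α.τ_e e, rfl]
    · exact fun x => congrArg Pushout.in₁ (α.d_v x)
  · have hv : ∀ y, (Pushout.in₁ (σ.v (G.c.v y)) : Pushout G'.c.v H.d.v) = Pushout.in₂ (H.d.v y) :=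
      fun y => by rw [← σ.c_v]; exact Pushout.glue y
    have hb := bijective_elim.1 σ.v_bijective
    refine .subdivide
      { e₀ := Sum.inl σ.e₀
        v := Pushout.desc (fun a => Pushout.in₁ (σ.v a)) Pushout.in₂ hv
        w := Pushout.in₁ σ.w
        v_bijective := bijective_elim.2 ⟨?_, ?_, ?_⟩
        e := Sum.map σ.e id
        e₁ := Sum.inl σ.e₁
        e_bijective := bijective_elim_inl σ.e_bijective
        src_e := ?_, tgt_e := ?_
        tgt_e₀ := congrArg Pushout.in₁ σ.tgt_e₀
        src_e₁ := congrArg Pushout.in₁ σ.src_e₁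
        tgt_e₁ := congrArg Pushout.in₁ σ.tgt_e₁
        τ_v := ?_
        τ_w := σ.τ_w
        τ_e := ?_
        τ_e₀ := σ.τ_e₀
        τ_e₁ := σ.τ_e₁
        d_v := fun x => congrArg Pushout.in₁ (σ.d_v x)
        c_v := fun _ => rfl }
    · intro x y hxy
      rcases Pushout.cases x with ⟨a, rfl⟩ | ⟨b, rfl⟩ <;>
        rcases Pushout.cases y with ⟨a', rfl⟩ | ⟨b', rfl⟩
      · exact congrArg _ (hb.1 (Pushout.in₁_inj H.d_injective hxy))
      · obtain ⟨y, h1, rfl⟩ := Pushout.in₁_eq_in₂ H.d_injective hxy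
        rw [σ.c_v] at h1
        rw [← hb.1 h1]
        exact Pushout.glue y
      · obtain ⟨y, h1, rfl⟩ := Pushout.in₁_eq_in₂ H.d_injective hxy.symm
        rw [σ.c_v] at h1
        rw [← hb.1 h1]
        exact (Pushout.glue y).symm
      · exact congrArg _ (Pushout.in₂_inj G'.c_injective hxy)
    · intro x hx
      rcases Pushout.cases x with ⟨a, rfl⟩ | ⟨b, rfl⟩
      · exact hb.2.1 a (Pushout.in₁_inj H.d_injective hx)
      · obtain ⟨y, h1, rfl⟩ := Pushout.in₁_eq_in₂ H.d_injective hx.symm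
        rw [σ.c_v] at h1
        exact hb.2.1 _ h1
    · intro k
      rcases Pushout.cases k with ⟨a, rfl⟩ | ⟨b, rfl⟩
      · rcases hb.2.2 a with rfl | ⟨a, rfl⟩
        exacts [Or.inl rfl, Or.inr ⟨Pushout.in₁ a, rfl⟩]
      · exact Or.inr ⟨Pushout.in₂ b, rfl⟩
    · rintro (e | e)
      exacts [congrArg Pushout.in₁ (σ.src_e e), rfl]
    · rintro (e | e) he
      exacts [congrArg Pushout.in₁ (σ.tgt_e e (fun h => he (congrArg _ h))), rfl]
    · intro x
      rcases Pushout.cases x with ⟨a, rfl⟩ | ⟨b, rfl⟩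
      exacts [σ.τ_v a, rfl]
    · rintro (e | e) he
      exacts [σ.τ_e e (fun h => he (congrArg _ h)), rfl]

theorem comp_right (G : FramedCospan X Y) {H H' : FramedCospan Y Z} (h : WireStep H H') :
    WireStep (G.comp H) (G.comp H') := by
  rcases h with α | σ
  · have hv : ∀ y, (Pushout.in₁ (G.c.v y) : Pushout G.c.v H'.d.v) = Pushout.in₂ (α.v (H.d.v y)) :=
      fun y => by rw [← α.d_v]; exact Pushout.glue y
    refine .iso
      { v := Equiv.ofBijective (Pushout.desc Pushout.in₁ (fun a => Pushout.in₂ (α.v a)) hv) ⟨?_, ?_⟩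
        e := Equiv.sumCongr (Equiv.refl _) α.e
        src_e := ?_, tgt_e := ?_, τ_v := ?_, τ_e := ?_, d_v := fun _ => rfl, c_v := ?_ }
    · intro x y hxy
      rcases Pushout.cases x with ⟨a, rfl⟩ | ⟨b, rfl⟩ <;>
        rcases Pushout.cases y with ⟨a', rfl⟩ | ⟨b', rfl⟩
      · exact congrArg _ (Pushout.in₁_inj H'.d_injective hxy)
      · obtain ⟨y, rfl, h1⟩ := Pushout.in₁_eq_in₂ H'.d_injective hxy
        rw [α.d_v] at h1
        rw [← α.v.injective h1]
        exact Pushout.glue y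
      · obtain ⟨y, rfl, h1⟩ := Pushout.in₁_eq_in₂ H'.d_injective hxy.symm
        rw [α.d_v] at h1
        rw [← α.v.injective h1]
        exact (Pushout.glue y).symm
      · exact congrArg _ (α.v.injective (Pushout.in₂_inj G.c_injective hxy))
    · intro k
      rcases Pushout.cases k with ⟨a, rfl⟩ | ⟨b, rfl⟩
      · exact ⟨Pushout.in₁ a, rfl⟩
      · exact ⟨Pushout.in₂ (α.v.symm b), congrArg Pushout.in₂ (α.v.apply_symm_apply b)⟩
    · rintro (e | e)
      exacts [rfl, congrArg Pushout.in₂ (α.src_e e)]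
    · rintro (e | e)
      exacts [rfl, congrArg Pushout.in₂ (α.tgt_e e)]
    · intro x
      rcases Pushout.cases x with ⟨a, rfl⟩ | ⟨b, rfl⟩
      exacts [rfl, α.τ_v b]
    · rintro (e | e)
      exacts [rfl, α.τ_e e]
    · exact fun x => congrArg Pushout.in₂ (α.c_v x)
  · have hv : ∀ y, (Pushout.in₁ (G.c.v y) : Pushout G.c.v H'.d.v) = Pushout.in₂ (σ.v (H.d.v y)) :=
      fun y => by rw [← σ.d_v]; exact Pushout.glue y
    have hb := bijective_elim.1 σ.v_bijective
    refine .subdivide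
      { e₀ := Sum.inr σ.e₀
        v := Pushout.desc Pushout.in₁ (fun a => Pushout.in₂ (σ.v a)) hv
        w := Pushout.in₂ σ.w
        v_bijective := bijective_elim.2 ⟨?_, ?_, ?_⟩
        e := Sum.map id σ.e
        e₁ := Sum.inr σ.e₁
        e_bijective := bijective_elim_inr σ.e_bijective
        src_e := ?_, tgt_e := ?_
        tgt_e₀ := congrArg Pushout.in₂ σ.tgt_e₀
        src_e₁ := congrArg Pushout.in₂ σ.src_e₁
        tgt_e₁ := congrArg Pushout.in₂ σ.tgt_e₁
        τ_v := ?_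
        τ_w := σ.τ_w
        τ_e := ?_
        τ_e₀ := σ.τ_e₀
        τ_e₁ := σ.τ_e₁
        d_v := fun _ => rfl
        c_v := fun x => congrArg Pushout.in₂ (σ.c_v x) }
    · intro x y hxy
      rcases Pushout.cases x with ⟨a, rfl⟩ | ⟨b, rfl⟩ <;>
        rcases Pushout.cases y with ⟨a', rfl⟩ | ⟨b', rfl⟩
      · exact congrArg _ (Pushout.in₁_inj H'.d_injective hxy)
      · obtain ⟨y, rfl, h1⟩ := Pushout.in₁_eq_in₂ H'.d_injective hxy
        rw [σ.d_v] at h1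
        rw [← hb.1 h1]
        exact Pushout.glue y
      · obtain ⟨y, rfl, h1⟩ := Pushout.in₁_eq_in₂ H'.d_injective hxy.symm
        rw [σ.d_v] at h1
        rw [← hb.1 h1]
        exact (Pushout.glue y).symm
      · exact congrArg _ (hb.1 (Pushout.in₂_inj G.c_injective hxy))
    · intro x hx
      rcases Pushout.cases x with ⟨a, rfl⟩ | ⟨b, rfl⟩
      · obtain ⟨y, rfl, h1⟩ := Pushout.in₁_eq_in₂ H'.d_injective hx
        rw [σ.d_v] at h1
        exact hb.2.1 _ h1
      · exact hb.2.1 b (Pushout.in₂_inj G.c_injective hx)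
    · intro k
      rcases Pushout.cases k with ⟨a, rfl⟩ | ⟨b, rfl⟩
      · exact Or.inr ⟨Pushout.in₁ a, rfl⟩
      · rcases hb.2.2 b with rfl | ⟨a, rfl⟩
        exacts [Or.inl rfl, Or.inr ⟨Pushout.in₂ a, rfl⟩]
    · rintro (e | e)
      exacts [rfl, congrArg Pushout.in₂ (σ.src_e e)]
    · rintro (e | e) he
      exacts [rfl, congrArg Pushout.in₂ (σ.tgt_e e (fun h => he (congrArg _ h)))]
    · intro x
      rcases Pushout.cases x with ⟨a, rfl⟩ | ⟨b, rfl⟩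
      exacts [rfl, σ.τ_v b]
    · rintro (e | e) he
      exacts [rfl, σ.τ_e e (fun h => he (congrArg _ h))]

variable {A A' B B' W : List T.Obj}

theorem tensor_left {G G' : FramedCospan (wordGraph A) (wordGraph B)} (h : WireStep G G')
    (H : FramedCospan (wordGraph A') (wordGraph B')) : WireStep (G.tensor H) (G'.tensor H) := by
  rcases h with α | σ
  · refine .iso
      { v := Equiv.sumCongr α.v (Equiv.refl _)
        e := Equiv.sumCongr α.e (Equiv.refl _)
        src_e := ?_, tgt_e := ?_, τ_v := ?_, τ_e := ?_, d_v := fun x => ?_, c_v := fun x => ?_ }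
    · rintro (e | e)
      exacts [congrArg Sum.inl (α.src_e e), rfl]
    · rintro (e | e)
      exacts [congrArg Sum.inl (α.tgt_e e), rfl]
    · rintro (a | a)
      exacts [α.τ_v a, rfl]
    · rintro (e | e)
      exacts [α.τ_e e, rfl]
    · dsimp only
      rcases splitFin A A' x with i | i
      exacts [congrArg Sum.inl (α.d_v i), rfl]
    · dsimp only
      rcases splitFin B B' x with i | i
      exacts [congrArg Sum.inl (α.c_v i), rfl]
  · refine .subdivide
      { e₀ := Sum.inl σ.e₀
        v := Sum.map σ.v id
        w := Sum.inl σ.w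
        v_bijective := bijective_elim_inl σ.v_bijective
        e := Sum.map σ.e id
        e₁ := Sum.inl σ.e₁
        e_bijective := bijective_elim_inl σ.e_bijective
        src_e := ?_, tgt_e := ?_
        tgt_e₀ := congrArg Sum.inl σ.tgt_e₀
        src_e₁ := congrArg Sum.inl σ.src_e₁
        tgt_e₁ := congrArg Sum.inl σ.tgt_e₁
        τ_v := ?_
        τ_w := σ.τ_w
        τ_e := ?_
        τ_e₀ := σ.τ_e₀
        τ_e₁ := σ.τ_e₁
        d_v := fun x => ?_
        c_v := fun x => ?_ }
    · rintro (e | e)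
      exacts [congrArg Sum.inl (σ.src_e e), rfl]
    · rintro (e | e) he
      exacts [congrArg Sum.inl (σ.tgt_e e (fun h => he (congrArg _ h))), rfl]
    · rintro (a | a)
      exacts [σ.τ_v a, rfl]
    · rintro (e | e) he
      exacts [σ.τ_e e (fun h => he (congrArg _ h)), rfl]
    · dsimp only
      rcases splitFin A A' x with i | i
      exacts [congrArg Sum.inl (σ.d_v i), rfl]
    · dsimp only
      rcases splitFin B B' x with i | i
      exacts [congrArg Sum.inl (σ.c_v i), rfl]

theorem tensor_right (G : FramedCospan (wordGraph A) (wordGraph B))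
    {H H' : FramedCospan (wordGraph A') (wordGraph B')} (h : WireStep H H') :
    WireStep (G.tensor H) (G.tensor H') := by
  rcases h with α | σ
  · refine .iso
      { v := Equiv.sumCongr (Equiv.refl _) α.v
        e := Equiv.sumCongr (Equiv.refl _) α.e
        src_e := ?_, tgt_e := ?_, τ_v := ?_, τ_e := ?_, d_v := fun x => ?_, c_v := fun x => ?_ }
    · rintro (e | e)
      exacts [rfl, congrArg Sum.inr (α.src_e e)]
    · rintro (e | e)
      exacts [rfl, congrArg Sum.inr (α.tgt_e e)]
    · rintro (a | a)
      exacts [rfl, α.τ_v a]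
    · rintro (e | e)
      exacts [rfl, α.τ_e e]
    · dsimp only
      rcases splitFin A A' x with i | i
      exacts [rfl, congrArg Sum.inr (α.d_v i)]
    · dsimp only
      rcases splitFin B B' x with i | i
      exacts [rfl, congrArg Sum.inr (α.c_v i)]
  · refine .subdivide
      { e₀ := Sum.inr σ.e₀
        v := Sum.map id σ.v
        w := Sum.inr σ.w
        v_bijective := bijective_elim_inr σ.v_bijective
        e := Sum.map id σ.e
        e₁ := Sum.inr σ.e₁
        e_bijective := bijective_elim_inr σ.e_bijective
        src_e := ?_, tgt_e := ?_
        tgt_e₀ := congrArg Sum.inr σ.tgt_e₀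
        src_e₁ := congrArg Sum.inr σ.src_e₁
        tgt_e₁ := congrArg Sum.inr σ.tgt_e₁
        τ_v := ?_
        τ_w := σ.τ_w
        τ_e := ?_
        τ_e₀ := σ.τ_e₀
        τ_e₁ := σ.τ_e₁
        d_v := fun x => ?_
        c_v := fun x => ?_ }
    · rintro (e | e)
      exacts [rfl, congrArg Sum.inr (σ.src_e e)]
    · rintro (e | e) he
      exacts [rfl, congrArg Sum.inr (σ.tgt_e e (fun h => he (congrArg _ h)))]
    · rintro (a | a)
      exacts [rfl, σ.τ_v a]
    · rintro (e | e) he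
      exacts [rfl, σ.τ_e e (fun h => he (congrArg _ h))]
    · dsimp only
      rcases splitFin A A' x with i | i
      exacts [rfl, congrArg Sum.inr (σ.d_v i)]
    · dsimp only
      rcases splitFin B B' x with i | i
      exacts [rfl, congrArg Sum.inr (σ.c_v i)]

theorem trace {G G' : FramedCospan (wordGraph (A ++ W)) (wordGraph (B ++ W))} (h : WireStep G G') :
    WireStep G.trace G'.trace := by
  rcases h with α | σ
  · refine .iso
      { v := α.v
        e := Equiv.sumCongr α.e (Equiv.refl _)
        src_e := ?_, tgt_e := ?_, τ_v := α.τ_v, τ_e := ?_, d_v := fun x => α.d_v _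
        c_v := fun x => α.c_v _ }
    · rintro (e | e)
      exacts [α.src_e e, α.c_v _]
    · rintro (e | e)
      exacts [α.tgt_e e, α.d_v _]
    · rintro (e | e)
      exacts [α.τ_e e, rfl]
  · refine .subdivide
      { e₀ := Sum.inl σ.e₀
        v := σ.v
        w := σ.w
        v_bijective := σ.v_bijective
        e := Sum.map σ.e id
        e₁ := Sum.inl σ.e₁
        e_bijective := bijective_elim_inl σ.e_bijective
        src_e := ?_, tgt_e := ?_
        tgt_e₀ := σ.tgt_e₀
        src_e₁ := σ.src_e₁
        tgt_e₁ := σ.tgt_e₁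
        τ_v := σ.τ_v
        τ_w := σ.τ_w
        τ_e := ?_
        τ_e₀ := σ.τ_e₀
        τ_e₁ := σ.τ_e₁
        d_v := fun x => σ.d_v _
        c_v := fun x => σ.c_v _ }
    · rintro (e | e)
      exacts [σ.src_e e, σ.c_v _]
    · rintro (e | e) he
      exacts [σ.tgt_e e (fun h => he (congrArg _ h)), σ.d_v _]
    · rintro (e | e) he
      exacts [σ.τ_e e (fun h => he (congrArg _ h)), rfl]

end WireStep

/-! ## Every positive framed point graph is a word -/

/-- An isomorphism of framed point graphs is an isomorphism of ordered sets. -/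
def FramedPointGraph.Iso.toOrderIso {T : MonoidalSignature.{u, v}} {X Y : FramedPointGraph T}
    (α : X.Iso Y) : @OrderIso X.V Y.V X.order.toLE Y.order.toLE :=
  @RelIso.mk X.V Y.V X.order.le Y.order.le α.v (fun {a b} => α.order_v a b)

/-- Isomorphisms of framed point graphs are unique. -/
theorem FramedPointGraph.iso_unique {T : MonoidalSignature.{u, v}} {X Y : FramedPointGraph T}
    (α β : X.Iso Y) : α = β := by
  let _ := X.order
  let _ := Y.order
  have := X.finite_V
  have h : α.toOrderIso = β.toOrderIso := Subsingleton.elim _ _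
  ext1
  ext x
  exact congrArg (fun f : X.V ≃o Y.V => f x) h

/-- Every positive framed point graph is isomorphic (uniquely, by `FramedPointGraph.iso_unique`) to
the standard one of exactly one word. -/
theorem FramedPointGraph.existsUnique_word {T : MonoidalSignature.{u, v}} (X : FramedPointGraph T)
    (hX : X.IsPositive) : ∃! L : List T.Obj, Nonempty (X.Iso (wordGraph L)) := by
  let _ := X.order
  have := X.finite_V
  let _ := Fintype.ofFinite X.V
  have hw : ∀ x : X.V, ∃ Z, X.τ.v x = Sum.inl Z := fun x => (X.isolated x).1.1
  choose t ht using hw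
  let e : Fin (Fintype.card X.V) ≃o X.V := Fintype.orderIsoFinOfCardEq X.V rfl
  let L : List T.Obj := List.ofFn (fun i => t (e i))
  have hL : L.length = Fintype.card X.V := List.length_ofFn
  have α : X.Iso (wordGraph L) :=
    { v := (e.symm.trans (Fin.castOrderIso hL.symm)).toEquiv
      τ_v := by
        intro x
        rw [ht]
        refine congrArg Sum.inl ((List.get_ofFn _ _).trans (congrArg t ?_))
        exact e.apply_symm_apply x
      order_v := fun x x' => (e.symm.trans (Fin.castOrderIso hL.symm)).le_iff_le
      sgn_v := fun x => (hX x).symm }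
  refine ⟨L, ⟨α⟩, ?_⟩
  rintro M ⟨β⟩
  let α' : X.V ≃o Fin L.length := α.toOrderIso
  let β' : X.V ≃o Fin M.length := β.toOrderIso
  let ε : Fin L.length ≃o Fin M.length := α'.symm.trans β'
  have hlen : L.length = M.length := by simpa using Fintype.card_congr ε.toEquiv
  have hε : ε = Fin.castOrderIso hlen := Subsingleton.elim _ _
  refine (List.ext_get hlen (fun n h1 h2 => ?_)).symm
  have h3 : ε ⟨n, h1⟩ = ⟨n, h2⟩ := by rw [hε]; rfl
  have h4 := β.τ_v (α'.symm ⟨n, h1⟩)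
  have h5 := α.τ_v (α'.symm ⟨n, h1⟩)
  have h6 : β.v (α'.symm ⟨n, h1⟩) = (⟨n, h2⟩ : Fin M.length) := h3
  have h7 : α.v (α'.symm ⟨n, h1⟩) = (⟨n, h1⟩ : Fin L.length) := α'.apply_symm_apply ⟨n, h1⟩
  rw [h6] at h4
  rw [h7] at h5
  exact Sum.inl_injective (h5.trans h4.symm)

/-! ## The category of positive framed cospans -/

/-- The objects of the category of positive framed cospans: a word of objects stands for the
positive framed point graph `wordGraph`, which represents its isomorphism class
(see `FramedPointGraph.existsUnique_word`). -/
def FCspPlus (T : MonoidalSignature.{u, v}) : Type u := List T.Obj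

/-- Morphisms are positive framed cospans up to wire-homeomorphism; composition is by pushout
(plugging), identities are the pseudo-identities, the monoidal product is disjoint union, symmetries
are crossing wires, and the trace connects outputs to inputs. -/
instance FCspPlus.tracedStruct (T : MonoidalSignature.{u, v}) :
    TracedStruct.{u, max 1 u v} (FCspPlus T) where
  Hom A B := CospanClass (wordGraph A) (wordGraph B)
  id A := Quot.mk _ (FramedCospan.pseudoId A)
  comp := Quot.map₂ FramedCospan.comp (fun G _ _ h => WireStep.comp_right G h)
    (fun _ _ H h => WireStep.comp_left h H)
  unit := ([] : List T.Obj)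
  tensor A B := List.append A B
  tensorHom := Quot.map₂ FramedCospan.tensor (fun G _ _ h => WireStep.tensor_right G h)
    (fun _ _ H h => WireStep.tensor_left h H)
  braid A B := Quot.mk _ (FramedCospan.swap A B)
  trace _ := Quot.map FramedCospan.trace (fun _ _ h => WireStep.trace h)

/-- The class of a positive framed cospan. -/
def FCspPlus.mk {T : MonoidalSignature.{u, v}} {A B : FCspPlus T}
    (G : FramedCospan (wordGraph A) (wordGraph B)) : A ⟶ B := Quot.mk _ G

/-- The object of a single wire. -/
def FCspPlus.of {T : MonoidalSignature.{u, v}} (Z : T.Obj) : FCspPlus T := [Z]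

theorem FCspPlus.tensorList_of {T : MonoidalSignature.{u, v}} (L : List T.Obj) :
    (show FCspPlus T from L) = tensorList (L.map FCspPlus.of) := by
  induction L with
  | nil => rfl
  | cons Z L ih => exact congrArg (List.cons Z) ih

/-- The canonical homomorphism from `T` to the underlying signature of the category of positive
framed cospans: an object goes to a single wire, a morphism to a single box. -/
def FCspPlus.generators (T : MonoidalSignature.{u, v}) : T.Hom (underlyingSignature (FCspPlus T)) where
  obj := FCspPlus.of
  mor m := ⟨(T.dom m).map FCspPlus.of, (T.cod m).map FCspPlus.of,
    (FCspPlus.mk (FramedCospan.box m)).cast (FCspPlus.tensorList_of _) (FCspPlus.tensorList_of _)⟩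
  dom_mor _ := rfl
  cod_mor _ := rfl


/-! ## Contraction normal forms -/

/-- An indexed morphism: a morphism between the monoidal products of two words `src` and `tgt`,
together with names for the positions of the two words. -/
structure IndexedMor (ι : Type) (C : Type u) [TracedStruct.{u, v} C] where
  inNames : List ι
  outNames : List ι
  src : List C
  tgt : List C
  hom : tensorList src ⟶ tensorList tgt

namespace IndexedMor

variable {C : Type u} [TracedStruct.{u, v} C] [IsStrictSymmetricTraced C] {ι : Type}

/-- The symmetry moving the object `X` of a word to the end. -/
def toEnd (L₁ : List C) (X : C) (L₂ : List C) :
    tensorList (L₁ ++ X :: L₂) ⟶ tensorList (L₁ ++ L₂) ⊙ X :=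
  (𝟙 (tensorList L₁) ⊙ₘ TracedStruct.braid X (tensorList L₂)).cast
    (tensorList_append L₁ (X :: L₂)).symm
    ((IsStrictSymmetricTraced.tensor_assoc _ _ _).symm.trans
      (congrArg (· ⊙ X) (tensorList_append L₁ L₂).symm))

/-- The inverse symmetry, moving `X` from the end of a word to its place. -/
def fromEnd (L₁ : List C) (X : C) (L₂ : List C) :
    tensorList (L₁ ++ L₂) ⊙ X ⟶ tensorList (L₁ ++ X :: L₂) :=
  (𝟙 (tensorList L₁) ⊙ₘ TracedStruct.braid (tensorList L₂) X).cast
    ((IsStrictSymmetricTraced.tensor_assoc _ _ _).symm.trans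
      (congrArg (· ⊙ X) (tensorList_append L₁ L₂).symm))
    (tensorList_append L₁ (X :: L₂)).symm

/-- `Contraction f i j g` says that `g` is the contraction of `f` along the input named `i` and the
output named `j`, which carry the same object `X`: both are moved to the end and traced out. -/
inductive Contraction : IndexedMor ι C → ι → ι → IndexedMor ι C → Prop
  | mk (I₁ I₂ J₁ J₂ : List ι) (i j : ι) (L₁ L₂ M₁ M₂ : List C) (X : C)
      (hI : I₁.length = L₁.length) (hJ : J₁.length = M₁.length)
      (f : tensorList (L₁ ++ X :: L₂) ⟶ tensorList (M₁ ++ X :: M₂)) :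
      Contraction ⟨I₁ ++ i :: I₂, J₁ ++ j :: J₂, L₁ ++ X :: L₂, M₁ ++ X :: M₂, f⟩ i j
        ⟨I₁ ++ I₂, J₁ ++ J₂, L₁ ++ L₂, M₁ ++ M₂,
          TracedStruct.trace X (fromEnd L₁ X L₂ ≫ f ≫ toEnd M₁ X M₂)⟩

/-- Contracting along a list of pairs of an input and an output, one after the other. -/
inductive Contractions : IndexedMor ι C → List (ι × ι) → IndexedMor ι C → Prop
  | nil (f : IndexedMor ι C) : Contractions f [] f
  | cons {f g h : IndexedMor ι C} {i j : ι} {l : List (ι × ι)} (hfg : Contraction f i j g)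
      (hgh : Contractions g l h) : Contractions f ((i, j) :: l) h

/-- The monoidal product of two indexed morphisms. -/
def tensor (f g : IndexedMor ι C) : IndexedMor ι C where
  inNames := f.inNames ++ g.inNames
  outNames := f.outNames ++ g.outNames
  src := f.src ++ g.src
  tgt := f.tgt ++ g.tgt
  hom := (f.hom ⊙ₘ g.hom).cast (tensorList_append f.src g.src).symm
    (tensorList_append f.tgt g.tgt).symm

/-- The monoidal product of a list of indexed morphisms. -/
def tensorAll (l : List (IndexedMor ι C)) : IndexedMor ι C :=
  l.foldr tensor ⟨[], [], [], [], 𝟙 _⟩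

end IndexedMor

section CNF

variable {T : MonoidalSignature.{u₁, v₁}} {C : Type u} [TracedStruct.{u, v} C]

/-- The indexed morphism of a vertex of a string graph: the value of its generator for a
box-vertex, an identity for a wire-vertex. Its `k`-th input and its `k`-th output are named by the
vertex and `k`. -/
def vertexValue (F : T.Hom (underlyingSignature C)) (G : TypedGraph T) (x : G.V) : IndexedMor (G.V × ℕ) C :=
  match G.τ.v x with
  | Sum.inl Z => ⟨[(x, 0)], [(x, 0)], [F.obj Z], [F.obj Z], 𝟙 _⟩
  | Sum.inr m =>
    ⟨(List.range (T.dom m).length).map (fun k => (x, k)),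
      (List.range (T.cod m).length).map (fun k => (x, k)),
      (F.mor m).src, (F.mor m).tgt, (F.mor m).hom⟩

/-- The names of the input (of the target of the edge) and the output (of the source of the edge)
that an edge connects. -/
def edgeNames (G : TypedGraph T) (e : G.E) : (G.V × ℕ) × (G.V × ℕ) :=
  match G.τ.e e with
  | .mid _ => ((G.tgt e, 0), (G.src e, 0))
  | .inp _ i => ((G.tgt e, i), (G.src e, 0))
  | .out _ j => ((G.tgt e, 0), (G.src e, j))

/-- `HasNormalForm F G f` says that `f` is the value of the framed cospan `G` given by
contraction normal forms: for every enumeration `zs` of the vertices of `G` that are not in the image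
of the two legs and every enumeration `es` of the edges, the monoidal product of the values of
the images of the points of `A`, of the images of the points of `B`, and of the vertices `zs`,
contracted along all edges, is `f`. -/
def HasNormalForm [IsStrictSymmetricTraced C] (F : T.Hom (underlyingSignature C)) {A B : List T.Obj}
    (G : FramedCospan (wordGraph A) (wordGraph B))
    (f : tensorList (A.map F.obj) ⟶ tensorList (B.map F.obj)) : Prop :=
  ∀ (zs : List G.V) (es : List G.E), zs.Nodup →
    (∀ x, x ∈ zs ↔ x ∉ Set.range G.d.v ∧ x ∉ Set.range G.c.v) → es.Nodup → (∀ e, e ∈ es) →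
    ∃ (I J : List (G.V × ℕ)), IndexedMor.Contractions
      (IndexedMor.tensorAll ((List.ofFn (n := A.length) G.d.v ++ List.ofFn (n := B.length) G.c.v ++
        zs).map (vertexValue F G.toTypedGraph)))
      (es.map (edgeNames G.toTypedGraph)) ⟨I, J, A.map F.obj, B.map F.obj, f⟩

end CNF

theorem StrictTracedFunctor.obj_word {T : MonoidalSignature.{u₁, v₁}} {C : Type u}
    [TracedStruct.{u, v} C] (E : StrictTracedFunctor (FCspPlus T) C) {F : T.Hom (underlyingSignature C)}
    (h : (FCspPlus.generators T).comp E.underlying = F) (A : FCspPlus T) :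
    E.obj A = tensorList (List.map F.obj A) := by
  subst h
  refine (congrArg E.obj (FCspPlus.tensorList_of A)).trans ((E.obj_tensorList _).trans ?_)
  exact congrArg tensorList List.map_map

/-! ## Arrows of a strict symmetric traced category -/

/-! The laws of a traced category are statements about graphs. The tool is the `Collapse`: a map of
graphs that contracts disjoint paths of wires exhibits its source and its target as
wire-homeomorphic (`Collapse.mk_eq`). Plugging by pushout is a collapse of linking (`cls_comp`),
where the outputs of one graph are joined to the inputs of the next by new wires over a plain
disjoint union. After this replacement each law compares two explicit graphs that are isomorphic, or
one of which collapses onto the other, or that collapse onto a common third graph (sliding).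

For existence, a functor has to be built out of `F`. The value of a framed cospan is the tensor
product of the values of all its vertices, with one trace taken over all its edges. Every port of a
vertex carries a unique name, so the symmetries that occur are the canonical ones between words
without repetitions. Coherence for these symmetries (`perm_comp_perm`) makes them compose strictly,
and `ctr` is the resulting operation: permute, apply the arrow, permute, trace. Each axiom of the
trace has one role. Sliding makes the order of the edges irrelevant (`ctr_perm`). Vanishing allows
the edges to be contracted in portions (`ctr_append`). Superposing turns products of contractions
into contractions of products (`ctr_mul_ctr`). Naturality governs the order of the boundary
(`ctr_boundary`). Yanking makes an inserted identity harmless (`ctr_insert`) and expresses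
composition as a trace of a tensor product (`tr_mul_comp_br`). Together with the naturality of the
symmetry, which makes the order of the vertices irrelevant (`tensorOf_perm`), this shows that the
value is invariant under wire-homeomorphism and preserves all operations. The value of a single box
is its generator (`value_box`).

The contraction normal form is the same contraction performed edge by edge. Both agree by
`exists_contractions`; the names left at the end are the boundary in its original order, since
contracting never reorders the surviving names.

For uniqueness, a string graph is cut at its wire-vertices. What remains is a disjoint union of
single boxes and bare wires, which certainly arises from the generators. Rearranging its boundary
and tracing over a word that enumerates the interior wire-vertices glues the pieces back together,
up to a collapse (`generated`). Hence every morphism is built from boxes by the operations, and a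
strict traced functor that is prescribed on boxes has no freedom left.

Strictness holds only along equalities of objects. To keep casts out of the computations, the
algebra is done with arrows that carry their source and target, and objects and arrows are treated
as monoids under the tensor product. -/

/-- The objects of a strict symmetric traced category form a monoid. -/
@[reducible]
def TracedStruct.objMonoid (C : Type u) [TracedStruct.{u, v} C] [IsStrictSymmetricTraced C] :
    Monoid C where
  mul := TracedStruct.tensor
  one := TracedStruct.unit
  mul_assoc := IsStrictSymmetricTraced.tensor_assoc
  one_mul := IsStrictSymmetricTraced.unit_tensor
  mul_one := IsStrictSymmetricTraced.tensor_unit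

/-- An arrow: a morphism together with its source and its target. -/
structure Arr (C : Type u) [TracedStruct.{u, v} C] where
  dom : C
  cod : C
  hom : dom ⟶ cod

namespace Arr

section basic

variable {C : Type u} [TracedStruct.{u, v} C]

/-- An equation up to casts is a genuine equation of arrows. This, with `cast_eq_of_mk` for the way
back, is how the casts in the axioms are removed once and for all. -/
theorem ext_cast {f g : Arr C} (h : f.dom = g.dom) (h' : f.cod = g.cod)
    (e : f.hom.cast h h' = g.hom) : f = g := by
  obtain ⟨A, B, f⟩ := f
  obtain ⟨A', B', g⟩ := g
  dsimp only at h h'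
  subst h h'
  exact congrArg (Arr.mk A B) e

theorem mk_cast {A B A' B' : C} (h : A = A') (h' : B = B') (f : A ⟶ B) :
    Arr.mk A' B' (f.cast h h') = Arr.mk A B f := by
  subst h h'
  rfl

theorem cast_eq_of_mk {A B A' B' : C} {f : A ⟶ B} {g : A' ⟶ B'} (h : A = A') (h' : B = B')
    (e : Arr.mk A B f = Arr.mk A' B' g) : f.cast h h' = g := by
  subst h h'
  cases e
  rfl

theorem mk_inj {A B : C} {f g : A ⟶ B} (e : Arr.mk A B f = Arr.mk A B g) : f = g := by
  cases e
  rfl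

/-- The identity arrow. -/
def id (A : C) : Arr C := ⟨A, A, 𝟙 A⟩

/-- The symmetry as an arrow. -/
def br (A B : C) : Arr C := ⟨A ⊙ B, B ⊙ A, TracedStruct.braid A B⟩

open Classical in
/-- Composition of arrows, with the first arrow as a default value if they are not composable. -/
noncomputable def comp (f g : Arr C) : Arr C :=
  if h : f.cod = g.dom then ⟨f.dom, g.cod, f.hom ≫ g.hom.cast h.symm rfl⟩ else f

open Classical in
/-- The trace of an arrow from `A ⊙ X` to `B ⊙ X`. -/
noncomputable def tr (A B X : C) (f : Arr C) : Arr C :=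
  -- The factors `A`, `B` and `X` cannot be recovered from the source and target of `f`, so they are
  -- given explicitly. An arrow of the wrong shape is returned unchanged.
  if h : f.dom = A ⊙ X ∧ f.cod = B ⊙ X then
    ⟨A, B, TracedStruct.trace X (f.hom.cast h.1 h.2)⟩ else f

end basic

end Arr

infixl:60 " ⨟ " => Arr.comp

namespace Arr

variable {C : Type u} [TracedStruct.{u, v} C]

theorem mk_comp {A B D : C} (f : A ⟶ B) (g : B ⟶ D) :
    Arr.mk A B f ⨟ Arr.mk B D g = Arr.mk A D (f ≫ g) := by
  unfold comp
  rw [dif_pos rfl]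
  rfl

theorem tr_mk {A B X : C} (f : A ⊙ X ⟶ B ⊙ X) :
    tr A B X (Arr.mk _ _ f) = Arr.mk A B (TracedStruct.trace X f) := by
  unfold tr
  rw [dif_pos ⟨rfl, rfl⟩]
  rfl

@[simp] theorem dom_comp (f g : Arr C) : (f ⨟ g).dom = f.dom := by
  unfold comp
  split_ifs <;> rfl

@[simp] theorem cod_comp {f g : Arr C} (h : f.cod = g.dom) : (f ⨟ g).cod = g.cod := by
  unfold comp
  rw [dif_pos h]

@[simp] theorem dom_id (A : C) : (id A).dom = A := (rfl)

@[simp] theorem cod_id (A : C) : (id A).cod = A := (rfl)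

variable [IsStrictSymmetricTraced C]

attribute [local instance] TracedStruct.objMonoid

instance : Monoid (Arr C) where
  mul f g := ⟨f.dom ⊙ g.dom, f.cod ⊙ g.cod, f.hom ⊙ₘ g.hom⟩
  one := id TracedStruct.unit
  mul_assoc f g h := ext_cast (mul_assoc _ _ _) (mul_assoc _ _ _)
    (IsStrictSymmetricTraced.tensorHom_assoc _ _ _)
  one_mul f := ext_cast (one_mul _) (one_mul _) (IsStrictSymmetricTraced.unit_tensorHom _)
  mul_one f := ext_cast (mul_one _) (mul_one _) (IsStrictSymmetricTraced.tensorHom_unit _)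

theorem mk_mul {A B A' B' : C} (f : A ⟶ B) (g : A' ⟶ B') :
    Arr.mk A B f * Arr.mk A' B' g = Arr.mk (A ⊙ A') (B ⊙ B') (f ⊙ₘ g) := rfl

@[simp] theorem dom_mul (f g : Arr C) : (f * g).dom = f.dom * g.dom := (rfl)

@[simp] theorem cod_mul (f g : Arr C) : (f * g).cod = f.cod * g.cod := (rfl)

@[simp] theorem dom_br (A B : C) : (br A B).dom = A * B := (rfl)

@[simp] theorem cod_br (A B : C) : (br A B).cod = B * A := (rfl)

@[simp] theorem dom_tr {A B X : C} {f : Arr C} (h : f.dom = A * X) (h' : f.cod = B * X) :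
    (tr A B X f).dom = A := by
  unfold tr
  rw [dif_pos ⟨h, h'⟩]

@[simp] theorem cod_tr {A B X : C} {f : Arr C} (h : f.dom = A * X) (h' : f.cod = B * X) :
    (tr A B X f).cod = B := by
  unfold tr
  rw [dif_pos ⟨h, h'⟩]

@[simp] theorem id_one : id (1 : C) = 1 := (rfl)

theorem id_mul_id (A B : C) : id A * id B = id (A * B) :=
  congrArg (Arr.mk _ _) (IsStrictSymmetricTraced.id_tensorHom_id A B)

@[simp] theorem id_comp {A : C} {f : Arr C} (h : f.dom = A) : id A ⨟ f = f := by
  subst h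
  exact (mk_comp _ _).trans (congrArg (Arr.mk _ _) (IsStrictSymmetricTraced.id_comp f.hom))

@[simp] theorem comp_id {A : C} {f : Arr C} (h : f.cod = A) : f ⨟ id A = f := by
  subst h
  exact (mk_comp _ _).trans (congrArg (Arr.mk _ _) (IsStrictSymmetricTraced.comp_id f.hom))

theorem assoc {f g h : Arr C} (h1 : f.cod = g.dom) (h2 : g.cod = h.dom) :
    f ⨟ g ⨟ h = f ⨟ (g ⨟ h) := by
  obtain ⟨A, B, f⟩ := f
  obtain ⟨B', D, g⟩ := g
  obtain ⟨D', E, h⟩ := h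
  dsimp only at h1 h2
  subst h1 h2
  simp only [mk_comp, IsStrictSymmetricTraced.assoc]

theorem comp_mul_comp {f g f' g' : Arr C} (h : f.cod = g.dom) (h' : f'.cod = g'.dom) :
    (f ⨟ g) * (f' ⨟ g') = f * f' ⨟ g * g' := by
  obtain ⟨A, B, f⟩ := f
  obtain ⟨B', D, g⟩ := g
  obtain ⟨A', B'', f'⟩ := f'
  obtain ⟨D', E, g'⟩ := g'
  dsimp only at h h'
  subst h h'
  simp only [mk_comp, mk_mul, IsStrictSymmetricTraced.comp_tensorHom_comp]

theorem br_nat (f g : Arr C) : f * g ⨟ br f.cod g.cod = br f.dom g.dom ⨟ g * f := by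
  obtain ⟨A, B, f⟩ := f
  obtain ⟨A', B', g⟩ := g
  simp only [mk_mul, br, mk_comp, IsStrictSymmetricTraced.braid_naturality]

@[simp] theorem br_br (A B : C) : br A B ⨟ br B A = id (A * B) := by
  simp only [br, mk_comp, IsStrictSymmetricTraced.braid_braid]
  rfl

theorem br_mul_right (A B D : C) : br A (B * D) = br A B * id D ⨟ id B * br A D := by
  have h := congrArg (Arr.mk _ _) (IsStrictSymmetricTraced.hexagon A B D)
  rw [mk_cast, ← mk_comp, mk_cast] at h
  exact h

theorem tr_nat {A A' B B' X : C} {f g h : Arr C} (hh : h.dom = A') (hh' : h.cod = A)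
    (hf : f.dom = A * X) (hf' : f.cod = B * X) (hg : g.dom = B) (hg' : g.cod = B') :
    tr A' B' X (h * id X ⨟ f ⨟ g * id X) = h ⨟ tr A B X f ⨟ g := by
  obtain ⟨_, _, f⟩ := f
  obtain ⟨_, _, h⟩ := h
  obtain ⟨_, _, g⟩ := g
  dsimp only at *
  subst hh hh' hg hg' hf hf'
  change tr _ _ X (Arr.mk _ _ h * Arr.mk X X (𝟙 X) ⨟ Arr.mk (_ ⊙ X) (_ ⊙ X) f ⨟
    Arr.mk _ _ g * Arr.mk X X (𝟙 X)) = Arr.mk _ _ h ⨟ tr _ _ X (Arr.mk (_ ⊙ X) (_ ⊙ X) f) ⨟ Arr.mk _ _ g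
  simp only [mk_mul, mk_comp, tr_mk, IsStrictSymmetricTraced.assoc,
    IsStrictSymmetricTraced.trace_naturality]

theorem tr_nat_right {A B B' X : C} {f g : Arr C}
    (hf : f.dom = A * X) (hf' : f.cod = B * X) (hg : g.dom = B) (hg' : g.cod = B') :
    tr A B' X (f ⨟ g * id X) = tr A B X f ⨟ g := by
  have := tr_nat (dom_id A) (cod_id A) hf hf' hg hg'
  rwa [id_mul_id, id_comp hf, id_comp (dom_tr hf hf')] at this

theorem tr_slide {A B X Y : C} {f g : Arr C} (hf : f.dom = A * X) (hf' : f.cod = B * Y)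
    (hg : g.dom = Y) (hg' : g.cod = X) :
    tr A B Y (id A * g ⨟ f) = tr A B X (f ⨟ id B * g) := by
  obtain ⟨_, _, f⟩ := f
  obtain ⟨_, _, g⟩ := g
  dsimp only at *
  subst hg hg' hf hf'
  change tr A B _ (Arr.mk A A (𝟙 A) * Arr.mk _ _ g ⨟ Arr.mk (A ⊙ _) (B ⊙ _) f) =
    tr A B _ (Arr.mk (A ⊙ _) (B ⊙ _) f ⨟ Arr.mk B B (𝟙 B) * Arr.mk _ _ g)
  simp only [mk_mul, mk_comp, tr_mk, IsStrictSymmetricTraced.trace_sliding]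

theorem tr_one {A B : C} {f : Arr C} (hf : f.dom = A) (hf' : f.cod = B) : tr A B 1 f = f := by
  obtain ⟨_, _, f⟩ := f
  dsimp only at *
  subst hf hf'
  have h := tr_mk (X := TracedStruct.unit) (f.cast (mul_one _).symm (mul_one _).symm)
  rw [IsStrictSymmetricTraced.trace_unit, mk_cast, mk_cast, mk_cast] at h
  exact h

theorem tr_mul {A B X Y : C} {f : Arr C} (hf : f.dom = A * (X * Y)) (hf' : f.cod = B * (X * Y)) :
    tr A B (X * Y) f = tr A B X (tr (A * X) (B * X) Y f) := by
  obtain ⟨_, _, f⟩ := f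
  dsimp only at *
  subst hf hf'
  have h : tr (A ⊙ X) (B ⊙ X) Y (Arr.mk _ _ f) = _ :=
    (congrArg _ (mk_cast (mul_assoc A X Y).symm (mul_assoc B X Y).symm f).symm).trans
      (tr_mk (f.cast (mul_assoc A X Y).symm (mul_assoc B X Y).symm))
  exact (tr_mk f).trans ((congrArg (Arr.mk A B) (IsStrictSymmetricTraced.trace_tensor X Y f)).trans
    ((tr_mk _).symm.trans (congrArg (tr A B X) h.symm)))

theorem tr_super {A B X : C} {f : Arr C} (g : Arr C) (hf : f.dom = A * X) (hf' : f.cod = B * X) :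
    tr (g.dom * A) (g.cod * B) X (g * f) = g * tr A B X f := by
  obtain ⟨_, _, f⟩ := f
  obtain ⟨A', B', g⟩ := g
  dsimp only at *
  subst hf hf'
  refine Eq.trans ?_ (congrArg (Arr.mk A' B' g * ·) (tr_mk f).symm)
  refine Eq.trans ?_ (congrArg (Arr.mk _ _) (IsStrictSymmetricTraced.trace_superposing X g f))
  exact (congrArg _ (mk_cast _ _ _).symm).trans (tr_mk _)

theorem tr_br (X : C) : tr X X X (br X X) = id X := by
  refine (tr_mk _).trans ?_
  rw [IsStrictSymmetricTraced.trace_yanking]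
  rfl

end Arr

/-! ## Permutations of the letters of a word -/

namespace Arr

variable {C : Type u} [TracedStruct.{u, v} C] [IsStrictSymmetricTraced C]

attribute [local instance] TracedStruct.objMonoid

theorem mul_id_comp {f g : Arr C} (A : C) (h : f.cod = g.dom) :
    f * id A ⨟ g * id A = (f ⨟ g) * id A := by
  rw [comp_mul_comp h rfl |>.symm, id_comp (dom_id A)]

theorem id_mul_comp {f g : Arr C} (A : C) (h : f.cod = g.dom) :
    id A * f ⨟ id A * g = id A * (f ⨟ g) := by
  rw [comp_mul_comp rfl h |>.symm, id_comp (dom_id A)]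

theorem mul_eq_left (f g : Arr C) : f * g = f * id g.dom ⨟ id f.cod * g := by
  rw [← comp_mul_comp (by simp) (by simp), comp_id rfl, id_comp rfl]

theorem mul_eq_right (f g : Arr C) : f * g = id f.dom * g ⨟ f * id g.cod := by
  rw [← comp_mul_comp (by simp) (by simp), comp_id rfl, id_comp rfl]

/-- By `br_mul_right` the symmetry in the opposite direction splits into two crossings. Their
inverses, composed in reverse order, form the only possible inverse. -/
theorem br_mul_left (A B D : C) : br (A * B) D = id A * br B D ⨟ br A D * id B := by
  have h1 := br_br D (A * B)
  rw [br_mul_right] at h1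
  have h2 : id A * br B D ⨟ br A D * id B ⨟ (br D A * id B ⨟ id A * br D B) = id (A * B * D) := by
    rw [assoc (by simp [mul_assoc]) (by simp [mul_assoc]),
      ← assoc (f := br A D * id B) (by simp [mul_assoc]) (by simp [mul_assoc]),
      mul_id_comp _ (by simp), br_br, id_mul_id, id_comp (by simp [mul_assoc]),
      id_mul_comp _ (by simp), br_br, id_mul_id, mul_assoc]
  have h3 := congrArg (fun x => id A * br B D ⨟ br A D * id B ⨟ x) h1
  rw [← assoc (by simp [mul_assoc]) (by simp [mul_assoc]), h2, id_comp (by simp [mul_assoc]),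
    comp_id (by simp [mul_assoc])] at h3
  exact h3

-- The hexagon with two unit factors makes `br A 1` idempotent, and an invertible idempotent is an
-- identity.
@[simp] theorem br_one_right (A : C) : br A 1 = id A := by
  have h1 := br_mul_right A 1 1
  have h2 : br A 1 ⨟ br A 1 = br A 1 := by
    have e : (id (1 : C)) * br A 1 = br A 1 := by rw [id_one, one_mul]
    have e' : br A 1 * (id (1 : C)) = br A 1 := by rw [id_one, mul_one]
    rw [e, e', mul_one] at h1
    exact h1.symm
  have h3 : br A 1 ⨟ br A 1 ⨟ br 1 A = id A := by
    rw [h2, br_br, mul_one]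
  rw [assoc (by simp) (by simp), br_br, comp_id (by simp)] at h3
  exact h3

@[simp] theorem br_one_left (A : C) : br 1 A = id A := by
  have h := br_br A 1
  rwa [br_one_right, id_comp (by simp), mul_one] at h

theorem br_id_nat (f : Arr C) (A : C) : id A * f ⨟ br A f.cod = br A f.dom ⨟ f * id A :=
  br_nat (id A) f

theorem id_mul_comp_mul_id (f g : Arr C) :
    id f.dom * g ⨟ f * id g.cod = f * id g.dom ⨟ id f.cod * g := by
  rw [← mul_eq_left, ← mul_eq_right]

/-- This is naturality of the symmetry of `A` with respect to the arrow `br B D`, with both long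
crossings split by the hexagon. -/
theorem yang_baxter (A B D : C) :
    br A B * id D ⨟ id B * br A D ⨟ br B D * id A =
      id A * br B D ⨟ (br A D * id B ⨟ id D * br A B) := by
  have h := br_id_nat (br B D) A
  rw [cod_br, dom_br, br_mul_right, br_mul_right] at h
  exact h.symm

end Arr

/-! ### Canonical symmetries between words without repetitions -/

section Words

variable {C : Type u} [TracedStruct.{u, v} C] [IsStrictSymmetricTraced C]

attribute [local instance] TracedStruct.objMonoid

variable {ι κ : Type*} (ob : ι → C)

/-- The object of a word of names. -/
def wordObj (L : List ι) : C := (L.map ob).prod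

@[simp] theorem wordObj_nil : wordObj ob [] = 1 := (rfl)

@[simp] theorem wordObj_cons (a : ι) (L : List ι) : wordObj ob (a :: L) = ob a * wordObj ob L := by
  simp [wordObj]

@[simp] theorem wordObj_append (L M : List ι) : wordObj ob (L ++ M) = wordObj ob L * wordObj ob M := by
  simp [wordObj]

theorem wordObj_map (f : κ → ι) (L : List κ) : wordObj ob (L.map f) = wordObj (ob ∘ f) L := by
  simp [wordObj]

namespace Arr

open scoped Classical

/-- The symmetry moving the letter `a` of a word to the front. -/
noncomputable def front (a : ι) : List ι → Arr C
  -- A default value: it is reached only if the letter does not occur in the word.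
  | [] => 1
  | b :: L => if b = a then id (wordObj ob (b :: L)) else
      id (ob b) * front a L ⨟ br (ob b) (ob a) * id (wordObj ob (L.erase a))

/-- The symmetry from a word without repetitions to a permutation of it. -/
noncomputable def perm : List ι → List ι → Arr C
  | _, [] => 1
  | L, a :: M => front ob a L ⨟ id (ob a) * perm (L.erase a) M

variable {ob}

theorem front_cons_self (a : ι) (L : List ι) : front ob a (a :: L) = id (wordObj ob (a :: L)) := by
  rw [front, if_pos rfl]

theorem front_cons_ne {a b : ι} (h : b ≠ a) (L : List ι) : front ob a (b :: L) =
    id (ob b) * front ob a L ⨟ br (ob b) (ob a) * id (wordObj ob (L.erase a)) := by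
  rw [front, if_neg h]

theorem perm_cons (L : List ι) (a : ι) (M : List ι) :
    perm ob L (a :: M) = front ob a L ⨟ id (ob a) * perm ob (L.erase a) M := rfl

theorem front_typed {a : ι} {L : List ι} (h : a ∈ L) : (front ob a L).dom = wordObj ob L ∧
    (front ob a L).cod = ob a * wordObj ob (L.erase a) := by
  induction L with
  | nil => simp at h
  | cons b L ih =>
    by_cases hb : b = a
    · subst hb
      simp [front_cons_self]
    · have h' : a ∈ L := by simpa [Ne.symm hb] using h
      have e : (b :: L).erase a = b :: L.erase a := by simp [hb]
      rw [front_cons_ne hb, e]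
      refine ⟨by simp [(ih h').1], ?_⟩
      rw [cod_comp]
      · simp [mul_assoc]
      · simp [(ih h').2, mul_assoc]

@[simp] theorem dom_front {a : ι} {L : List ι} (h : a ∈ L) : (front ob a L).dom = wordObj ob L :=
  (front_typed h).1

@[simp] theorem cod_front {a : ι} {L : List ι} (h : a ∈ L) :
    (front ob a L).cod = ob a * wordObj ob (L.erase a) := (front_typed h).2

theorem perm_typed {L M : List ι} (h : L.Perm M) : (perm ob L M).dom = wordObj ob L ∧
    (perm ob L M).cod = wordObj ob M := by
  induction M generalizing L with
  | nil =>
    obtain rfl := h.eq_nil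
    exact ⟨rfl, rfl⟩
  | cons a M ih =>
    have ha : a ∈ L := h.symm.subset (by simp)
    have h' : (L.erase a).Perm M := by simpa using h.erase a
    rw [perm_cons]
    refine ⟨by simp [ha], ?_⟩
    rw [cod_comp]
    · simp [ih h']
    · simp [ha, ih h']

@[simp] theorem dom_perm {L M : List ι} (h : L.Perm M) : (perm ob L M).dom = wordObj ob L :=
  (perm_typed h).1

@[simp] theorem cod_perm {L M : List ι} (h : L.Perm M) : (perm ob L M).cod = wordObj ob M :=
  (perm_typed h).2

@[simp] theorem perm_self (L : List ι) : perm ob L L = id (wordObj ob L) := by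
  induction L with
  | nil => rfl
  | cons a L ih => rw [perm_cons, front_cons_self, List.erase_cons_head, ih, id_mul_id, id_comp (by simp)]; simp

theorem front_append {a : ι} {L : List ι} (h : a ∈ L) (M : List ι) :
    front ob a (L ++ M) = front ob a L * id (wordObj ob M) := by
  induction L with
  | nil => simp at h
  | cons b L ih =>
    by_cases hb : b = a
    · subst hb
      simp [front_cons_self, id_mul_id, mul_assoc]
    · have h' : a ∈ L := by simpa [Ne.symm hb] using h
      rw [List.cons_append, front_cons_ne hb, front_cons_ne hb, ih h', List.erase_append_left _ h',
        ← mul_id_comp _ (by simp [h', mul_assoc]), wordObj_append, ← id_mul_id, mul_assoc, mul_assoc]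

theorem front_append_cons {a : ι} {L : List ι} (h : a ∉ L) (M : List ι) :
    front ob a (L ++ a :: M) = br (wordObj ob L) (ob a) * id (wordObj ob M) := by
  induction L with
  | nil => simp [front_cons_self, id_mul_id]
  | cons b L ih =>
    simp only [List.mem_cons, not_or] at h
    rw [List.cons_append, front_cons_ne (Ne.symm h.1), ih h.2, List.erase_append_right _ h.2,
      List.erase_cons_head, wordObj_append, ← id_mul_id, ← mul_assoc, ← mul_assoc,
      mul_id_comp _ (by simp [mul_assoc]), wordObj_cons, br_mul_left]

/-- Every letter of `M` is already found in `L`, so pulling it to the front never touches `L'`. -/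
theorem perm_mul_perm {L M L' M' : List ι} (h : L.Perm M) (h' : L'.Perm M') :
    perm ob L M * perm ob L' M' = perm ob (L ++ L') (M ++ M') := by
  induction M generalizing L with
  | nil =>
    obtain rfl := h.eq_nil
    simp [perm]
  | cons a M ih =>
    have ha : a ∈ L := h.symm.subset (by simp)
    have h2 : (L.erase a).Perm M := by simpa using h.erase a
    rw [List.cons_append, perm_cons, perm_cons, front_append ha, List.erase_append_left _ ha, ← ih h2,
      ← mul_assoc, comp_mul_comp (by simp [ha, h2]) (by simp [h']) |>.symm, id_comp (by simp [h'])]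

/-- The letters of `M` are pulled through `L` one at a time, and the hexagon assembles the
crossings. Thus the symmetries of the category are canonical symmetries of words, and calculations
with them reduce to `perm_comp_perm`. Distinctness ensures that no letter of `M` is found in `L` by
mistake. -/
theorem perm_swap {L M : List ι} (h : (L ++ M).Nodup) :
    perm ob (L ++ M) (M ++ L) = br (wordObj ob L) (wordObj ob M) := by
  induction M with
  | nil => simp
  | cons a M ih =>
    have ha : a ∉ L := fun h' => by
      rw [List.nodup_append] at h
      exact h.2.2 a h' a (by simp) rfl
    have h2 : (L ++ M).Nodup := h.sublist (by simp)
    rw [List.cons_append, perm_cons, front_append_cons ha, List.erase_append_right _ ha,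
      List.erase_cons_head, ih h2, wordObj_cons, br_mul_right]

/-- The inductive step of `front_front`, with the words replaced by arbitrary objects. Both letters
have to pass a further letter `c`: naturality moves the remaining symmetries past the crossings with
`c`, the Yang–Baxter equation reorders the three crossings, and the hypothesis does the rest. -/
theorem front_front_aux {a b c V V' W : C} {F G F' G' : Arr C} (hF' : F.cod = b * V) (hG : G.dom = V)
    (hG' : G.cod = a * W) (hf' : F'.cod = a * V') (hg : G'.dom = V') (hg' : G'.cod = b * W)
    (h : F ⨟ id b * G ⨟ br b a * id W = F' ⨟ id a * G') :
    id c * F ⨟ br c b * id V ⨟ id b * (id c * G ⨟ br c a * id W) ⨟ br b a * id (c * W) =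
      id c * F' ⨟ br c a * id V' ⨟ id a * (id c * G' ⨟ br c b * id W) := by
  have e1 : br c b * id V ⨟ id (b * c) * G = id (c * b) * G ⨟ br c b * id (a * W) := by
    have := id_mul_comp_mul_id (br c b) G
    rw [hG, hG'] at this
    exact this.symm
  have e2 : br c a * id V' ⨟ id (a * c) * G' = id (c * a) * G' ⨟ br c a * id (b * W) := by
    have := id_mul_comp_mul_id (br c a) G'
    rw [hg, hg'] at this
    exact this.symm
  have e3 : br c b * id (a * W) ⨟ id b * br c a * id W ⨟ br b a * id (c * W) =
      id c * br b a * id W ⨟ (br c a * id (b * W) ⨟ id a * br c b * id W) := by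
    have := congrArg (· * id W) (yang_baxter c b a)
    rw [← mul_id_comp _ (by simp [mul_assoc]), ← mul_id_comp _ (by simp [mul_assoc]),
      ← mul_id_comp _ (by simp [mul_assoc]), ← mul_id_comp _ (by simp [mul_assoc])] at this
    simpa only [mul_assoc, id_mul_id] using this
  have hl : id c * F ⨟ br c b * id V ⨟ id b * (id c * G ⨟ br c a * id W) ⨟ br b a * id (c * W) =
      id c * F ⨟ id (c * b) * G ⨟
        (br c b * id (a * W) ⨟ id b * br c a * id W ⨟ br b a * id (c * W)) := by
    rw [← id_mul_comp _ (by simp [hG', mul_assoc]), ← mul_assoc, ← mul_assoc, id_mul_id,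
      ← assoc (g := id (b * c) * G) (by simp [hG, hF', mul_assoc]) (by simp [hG', mul_assoc]),
      assoc (g := br c b * id V) (by simp [hF', mul_assoc]) (by simp [hG, mul_assoc]), e1]
    simp (disch := simp [hF', hG, hG', mul_assoc]) only [assoc]
  have hr : id c * F' ⨟ br c a * id V' ⨟ id a * (id c * G' ⨟ br c b * id W) =
      id c * (F' ⨟ id a * G') ⨟ (br c a * id (b * W) ⨟ id a * br c b * id W) := by
    rw [← id_mul_comp _ (by simp [hg', mul_assoc]), ← mul_assoc, ← mul_assoc, id_mul_id,
      ← assoc (g := id (a * c) * G') (by simp [hg, hf', mul_assoc]) (by simp [hg', mul_assoc]),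
      assoc (g := br c a * id V') (by simp [hf', mul_assoc]) (by simp [hg, mul_assoc]), e2,
      ← id_mul_comp _ (by simp [hf', hg]), ← mul_assoc, id_mul_id]
    simp (disch := simp [hf', hg, hg', mul_assoc]) only [assoc]
  rw [hl, hr, e3, ← h, ← id_mul_comp _ (by simp [hF', hG, hG', mul_assoc]),
    ← id_mul_comp _ (by simp [hF', hG]), ← mul_assoc, ← mul_assoc, id_mul_id]
  simp (disch := simp [hF', hG, hG', mul_assoc]) only [assoc]

/-- The order in which two letters are pulled to the front matters only by their crossing. This is
the coherence relation on which the composition law of `perm` rests. -/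
theorem front_front {a b : ι} {L : List ι} (hab : a ≠ b) (ha : a ∈ L) (hb : b ∈ L) :
    front ob b L ⨟ id (ob b) * front ob a (L.erase b) ⨟
      br (ob b) (ob a) * id (wordObj ob ((L.erase b).erase a)) =
    front ob a L ⨟ id (ob a) * front ob b (L.erase a) := by
  induction L with
  | nil => simp at ha
  | cons c L ih =>
    by_cases hca : c = a
    · subst hca
      have hb' : b ∈ L := by simpa [Ne.symm hab] using hb
      rw [front_cons_ne hab, front_cons_self, List.erase_cons_head,
        List.erase_cons_tail (by simpa using hab), front_cons_self, List.erase_cons_head,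
        id_mul_id, comp_id (by simp [hb', mul_assoc]), id_comp (by simp [hb']), assoc (by simp [hb', mul_assoc])
        (by simp), mul_id_comp _ (by simp), br_br, id_mul_id, comp_id (by simp [hb', mul_assoc])]
    · by_cases hcb : c = b
      · subst hcb
        have ha' : a ∈ L := by simpa [hab] using ha
        rw [front_cons_ne hca, front_cons_self, List.erase_cons_head,
          List.erase_cons_tail (by simpa using hca), front_cons_self,
          id_mul_id, comp_id (by simp [ha', mul_assoc]), id_comp (by simp [ha'])]
      · have ha' : a ∈ L := by simpa [Ne.symm hca] using ha
        have hb' : b ∈ L := by simpa [Ne.symm hcb] using hb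
        have ha2 : a ∈ L.erase b := (List.mem_erase_of_ne hab).2 ha'
        have hb2 : b ∈ L.erase a := (List.mem_erase_of_ne (Ne.symm hab)).2 hb'
        have ih := ih ha' hb'
        rw [List.erase_cons_tail (by simpa using hcb), List.erase_cons_tail (by simpa using hca),
          List.erase_cons_tail (by simpa using hca)]
        simp only [front_cons_ne hca, front_cons_ne hcb]
        rw [List.erase_comm b a]
        rw [List.erase_comm b a] at ih
        have e : wordObj ob ((L.erase b).erase a) = wordObj ob ((L.erase a).erase b) := by
          rw [List.erase_comm]
        have := front_front_aux (c := ob c) (cod_front hb') (dom_front ha2)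
          ((cod_front ha2).trans (by rw [e])) (cod_front ha') (dom_front hb2)
          (cod_front hb2) ih
        rw [← this, wordObj_cons]

/-- A letter may be pulled to the front before or after permuting. If `a` is the first letter of `M`
this is the definition of `perm`. Otherwise `front_front` exchanges `a` with that first letter. -/
theorem perm_front {a : ι} {L M : List ι} (h : L.Perm M) (hM : M.Nodup) (ha : a ∈ M) :
    perm ob L M ⨟ front ob a M = front ob a L ⨟ id (ob a) * perm ob (L.erase a) (M.erase a) := by
  induction M generalizing L with
  | nil => simp at ha
  | cons b M ih =>
    have hb : b ∈ L := h.symm.subset (by simp)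
    have hL : L.Nodup := h.nodup_iff.2 hM
    have h2 : (L.erase b).Perm M := by simpa using h.erase b
    by_cases hab : a = b
    · subst hab
      rw [front_cons_self, comp_id (cod_perm h), List.erase_cons_head, perm_cons]
    · have ha' : a ∈ M := by simpa [hab] using ha
      have ha1 : a ∈ L := h.symm.subset ha
      have ha2 : a ∈ L.erase b := (List.mem_erase_of_ne hab).2 ha1
      have hb2 : b ∈ L.erase a := (List.mem_erase_of_ne (Ne.symm hab)).2 hb
      have h3 : ((L.erase b).erase a).Perm (M.erase a) := h2.erase a
      have e : (L.erase b).erase a = (L.erase a).erase b := List.erase_comm _ _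
      have h4 : ((L.erase a).erase b).Perm (M.erase a) := e ▸ h3
      have e1 : id (ob b) * perm ob (L.erase b) M ⨟ id (ob b) * front ob a M =
          id (ob b) * front ob a (L.erase b) ⨟ id (ob b) *
              (id (ob a) * perm ob ((L.erase a).erase b) (M.erase a)) := by
        rw [id_mul_comp _ (by simp [h2, ha']), ih h2 (List.nodup_cons.1 hM).2 ha', e,
          ← id_mul_comp _ (by simp [h4, ha2, e])]
      have e2 : id (ob b) * (id (ob a) * perm ob ((L.erase a).erase b) (M.erase a)) ⨟
          br (ob b) (ob a) * id (wordObj ob (M.erase a)) =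
          br (ob b) (ob a) * id (wordObj ob ((L.erase a).erase b)) ⨟
            id (ob a) * (id (ob b) * perm ob ((L.erase a).erase b) (M.erase a)) := by
        have := id_mul_comp_mul_id (br (ob b) (ob a)) (perm ob ((L.erase a).erase b) (M.erase a))
        rw [cod_perm h4, dom_perm h4, dom_br, cod_br, ← id_mul_id, ← id_mul_id] at this
        simpa only [mul_assoc] using this
      rw [front_cons_ne (Ne.symm hab), perm_cons, List.erase_cons_tail (by simpa using Ne.symm hab), perm_cons,
        ← assoc, assoc (g := id (ob b) * perm ob (L.erase b) M), e1, assoc, assoc, e2,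
        ← assoc (f := id (ob b) * front ob a (L.erase b)), ← assoc, ← assoc, ← e, front_front hab ha1 hb, assoc,
        id_mul_comp]
      all_goals simp (maxDischargeDepth := 6) [h2, h4, ha', ha1, ha2, hb, hb2, mul_assoc, e]

/-- Coherence: since the names are distinct, two words determine a single bijection of their
letters, and composition of symmetries follows composition of bijections. The induction on `N` moves
its first letter through the intermediate word by `perm_front`. -/
theorem perm_comp_perm {L M N : List ι} (h : L.Perm M) (h' : M.Perm N) (hN : N.Nodup) :
    perm ob L M ⨟ perm ob M N = perm ob L N := by
  induction N generalizing L M with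
  | nil =>
    obtain rfl := h'.eq_nil
    obtain rfl := h.eq_nil
    exact id_comp (A := 1) rfl
  | cons a N ih =>
    have haM : a ∈ M := h'.symm.subset (by simp)
    have haL : a ∈ L := h.symm.subset haM
    have h1 : (M.erase a).Perm N := by simpa using h'.erase a
    have h2 : (L.erase a).Perm (M.erase a) := h.erase a
    rw [perm_cons, perm_cons, ← assoc (by simp [h, haM]) (by simp [h1, haM]),
      perm_front h (h'.nodup_iff.2 hN) haM, assoc (by simp [h2, haL]) (by simp [h1, h2]),
      id_mul_comp _ (by simp [h1, h2]), ih h2 h1 (List.nodup_cons.1 hN).2]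

theorem front_map (f : κ → ι) (hf : Function.Injective f) (a : κ) (L : List κ) :
    front ob (f a) (L.map f) = front (ob ∘ f) a L := by
  induction L with
  | nil => rfl
  | cons b L ih =>
    simp only [List.map_cons, front, hf.eq_iff, ih, ← List.map_erase hf, wordObj_map, wordObj_cons,
      Function.comp_apply]

/-- Only the equality pattern of the names enters, so an injective renaming changes nothing. -/
theorem perm_map (f : κ → ι) (hf : Function.Injective f) (L M : List κ) :
    perm ob (L.map f) (M.map f) = perm (ob ∘ f) L M := by
  induction M generalizing L with
  | nil => rfl
  | cons a M ih =>
    simp only [List.map_cons, perm_cons, front_map f hf, ← List.map_erase hf, ih, Function.comp_apply]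

end Arr

end Words

/-! ## Consequences of the trace axioms -/

namespace Arr

variable {C : Type u} [TracedStruct.{u, v} C] [IsStrictSymmetricTraced C]

attribute [local instance] TracedStruct.objMonoid

/-- Naturality pulls `g` out of the trace; the remaining crossing is yanked straight next to the
idle strand `Z`. This is the algebra behind the insertion of a wire-vertex. -/
theorem tr_br_comp {Z B X : C} {g : Arr C} (hg : g.dom = Z * X) (hg' : g.cod = B * X) :
    tr (Z * X) (B * X) X (id Z * br X X ⨟ g * id X) = g := by
  rw [tr_nat_right (by simp [mul_assoc]) (by simp [mul_assoc]) hg hg']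
  have := tr_super (id Z) (dom_br X X) (cod_br X X)
  rw [dom_id, cod_id, tr_br, id_mul_id] at this
  rw [this, id_comp hg]

/-- Composition is a feedback of the output of `f` into the input of `g`. Naturality of the symmetry
moves `g` behind the crossing, then yanking applies. -/
theorem tr_mul_comp_br {A Y B : C} {f g : Arr C} (hf : f.dom = A) (hf' : f.cod = Y) (hg : g.dom = Y)
    (hg' : g.cod = B) : tr A B Y (f * g ⨟ br Y B) = f ⨟ g := by
  have e1 : f * g ⨟ br Y B = f * id Y ⨟ br Y Y ⨟ g * id Y := by
    rw [mul_eq_left, hf', hg, assoc (by simp [hf', hg]) (by simp [hg'])]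
    have := br_id_nat g Y
    rw [hg, hg'] at this
    rw [this, assoc (by simp [hf']) (by simp [hg])]
  rw [e1, tr_nat hf hf' (dom_br Y Y) (cod_br Y Y) hg hg', tr_br, comp_id hf']

/-- Superposing is an axiom only for a factor on the left. Conjugating with symmetries, which
naturality brings inside the trace, carries it to the right. -/
theorem tr_mul_right {A B X A' B' : C} {f g : Arr C} (hf : f.dom = A * X) (hf' : f.cod = B * X)
    (hg : g.dom = A') (hg' : g.cod = B') :
    tr (A * A') (B * B') X (id A * br A' X ⨟ f * g ⨟ id B * br X B') = tr A B X f * g := by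
  have e1 : tr A B X f * g = br A A' ⨟ g * tr A B X f ⨟ br B' B := by
    have := br_nat (tr A B X f) g
    rw [cod_tr hf hf', dom_tr hf hf', hg, hg'] at this
    rw [← this, assoc (by simp [hf, hf', hg']) (by simp), br_br, comp_id (by simp [hf, hf', hg'])]
  have e2 := tr_super g hf hf'
  rw [hg, hg'] at e2
  rw [e1, ← e2, ← tr_nat (dom_br _ _) (cod_br _ _) (by simp [hg, hf, mul_assoc])
    (by simp [hg', hf', mul_assoc]) (dom_br _ _) (cod_br _ _)]
  have e3 : br A' (A * X) ⨟ f * g = g * f ⨟ br B' (B * X) := by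
    have := br_nat g f
    rw [hg, hg', hf, hf'] at this
    exact this.symm
  have e4 : id A * br A' X = br A A' * id X ⨟ br A' (A * X) := by
    rw [br_mul_right, ← assoc (by simp) (by simp [mul_assoc]), mul_id_comp _ (by simp), br_br, id_mul_id,
      id_comp (by simp [mul_assoc])]
  have e5 : br B' (B * X) ⨟ id B * br X B' = br B' B * id X := by
    rw [br_mul_right, assoc (by simp [mul_assoc]) (by simp), id_mul_comp _ (by simp), br_br, id_mul_id,
      comp_id (by simp [mul_assoc])]
  rw [e4, assoc (g := br A' (A * X)) (h := f * g), e3, ← e5, assoc (g := g * f),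
    assoc (g := g * f ⨟ br B' (B * X)), assoc (f := g * f)]
  all_goals simp [hf, hf', hg, hg', mul_assoc]

/-- Superposing on both sides gives two nested traces, and vanishing merges them; the symmetries
collect the two traced objects at the end. -/
theorem tr_mul_tr {A B U A' B' U' : C} {f g : Arr C} (hf : f.dom = A * U) (hf' : f.cod = B * U)
    (hg : g.dom = A' * U') (hg' : g.cod = B' * U') :
    tr A B U f * tr A' B' U' g = tr (A * A') (B * B') (U * U')
      (id A * br A' U * id U' ⨟ f * g ⨟ id B * br U B' * id U') := by
  have h1 := tr_super f hg hg'
  rw [hf, hf'] at h1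
  rw [← tr_mul_right hf hf' (dom_tr hg hg') (cod_tr hg hg'), ← h1,
    ← tr_nat (A := A * U * A') (A' := A * A' * U) (B := B * U * B') (B' := B * B' * U) (by simp [mul_assoc])
        (by simp [mul_assoc]) (by simp [hf, hg, mul_assoc]) (by simp [hf', hg', mul_assoc])
      (by simp [mul_assoc]) (by simp [mul_assoc]), tr_mul]
  · simp [mul_assoc]
  · rw [cod_comp, cod_mul, cod_mul]
    · simp [mul_assoc]
    · rw [cod_comp] <;> simp [hf, hg, hf', hg', mul_assoc]

/-- The shape in which the value of a single box appears: identities for its input and output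
vertices beside `f`, with all edges traced. The part over `Q` is straightened by yanking, the part
over `P` is a composition by `tr_mul_comp_br`. -/
theorem tr_generator {P Q : C} {f : Arr C} (hf : f.dom = P) (hf' : f.cod = Q) :
    tr P Q (P * Q) (id P * f * id Q ⨟ br (P * Q) Q) = f := by
  have h : id P * f * id Q ⨟ br (P * Q) Q = id P * f * id Q ⨟ id P * br Q Q ⨟ br P Q * id Q := by
    rw [br_mul_left, assoc (by simp [hf', mul_assoc]) (by simp [mul_assoc])]
  have h2 := tr_super (id P) (dom_br Q Q) (cod_br Q Q)
  rw [dom_id, cod_id, tr_br, id_mul_id] at h2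
  rw [tr_mul (by simp [hf, mul_assoc]) (by simp [hf', mul_assoc]), h,
    tr_nat (A := P * Q) (B := P * Q) (by simp [hf]) (by simp [hf']) (by simp [mul_assoc]) (by simp [mul_assoc])
        (dom_br _ _)
      (cod_br _ _), h2, comp_id (by simp [hf']), tr_mul_comp_br (dom_id P) (cod_id P) hf hf', id_comp hf]

end Arr

/-! ## Contraction of named arrows -/

namespace Arr

variable {C : Type u} [TracedStruct.{u, v} C] [IsStrictSymmetricTraced C]

attribute [local instance] TracedStruct.objMonoid

variable {ι κ ε : Type*}
  (obI : ι → C) (obJ : κ → C) (s : ε → ι) (t : ε → κ)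

/-- The contraction of an arrow from the word `I` to the word `J` along the pairs `s e`, `t e` of an
input and an output, for `e` in the list `es`; the remaining inputs and outputs are `I'` and `J'`. -/
noncomputable def ctr (I : List ι) (J : List κ) (f : Arr C) (I' : List ι) (J' : List κ)
    (es : List ε) : Arr C :=
  -- The traced object is read off from the inputs. On the output side the word `es.map t` has the
  -- same object as soon as the two ends of each pair carry equal objects, which `IsCtr.obj`
  -- demands.
  tr (wordObj obI I') (wordObj obJ J') (wordObj obI (es.map s))
    (perm obI (I' ++ es.map s) I ⨟ f ⨟ perm obJ J (J' ++ es.map t))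

/-- The conditions under which a contraction is meaningful. -/
structure IsCtr (I : List ι) (J : List κ) (f : Arr C) (I' : List ι) (J' : List κ)
    (es : List ε) : Prop where
  obj : ∀ e, obI (s e) = obJ (t e)
  nodupI : I.Nodup
  nodupJ : J.Nodup
  permI : (I' ++ es.map s).Perm I
  permJ : J.Perm (J' ++ es.map t)
  dom : f.dom = wordObj obI I
  cod : f.cod = wordObj obJ J
  s_inj : Function.Injective s
  t_inj : Function.Injective t

namespace IsCtr

variable {obI obJ s t}

variable {I I₂ : List ι} {J J₂ : List κ} {f : Arr C} {I' : List ι} {J' : List κ} {es es₁ es₂ : List ε}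

theorem wordObj_eq (h : IsCtr obI obJ s t I J f I' J' es) (l : List ε) :
    wordObj obJ (l.map t) = wordObj obI (l.map s) := by
  rw [wordObj_map, wordObj_map]
  congr 1
  funext e
  exact (h.obj e).symm

theorem cod_inner (h : IsCtr obI obJ s t I J f I' J' es) :
    (perm obI (I' ++ es.map s) I ⨟ f ⨟ perm obJ J (J' ++ es.map t)).cod =
      wordObj obJ J' * wordObj obI (es.map s) := by
  rw [cod_comp, cod_perm h.permJ, wordObj_append, h.wordObj_eq]
  rw [cod_comp] <;> simp [h.permI, h.permJ, h.dom, h.cod]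

theorem dom_inner (h : IsCtr obI obJ s t I J f I' J' es) :
    (perm obI (I' ++ es.map s) I ⨟ f ⨟ perm obJ J (J' ++ es.map t)).dom =
      wordObj obI I' * wordObj obI (es.map s) := by
  simp [h.permI]

theorem dom_ctr (h : IsCtr obI obJ s t I J f I' J' es) :
    (ctr obI obJ s t I J f I' J' es).dom = wordObj obI I' := dom_tr h.dom_inner h.cod_inner

theorem cod_ctr (h : IsCtr obI obJ s t I J f I' J' es) :
    (ctr obI obJ s t I J f I' J' es).cod = wordObj obJ J' := cod_tr h.dom_inner h.cod_inner

/-- Symmetries in front of and behind `f` are absorbed into those of the contraction by coherence.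
Hence the order in which the ports are listed is immaterial. -/
theorem ctr_congr (h : IsCtr obI obJ s t I J f I' J' es) (hI : I₂.Perm I) (hJ : J.Perm J₂) :
    ctr obI obJ s t I₂ J₂ (perm obI I₂ I ⨟ f ⨟ perm obJ J J₂) I' J' es =
      ctr obI obJ s t I J f I' J' es := by
  have h1 : (perm obI I₂ I).cod = f.dom := by rw [cod_perm hI, h.dom]
  have h2 : f.cod = (perm obJ J J₂).dom := by rw [dom_perm hJ, h.cod]
  have h3 : (I' ++ es.map s).Perm I₂ := h.permI.trans hI.symm
  have h4 : J₂.Perm (J' ++ es.map t) := hJ.symm.trans h.permJ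
  have h5 : (J' ++ es.map t).Nodup := h.permJ.nodup_iff.1 h.nodupJ
  unfold ctr
  congr 1
  rw [← perm_comp_perm h3 hI h.nodupI, ← perm_comp_perm hJ h4 h5,
    assoc (f := perm obI I₂ I) h1 h2, ← assoc (f := perm obI (I' ++ es.map s) I₂),
    assoc (g := f ⨟ perm obJ J J₂), assoc (f := f), assoc (g := f), assoc (g := perm obI I₂ I)]
  all_goals simp (maxDischargeDepth := 5) [h2, h3, h4, hI, hJ, h.dom]

/-- Reordering the pairs inserts a symmetry of the traced word on the input side and the inverse
symmetry on the output side. Sliding brings the two together, and they cancel. -/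
theorem ctr_perm (h : IsCtr obI obJ s t I J f I' J' es) (hes : es₂.Perm es) :
    ctr obI obJ s t I J f I' J' es₂ = ctr obI obJ s t I J f I' J' es := by
  have hs : (es₂.map s).Perm (es.map s) := hes.map s
  have ht : (es.map t).Perm (es₂.map t) := (hes.map t).symm
  have hJ : (J' ++ es.map t).Nodup := h.permJ.nodup_iff.1 h.nodupJ
  have ht' : (J' ++ es.map t).Perm (J' ++ es₂.map t) := ht.append_left _
  have hs' : (I' ++ es₂.map s).Perm (I' ++ es.map s) := hs.append_left _
  have hI : (I' ++ es.map s).Nodup := h.permI.nodup_iff.2 h.nodupI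
  have e1 : perm obI (es₂.map s) (es.map s) = perm (obI ∘ s) es₂ es := perm_map s h.s_inj _ _
  have e2 : perm obJ (es.map t) (es₂.map t) = perm (obI ∘ s) es es₂ := by
    rw [perm_map t h.t_inj]
    congr 1
    funext e
    exact (h.obj e).symm
  have e3 : perm (obI ∘ s) es es₂ ⨟ perm (obI ∘ s) es₂ es = id (wordObj (obI ∘ s) es) := by
    rw [perm_comp_perm hes.symm hes, perm_self]
    exact List.Nodup.of_map _ (List.nodup_append.1 hI).2.1
  set P := perm (obI ∘ s) es₂ es with hP
  set Q := perm (obI ∘ s) es es₂ with hQ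
  have hP1 : P.dom = wordObj obI (es₂.map s) := by rw [hP, dom_perm hes, wordObj_map]
  have hP2 : P.cod = wordObj obI (es.map s) := by rw [hP, cod_perm hes, wordObj_map]
  have hQ1 : Q.dom = wordObj obI (es.map s) := by rw [hQ, dom_perm hes.symm, wordObj_map]
  have hQ2 : Q.cod = wordObj obI (es₂.map s) := by rw [hQ, cod_perm hes.symm, wordObj_map]
  have e4 : perm obI (I' ++ es₂.map s) I = id (wordObj obI I') * P ⨟ perm obI (I' ++ es.map s) I := by
    rw [← perm_comp_perm hs' h.permI h.nodupI, ← perm_mul_perm (List.Perm.refl _) hs, perm_self, e1]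
  have e5 : perm obJ J (J' ++ es₂.map t) = perm obJ J (J' ++ es.map t) ⨟ id (wordObj obJ J') * Q := by
    rw [← perm_comp_perm h.permJ ht' (ht'.nodup_iff.1 hJ), ← perm_mul_perm (List.Perm.refl _) ht,
      perm_self, e2]
  have hd := h.dom_inner
  have hc := h.cod_inner
  set g := perm obI (I' ++ es.map s) I ⨟ f ⨟ perm obJ J (J' ++ es.map t) with hg
  have e6 : perm obI (I' ++ es₂.map s) I ⨟ f ⨟ perm obJ J (J' ++ es₂.map t) =
      id (wordObj obI I') * P ⨟ (g ⨟ id (wordObj obJ J') * Q) := by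
    rw [e4, e5, hg, assoc (g := perm obI _ I), assoc (g := perm obI _ I ⨟ f), assoc (g := f) (h := perm obJ _ _),
      assoc (g := f ⨟ perm obJ _ _), assoc (g := f) (h := perm obJ _ _ ⨟ _), assoc (f := f)]
    all_goals
      simp (maxDischargeDepth := 5) [h.permI, h.permJ, h.dom, h.cod, hP2, hQ1, h.wordObj_eq]
  unfold ctr
  rw [e6, tr_slide (by simp [hd]) (by rw [cod_comp] <;> simp [hQ2, hc, hQ1]) hP1 hP2,
    assoc (by simp [hc, hQ1]) (by simp [hQ2, hP1]), id_mul_comp _ (by rw [hP1, hQ2]), e3, id_mul_id,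
    comp_id]
  rw [hc, wordObj_map obI s]

/-- Vanishing for a product traces its last factor first, so the tail `es₂` of the list is
contracted first and `es₁` afterwards. -/
theorem ctr_append (h : IsCtr obI obJ s t I J f I' J' (es₁ ++ es₂)) :
    ctr obI obJ s t I J f I' J' (es₁ ++ es₂) =
      ctr obI obJ s t (I' ++ es₁.map s) (J' ++ es₁.map t)
        (ctr obI obJ s t I J f (I' ++ es₁.map s) (J' ++ es₁.map t) es₂) I' J' es₁ := by
  have h' : IsCtr obI obJ s t I J f (I' ++ es₁.map s) (J' ++ es₁.map t) es₂ :=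
    { h with
      permI := by simpa using h.permI
      permJ := by simpa using h.permJ }
  have hd := h.dom_inner
  have hc := h.cod_inner
  unfold ctr
  rw [perm_self, perm_self, id_comp, comp_id, List.map_append, wordObj_append, tr_mul, wordObj_append,
    wordObj_append, h.wordObj_eq, List.append_assoc, List.map_append, List.append_assoc]
  · simpa using hd
  · simpa using hc
  · exact h'.cod_ctr
  · exact h'.dom_ctr

end IsCtr

end Arr

/-! ## Contracting wires of a framed cospan -/

namespace FramedCospan

variable {T : MonoidalSignature.{u, v}} {A B : List T.Obj}

theorem tgt_ne_d (G : FramedCospan (wordGraph A) (wordGraph B)) (i) (e : G.E) : G.tgt e ≠ G.d.v i :=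
  ((G.d_in i).2 rfl).2 e

theorem src_ne_c (G : FramedCospan (wordGraph A) (wordGraph B)) (i) (e : G.E) : G.src e ≠ G.c.v i :=
  ((G.c_out i).2 rfl).2 e

/-- An edge whose two ends have the same type connects two wire-vertices. -/
theorem exists_mid (G : TypedGraph T) (s : G.E) (h : G.τ.v (G.src s) = G.τ.v (G.tgt s)) :
    ∃ Z, G.τ.e s = TypeEdge.mid Z ∧ G.τ.v (G.src s) = Sum.inl Z ∧ G.τ.v (G.tgt s) = Sum.inl Z := by
  have h1 := G.τ.src_e s
  have h2 := G.τ.tgt_e s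
  rw [← h] at h2
  rw [← h]
  cases hs : G.τ.e s with
  | mid Z =>
    rw [hs] at h1
    exact ⟨Z, rfl, h1.symm, h1.symm⟩
  | inp f i =>
    rw [hs] at h1 h2
    cases h1.trans h2.symm
  | out f i =>
    rw [hs] at h1 h2
    cases h1.trans h2.symm

section contract

variable (H : FramedCospan (wordGraph A) (wordGraph B)) (s : H.E)

/-- An edge can be contracted if it connects two different wire-vertices and is not a bare wire. -/
structure Contractible : Prop where
  ne : H.src s ≠ H.tgt s
  type : H.τ.v (H.src s) = H.τ.v (H.tgt s)
  not_bare : ¬ (H.src s ∈ H.inputs ∧ H.tgt s ∈ H.outputs)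

variable {H s}

open Classical in
/-- The map that moves the target of the edge `s` to its source. -/
noncomputable def moveTgt (hs : Contractible H s) (x : H.V) : {x : H.V // x ≠ H.tgt s} :=
  if h : x = H.tgt s then ⟨H.src s, hs.ne⟩ else ⟨x, h⟩

theorem moveTgt_of_ne (hs : Contractible H s) {x : H.V} (h : x ≠ H.tgt s) :
    moveTgt hs x = ⟨x, h⟩ := dif_neg h

theorem moveTgt_tgt (hs : Contractible H s) : moveTgt hs (H.tgt s) = ⟨H.src s, hs.ne⟩ := dif_pos rfl

theorem Contractible.wire_src (hs : Contractible H s) : H.IsWire (H.src s) := by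
  obtain ⟨Z, -, h, -⟩ := exists_mid H.toTypedGraph s hs.type
  exact ⟨Z, h⟩

theorem Contractible.wire_tgt (hs : Contractible H s) : H.IsWire (H.tgt s) := by
  obtain ⟨Z, -, -, h⟩ := exists_mid H.toTypedGraph s hs.type
  exact ⟨Z, h⟩

theorem Contractible.src_eq (hs : Contractible H s) {e : H.E} (h : H.src e = H.src s) : e = s :=
  H.out_unique e s (h ▸ hs.wire_src) h

theorem Contractible.tgt_eq (hs : Contractible H s) {e : H.E} (h : H.tgt e = H.tgt s) : e = s :=
  H.in_unique e s (h ▸ hs.wire_tgt) h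

theorem τ_moveTgt (hs : Contractible H s) (x : H.V) : H.τ.v (moveTgt hs x).1 = H.τ.v x := by
  by_cases h : x = H.tgt s
  · rw [h, moveTgt_tgt, hs.type]
  · rw [moveTgt_of_ne hs h]

theorem moveTgt_tgt_edge (hs : Contractible H s) {e : H.E} (he : e ≠ s) :
    (moveTgt hs (H.tgt e)).1 = H.tgt e := by
  rw [moveTgt_of_ne hs (fun h => he (hs.tgt_eq h))]

theorem moveTgt_src_box (hs : Contractible H s) {e : H.E} {x : H.V} (hx : H.IsBox x) :
    (moveTgt hs (H.src e)).1 = x ↔ H.src e = x := by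
  by_cases h : H.src e = H.tgt s
  · rw [h, moveTgt_tgt]
    constructor
    · rintro rfl
      exact (not_box_and_wire _ hx hs.wire_src).elim
    · rintro rfl
      exact (not_box_and_wire _ hx hs.wire_tgt).elim
  · rw [moveTgt_of_ne hs h]

theorem moveTgt_d (hs : Contractible H s) (i : Fin A.length) :
    (moveTgt hs (H.d.v i)).1 = H.d.v i := by
  rw [moveTgt_of_ne hs (H.tgt_ne_d i s).symm]

open Classical in
/-- The map that moves the source of the edge `s` to its target. -/
noncomputable def moveSrc (s : H.E) (x : {x : H.V // x ≠ H.tgt s}) : H.V :=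
  if x.1 = H.src s then H.tgt s else x.1

theorem moveSrc_of_eq {x : {x : H.V // x ≠ H.tgt s}} (h : x.1 = H.src s) : moveSrc s x = H.tgt s :=
  if_pos h

theorem moveSrc_of_ne {x : {x : H.V // x ≠ H.tgt s}} (h : x.1 ≠ H.src s) : moveSrc s x = x.1 :=
  if_neg h

theorem moveSrc_moveTgt (hs : Contractible H s) {x : H.V} (h : x ≠ H.src s) :
    moveSrc s (moveTgt hs x) = x := by
  by_cases h' : x = H.tgt s
  · rw [h', moveTgt_tgt, moveSrc_of_eq rfl]
  · rw [moveTgt_of_ne hs h', moveSrc_of_ne h]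

/-- The graph obtained by contracting an edge into its source. -/
noncomputable abbrev contractGraph (hs : Contractible H s) : StringGraph T where
  V := {x : H.V // x ≠ H.tgt s}
  E := {e : H.E // e ≠ s}
  src e := moveTgt hs (H.src e.1)
  tgt e := moveTgt hs (H.tgt e.1)
  τ :=
    { v := fun x => H.τ.v x.1
      e := fun e => H.τ.e e.1
      src_e := fun e => (H.τ.src_e e.1).trans (τ_moveTgt hs _).symm
      tgt_e := fun e => (H.τ.tgt_e e.1).trans (τ_moveTgt hs _).symm }
  finite_V := by
    have := H.finite_V
    infer_instance
  finite_E := by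
    have := H.finite_E
    infer_instance
  local_iso := by
    rintro ⟨x, hx⟩ hb
    have hb' : H.IsBox x := hb
    have key : ∀ e : {e : H.E // e ≠ s}, (moveTgt hs (H.src e.1) = ⟨x, hx⟩ ∨
        moveTgt hs (H.tgt e.1) = ⟨x, hx⟩) ↔ e.1 ∈ H.nbhd x := by
      intro e
      rw [Subtype.ext_iff, Subtype.ext_iff, moveTgt_src_box hs hb', moveTgt_tgt_edge hs e.2]
      rfl
    have h := H.local_iso x hb'
    refine ⟨fun e he => h.mapsTo ((key e).1 he), fun e he e' he' hee =>
      Subtype.ext (h.injOn ((key e).1 he) ((key e').1 he') hee), fun t ht => ?_⟩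
    obtain ⟨e, he, het⟩ := h.surjOn ht
    have hes : e ≠ s := by
      rintro rfl
      rcases he with he | he
      · exact not_box_and_wire _ (he ▸ hb') hs.wire_src
      · exact not_box_and_wire _ (he ▸ hb') hs.wire_tgt
    exact ⟨⟨e, hes⟩, (key ⟨e, hes⟩).2 he, het⟩
  out_unique := by
    rintro ⟨e, he⟩ ⟨e', he'⟩ hw h
    have hw1 : H.IsWire (H.src e) := by
      obtain ⟨Z, hZ⟩ := hw
      exact ⟨Z, (τ_moveTgt hs _).symm.trans hZ⟩
    refine Subtype.ext (H.out_unique e e' hw1 ?_)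
    dsimp only at h
    by_cases h1 : H.src e = H.tgt s <;> by_cases h2 : H.src e' = H.tgt s
    · rw [h1, h2]
    · rw [h1, moveTgt_tgt, moveTgt_of_ne hs h2] at h
      exact absurd (hs.src_eq (congrArg Subtype.val h).symm) he'
    · rw [h2, moveTgt_tgt, moveTgt_of_ne hs h1] at h
      exact absurd (hs.src_eq (congrArg Subtype.val h)) he
    · rw [moveTgt_of_ne hs h1, moveTgt_of_ne hs h2] at h
      exact congrArg Subtype.val h
  in_unique := by
    rintro ⟨e, he⟩ ⟨e', he'⟩ hw h
    have hw1 : H.IsWire (H.tgt e) := by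
      obtain ⟨Z, hZ⟩ := hw
      exact ⟨Z, (τ_moveTgt hs _).symm.trans hZ⟩
    refine Subtype.ext (H.in_unique e e' hw1 ?_)
    have h := congrArg Subtype.val h
    rwa [moveTgt_tgt_edge hs he, moveTgt_tgt_edge hs he'] at h

theorem mem_inputs_contractGraph (hs : Contractible H s) (x : {x : H.V // x ≠ H.tgt s}) :
    x ∈ (contractGraph hs).inputs ↔ x.1 ∈ H.inputs := by
  refine and_congr Iff.rfl ⟨fun h e he => ?_, fun h e he => ?_⟩
  · have hes : e ≠ s := by
      rintro rfl
      exact x.2 he.symm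
    exact h ⟨e, hes⟩ (Subtype.ext ((moveTgt_tgt_edge hs hes).trans he))
  · exact h e.1 ((moveTgt_tgt_edge hs e.2).symm.trans (congrArg Subtype.val he))

/-- Contracting deletes the target of `s`. If this was an output, the source of `s` takes over its
role; so outputs correspond along `moveTgt`, while inputs keep their place. -/
theorem mem_outputs_contractGraph (hs : Contractible H s) (x : {x : H.V // x ≠ H.tgt s}) :
    x ∈ (contractGraph hs).outputs ↔ ∃ y ∈ H.outputs, moveTgt hs y = x := by
  constructor
  · rintro ⟨h1, h2⟩
    by_cases hx : x.1 = H.src s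
    · refine ⟨H.tgt s, ⟨hs.wire_tgt, fun e he => ?_⟩, (moveTgt_tgt hs).trans (Subtype.ext hx.symm)⟩
      have hes : e ≠ s := by
        rintro rfl
        exact hs.ne he
      refine h2 ⟨e, hes⟩ (Subtype.ext ?_)
      dsimp only
      rw [he, moveTgt_tgt, hx]
    · refine ⟨x.1, ⟨h1, fun e he => ?_⟩, moveTgt_of_ne hs x.2⟩
      have hes : e ≠ s := by
        rintro rfl
        exact hx he.symm
      refine h2 ⟨e, hes⟩ (Subtype.ext ?_)
      dsimp only
      rw [he, moveTgt_of_ne hs x.2]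
  · rintro ⟨y, ⟨⟨Z, hZ⟩, h2⟩, rfl⟩
    refine ⟨⟨Z, (τ_moveTgt hs y).trans hZ⟩, fun e he => ?_⟩
    have he := congrArg Subtype.val he
    dsimp only at he
    by_cases hy : y = H.tgt s
    · subst hy
      rw [moveTgt_tgt] at he
      by_cases h3 : H.src e.1 = H.tgt s
      · exact h2 e.1 h3
      · rw [moveTgt_of_ne hs h3] at he
        exact e.2 (hs.src_eq he)
    · rw [moveTgt_of_ne hs hy] at he
      by_cases h3 : H.src e.1 = H.tgt s
      · rw [h3, moveTgt_tgt] at he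
        exact h2 s he
      · rw [moveTgt_of_ne hs h3] at he
        exact h2 e.1 he

/-- Contracting an edge of a framed cospan into its source. -/
noncomputable abbrev contract (hs : Contractible H s) : FramedCospan (wordGraph A) (wordGraph B) :=
  ofWords (contractGraph hs) (fun i => moveTgt hs (H.d.v i)) (fun i => moveTgt hs (H.c.v i))
    (fun i => (τ_moveTgt hs _).trans (H.d.τ_v i)) (fun i => (τ_moveTgt hs _).trans (H.c.τ_v i))
    (fun i j h => by
      exact H.d_injective ((moveTgt_d hs i).symm.trans ((congrArg Subtype.val h).trans (moveTgt_d hs j))))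
    (fun i j h => by
      replace h : (moveTgt hs (H.c.v i)).1 = (moveTgt hs (H.c.v j)).1 := congrArg Subtype.val h
      by_cases h1 : H.c.v i = H.tgt s <;> by_cases h2 : H.c.v j = H.tgt s
      · exact H.c_injective (h1.trans h2.symm)
      · rw [h1, moveTgt_tgt, moveTgt_of_ne hs h2] at h
        exact absurd h (H.src_ne_c j s)
      · rw [h2, moveTgt_tgt, moveTgt_of_ne hs h1] at h
        exact absurd h.symm (H.src_ne_c i s)
      · rw [moveTgt_of_ne hs h1, moveTgt_of_ne hs h2] at h
        exact H.c_injective h)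
    (by
      ext x
      rw [mem_inputs_contractGraph, ← range_d]
      constructor
      · rintro ⟨i, rfl⟩
        exact ⟨i, (moveTgt_d hs i).symm⟩
      · rintro ⟨i, hi⟩
        exact ⟨i, Subtype.ext ((moveTgt_d hs i).trans hi)⟩)
    (by
      ext x
      rw [mem_outputs_contractGraph, ← range_c]
      exact ⟨fun ⟨i, hi⟩ => ⟨_, ⟨i, rfl⟩, hi⟩, fun ⟨_, ⟨i, hi⟩, h⟩ => ⟨i, (congrArg (moveTgt hs) hi).trans h⟩⟩)
    (by
      rintro x ⟨h1, h2⟩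
      rw [mem_inputs_contractGraph] at h1
      rw [mem_outputs_contractGraph] at h2
      obtain ⟨y, hy, rfl⟩ := h2
      by_cases h : y = H.tgt s
      · subst h
        rw [moveTgt_tgt] at h1
        exact hs.not_bare ⟨h1, hy⟩
      · rw [moveTgt_of_ne hs h] at h1
        exact H.no_isolated y ⟨h1, hy⟩)

/-- An edge that leaves a wire-vertex has type `mid` or `inp`. Subdividing it keeps its type on the
second half, which is the typing needed to recognise a contraction as a subdivision read backwards.
-/
theorem wire_of_src (G : TypedGraph T) (e : G.E) {Z} (h : G.τ.v (G.src e) = Sum.inl Z) :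
    (G.τ.e e).wire = Z ∧ (G.τ.e e).firstHalf = .mid Z ∧ (G.τ.e e).secondHalf = G.τ.e e := by
  have h1 := G.τ.src_e e
  rw [h] at h1
  cases hs : G.τ.e e <;> rw [hs] at h1 <;> cases h1 <;> exact ⟨rfl, rfl, rfl⟩

theorem wire_of_tgt (G : TypedGraph T) (e : G.E) {Z} (h : G.τ.v (G.tgt e) = Sum.inl Z) :
    (G.τ.e e).wire = Z ∧ (G.τ.e e).secondHalf = .mid Z ∧ (G.τ.e e).firstHalf = G.τ.e e := by
  have h1 := G.τ.tgt_e e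
  rw [h] at h1
  cases hs : G.τ.e e <;> rw [hs] at h1 <;> cases h1 <;> exact ⟨rfl, rfl, rfl⟩

-- The source and the target of `s` cannot be an input and an output simultaneously, so one of the
-- two is an inner vertex and can be regarded as the one inserted by a subdivision. Which one
-- depends on whether the target is an output.
open Classical in
theorem wireStep_contract (hs : Contractible H s) : WireStep (contract hs) H := by
  obtain ⟨Z, hZ, hZ1, hZ2⟩ := exists_mid H.toTypedGraph s hs.type
  by_cases hw : H.tgt s ∈ H.outputs
  · have hu : ¬ H.src s ∈ H.inputs := fun h => hs.not_bare ⟨h, hw⟩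
    obtain ⟨e₀, he₀⟩ : ∃ e, H.tgt e = H.src s := by
      by_contra h
      exact hu ⟨hs.wire_src, fun e he => h ⟨e, he⟩⟩
    have hes : e₀ ≠ s := by
      rintro rfl
      exact hs.ne he₀.symm
    have hZ0 := wire_of_tgt H.toTypedGraph e₀ (he₀ ▸ hZ1)
    have hsrc : ∀ e, H.src e ≠ H.tgt s := hw.2
    refine .subdivide
      { e₀ := ⟨e₀, hes⟩
        -- The target is an output and has to remain the image of its boundary point. So the source
        -- of `s` is the inserted vertex, and the merged vertex is read as the target.
        v := moveSrc s
        w := H.src s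
        v_bijective := bijective_elim.2 ⟨?_, ?_, ?_⟩
        e := Subtype.val
        e₁ := s
        e_bijective := bijective_elim.2 ⟨Subtype.val_injective, fun e => e.2, fun e => ?_⟩
        src_e := ?_, tgt_e := ?_
        tgt_e₀ := he₀
        src_e₁ := rfl
        tgt_e₁ := ?_
        τ_v := ?_
        τ_w := by rw [hZ1, hZ0.1]
        τ_e := fun _ _ => rfl
        τ_e₀ := hZ0.2.2.symm
        τ_e₁ := by rw [hZ, hZ0.2.1]
        d_v := fun i => ?_
        c_v := fun i => ?_ }
    · rintro x y h
      refine Subtype.ext ?_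
      by_cases h1 : x.1 = H.src s <;> by_cases h2 : y.1 = H.src s
      · exact h1.trans h2.symm
      · rw [moveSrc_of_eq h1, moveSrc_of_ne h2] at h
        exact absurd h.symm y.2
      · rw [moveSrc_of_eq h2, moveSrc_of_ne h1] at h
        exact absurd h x.2
      · rwa [moveSrc_of_ne h1, moveSrc_of_ne h2] at h
    · rintro x h
      by_cases h1 : x.1 = H.src s
      · rw [moveSrc_of_eq h1] at h
        exact hs.ne h.symm
      · rw [moveSrc_of_ne h1] at h
        exact h1 h
    · intro x
      by_cases h1 : x = H.src s
      · exact Or.inl h1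
      · exact Or.inr ⟨_, moveSrc_moveTgt hs h1⟩
    · by_cases h : e = s
      exacts [Or.inl h, Or.inr ⟨⟨e, h⟩, rfl⟩]
    · rintro ⟨e, he⟩
      exact (moveSrc_moveTgt hs (fun h => he (hs.src_eq h))).symm
    · rintro ⟨e, he⟩ he'
      refine (moveSrc_moveTgt hs (fun h => ?_)).symm
      exact he' (Subtype.ext (H.in_unique e e₀ (h ▸ hs.wire_src) (h.trans he₀.symm)))
    · exact (moveSrc_of_eq ((moveTgt_tgt_edge hs hes).trans he₀)).symm
    · intro x
      by_cases h : x.1 = H.src s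
      · rw [moveSrc_of_eq h]
        exact hs.type.symm.trans (congrArg H.τ.v h.symm)
      · rw [moveSrc_of_ne h]
    · exact (moveSrc_moveTgt hs (fun h => H.tgt_ne_d i e₀ (he₀.trans h.symm))).symm
    · exact (moveSrc_moveTgt hs (fun h => H.src_ne_c i s h.symm)).symm
  · obtain ⟨e₀, he₀⟩ : ∃ e, H.src e = H.tgt s := by
      by_contra h
      exact hw ⟨hs.wire_tgt, fun e he => h ⟨e, he⟩⟩
    have hes : e₀ ≠ s := by
      rintro rfl
      exact hs.ne he₀
    have hZ0 := wire_of_src H.toTypedGraph e₀ (he₀ ▸ hZ2)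
    have huniq : ∀ e, H.src e = H.tgt s → e = e₀ := fun e he =>
      H.out_unique e e₀ (he ▸ hs.wire_tgt) (he.trans he₀.symm)
    refine .subdivide
      { e₀ := ⟨e₀, hes⟩
        v := Subtype.val
        w := H.tgt s
        v_bijective := bijective_elim.2 ⟨Subtype.val_injective, fun x => x.2, fun x => ?_⟩
        -- Here the target of `s` is the inserted vertex. After contraction `e₀` starts at the
        -- source of `s`; its first half is `s`, and its second half is `e₀` itself.
        e := fun x => if x.1 = e₀ then s else x.1
        e₁ := e₀
        e_bijective := bijective_elim.2 ⟨?_, ?_, ?_⟩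
        src_e := ?_, tgt_e := ?_
        tgt_e₀ := by rw [if_pos rfl]
        src_e₁ := he₀
        tgt_e₁ := (moveTgt_tgt_edge hs hes).symm
        τ_v := fun _ => rfl
        τ_w := by rw [hZ2, hZ0.1]
        τ_e := ?_
        τ_e₀ := by rw [if_pos rfl, hZ, hZ0.2.1]
        τ_e₁ := hZ0.2.2.symm
        d_v := fun i => (moveTgt_d hs i).symm
        c_v := fun i => (congrArg Subtype.val
          (moveTgt_of_ne hs (fun h => H.src_ne_c i e₀ (he₀.trans h.symm)))).symm }
    · by_cases h : x = H.tgt s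
      exacts [Or.inl h, Or.inr ⟨⟨x, h⟩, rfl⟩]
    · rintro ⟨x, hx⟩ ⟨y, hy⟩ h
      dsimp only at h
      refine Subtype.ext ?_
      split_ifs at h with h1 h2 h2
      · exact h1.trans h2.symm
      · exact absurd h.symm hy
      · exact absurd h hx
      · exact h
    · rintro ⟨x, hx⟩ h
      dsimp only at h
      split_ifs at h with h1
      · exact hes h.symm
      · exact h1 h
    · intro x
      by_cases h1 : x = e₀
      · exact Or.inl h1
      · refine Or.inr ?_
        by_cases h2 : x = s
        · exact ⟨⟨e₀, hes⟩, by simp [h2]⟩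
        · exact ⟨⟨x, h2⟩, by simp [h1]⟩
    · rintro ⟨e, he⟩
      dsimp only
      split_ifs with h
      · rw [h, he₀, moveTgt_tgt]
      · rw [moveTgt_of_ne hs (fun h' => h (huniq e h'))]
    · rintro ⟨e, he⟩ he'
      dsimp only
      rw [if_neg (fun h => he' (Subtype.ext h)), moveTgt_tgt_edge hs he]
    · rintro ⟨e, he⟩ he'
      dsimp only
      rw [if_neg (fun h => he' (Subtype.ext h))]

end contract

/-! ### Collapses: contracting a family of wires at once -/

/-- A collapse of `H` onto `G`: a map of graphs that contracts the edges of `H` that are not in the image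
of `e`, where the contracted edges form disjoint paths. -/
structure Collapse (H G : FramedCospan (wordGraph A) (wordGraph B)) where
  v : H.V → G.V
  e : G.E → H.E
  e_inj : Function.Injective e
  -- The rank grows along contracted edges and thereby excludes contracted cycles. The root is a
  -- chosen vertex of each fibre; by `root_or` every other vertex is the end of a contracted edge,
  -- so nothing is identified unless some edge accounts for it.
  rk : H.V → ℕ
  root : G.V → H.V
  src_e : ∀ x, v (H.src (e x)) = G.src x
  tgt_e : ∀ x, v (H.tgt (e x)) = G.tgt x
  τ_v : ∀ x, G.τ.v (v x) = H.τ.v x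
  τ_e : ∀ x, H.τ.e (e x) = G.τ.e x
  v_eq : ∀ s, s ∉ Set.range e → v (H.src s) = v (H.tgt s)
  rk_lt : ∀ s, s ∉ Set.range e → rk (H.src s) < rk (H.tgt s)
  v_root : ∀ x, v (root x) = x
  root_or : ∀ x, x = root (v x) ∨ ∃ s, s ∉ Set.range e ∧ H.tgt s = x
  d_v : ∀ i, v (H.d.v i) = G.d.v i
  c_v : ∀ i, v (H.c.v i) = G.c.v i

/-- The rank excludes loops. A bare wire from an input to an output cannot be contracted either,
since `G` would then have a vertex that is the image of a point of `A` and of a point of `B`. -/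
theorem Collapse.contractible {H G : FramedCospan (wordGraph A) (wordGraph B)} (φ : Collapse H G) {s : H.E}
    (hs : s ∉ Set.range φ.e) : Contractible H s where
  ne h := by
    have := φ.rk_lt s hs
    rw [h] at this
    exact lt_irrefl _ this
  type := by rw [← φ.τ_v, ← φ.τ_v, φ.v_eq s hs]
  not_bare := by
    rintro ⟨h1, h2⟩
    rw [← range_d] at h1
    rw [← range_c] at h2
    obtain ⟨i, hi⟩ := h1
    obtain ⟨j, hj⟩ := h2
    have := φ.v_eq s hs
    rw [← hi, ← hj, φ.d_v, φ.c_v] at this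
    exact G.d_ne_c i j this

theorem Collapse.v_moveTgt {H G : FramedCospan (wordGraph A) (wordGraph B)} (φ : Collapse H G) {s : H.E}
    (hs : s ∉ Set.range φ.e) (x : H.V) : φ.v (moveTgt (φ.contractible hs) x).1 = φ.v x := by
  by_cases h : x = H.tgt s
  · rw [h, moveTgt_tgt, φ.v_eq s hs]
  · rw [moveTgt_of_ne _ h]

/-- The collapse that remains after contracting one edge. -/
noncomputable def Collapse.step {H G : FramedCospan (wordGraph A) (wordGraph B)} (φ : Collapse H G) {s : H.E}
    (hs : s ∉ Set.range φ.e) : Collapse (contract (φ.contractible hs)) G where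
  v x := φ.v x.1
  e x := ⟨φ.e x, fun h => hs ⟨x, h⟩⟩
  e_inj x y h := φ.e_inj (congrArg Subtype.val h)
  rk x := φ.rk x.1
  root x := moveTgt (φ.contractible hs) (φ.root x)
  src_e x := (φ.v_moveTgt hs _).trans (φ.src_e x)
  tgt_e x := (φ.v_moveTgt hs _).trans (φ.tgt_e x)
  τ_v x := φ.τ_v x.1
  τ_e x := φ.τ_e x
  v_eq t ht := by
    refine (φ.v_moveTgt hs _).trans ((φ.v_eq t.1 ?_).trans (φ.v_moveTgt hs _).symm)
    rintro ⟨x, hx⟩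
    exact ht ⟨x, Subtype.ext hx⟩
  rk_lt t ht := by
    have h1 : φ.rk (H.src t.1) < φ.rk (H.tgt t.1) := φ.rk_lt t.1 (by
      rintro ⟨x, hx⟩
      exact ht ⟨x, Subtype.ext hx⟩)
    dsimp only
    rw [moveTgt_tgt_edge _ t.2]
    -- An edge starting at the deleted vertex now starts at the source of `s`, whose rank is even
    -- lower.
    by_cases h : H.src t.1 = H.tgt s
    · rw [h, moveTgt_tgt]
      rw [h] at h1
      exact (φ.rk_lt s hs).trans h1
    · rwa [moveTgt_of_ne _ h]
  v_root x := (φ.v_moveTgt hs _).trans (φ.v_root x)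
  root_or := by
    rintro ⟨x, hx⟩
    rcases φ.root_or x with h | ⟨t, ht, h⟩
    · refine Or.inl ?_
      dsimp only
      rw [← h, moveTgt_of_ne _ hx]
    · have hts : t ≠ s := by
        rintro rfl
        exact hx h.symm
      refine Or.inr ⟨⟨t, hts⟩, ?_, ?_⟩
      · rintro ⟨y, hy⟩
        exact ht ⟨y, congrArg Subtype.val hy⟩
      · exact Subtype.ext ((moveTgt_tgt_edge (φ.contractible hs) hts).trans h)
  d_v i := (φ.v_moveTgt hs _).trans (φ.d_v i)
  c_v i := (φ.v_moveTgt hs _).trans (φ.c_v i)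

/-- A collapse that contracts nothing is an isomorphism. -/
noncomputable def Collapse.iso {H G : FramedCospan (wordGraph A) (wordGraph B)} (φ : Collapse H G)
    (h : ∀ s, s ∈ Set.range φ.e) : CospanIso H G where
  v := Equiv.ofBijective φ.v ⟨fun x y hxy => by
      have key : ∀ x, x = φ.root (φ.v x) := fun x => (φ.root_or x).resolve_right (fun ⟨s, hs, _⟩ => hs (h s))
      rw [key x, key y, hxy], fun x => ⟨φ.root x, φ.v_root x⟩⟩
  e := (Equiv.ofBijective φ.e ⟨φ.e_inj, h⟩).symm
  src_e x := by
    obtain ⟨y, rfl⟩ := h x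
    rw [show φ.e y = Equiv.ofBijective φ.e ⟨φ.e_inj, h⟩ y from rfl, Equiv.symm_apply_apply]
    exact (φ.src_e y).symm
  tgt_e x := by
    obtain ⟨y, rfl⟩ := h x
    rw [show φ.e y = Equiv.ofBijective φ.e ⟨φ.e_inj, h⟩ y from rfl, Equiv.symm_apply_apply]
    exact (φ.tgt_e y).symm
  τ_v := φ.τ_v
  τ_e x := by
    obtain ⟨y, rfl⟩ := h x
    rw [show φ.e y = Equiv.ofBijective φ.e ⟨φ.e_inj, h⟩ y from rfl, Equiv.symm_apply_apply]
    exact (φ.τ_e y).symm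
  d_v i := (φ.d_v i).symm
  c_v i := (φ.c_v i).symm

/-- By induction on the number of edges of `H`: one superfluous edge is contracted, which is a
single step of wire-homeomorphism, and the map factors through the result. Once no edge is
superfluous the collapse is an isomorphism. The laws below thus need only one map of graphs instead
of a sequence of subdivisions. -/
theorem Collapse.mk_eq {H G : FramedCospan (wordGraph A) (wordGraph B)} (φ : Collapse H G) :
    (Quot.mk _ H : CospanClass (wordGraph A) (wordGraph B)) = Quot.mk _ G := by
  obtain ⟨n, hn⟩ : ∃ n, Nat.card H.E = n := ⟨_, rfl⟩
  induction n using Nat.strong_induction_on generalizing H with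
  | _ n ih =>
    by_cases h : ∀ s, s ∈ Set.range φ.e
    · exact Quot.sound (.iso (φ.iso h))
    · push Not at h
      obtain ⟨s, hs⟩ := h
      have hfin := H.finite_E
      have hlt : Nat.card {e : H.E // e ≠ s} < Nat.card H.E :=
        Finite.card_subtype_lt (x := s) (by simp)
      rw [← ih _ (hn ▸ hlt) (φ.step hs) rfl]
      exact (Quot.sound (wireStep_contract (φ.contractible hs))).symm

end FramedCospan

/-! ## Linked composition -/

namespace FramedCospan

variable {T : MonoidalSignature.{u, v}} {A B D X Y A' B' D' : List T.Obj}

/-- The class of a framed cospan between words. -/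
abbrev cls (G : FramedCospan (wordGraph A) (wordGraph B)) : CospanClass (wordGraph A) (wordGraph B) :=
  Quot.mk _ G

theorem tensor_d (G : FramedCospan (wordGraph A) (wordGraph B))
    (H : FramedCospan (wordGraph A') (wordGraph B')) (s : Fin A.length ⊕ Fin A'.length) :
    (G.tensor H).d.v ((splitFin A A').symm s) = Sum.map G.d.v H.d.v s :=
  congrArg (Sum.map G.d.v H.d.v) (Equiv.apply_symm_apply _ _)

theorem tensor_c (G : FramedCospan (wordGraph A) (wordGraph B))
    (H : FramedCospan (wordGraph A') (wordGraph B')) (s : Fin B.length ⊕ Fin B'.length) :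
    (G.tensor H).c.v ((splitFin B B').symm s) = Sum.map G.c.v H.c.v s :=
  congrArg (Sum.map G.c.v H.c.v) (Equiv.apply_symm_apply _ _)

/-- The disjoint union of two composable framed cospans, where the outputs of the first are connected to
the inputs of the second by wires. -/
abbrev linkGraph (G : FramedCospan (wordGraph A) (wordGraph B))
    (H : FramedCospan (wordGraph B) (wordGraph D)) : StringGraph T where
  V := G.V ⊕ H.V
  E := (G.E ⊕ H.E) ⊕ Fin B.length
  src := Sum.elim (Sum.map G.src H.src) (fun k => Sum.inl (G.c.v k))
  tgt := Sum.elim (Sum.map G.tgt H.tgt) (fun k => Sum.inr (H.d.v k))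
  τ :=
    { v := Sum.elim G.τ.v H.τ.v
      e := Sum.elim (Sum.elim G.τ.e H.τ.e) (fun k => TypeEdge.mid (B.get k))
      src_e := by
        rintro ((e | e) | k)
        exacts [G.τ.src_e e, H.τ.src_e e, (G.c.τ_v k).symm]
      tgt_e := by
        rintro ((e | e) | k)
        exacts [G.τ.tgt_e e, H.τ.tgt_e e, (H.d.τ_v k).symm] }
  finite_V := (sumGraph G.toStringGraph H.toStringGraph).finite_V
  finite_E := by
    have := G.finite_E
    have := H.finite_E
    infer_instance
  local_iso a ha := by
    refine ((sumGraph G.toStringGraph H.toStringGraph).local_iso a ha).of_image (ι := Sum.inl)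
      (fun _ => rfl) ?_
    ext (e | k)
    · simp [DirGraph.nbhd]
    · simp only [Set.mem_image, reduceCtorEq, and_false, exists_false, iff_false]
      rintro (h | h)
      · subst h
        exact not_box_and_wire G.toTypedGraph ha (G.c_wire k)
      · subst h
        exact not_box_and_wire H.toTypedGraph ha (H.d_wire k)
  out_unique := by
    rintro (e | k) (e' | k') hw h
    · exact congrArg _ ((sumGraph G.toStringGraph H.toStringGraph).out_unique e e' hw h)
    · rcases e with e | e
      · exact absurd (Sum.inl_injective h) (G.src_ne_c k' e)
      · cases h
    · rcases e' with e | e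
      · exact absurd (Sum.inl_injective h).symm (G.src_ne_c k e)
      · cases h
    · exact congrArg _ (G.c_injective (Sum.inl_injective h))
  in_unique := by
    rintro (e | k) (e' | k') hw h
    · exact congrArg _ ((sumGraph G.toStringGraph H.toStringGraph).in_unique e e' hw h)
    · rcases e with e | e
      · cases h
      · exact absurd (Sum.inr_injective h) (H.tgt_ne_d k' e)
    · rcases e' with e | e
      · cases h
      · exact absurd (Sum.inr_injective h).symm (H.tgt_ne_d k e)
    · exact congrArg _ (H.d_injective (Sum.inr_injective h))

/-- Composition by connecting outputs to inputs with wires. -/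
abbrev link (G : FramedCospan (wordGraph A) (wordGraph B))
    (H : FramedCospan (wordGraph B) (wordGraph D)) : FramedCospan (wordGraph A) (wordGraph D) :=
  ofWords (linkGraph G H) (fun i => Sum.inl (G.d.v i)) (fun i => Sum.inr (H.c.v i))
    (fun i => G.d.τ_v i) (fun i => H.c.τ_v i) (fun _ _ h => G.d_injective (Sum.inl_injective h))
    (fun _ _ h => H.c_injective (Sum.inr_injective h))
    (by
      ext (x | x)
      · constructor
        · rintro ⟨i, hi⟩
          have h := (G.d_in i).2 rfl
          rw [Sum.inl_injective hi] at h
          refine ⟨h.1, ?_⟩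
          rintro ((e | e) | k) he
          · exact h.2 e (Sum.inl_injective he)
          · cases he
          · cases he
        · intro h
          have h' : x ∈ G.inputs := ⟨h.1, fun e he => h.2 (Sum.inl (Sum.inl e)) (congrArg _ he)⟩
          rw [← range_d] at h'
          obtain ⟨i, hi⟩ := h'
          exact ⟨i, congrArg _ hi⟩
      · refine ⟨fun ⟨_, h⟩ => (by cases h), fun h => ?_⟩
        have h' : x ∈ H.inputs := ⟨h.1, fun e he => h.2 (Sum.inl (Sum.inr e)) (congrArg _ he)⟩
        rw [← range_d] at h'
        obtain ⟨i, hi⟩ := h'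
        exact absurd (congrArg Sum.inr hi) (h.2 (Sum.inr i)))
    (by
      ext (x | x)
      · refine ⟨fun ⟨_, h⟩ => (by cases h), fun h => ?_⟩
        have h' : x ∈ G.outputs := ⟨h.1, fun e he => h.2 (Sum.inl (Sum.inl e)) (congrArg _ he)⟩
        rw [← range_c] at h'
        obtain ⟨i, hi⟩ := h'
        exact absurd (congrArg Sum.inl hi) (h.2 (Sum.inr i))
      · constructor
        · rintro ⟨i, hi⟩
          have h := (H.c_out i).2 rfl
          rw [Sum.inr_injective hi] at h
          refine ⟨h.1, ?_⟩
          rintro ((e | e) | k) he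
          · cases he
          · exact h.2 e (Sum.inr_injective he)
          · cases he
        · intro h
          have h' : x ∈ H.outputs := ⟨h.1, fun e he => h.2 (Sum.inl (Sum.inr e)) (congrArg _ he)⟩
          rw [← range_c] at h'
          obtain ⟨i, hi⟩ := h'
          exact ⟨i, congrArg _ hi⟩)
    (by
      rintro (x | x) ⟨h1, h2⟩
      · exact G.no_isolated x ⟨⟨h1.1, fun e he => h1.2 (Sum.inl (Sum.inl e)) (congrArg _ he)⟩,
          ⟨h2.1, fun e he => h2.2 (Sum.inl (Sum.inl e)) (congrArg _ he)⟩⟩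
      · exact H.no_isolated x ⟨⟨h1.1, fun e he => h1.2 (Sum.inl (Sum.inr e)) (congrArg _ he)⟩,
          ⟨h2.1, fun e he => h2.2 (Sum.inl (Sum.inr e)) (congrArg _ he)⟩⟩)

/-- A framed cospan with its boundary words rearranged. -/
abbrev relabel (G : FramedCospan (wordGraph A) (wordGraph B)) (π : Fin A'.length ≃ Fin A.length)
    (hπ : ∀ i, A.get (π i) = A'.get i) (σ : Fin B'.length ≃ Fin B.length)
    (hσ : ∀ i, B.get (σ i) = B'.get i) : FramedCospan (wordGraph A') (wordGraph B') :=
  ofWords G.toStringGraph (fun i => G.d.v (π i)) (fun i => G.c.v (σ i))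
    (fun i => (G.d.τ_v (π i)).trans (congrArg Sum.inl (hπ i)))
    (fun i => (G.c.τ_v (σ i)).trans (congrArg Sum.inl (hσ i)))
    (fun _ _ h => π.injective (G.d_injective h)) (fun _ _ h => σ.injective (G.c_injective h))
    ((π.surjective.range_comp G.d.v).trans G.range_d) ((σ.surjective.range_comp G.c.v).trans G.range_c)
    G.no_isolated

open Classical in
/-- A vertex that is an input is replaced by another one. -/
noncomputable def replaceIn {α : Type} (G : FramedCospan (wordGraph A) (wordGraph B)) (f : Fin A.length → α)
    (g : G.V → α) (x : G.V) : α :=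
  if h : ∃ i : Fin A.length, G.d.v i = x then f h.choose else g x

theorem replaceIn_d {α : Type} (G : FramedCospan (wordGraph A) (wordGraph B)) (f : Fin A.length → α)
    (g : G.V → α) (i : Fin A.length) : replaceIn G f g (G.d.v i) = f i := by
  have h : ∃ j : Fin A.length, G.d.v j = G.d.v i := ⟨i, rfl⟩
  rw [replaceIn, dif_pos h]
  exact congrArg f (G.d_injective h.choose_spec)

theorem replaceIn_of_ne {α : Type} (G : FramedCospan (wordGraph A) (wordGraph B)) (f : Fin A.length → α)
    (g : G.V → α) {x : G.V} (h : ∀ i : Fin A.length, G.d.v i ≠ x) : replaceIn G f g x = g x :=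
  dif_neg (fun ⟨i, hi⟩ => h i hi)

theorem replaceIn_cases (G : FramedCospan (wordGraph A) (wordGraph B)) (x : G.V) :
    (∃ i : Fin A.length, G.d.v i = x) ∨ ∀ i : Fin A.length, G.d.v i ≠ x := by
  by_cases h : ∃ i : Fin A.length, G.d.v i = x
  exacts [Or.inl h, Or.inr (fun i hi => h ⟨i, hi⟩)]

/-- Linking collapses onto plugging. -/
noncomputable def collapseLink (G : FramedCospan (wordGraph A) (wordGraph B))
    (H : FramedCospan (wordGraph B) (wordGraph D)) : Collapse (G.link H) (G.comp H) where
  v := Sum.elim Pushout.in₁ Pushout.in₂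
  e := Sum.inl
  e_inj := Sum.inl_injective
  rk := Sum.elim (fun _ => 0) (fun _ => 1)
  -- A glued vertex is represented by its copy in `G`, where the contracted wire starts; its copy in
  -- `H` is redirected there.
  root := Pushout.desc Sum.inl (replaceIn H (fun i => Sum.inl (G.c.v i)) Sum.inr)
    (fun i => (replaceIn_d H (fun i => Sum.inl (G.c.v i)) Sum.inr i).symm)
  src_e := by rintro (e | e) <;> rfl
  tgt_e := by rintro (e | e) <;> rfl
  τ_v := by rintro (x | x) <;> rfl
  τ_e := by rintro (e | e) <;> rfl
  v_eq := by
    rintro (e | k) h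
    · exact absurd ⟨e, rfl⟩ h
    · exact Pushout.glue (f := G.c.v) (g := H.d.v) k
  rk_lt := by
    rintro (e | k) h
    · exact absurd ⟨e, rfl⟩ h
    · exact Nat.zero_lt_one
  v_root x := by
    rcases Pushout.cases x with ⟨y, rfl⟩ | ⟨y, rfl⟩
    · rfl
    · change Sum.elim Pushout.in₁ Pushout.in₂ (replaceIn H (fun i => Sum.inl (G.c.v i)) Sum.inr y) = _
      rcases replaceIn_cases H y with ⟨i, rfl⟩ | h
      · rw [replaceIn_d]
        exact Pushout.glue (f := G.c.v) (g := H.d.v) i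
      · rw [replaceIn_of_ne _ _ _ h]
        rfl
  root_or := by
    rintro (x | x)
    · exact Or.inl rfl
    · rcases replaceIn_cases H x with ⟨i, rfl⟩ | h
      · exact Or.inr ⟨Sum.inr i, fun ⟨_, h⟩ => (by cases h), rfl⟩
      · exact Or.inl (replaceIn_of_ne H (fun i => Sum.inl (G.c.v i)) Sum.inr h).symm
  d_v _ := rfl
  c_v _ := rfl

/-- This eliminates the quotient from the pushout: the vertices of a link form a plain disjoint
union, so maps out of it can be defined by cases. -/
theorem cls_comp (G : FramedCospan (wordGraph A) (wordGraph B))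
    (H : FramedCospan (wordGraph B) (wordGraph D)) : cls (G.comp H) = cls (G.link H) :=
  (collapseLink G H).mk_eq.symm

/-- Wires in front of a framed cospan collapse. -/
noncomputable def collapseWiresLink (π : Fin A.length ≃ Fin B.length) (hπ : ∀ i, B.get (π i) = A.get i)
    (G : FramedCospan (wordGraph B) (wordGraph D)) :
    Collapse ((wires π hπ).link G) (G.relabel π hπ (Equiv.refl _) (fun _ => rfl)) where
  v := Sum.elim (Sum.elim (fun i => G.d.v (π i)) (fun j => G.d.v j)) id
  e e := Sum.inl (Sum.inr e)
  e_inj _ _ h := Sum.inr_injective (Sum.inl_injective h)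
  -- The contracted paths have three vertices: the two ends of a bare wire, and the input of `G` to
  -- which it is linked.
  rk := Sum.elim (Sum.elim (fun _ => 0) (fun _ => 1)) (fun _ => 2)
  root := replaceIn G (fun i => Sum.inl (Sum.inl (π.symm i))) Sum.inr
  src_e _ := rfl
  tgt_e _ := rfl
  τ_v := by
    rintro ((i | i) | x)
    exacts [(G.d.τ_v (π i)).trans (congrArg Sum.inl (hπ i)), G.d.τ_v i, rfl]
  τ_e _ := rfl
  v_eq := by
    rintro ((i | e) | k) h
    · rfl
    · exact absurd ⟨e, rfl⟩ h
    · rfl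
  rk_lt := by
    rintro ((i | e) | k) h
    · exact Nat.zero_lt_one
    · exact absurd ⟨e, rfl⟩ h
    · exact Nat.one_lt_two
  v_root x := by
    rcases replaceIn_cases G x with ⟨i, rfl⟩ | h
    · rw [replaceIn_d]
      exact congrArg G.d.v (π.apply_symm_apply i)
    · rw [replaceIn_of_ne _ _ _ h]
      rfl
  root_or := by
    rintro ((i | i) | x)
    · refine Or.inl (Eq.trans ?_ (replaceIn_d G _ _ (π i)).symm)
      rw [Equiv.symm_apply_apply]
    · refine Or.inr ⟨Sum.inl (Sum.inl (π.symm i)), fun ⟨_, h⟩ => (by cases h), ?_⟩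
      exact congrArg (fun j => Sum.inl (Sum.inr j)) (π.apply_symm_apply i)
    · rcases replaceIn_cases G x with ⟨i, rfl⟩ | h
      · exact Or.inr ⟨Sum.inr i, fun ⟨_, h⟩ => (by cases h), rfl⟩
      · exact Or.inl (replaceIn_of_ne _ _ _ h).symm
  d_v _ := rfl
  c_v _ := rfl

/-- Wires behind a framed cospan collapse. -/
noncomputable def collapseLinkWires (G : FramedCospan (wordGraph A) (wordGraph B))
    (π : Fin B.length ≃ Fin D.length) (hπ : ∀ i, D.get (π i) = B.get i) :
    Collapse (G.link (wires π hπ)) (G.relabel (Equiv.refl _) (fun _ => rfl) π.symm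
      (fun i => by rw [← hπ, Equiv.apply_symm_apply])) where
  v := Sum.elim id (Sum.elim (fun i => G.c.v i) (fun j => G.c.v (π.symm j)))
  e e := Sum.inl (Sum.inl e)
  e_inj _ _ h := Sum.inl_injective (Sum.inl_injective h)
  rk := Sum.elim (fun _ => 0) (Sum.elim (fun _ => 1) (fun _ => 2))
  root := Sum.inl
  src_e _ := rfl
  tgt_e _ := rfl
  τ_v := by
    rintro (x | i | i)
    · rfl
    · exact G.c.τ_v i
    · refine (G.c.τ_v (π.symm i)).trans (congrArg Sum.inl ?_)
      have := hπ (π.symm i)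
      rw [Equiv.apply_symm_apply] at this
      exact this.symm
  τ_e _ := rfl
  v_eq := by
    rintro ((e | i) | k) h
    · exact absurd ⟨e, rfl⟩ h
    · exact congrArg G.c.v (π.symm_apply_apply i).symm
    · rfl
  rk_lt := by
    rintro ((e | i) | k) h
    · exact absurd ⟨e, rfl⟩ h
    · exact Nat.one_lt_two
    · exact Nat.zero_lt_one
  v_root x := rfl
  root_or := by
    rintro (x | i | i)
    · exact Or.inl rfl
    · exact Or.inr ⟨Sum.inr i, fun ⟨_, h⟩ => (by cases h), rfl⟩
    · refine Or.inr ⟨Sum.inl (Sum.inr (π.symm i)), fun ⟨_, h⟩ => (by cases h), ?_⟩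
      exact congrArg (fun j => Sum.inr (Sum.inr j)) (π.apply_symm_apply i)
  d_v _ := rfl
  c_v _ := rfl

/-- Inherited from plugging, for which the individual steps have been checked. -/
theorem cls_link_congr {G G' : FramedCospan (wordGraph A) (wordGraph B)}
    {H H' : FramedCospan (wordGraph B) (wordGraph D)} (h : cls G = cls G') (h' : cls H = cls H') :
    cls (G.link H) = cls (G'.link H') := by
  rw [← cls_comp, ← cls_comp]
  exact congrArg₂ (Quot.map₂ FramedCospan.comp (fun G _ _ h => WireStep.comp_right G h)
    (fun _ _ H h => WireStep.comp_left h H)) h h'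

theorem cls_trace_congr {G G' : FramedCospan (wordGraph (A ++ X)) (wordGraph (B ++ X))} (h : cls G = cls G') :
    cls G.trace = cls G'.trace :=
  congrArg (Quot.map FramedCospan.trace (fun _ _ h => WireStep.trace h)) h

theorem cls_tensor_congr {G G' : FramedCospan (wordGraph A) (wordGraph B)}
    {H H' : FramedCospan (wordGraph A') (wordGraph B')} (h : cls G = cls G') (h' : cls H = cls H') :
    cls (G.tensor H) = cls (G'.tensor H') :=
  congrArg₂ (Quot.map₂ FramedCospan.tensor (fun G _ _ h => WireStep.tensor_right G h)
    (fun _ _ H h => WireStep.tensor_left h H)) h h'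

end FramedCospan

/-! ## Positions in concatenated words -/

section positions

variable {α : Type u} (A B D : List α)

theorem splitFin_cases {P : Fin (A ++ B).length → Prop} (h : ∀ i, P ((splitFin A B).symm (Sum.inl i)))
    (h' : ∀ i, P ((splitFin A B).symm (Sum.inr i))) (i : Fin (A ++ B).length) : P i := by
  obtain ⟨s | s, rfl⟩ := (splitFin A B).symm.surjective i
  exacts [h s, h' s]

theorem finCongr_assoc_inl (h : (A ++ (B ++ D)).length = ((A ++ B) ++ D).length) (a : Fin A.length) :
    finCongr h ((splitFin A (B ++ D)).symm (Sum.inl a)) =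
      (splitFin (A ++ B) D).symm (Sum.inl ((splitFin A B).symm (Sum.inl a))) :=
  Fin.ext (by simp [splitFin])

theorem finCongr_assoc_mid (h : (A ++ (B ++ D)).length = ((A ++ B) ++ D).length) (b : Fin B.length) :
    finCongr h ((splitFin A (B ++ D)).symm (Sum.inr ((splitFin B D).symm (Sum.inl b)))) =
      (splitFin (A ++ B) D).symm (Sum.inl ((splitFin A B).symm (Sum.inr b))) :=
  Fin.ext (by simp [splitFin])

theorem finCongr_assoc_inr (h : (A ++ (B ++ D)).length = ((A ++ B) ++ D).length) (d : Fin D.length) :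
    finCongr h ((splitFin A (B ++ D)).symm (Sum.inr ((splitFin B D).symm (Sum.inr d)))) =
      (splitFin (A ++ B) D).symm (Sum.inr d) :=
  Fin.ext (by simp [splitFin, add_assoc])

theorem finCongr_assoc_inl' (h : ((A ++ B) ++ D).length = (A ++ (B ++ D)).length) (a : Fin A.length) :
    finCongr h ((splitFin (A ++ B) D).symm (Sum.inl ((splitFin A B).symm (Sum.inl a)))) =
      (splitFin A (B ++ D)).symm (Sum.inl a) :=
  Fin.ext (by simp [splitFin])

theorem finCongr_assoc_mid' (h : ((A ++ B) ++ D).length = (A ++ (B ++ D)).length) (b : Fin B.length) :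
    finCongr h ((splitFin (A ++ B) D).symm (Sum.inl ((splitFin A B).symm (Sum.inr b)))) =
      (splitFin A (B ++ D)).symm (Sum.inr ((splitFin B D).symm (Sum.inl b))) :=
  Fin.ext (by simp [splitFin])

theorem finCongr_assoc_inr' (h : ((A ++ B) ++ D).length = (A ++ (B ++ D)).length) (d : Fin D.length) :
    finCongr h ((splitFin (A ++ B) D).symm (Sum.inr d)) =
      (splitFin A (B ++ D)).symm (Sum.inr ((splitFin B D).symm (Sum.inr d))) :=
  Fin.ext (by simp [splitFin, add_assoc])

theorem finCongr_nil_append (h : A.length = ([] ++ A).length) (a : Fin A.length) :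
    finCongr h a = (splitFin [] A).symm (Sum.inr a) :=
  Fin.ext (by simp [splitFin])

theorem finCongr_append_nil (h : A.length = (A ++ []).length) (a : Fin A.length) :
    finCongr h a = (splitFin A []).symm (Sum.inl a) :=
  Fin.ext rfl

/-- The permutation of positions that exchanges the two parts of a word. -/
abbrev swapFin : Fin (A ++ B).length ≃ Fin (B ++ A).length :=
  (splitFin A B).trans ((Equiv.sumComm _ _).trans (splitFin B A).symm)

theorem swapFin_symm (s : Fin A.length ⊕ Fin B.length) :
    swapFin A B ((splitFin A B).symm s) = (splitFin B A).symm s.swap := by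
  simp

variable {A B} in
theorem get_finCongr (h : A = B) (i : Fin A.length) :
    B.get (finCongr (congrArg List.length h) i) = A.get i := by
  subst h
  rfl

end positions

/-! ### Wires, linking and disjoint union up to wire-homeomorphism -/

namespace FramedCospan

variable {T : MonoidalSignature.{u, v}} {A B D X Y A' B' D' A'' B'' : List T.Obj}

theorem cls_iso {G H : FramedCospan (wordGraph A) (wordGraph B)} (α : CospanIso G H) : cls G = cls H :=
  Quot.sound (.iso α)

/-- Moving a framed cospan along equalities of words. -/
abbrev castWords (hA : A = A') (hB : B = B') (G : FramedCospan (wordGraph A) (wordGraph B)) :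
    FramedCospan (wordGraph A') (wordGraph B') :=
  G.relabel (finCongr (congrArg List.length hA.symm)) (get_finCongr hA.symm)
    (finCongr (congrArg List.length hB.symm)) (get_finCongr hB.symm)

/-- The casts in the strictness laws become renumberings of the boundary, so that those laws can be
proved by exhibiting isomorphisms of graphs. -/
theorem cast_mk {A B A' B' : FCspPlus T} (hA : A = A') (hB : B = B')
    (G : FramedCospan (wordGraph A) (wordGraph B)) :
    (FCspPlus.mk G).cast hA hB = FCspPlus.mk (G.castWords hA hB) := by
  subst hA hB
  exact cls_iso
    { v := Equiv.refl _, e := Equiv.refl _, src_e := fun _ => rfl, tgt_e := fun _ => rfl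
      τ_v := fun _ => rfl, τ_e := fun _ => rfl, d_v := fun _ => rfl, c_v := fun _ => rfl }

theorem cls_relabel_refl (G : FramedCospan (wordGraph A) (wordGraph B)) :
    cls (G.relabel (Equiv.refl _) (fun _ => rfl) (Equiv.refl _) (fun _ => rfl)) = cls G :=
  cls_iso
    { v := Equiv.refl _, e := Equiv.refl _, src_e := fun _ => rfl, tgt_e := fun _ => rfl
      τ_v := fun _ => rfl, τ_e := fun _ => rfl, d_v := fun _ => rfl, c_v := fun _ => rfl }

theorem cls_wires_congr {π σ : Fin A.length ≃ Fin B.length} (h : π = σ) (hπ : ∀ i, B.get (π i) = A.get i)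
    (hσ : ∀ i, B.get (σ i) = A.get i) : cls (wires π hπ) = cls (wires σ hσ) := by
  subst h
  rfl

theorem cls_wires_link (π : Fin A.length ≃ Fin B.length) (hπ : ∀ i, B.get (π i) = A.get i)
    (G : FramedCospan (wordGraph B) (wordGraph D)) :
    cls ((wires π hπ).link G) = cls (G.relabel π hπ (Equiv.refl _) (fun _ => rfl)) :=
  (collapseWiresLink π hπ G).mk_eq

theorem cls_link_wires (G : FramedCospan (wordGraph A) (wordGraph B)) (π : Fin B.length ≃ Fin D.length)
    (hπ : ∀ i, D.get (π i) = B.get i) (hπ' : ∀ i, B.get (π.symm i) = D.get i) :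
    cls (G.link (wires π hπ)) = cls (G.relabel (Equiv.refl _) (fun _ => rfl) π.symm hπ') :=
  (collapseLinkWires G π hπ).mk_eq

theorem cls_wires_link_wires (π : Fin A.length ≃ Fin B.length) (hπ : ∀ i, B.get (π i) = A.get i)
    (σ : Fin B.length ≃ Fin D.length) (hσ : ∀ i, D.get (σ i) = B.get i) :
    cls ((wires π hπ).link (wires σ hσ)) = cls (wires (π.trans σ) (fun i => (hσ _).trans (hπ i))) := by
  rw [cls_link_wires _ _ _ (fun i => by rw [← hσ, Equiv.apply_symm_apply])]
  refine cls_iso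
    { v := Equiv.sumCongr (Equiv.refl _) σ, e := Equiv.refl _, src_e := fun _ => rfl, tgt_e := fun _ => rfl
      τ_v := ?_, τ_e := fun _ => rfl, d_v := fun _ => rfl, c_v := fun i => ?_ }
  · rintro (i | i)
    exacts [rfl, congrArg Sum.inl (hσ i)]
  · exact congrArg Sum.inr (σ.apply_symm_apply i).symm

theorem cls_wires_tensor_wires (π : Fin A.length ≃ Fin B.length) (hπ : ∀ i, B.get (π i) = A.get i)
    (σ : Fin A'.length ≃ Fin B'.length) (hσ : ∀ i, B'.get (σ i) = A'.get i)
    (hπσ : ∀ i, (B ++ B').get (((splitFin A A').trans ((Equiv.sumCongr π σ).trans (splitFin B B').symm)) i) =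
      (A ++ A').get i) :
    cls ((wires π hπ).tensor (wires σ hσ)) =
      cls (wires ((splitFin A A').trans ((Equiv.sumCongr π σ).trans (splitFin B B').symm)) hπσ) := by
  refine cls_iso
    { v := (Equiv.sumSumSumComm _ _ _ _).trans (Equiv.sumCongr (splitFin A A').symm (splitFin B B').symm)
      e := (splitFin A A').symm
      src_e := ?_, tgt_e := ?_, τ_v := ?_, τ_e := ?_
      d_v := fun i => ?_, c_v := fun i => ?_ }
  · rintro (e | e) <;> rfl
  · rintro (e | e)
    · refine congrArg Sum.inr (congrArg (splitFin B B').symm ?_)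
      exact congrArg (Sum.map π σ) ((splitFin A A').apply_symm_apply (Sum.inl e))
    · refine congrArg Sum.inr (congrArg (splitFin B B').symm ?_)
      exact congrArg (Sum.map π σ) ((splitFin A A').apply_symm_apply (Sum.inr e))
  · rintro ((i | i) | (i | i))
    · exact congrArg Sum.inl (get_splitFin_symm A A' (Sum.inl i))
    · exact congrArg Sum.inl (get_splitFin_symm B B' (Sum.inl i))
    · exact congrArg Sum.inl (get_splitFin_symm A A' (Sum.inr i))
    · exact congrArg Sum.inl (get_splitFin_symm B B' (Sum.inr i))
  · rintro (e | e)
    · exact congrArg TypeEdge.mid (get_splitFin_symm A A' (Sum.inl e))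
    · exact congrArg TypeEdge.mid (get_splitFin_symm A A' (Sum.inr e))
  · induction i using splitFin_cases A A' with
    | h i =>
      exact congrArg ((Equiv.sumSumSumComm _ _ _ _).trans (Equiv.sumCongr (splitFin A A').symm (splitFin B B').symm))
        (tensor_d (wires π hπ) (wires σ hσ) (Sum.inl i)).symm
    | h' i =>
      exact congrArg ((Equiv.sumSumSumComm _ _ _ _).trans (Equiv.sumCongr (splitFin A A').symm (splitFin B B').symm))
        (tensor_d (wires π hπ) (wires σ hσ) (Sum.inr i)).symm
  · induction i using splitFin_cases B B' with
    | h i =>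
      exact congrArg ((Equiv.sumSumSumComm _ _ _ _).trans (Equiv.sumCongr (splitFin A A').symm (splitFin B B').symm))
        (tensor_c (wires π hπ) (wires σ hσ) (Sum.inl i)).symm
    | h' i =>
      exact congrArg ((Equiv.sumSumSumComm _ _ _ _).trans (Equiv.sumCongr (splitFin A A').symm (splitFin B B').symm))
        (tensor_c (wires π hπ) (wires σ hσ) (Sum.inr i)).symm

theorem cls_castWords_wires (π : Fin A.length ≃ Fin B.length) (hπ : ∀ i, B.get (π i) = A.get i)
    (hA : A = A') (hB : B = B')
    (h : ∀ i, B'.get (((finCongr (congrArg List.length hA)).symm.trans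
      (π.trans (finCongr (congrArg List.length hB)))) i) = A'.get i) :
    cls ((wires π hπ).castWords hA hB) = cls (wires ((finCongr (congrArg List.length hA)).symm.trans
      (π.trans (finCongr (congrArg List.length hB)))) h) := by
  subst hA hB
  exact cls_iso
    { v := Equiv.refl _, e := Equiv.refl _, src_e := fun _ => rfl, tgt_e := fun _ => rfl
      τ_v := fun _ => rfl, τ_e := fun _ => rfl, d_v := fun _ => rfl, c_v := fun _ => rfl }

/-- Linking is associative. -/
theorem cls_link_assoc (F : FramedCospan (wordGraph A) (wordGraph B)) (G : FramedCospan (wordGraph B) (wordGraph D))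
    (H : FramedCospan (wordGraph D) (wordGraph D')) : cls ((F.link G).link H) = cls (F.link (G.link H)) := by
  refine cls_iso
    { v := Equiv.sumAssoc _ _ _
      e := { toFun := Sum.elim (Sum.elim (Sum.elim (Sum.elim (fun x => Sum.inl (Sum.inl x))
                (fun x => Sum.inl (Sum.inr (Sum.inl (Sum.inl x))))) Sum.inr)
                (fun x => Sum.inl (Sum.inr (Sum.inl (Sum.inr x))))) (fun x => Sum.inl (Sum.inr (Sum.inr x)))
             invFun := Sum.elim (Sum.elim (fun x => Sum.inl (Sum.inl (Sum.inl (Sum.inl x))))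
                (Sum.elim (Sum.elim (fun x => Sum.inl (Sum.inl (Sum.inl (Sum.inr x))))
                  (fun x => Sum.inl (Sum.inr x))) Sum.inr)) (fun x => Sum.inl (Sum.inl (Sum.inr x)))
             left_inv := by rintro ((((x | x) | x) | x) | x) <;> rfl
             right_inv := by rintro ((x | ((x | x) | x)) | x) <;> rfl }
      src_e := ?_, tgt_e := ?_, τ_v := ?_, τ_e := ?_, d_v := fun i => rfl, c_v := fun i => rfl }
  · rintro ((((x | x) | x) | x) | x) <;> rfl
  · rintro ((((x | x) | x) | x) | x) <;> rfl
  · rintro ((x | x) | x) <;> rfl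
  · rintro ((((x | x) | x) | x) | x) <;> rfl

/-- Both sides consist of the same four graphs with the same connecting wires. Only the numbering
differs, so an isomorphism suffices and nothing has to be contracted. -/
theorem cls_tensor_link_tensor (F : FramedCospan (wordGraph A) (wordGraph B))
    (G : FramedCospan (wordGraph B) (wordGraph D)) (F' : FramedCospan (wordGraph A') (wordGraph B'))
    (G' : FramedCospan (wordGraph B') (wordGraph D')) :
    cls ((F.link G).tensor (F'.link G')) = cls ((F.tensor F').link (G.tensor G')) := by
  refine cls_iso
    { v := Equiv.sumSumSumComm _ _ _ _
      e := (Equiv.sumSumSumComm _ _ _ _).trans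
        (Equiv.sumCongr (Equiv.sumSumSumComm _ _ _ _) (splitFin B B').symm)
      src_e := ?_, tgt_e := ?_, τ_v := ?_, τ_e := ?_, d_v := fun i => ?_, c_v := fun i => ?_ }
  · rintro (((x | x) | x) | ((x | x) | x))
    · rfl
    · rfl
    · exact congrArg Sum.inl (tensor_c F F' (Sum.inl x))
    · rfl
    · rfl
    · exact congrArg Sum.inl (tensor_c F F' (Sum.inr x))
  · rintro (((x | x) | x) | ((x | x) | x))
    · rfl
    · rfl
    · exact congrArg Sum.inr (tensor_d G G' (Sum.inl x))
    · rfl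
    · rfl
    · exact congrArg Sum.inr (tensor_d G G' (Sum.inr x))
  · rintro ((x | x) | (x | x)) <;> rfl
  · rintro (((x | x) | x) | ((x | x) | x))
    · rfl
    · rfl
    · exact congrArg TypeEdge.mid (get_splitFin_symm B B' (Sum.inl x))
    · rfl
    · rfl
    · exact congrArg TypeEdge.mid (get_splitFin_symm B B' (Sum.inr x))
  · induction i using splitFin_cases A A' with
    | h i =>
      exact (congrArg Sum.inl (tensor_d F F' (Sum.inl i))).trans
        (congrArg (Equiv.sumSumSumComm _ _ _ _) (tensor_d (F.link G) (F'.link G') (Sum.inl i)).symm)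
    | h' i =>
      exact (congrArg Sum.inl (tensor_d F F' (Sum.inr i))).trans
        (congrArg (Equiv.sumSumSumComm _ _ _ _) (tensor_d (F.link G) (F'.link G') (Sum.inr i)).symm)
  · induction i using splitFin_cases D D' with
    | h i =>
      exact (congrArg Sum.inr (tensor_c G G' (Sum.inl i))).trans
        (congrArg (Equiv.sumSumSumComm _ _ _ _) (tensor_c (F.link G) (F'.link G') (Sum.inl i)).symm)
    | h' i =>
      exact (congrArg Sum.inr (tensor_c G G' (Sum.inr i))).trans
        (congrArg (Equiv.sumSumSumComm _ _ _ _) (tensor_c (F.link G) (F'.link G') (Sum.inr i)).symm)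

theorem cls_tensor_assoc (F : FramedCospan (wordGraph A) (wordGraph B))
    (G : FramedCospan (wordGraph A') (wordGraph B')) (H : FramedCospan (wordGraph A'') (wordGraph B'')) :
    cls (((F.tensor G).tensor H).castWords (List.append_assoc A A' A'') (List.append_assoc B B' B'')) =
      cls (F.tensor (G.tensor H)) := by
  refine cls_iso
    { v := Equiv.sumAssoc _ _ _
      e := Equiv.sumAssoc _ _ _
      src_e := ?_, tgt_e := ?_, τ_v := ?_, τ_e := ?_, d_v := fun i => ?_, c_v := fun i => ?_ }
  · rintro ((x | x) | x) <;> rfl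
  · rintro ((x | x) | x) <;> rfl
  · rintro ((x | x) | x) <;> rfl
  · rintro ((x | x) | x) <;> rfl
  · induction i using splitFin_cases A (A' ++ A'') with
    | h i =>
      refine (tensor_d F (G.tensor H) (Sum.inl i)).trans (Eq.trans ?_ (congrArg
        (fun i => Equiv.sumAssoc _ _ _ (((F.tensor G).tensor H).d.v i)) (finCongr_assoc_inl A A' A'' _ i).symm))
      refine Eq.trans ?_ (congrArg (Equiv.sumAssoc _ _ _) (tensor_d (F.tensor G) H (Sum.inl _)).symm)
      exact congrArg (fun x => Equiv.sumAssoc _ _ _ (Sum.inl x)) (tensor_d F G (Sum.inl i)).symm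
    | h' i =>
      induction i using splitFin_cases A' A'' with
      | h i =>
        refine (tensor_d F (G.tensor H) (Sum.inr _)).trans (Eq.trans ?_ (congrArg
          (fun i => Equiv.sumAssoc _ _ _ (((F.tensor G).tensor H).d.v i)) (finCongr_assoc_mid A A' A'' _ i).symm))
        refine Eq.trans ?_ (congrArg (Equiv.sumAssoc _ _ _) (tensor_d (F.tensor G) H (Sum.inl _)).symm)
        refine Eq.trans ?_ (congrArg (fun x => Equiv.sumAssoc _ _ _ (Sum.inl x)) (tensor_d F G (Sum.inr i)).symm)
        exact congrArg Sum.inr (tensor_d G H (Sum.inl i))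
      | h' i =>
        refine (tensor_d F (G.tensor H) (Sum.inr _)).trans (Eq.trans ?_ (congrArg
          (fun i => Equiv.sumAssoc _ _ _ (((F.tensor G).tensor H).d.v i)) (finCongr_assoc_inr A A' A'' _ i).symm))
        refine Eq.trans ?_ (congrArg (Equiv.sumAssoc _ _ _) (tensor_d (F.tensor G) H (Sum.inr _)).symm)
        exact congrArg Sum.inr (tensor_d G H (Sum.inr i))
  · induction i using splitFin_cases B (B' ++ B'') with
    | h i =>
      refine (tensor_c F (G.tensor H) (Sum.inl i)).trans (Eq.trans ?_ (congrArg
        (fun i => Equiv.sumAssoc _ _ _ (((F.tensor G).tensor H).c.v i)) (finCongr_assoc_inl B B' B'' _ i).symm))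
      refine Eq.trans ?_ (congrArg (Equiv.sumAssoc _ _ _) (tensor_c (F.tensor G) H (Sum.inl _)).symm)
      exact congrArg (fun x => Equiv.sumAssoc _ _ _ (Sum.inl x)) (tensor_c F G (Sum.inl i)).symm
    | h' i =>
      induction i using splitFin_cases B' B'' with
      | h i =>
        refine (tensor_c F (G.tensor H) (Sum.inr _)).trans (Eq.trans ?_ (congrArg
          (fun i => Equiv.sumAssoc _ _ _ (((F.tensor G).tensor H).c.v i)) (finCongr_assoc_mid B B' B'' _ i).symm))
        refine Eq.trans ?_ (congrArg (Equiv.sumAssoc _ _ _) (tensor_c (F.tensor G) H (Sum.inl _)).symm)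
        refine Eq.trans ?_ (congrArg (fun x => Equiv.sumAssoc _ _ _ (Sum.inl x)) (tensor_c F G (Sum.inr i)).symm)
        exact congrArg Sum.inr (tensor_c G H (Sum.inl i))
      | h' i =>
        refine (tensor_c F (G.tensor H) (Sum.inr _)).trans (Eq.trans ?_ (congrArg
          (fun i => Equiv.sumAssoc _ _ _ (((F.tensor G).tensor H).c.v i)) (finCongr_assoc_inr B B' B'' _ i).symm))
        refine Eq.trans ?_ (congrArg (Equiv.sumAssoc _ _ _) (tensor_c (F.tensor G) H (Sum.inr _)).symm)
        exact congrArg Sum.inr (tensor_c G H (Sum.inr i))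

end FramedCospan

/-! ### Unit laws, naturality of the symmetry, and laws of the trace -/

namespace FramedCospan

variable {T : MonoidalSignature.{u, v}} {A B D X Y A' B' D' A'' B'' : List T.Obj}

theorem cls_unit_tensor (G : FramedCospan (wordGraph A) (wordGraph B)) :
    cls (((pseudoId []).tensor G).castWords (List.nil_append A) (List.nil_append B)) = cls G := by
  have : IsEmpty (Fin ([] : List T.Obj).length) := Fin.isEmpty
  refine (cls_iso
    { v := (Equiv.emptySum _ _).symm
      e := (Equiv.emptySum _ _).symm
      src_e := fun _ => rfl, tgt_e := fun _ => rfl, τ_v := fun _ => rfl, τ_e := fun _ => rfl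
      d_v := fun i => ?_, c_v := fun i => ?_ }).symm
  · exact (congrArg (fun i => ((pseudoId []).tensor G).d.v i)
        (finCongr_nil_append A (congrArg List.length (List.nil_append A).symm) i)).trans
      (tensor_d (pseudoId []) G (Sum.inr i))
  · exact (congrArg (fun i => ((pseudoId []).tensor G).c.v i)
        (finCongr_nil_append B (congrArg List.length (List.nil_append B).symm) i)).trans
      (tensor_c (pseudoId []) G (Sum.inr i))

theorem cls_tensor_unit (G : FramedCospan (wordGraph A) (wordGraph B)) :
    cls ((G.tensor (pseudoId [])).castWords (List.append_nil A) (List.append_nil B)) = cls G := by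
  have : IsEmpty (Fin ([] : List T.Obj).length) := Fin.isEmpty
  refine (cls_iso
    { v := (Equiv.sumEmpty _ _).symm
      e := (Equiv.sumEmpty _ _).symm
      src_e := fun _ => rfl, tgt_e := fun _ => rfl, τ_v := fun _ => rfl, τ_e := fun _ => rfl
      d_v := fun i => ?_, c_v := fun i => ?_ }).symm
  · exact (congrArg (fun i => (G.tensor (pseudoId [])).d.v i)
        (finCongr_append_nil A (congrArg List.length (List.append_nil A).symm) i)).trans
      (tensor_d G (pseudoId []) (Sum.inl i))
  · exact (congrArg (fun i => (G.tensor (pseudoId [])).c.v i)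
        (finCongr_append_nil B (congrArg List.length (List.append_nil B).symm) i)).trans
      (tensor_c G (pseudoId []) (Sum.inl i))

theorem get_of_symm_get {π : Fin A.length ≃ Fin B.length} (hπ : ∀ i, B.get (π i) = A.get i) (i) :
    A.get (π.symm i) = B.get i := by
  rw [← hπ, Equiv.apply_symm_apply]

theorem get_swapFin (A B : List T.Obj) (i) : (B ++ A).get (swapFin A B i) = (A ++ B).get i := by
  rw [get_splitFin A B i]
  refine (get_splitFin_symm B A _).trans ?_
  rcases splitFin A B i with j | j <;> simp

/-- The symmetry is natural. -/
theorem cls_tensor_link_swap (F : FramedCospan (wordGraph A) (wordGraph B))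
    (G : FramedCospan (wordGraph A') (wordGraph B')) :
    cls ((F.tensor G).link (swap B B')) = cls ((swap A A').link (G.tensor F)) := by
  rw [cls_link_wires _ _ _ (get_of_symm_get (get_swapFin B B')), cls_wires_link]
  refine cls_iso
    { v := Equiv.sumComm _ _, e := Equiv.sumComm _ _
      src_e := ?_, tgt_e := ?_, τ_v := ?_, τ_e := ?_, d_v := fun i => ?_, c_v := fun i => ?_ }
  · rintro (x | x) <;> rfl
  · rintro (x | x) <;> rfl
  · rintro (x | x) <;> rfl
  · rintro (x | x) <;> rfl
  · induction i using splitFin_cases A A' with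
    | h i =>
      refine (congrArg (fun i => (G.tensor F).d.v i) (swapFin_symm A A' (Sum.inl i))).trans ?_
      exact (tensor_d G F (Sum.inr i)).trans (congrArg Sum.swap (tensor_d F G (Sum.inl i)).symm)
    | h' i =>
      refine (congrArg (fun i => (G.tensor F).d.v i) (swapFin_symm A A' (Sum.inr i))).trans ?_
      exact (tensor_d G F (Sum.inl i)).trans (congrArg Sum.swap (tensor_d F G (Sum.inr i)).symm)
  · induction i using splitFin_cases B' B with
    | h i =>
      refine (tensor_c G F (Sum.inl i)).trans ?_
      refine Eq.trans ?_ (congrArg (fun i => Sum.swap ((F.tensor G).c.v i)) (swapFin_symm B' B (Sum.inl i)).symm)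
      exact congrArg Sum.swap (tensor_c F G (Sum.inr i)).symm
    | h' i =>
      refine (tensor_c G F (Sum.inr i)).trans ?_
      refine Eq.trans ?_ (congrArg (fun i => Sum.swap ((F.tensor G).c.v i)) (swapFin_symm B' B (Sum.inr i)).symm)
      exact congrArg Sum.swap (tensor_c F G (Sum.inl i)).symm

/-- A morphism before a trace. -/
noncomputable def collapseTraceLeft (H : FramedCospan (wordGraph A') (wordGraph A))
    (F : FramedCospan (wordGraph (A ++ X)) (wordGraph (B ++ X))) :
    Collapse ((H.tensor (pseudoId X)).link F).trace (H.link F.trace) where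
  -- The identity wires on `X` and their links to `F` are contracted onto the traced inputs of `F`,
  -- whereas the feedback wires survive. The contracted paths run through the two ends of an
  -- identity wire to an input of `F`, hence the ranks 0, 1, 2.
  v := Sum.elim (Sum.elim Sum.inl (Sum.elim (fun k => Sum.inr (traceIn F k)) (fun k => Sum.inr (traceIn F k))))
    Sum.inr
  e := Sum.elim (Sum.elim (fun e => Sum.inl (Sum.inl (Sum.inl (Sum.inl e))))
    (Sum.elim (fun e => Sum.inl (Sum.inl (Sum.inr e))) Sum.inr))
    (fun i => Sum.inl (Sum.inr ((splitFin A X).symm (Sum.inl i))))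
  e_inj := by
    rintro ((e | e | e) | e) ((e' | e' | e') | e') h <;> simp at h <;> subst h <;> rfl
  rk := Sum.elim (Sum.elim (fun _ => 0) (Sum.elim (fun _ => 0) (fun _ => 1))) (fun _ => 2)
  root := Sum.elim (fun x => Sum.inl (Sum.inl x)) (replaceIn F (fun i => Sum.elim
    (fun a => Sum.inr (F.d.v ((splitFin A X).symm (Sum.inl a)))) (fun k => Sum.inl (Sum.inr (Sum.inl k)))
      (splitFin A X i)) Sum.inr)
  src_e := by
    rintro ((e | e | k) | i)
    · rfl
    · rfl
    · rfl
    · exact congrArg (Sum.elim (Sum.elim Sum.inl (Sum.elim (fun k => Sum.inr (traceIn F k))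
        (fun k => Sum.inr (traceIn F k)))) Sum.inr) (congrArg Sum.inl (tensor_c H (pseudoId X) (Sum.inl i)))
  tgt_e := by
    rintro ((e | e | k) | i)
    · rfl
    · rfl
    · exact congrArg (Sum.elim (Sum.elim Sum.inl (Sum.elim (fun k => Sum.inr (traceIn F k))
        (fun k => Sum.inr (traceIn F k)))) Sum.inr) (congrArg Sum.inl (tensor_d H (pseudoId X) (Sum.inr k)))
    · rfl
  τ_v := by
    rintro ((x | k | k) | x)
    · rfl
    · exact (F.d.τ_v _).trans (congrArg Sum.inl (get_splitFin_symm A X (Sum.inr k)))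
    · exact (F.d.τ_v _).trans (congrArg Sum.inl (get_splitFin_symm A X (Sum.inr k)))
    · rfl
  τ_e := by
    rintro ((e | e | k) | i)
    · rfl
    · rfl
    · rfl
    · exact congrArg TypeEdge.mid (get_splitFin_symm A X (Sum.inl i))
  v_eq := by
    rintro ((((e | k) | e) | i) | k) h
    · exact absurd ⟨Sum.inl (Sum.inl e), rfl⟩ h
    · rfl
    · exact absurd ⟨Sum.inl (Sum.inr (Sum.inl e)), rfl⟩ h
    · induction i using splitFin_cases A X with
      | h i => exact absurd ⟨Sum.inr i, rfl⟩ h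
      | h' k =>
        refine (congrArg (Sum.elim (Sum.elim Sum.inl (Sum.elim (fun k => Sum.inr (traceIn F k))
          (fun k => Sum.inr (traceIn F k)))) Sum.inr)
          (congrArg Sum.inl (tensor_c H (pseudoId X) (Sum.inr k)))).trans ?_
        rfl
    · exact absurd ⟨Sum.inl (Sum.inr (Sum.inr k)), rfl⟩ h
  rk_lt := by
    rintro ((((e | k) | e) | i) | k) h
    · exact absurd ⟨Sum.inl (Sum.inl e), rfl⟩ h
    · exact Nat.zero_lt_one
    · exact absurd ⟨Sum.inl (Sum.inr (Sum.inl e)), rfl⟩ h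
    · dsimp only [Sum.elim_inl, Sum.elim_inr]
      rcases Sum.map H.c.v (pseudoId X).c.v (splitFin A X i) with x | x | x
      exacts [Nat.zero_lt_two, Nat.zero_lt_two, Nat.one_lt_two]
    · exact absurd ⟨Sum.inl (Sum.inr (Sum.inr k)), rfl⟩ h
  v_root := by
    rintro (x | x)
    · rfl
    · dsimp only [Sum.elim_inr]
      rcases replaceIn_cases F x with ⟨i, rfl⟩ | h
      · rw [replaceIn_d]
        obtain ⟨s | s, rfl⟩ := (splitFin A X).symm.surjective i <;> rw [Equiv.apply_symm_apply] <;> rfl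
      · rw [replaceIn_of_ne _ _ _ h]
        rfl
  root_or := by
    rintro ((x | k | k) | x)
    · exact Or.inl rfl
    · refine Or.inl ?_
      dsimp only [Sum.elim_inl, Sum.elim_inr, traceIn]
      rw [replaceIn_d, Equiv.apply_symm_apply]
      rfl
    · refine Or.inr ⟨Sum.inl (Sum.inl (Sum.inl (Sum.inr k))), ?_, rfl⟩
      rintro ⟨(e | e | e) | e, h⟩ <;> cases h
    · rcases replaceIn_cases F x with ⟨i, rfl⟩ | h
      · induction i using splitFin_cases A X with
        | h i =>
          refine Or.inl ?_
          dsimp only [Sum.elim_inr]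
          rw [replaceIn_d, Equiv.apply_symm_apply]
          rfl
        | h' k =>
          refine Or.inr ⟨Sum.inl (Sum.inr ((splitFin A X).symm (Sum.inr k))), ?_, rfl⟩
          rintro ⟨(e | e | e) | e, h⟩
          · cases h
          · cases h
          · cases h
          · have := (splitFin A X).symm.injective (Sum.inr_injective (Sum.inl_injective h))
            cases this
      · refine Or.inl ?_
        dsimp only [Sum.elim_inr]
        rw [replaceIn_of_ne _ _ _ h]
  d_v i := congrArg (Sum.elim (Sum.elim Sum.inl (Sum.elim (fun k => Sum.inr (traceIn F k))
        (fun k => Sum.inr (traceIn F k)))) Sum.inr) (congrArg Sum.inl (tensor_d H (pseudoId X) (Sum.inl i)))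
  c_v _ := rfl

/-- A morphism after a trace. -/
noncomputable def collapseTraceRight (F : FramedCospan (wordGraph (A ++ X)) (wordGraph (B ++ X)))
    (H : FramedCospan (wordGraph B) (wordGraph B')) :
    Collapse (F.link (H.tensor (pseudoId X))).trace (F.trace.link H) where
  -- Dually, the identity wires on `X` are contracted onto the traced outputs of `F`, where the
  -- contracted paths now begin.
  v := Sum.elim Sum.inl (Sum.elim Sum.inr (Sum.elim (fun k => Sum.inl (traceOut F k))
    (fun k => Sum.inl (traceOut F k))))
  e := Sum.elim (Sum.elim (Sum.elim (fun e => Sum.inl (Sum.inl (Sum.inl e))) Sum.inr)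
    (fun e => Sum.inl (Sum.inl (Sum.inr (Sum.inl e)))))
    (fun i => Sum.inl (Sum.inr ((splitFin B X).symm (Sum.inl i))))
  e_inj := by
    rintro (((e | e) | e) | e) (((e' | e') | e') | e') h <;> simp at h <;> subst h <;> rfl
  rk := Sum.elim (fun _ => 0) (Sum.elim (fun _ => 0) (Sum.elim (fun _ => 1) (fun _ => 2)))
  root := Sum.elim Sum.inl (fun x => Sum.inr (Sum.inl x))
  src_e := by
    rintro (((e | k) | e) | i)
    · rfl
    · exact congrArg (Sum.elim Sum.inl (Sum.elim Sum.inr (Sum.elim (fun k => Sum.inl (traceOut F k))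
        (fun k => Sum.inl (traceOut F k))))) (congrArg Sum.inr (tensor_c H (pseudoId X) (Sum.inr k)))
    · rfl
    · rfl
  tgt_e := by
    rintro (((e | k) | e) | i)
    · rfl
    · rfl
    · rfl
    · exact congrArg (Sum.elim Sum.inl (Sum.elim Sum.inr (Sum.elim (fun k => Sum.inl (traceOut F k))
        (fun k => Sum.inl (traceOut F k))))) (congrArg Sum.inr (tensor_d H (pseudoId X) (Sum.inl i)))
  τ_v := by
    rintro (x | x | k | k)
    · rfl
    · rfl
    · exact (F.c.τ_v _).trans (congrArg Sum.inl (get_splitFin_symm B X (Sum.inr k)))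
    · exact (F.c.τ_v _).trans (congrArg Sum.inl (get_splitFin_symm B X (Sum.inr k)))
  τ_e := by
    rintro (((e | k) | e) | i)
    · rfl
    · rfl
    · rfl
    · exact congrArg TypeEdge.mid (get_splitFin_symm B X (Sum.inl i))
  v_eq := by
    rintro (((e | e | k) | i) | k) h
    · exact absurd ⟨Sum.inl (Sum.inl (Sum.inl e)), rfl⟩ h
    · exact absurd ⟨Sum.inl (Sum.inr e), rfl⟩ h
    · rfl
    · induction i using splitFin_cases B X with
      | h i => exact absurd ⟨Sum.inr i, rfl⟩ h
      | h' k =>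
        refine Eq.trans ?_ (congrArg (Sum.elim Sum.inl (Sum.elim Sum.inr (Sum.elim (fun k => Sum.inl (traceOut F k))
          (fun k => Sum.inl (traceOut F k))))) (congrArg Sum.inr (tensor_d H (pseudoId X) (Sum.inr k)))).symm
        rfl
    · exact absurd ⟨Sum.inl (Sum.inl (Sum.inr k)), rfl⟩ h
  rk_lt := by
    rintro (((e | e | k) | i) | k) h
    · exact absurd ⟨Sum.inl (Sum.inl (Sum.inl e)), rfl⟩ h
    · exact absurd ⟨Sum.inl (Sum.inr e), rfl⟩ h
    · exact Nat.one_lt_two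
    · induction i using splitFin_cases B X with
      | h i => exact absurd ⟨Sum.inr i, rfl⟩ h
      | h' k =>
        refine Nat.zero_lt_one.trans_eq ?_
        exact congrArg (Sum.elim (fun _ => 0) (Sum.elim (fun _ => 0) (Sum.elim (fun _ => 1) (fun _ => 2))))
          (congrArg Sum.inr (tensor_d H (pseudoId X) (Sum.inr k))).symm
    · exact absurd ⟨Sum.inl (Sum.inl (Sum.inr k)), rfl⟩ h
  v_root := by rintro (x | x) <;> rfl
  root_or := by
    rintro (x | x | k | k)
    · exact Or.inl rfl
    · exact Or.inl rfl
    · refine Or.inr ⟨Sum.inl (Sum.inr ((splitFin B X).symm (Sum.inr k))), ?_,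
        congrArg Sum.inr (tensor_d H (pseudoId X) (Sum.inr k))⟩
      rintro ⟨((e | e) | e) | e, h⟩
      · cases h
      · cases h
      · cases h
      · have := (splitFin B X).symm.injective (Sum.inr_injective (Sum.inl_injective h))
        cases this
    · refine Or.inr ⟨Sum.inl (Sum.inl (Sum.inr (Sum.inr k))), ?_, rfl⟩
      rintro ⟨((e | e) | e) | e, h⟩ <;> cases h
  d_v _ := rfl
  c_v i := congrArg (Sum.elim Sum.inl (Sum.elim Sum.inr (Sum.elim (fun k => Sum.inl (traceOut F k))
        (fun k => Sum.inl (traceOut F k))))) (congrArg Sum.inr (tensor_c H (pseudoId X) (Sum.inl i)))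

theorem cls_trace_unit (F : FramedCospan (wordGraph (A ++ [])) (wordGraph (B ++ []))) :
    cls F.trace = cls (F.castWords (List.append_nil A) (List.append_nil B)) := by
  have : IsEmpty (Fin ([] : List T.Obj).length) := Fin.isEmpty
  symm
  refine cls_iso
    { v := Equiv.refl _
      e := (Equiv.sumEmpty _ _).symm
      src_e := fun _ => rfl, tgt_e := fun _ => rfl, τ_v := fun _ => rfl, τ_e := fun _ => rfl
      d_v := fun i => ?_, c_v := fun i => ?_ }
  · exact congrArg (fun i => F.d.v i) (finCongr_append_nil A (congrArg List.length (List.append_nil A).symm) i).symm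
  · exact congrArg (fun i => F.c.v i) (finCongr_append_nil B (congrArg List.length (List.append_nil B).symm) i).symm

theorem cls_trace_append (F : FramedCospan (wordGraph (A ++ (X ++ Y))) (wordGraph (B ++ (X ++ Y)))) :
    cls F.trace = cls (F.castWords (List.append_assoc A X Y).symm (List.append_assoc B X Y).symm).trace.trace := by
  symm
  refine cls_iso
    { v := Equiv.refl _
      -- The inner trace adds the wires of `Y` before the outer one adds those of `X`, so the two
      -- blocks have to be exchanged.
      e := (Equiv.sumAssoc _ _ _).trans (Equiv.sumCongr (Equiv.refl _)
        ((Equiv.sumComm _ _).trans (splitFin X Y).symm))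
      src_e := ?_, tgt_e := ?_, τ_v := fun _ => rfl, τ_e := ?_
      d_v := fun i => ?_, c_v := fun i => ?_ }
  · rintro ((e | k) | k)
    · rfl
    · exact congrArg (fun i => F.c.v i) (finCongr_assoc_inr' B X Y _ k).symm
    · exact congrArg (fun i => F.c.v i) (finCongr_assoc_mid' B X Y _ k).symm
  · rintro ((e | k) | k)
    · rfl
    · exact congrArg (fun i => F.d.v i) (finCongr_assoc_inr' A X Y _ k).symm
    · exact congrArg (fun i => F.d.v i) (finCongr_assoc_mid' A X Y _ k).symm
  · rintro ((e | k) | k)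
    · rfl
    · exact congrArg TypeEdge.mid (get_splitFin_symm X Y (Sum.inr k))
    · exact congrArg TypeEdge.mid (get_splitFin_symm X Y (Sum.inl k))
  · exact congrArg (fun i => F.d.v i) (finCongr_assoc_inl' A X Y _ i).symm
  · exact congrArg (fun i => F.c.v i) (finCongr_assoc_inl' B X Y _ i).symm

theorem tensor_d_assoc_inr (G : FramedCospan (wordGraph A') (wordGraph B'))
    (F : FramedCospan (wordGraph (A ++ X)) (wordGraph (B ++ X))) (h) (k : Fin X.length) :
    (G.tensor F).d.v (finCongr h ((splitFin (A' ++ A) X).symm (Sum.inr k))) =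
      Sum.inr (F.d.v ((splitFin A X).symm (Sum.inr k))) :=
  (congrArg (fun i => (G.tensor F).d.v i) (finCongr_assoc_inr' A' A X h k)).trans
    (tensor_d G F (Sum.inr _))

theorem tensor_c_assoc_inr (G : FramedCospan (wordGraph A') (wordGraph B'))
    (F : FramedCospan (wordGraph (A ++ X)) (wordGraph (B ++ X))) (h) (k : Fin X.length) :
    (G.tensor F).c.v (finCongr h ((splitFin (B' ++ B) X).symm (Sum.inr k))) =
      Sum.inr (F.c.v ((splitFin B X).symm (Sum.inr k))) :=
  (congrArg (fun i => (G.tensor F).c.v i) (finCongr_assoc_inr' B' B X h k)).trans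
    (tensor_c G F (Sum.inr _))

theorem cls_superposing (G : FramedCospan (wordGraph A') (wordGraph B'))
    (F : FramedCospan (wordGraph (A ++ X)) (wordGraph (B ++ X))) :
    cls ((G.tensor F).castWords (List.append_assoc A' A X).symm (List.append_assoc B' B X).symm).trace =
      cls (G.tensor F.trace) := by
  refine cls_iso
    { v := Equiv.refl _
      e := Equiv.sumAssoc _ _ _
      src_e := ?_, tgt_e := ?_, τ_v := fun _ => rfl, τ_e := ?_
      d_v := fun i => ?_, c_v := fun i => ?_ }
  · rintro ((e | e) | k)
    · rfl
    · rfl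
    · exact (tensor_c_assoc_inr G F _ k).symm
  · rintro ((e | e) | k)
    · rfl
    · rfl
    · exact (tensor_d_assoc_inr G F _ k).symm
  · rintro ((e | e) | k) <;> rfl
  · induction i using splitFin_cases A' A with
    | h i =>
      refine (tensor_d G F.trace (Sum.inl i)).trans (Eq.symm ?_)
      exact (congrArg (fun i => (G.tensor F).d.v i) (finCongr_assoc_inl' A' A X _ i)).trans
        (tensor_d G F (Sum.inl i))
    | h' i =>
      refine (tensor_d G F.trace (Sum.inr i)).trans (Eq.symm ?_)
      exact (congrArg (fun i => (G.tensor F).d.v i) (finCongr_assoc_mid' A' A X _ i)).trans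
        (tensor_d G F (Sum.inr _))
  · induction i using splitFin_cases B' B with
    | h i =>
      refine (tensor_c G F.trace (Sum.inl i)).trans (Eq.symm ?_)
      exact (congrArg (fun i => (G.tensor F).c.v i) (finCongr_assoc_inl' B' B X _ i)).trans
        (tensor_c G F (Sum.inl i))
    | h' i =>
      refine (tensor_c G F.trace (Sum.inr i)).trans (Eq.symm ?_)
      exact (congrArg (fun i => (G.tensor F).c.v i) (finCongr_assoc_mid' B' B X _ i)).trans
        (tensor_c G F (Sum.inr _))

/-- The trace of a symmetry collapses onto the identity. -/
noncomputable def collapseYanking (X : List T.Obj) : Collapse (swap X X).trace (pseudoId X) where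
  -- Each strand runs from the first input to the second output, back to the second input, and on to
  -- the first output. Its two crossing wires are contracted, and the feedback wire between them
  -- becomes the identity wire.
  v := Sum.elim (splitFin X X) (fun i => Sum.swap (splitFin X X i))
  e k := Sum.inr k
  e_inj := Sum.inr_injective
  rk := Sum.elim (fun _ => 0) (fun _ => 1)
  root s := Sum.inl ((splitFin X X).symm s)
  src_e k := congrArg Sum.swap ((splitFin X X).apply_symm_apply (Sum.inr k))
  tgt_e k := (splitFin X X).apply_symm_apply (Sum.inr k)
  τ_v := by
    rintro (i | i)
    · refine Eq.trans ?_ (congrArg Sum.inl (get_splitFin X X i)).symm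
      dsimp only [Sum.elim_inl]
      rcases splitFin X X i with k | k <;> rfl
    · refine Eq.trans ?_ (congrArg Sum.inl (get_splitFin X X i)).symm
      dsimp only [Sum.elim_inr]
      rcases splitFin X X i with k | k <;> rfl
  τ_e _ := rfl
  v_eq := by
    rintro (i | k) h
    · exact (Sum.swap_swap _).symm.trans
        (congrArg Sum.swap ((splitFin X X).apply_symm_apply (Sum.swap (splitFin X X i))).symm)
    · exact absurd ⟨k, rfl⟩ h
  rk_lt := by
    rintro (i | k) h
    · exact Nat.zero_lt_one
    · exact absurd ⟨k, rfl⟩ h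
  v_root s := (splitFin X X).apply_symm_apply s
  root_or := by
    rintro (i | i)
    · exact Or.inl (congrArg Sum.inl ((splitFin X X).symm_apply_apply i).symm)
    · refine Or.inr ⟨Sum.inl ((swapFin X X).symm i), fun ⟨_, h⟩ => (by cases h), ?_⟩
      exact congrArg Sum.inr ((swapFin X X).apply_symm_apply i)
  d_v i := (splitFin X X).apply_symm_apply (Sum.inl i)
  c_v i := congrArg Sum.swap ((splitFin X X).apply_symm_apply (Sum.inl i))

end FramedCospan

/-! ### The sliding law of the trace -/

namespace FramedCospan

variable {T : MonoidalSignature.{u, v}} {A B D X Y A' B' D' A'' B'' : List T.Obj}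

section sliding

/-- The rearrangement of the positions of `(B ++ Y) ++ X` as those of `B ++ (X ++ Y)`. -/
abbrev slideFin (B X Y : List T.Obj) : Fin (B ++ (X ++ Y)).length ≃ Fin ((B ++ Y) ++ X).length :=
  (splitFin B (X ++ Y)).trans <| (Equiv.sumCongr (Equiv.refl _) ((splitFin X Y).trans (Equiv.sumComm _ _))).trans <|
    (Equiv.sumAssoc _ _ _).symm.trans <| (Equiv.sumCongr (splitFin B Y).symm (Equiv.refl _)).trans
      (splitFin (B ++ Y) X).symm

theorem slideFin_b (B X Y : List T.Obj) (b) : slideFin B X Y ((splitFin B (X ++ Y)).symm (Sum.inl b)) =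
    (splitFin (B ++ Y) X).symm (Sum.inl ((splitFin B Y).symm (Sum.inl b))) := by simp

theorem slideFin_x (B X Y : List T.Obj) (x) :
    slideFin B X Y ((splitFin B (X ++ Y)).symm (Sum.inr ((splitFin X Y).symm (Sum.inl x)))) =
    (splitFin (B ++ Y) X).symm (Sum.inr x) := by simp

theorem slideFin_y (B X Y : List T.Obj) (y) :
    slideFin B X Y ((splitFin B (X ++ Y)).symm (Sum.inr ((splitFin X Y).symm (Sum.inr y)))) =
    (splitFin (B ++ Y) X).symm (Sum.inl ((splitFin B Y).symm (Sum.inr y))) := by simp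

theorem get_slideFin (B X Y : List T.Obj) (i) : ((B ++ Y) ++ X).get (slideFin B X Y i) = (B ++ (X ++ Y)).get i := by
  induction i using splitFin_cases B (X ++ Y) with
  | h i =>
    rw [slideFin_b, get_splitFin_symm, Sum.elim_inl, get_splitFin_symm, get_splitFin_symm]
    rfl
  | h' i =>
    induction i using splitFin_cases X Y with
    | h i => rw [slideFin_x, get_splitFin_symm, get_splitFin_symm, Sum.elim_inr, Sum.elim_inr, get_splitFin_symm]; rfl
    | h' i =>
      rw [slideFin_y, get_splitFin_symm, get_splitFin_symm, Sum.elim_inl, Sum.elim_inr, get_splitFin_symm,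
        get_splitFin_symm]
      rfl

variable (F : FramedCospan (wordGraph (A ++ X)) (wordGraph (B ++ Y)))
  (G : FramedCospan (wordGraph Y) (wordGraph X))

/-- Two framed cospans traced around each other. -/
abbrev slide : FramedCospan (wordGraph A) (wordGraph B) :=
  ((F.tensor G).relabel (finCongr (congrArg List.length (List.append_assoc A X Y).symm))
    (get_finCongr (List.append_assoc A X Y).symm) (slideFin B X Y) (get_slideFin B X Y)).trace

theorem slide_traceIn_x (x : Fin X.length) :
    (slide F G).tgt (Sum.inr ((splitFin X Y).symm (Sum.inl x))) =
      Sum.inl (F.d.v ((splitFin A X).symm (Sum.inr x))) :=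
  (congrArg (fun i => (F.tensor G).d.v i) (finCongr_assoc_mid A X Y _ x)).trans (tensor_d F G (Sum.inl _))

theorem slide_traceIn_y (y : Fin Y.length) :
    (slide F G).tgt (Sum.inr ((splitFin X Y).symm (Sum.inr y))) = Sum.inr (G.d.v y) :=
  (congrArg (fun i => (F.tensor G).d.v i) (finCongr_assoc_inr A X Y _ y)).trans (tensor_d F G (Sum.inr _))

theorem slide_traceOut_x (x : Fin X.length) :
    (slide F G).src (Sum.inr ((splitFin X Y).symm (Sum.inl x))) = Sum.inr (G.c.v x) :=
  (congrArg (fun i => (F.tensor G).c.v i) (slideFin_x B X Y x)).trans (tensor_c F G (Sum.inr _))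

theorem slide_traceOut_y (y : Fin Y.length) :
    (slide F G).src (Sum.inr ((splitFin X Y).symm (Sum.inr y))) =
      Sum.inl (F.c.v ((splitFin B Y).symm (Sum.inr y))) :=
  (congrArg (fun i => (F.tensor G).c.v i) (slideFin_y B X Y y)).trans (tensor_c F G (Sum.inl _))

theorem slide_d (a : Fin A.length) : (slide F G).d.v a = Sum.inl (F.d.v ((splitFin A X).symm (Sum.inl a))) :=
  (congrArg (fun i => (F.tensor G).d.v i) (finCongr_assoc_inl A X Y _ a)).trans (tensor_d F G (Sum.inl _))

theorem slide_c (b : Fin B.length) : (slide F G).c.v b = Sum.inl (F.c.v ((splitFin B Y).symm (Sum.inl b))) :=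
  (congrArg (fun i => (F.tensor G).c.v i) (slideFin_b B X Y b)).trans (tensor_c F G (Sum.inl _))

/-- The vertex map of `collapseSlideLeft`. -/
abbrev slideLeft : ((Fin A.length ⊕ Fin A.length) ⊕ G.V) ⊕ F.V → F.V ⊕ G.V :=
  Sum.elim (Sum.elim (fun a => Sum.inl (F.d.v ((splitFin A X).symm (Sum.inl (Sum.elim (fun a => a) (fun a => a) a)))))
    Sum.inr) Sum.inl

/-- A morphism before the traced input. -/
noncomputable def collapseSlideLeft : Collapse (((pseudoId A).tensor G).link F).trace (slide F G) where
  v := slideLeft F G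
  -- Of the wires between `F` and `G`, those along `X` come from linking and those along `Y` from
  -- the trace. For a morphism after the traced output the two roles are exchanged.
  e := Sum.elim (Sum.elim (fun e => Sum.inl (Sum.inl (Sum.inr e))) (fun e => Sum.inl (Sum.inl (Sum.inl (Sum.inr e)))))
    (fun k => Sum.elim (fun x => Sum.inl (Sum.inr ((splitFin A X).symm (Sum.inr x)))) Sum.inr (splitFin X Y k))
  e_inj := by
    rintro ((e | e) | k) ((e' | e') | k') h
    · simpa using h
    · cases h
    · obtain ⟨s | s, rfl⟩ := (splitFin X Y).symm.surjective k' <;> simp at h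
    · cases h
    · simpa using h
    · obtain ⟨s | s, rfl⟩ := (splitFin X Y).symm.surjective k' <;> simp at h
    · obtain ⟨s | s, rfl⟩ := (splitFin X Y).symm.surjective k <;> simp at h
    · obtain ⟨s | s, rfl⟩ := (splitFin X Y).symm.surjective k <;> simp at h
    · obtain ⟨s | s, rfl⟩ := (splitFin X Y).symm.surjective k <;>
        obtain ⟨s' | s', rfl⟩ := (splitFin X Y).symm.surjective k' <;> simp at h <;> rw [h]
  rk := Sum.elim (Sum.elim (Sum.elim (fun _ => 0) (fun _ => 1)) (fun _ => 0)) (fun _ => 2)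
  root := Sum.elim (replaceIn F (fun i => Sum.elim
    (fun a => Sum.inl (Sum.inl (Sum.inl a))) (fun k => Sum.inr (F.d.v ((splitFin A X).symm (Sum.inr k))))
      (splitFin A X i)) Sum.inr) (fun x => Sum.inl (Sum.inr x))
  src_e := by
    rintro ((e | e) | k)
    · rfl
    · rfl
    · obtain ⟨s | s, rfl⟩ := (splitFin X Y).symm.surjective k <;> dsimp only [Sum.elim_inr] <;>
        rw [Equiv.apply_symm_apply]
      · exact (congrArg (fun x => slideLeft F G (Sum.inl x)) (tensor_c (pseudoId A) G (Sum.inr s))).trans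
          (slide_traceOut_x F G s).symm
      · exact (slide_traceOut_y F G s).symm
  tgt_e := by
    rintro ((e | e) | k)
    · rfl
    · rfl
    · obtain ⟨s | s, rfl⟩ := (splitFin X Y).symm.surjective k <;> dsimp only [Sum.elim_inr] <;>
        rw [Equiv.apply_symm_apply]
      · exact (slide_traceIn_x F G s).symm
      · exact (congrArg (fun x => slideLeft F G (Sum.inl x)) (tensor_d (pseudoId A) G (Sum.inr s))).trans
          (slide_traceIn_y F G s).symm
  τ_v := by
    rintro (((a | a) | x) | x)
    · exact (F.d.τ_v _).trans (congrArg Sum.inl (get_splitFin_symm A X (Sum.inl a)))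
    · exact (F.d.τ_v _).trans (congrArg Sum.inl (get_splitFin_symm A X (Sum.inl a)))
    · rfl
    · rfl
  τ_e := by
    rintro ((e | e) | k)
    · rfl
    · rfl
    · obtain ⟨s | s, rfl⟩ := (splitFin X Y).symm.surjective k <;> dsimp only [Sum.elim_inr] <;>
        rw [Equiv.apply_symm_apply]
      · exact (congrArg TypeEdge.mid (get_splitFin_symm A X (Sum.inr s))).trans
          (congrArg TypeEdge.mid (get_splitFin_symm X Y (Sum.inl s))).symm
      · exact (congrArg TypeEdge.mid (get_splitFin_symm X Y (Sum.inr s))).symm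
  v_eq := by
    rintro ((((a | e) | e) | i) | k) h
    · rfl
    · exact absurd ⟨Sum.inl (Sum.inr e), rfl⟩ h
    · exact absurd ⟨Sum.inl (Sum.inl e), rfl⟩ h
    · induction i using splitFin_cases A X with
      | h a =>
        refine (congrArg (fun x => slideLeft F G (Sum.inl x)) (tensor_c (pseudoId A) G (Sum.inl a))).trans ?_
        rfl
      | h' x =>
        refine absurd ⟨Sum.inr ((splitFin X Y).symm (Sum.inl x)), ?_⟩ h
        dsimp only [Sum.elim_inr]
        rw [Equiv.apply_symm_apply]
        rfl
    · refine absurd ⟨Sum.inr ((splitFin X Y).symm (Sum.inr k)), ?_⟩ h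
      dsimp only [Sum.elim_inr]
      rw [Equiv.apply_symm_apply]
      rfl
  rk_lt := by
    rintro ((((a | e) | e) | i) | k) h
    · exact Nat.zero_lt_one
    · exact absurd ⟨Sum.inl (Sum.inr e), rfl⟩ h
    · exact absurd ⟨Sum.inl (Sum.inl e), rfl⟩ h
    · dsimp only [Sum.elim_inl, Sum.elim_inr]
      rcases Sum.map (pseudoId A).c.v G.c.v (splitFin A X i) with (x | x) | x
      exacts [Nat.zero_lt_two, Nat.one_lt_two, Nat.zero_lt_two]
    · refine absurd ⟨Sum.inr ((splitFin X Y).symm (Sum.inr k)), ?_⟩ h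
      dsimp only [Sum.elim_inr]
      rw [Equiv.apply_symm_apply]
      rfl
  v_root := by
    rintro (x | x)
    · dsimp only [Sum.elim_inl]
      rcases replaceIn_cases F x with ⟨i, rfl⟩ | h
      · rw [replaceIn_d]
        obtain ⟨s | s, rfl⟩ := (splitFin A X).symm.surjective i <;> rw [Equiv.apply_symm_apply] <;> rfl
      · rw [replaceIn_of_ne _ _ _ h]
        rfl
    · rfl
  root_or := by
    have hsplit : ∀ (k : Fin X.length ⊕ Fin Y.length) (s : (((Fin A.length ⊕ G.E) ⊕ F.E) ⊕ Fin (A ++ X).length)),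
        Sum.elim (fun x => Sum.inl (Sum.inr ((splitFin A X).symm (Sum.inr x)))) Sum.inr k =
        (Sum.inl s : (((Fin A.length ⊕ G.E) ⊕ F.E) ⊕ Fin (A ++ X).length) ⊕ Fin Y.length) →
        ∃ x, s = Sum.inr ((splitFin A X).symm (Sum.inr x)) := by
      rintro (k | k) s h
      · exact ⟨k, (Sum.inl_injective h).symm⟩
      · cases h
    rintro (((a | a) | x) | x)
    · refine Or.inl ?_
      dsimp only [Sum.elim_inl]
      rw [replaceIn_d, Equiv.apply_symm_apply]
      rfl
    · refine Or.inr ⟨Sum.inl (Sum.inl (Sum.inl (Sum.inl a))), ?_, rfl⟩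
      rintro ⟨(e | e) | e, h⟩
      · cases h
      · cases h
      · obtain ⟨x, hx⟩ := hsplit _ _ h
        cases hx
    · exact Or.inl rfl
    · rcases replaceIn_cases F x with ⟨i, rfl⟩ | h
      · induction i using splitFin_cases A X with
        | h a =>
          refine Or.inr ⟨Sum.inl (Sum.inr ((splitFin A X).symm (Sum.inl a))), ?_, rfl⟩
          rintro ⟨(e | e) | e, h⟩
          · cases h
          · cases h
          · obtain ⟨x, hx⟩ := hsplit _ _ h
            have := (splitFin A X).symm.injective (Sum.inr_injective hx)
            cases this
        | h' k =>
          refine Or.inl ?_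
          dsimp only [Sum.elim_inl, Sum.elim_inr]
          rw [replaceIn_d, Equiv.apply_symm_apply]
          rfl
      · refine Or.inl ?_
        dsimp only [Sum.elim_inl, Sum.elim_inr]
        rw [replaceIn_of_ne _ _ _ h]
  d_v a := (congrArg (fun x => slideLeft F G (Sum.inl x)) (tensor_d (pseudoId A) G (Sum.inl a))).trans
    (slide_d F G a).symm
  c_v b := (slide_c F G b).symm

/-- The vertex map of `collapseSlideRight`. -/
abbrev slideRight : F.V ⊕ ((Fin B.length ⊕ Fin B.length) ⊕ G.V) → F.V ⊕ G.V :=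
  Sum.elim Sum.inl (Sum.elim
    (fun b => Sum.inl (F.c.v ((splitFin B Y).symm (Sum.inl (Sum.elim (fun b => b) (fun b => b) b))))) Sum.inr)

/-- A morphism after the traced output. -/
noncomputable def collapseSlideRight : Collapse (F.link ((pseudoId B).tensor G)).trace (slide F G) where
  v := slideRight F G
  e := Sum.elim (Sum.elim (fun e => Sum.inl (Sum.inl (Sum.inl e))) (fun e => Sum.inl (Sum.inl (Sum.inr (Sum.inr e)))))
    (fun k => Sum.elim Sum.inr (fun y => Sum.inl (Sum.inr ((splitFin B Y).symm (Sum.inr y)))) (splitFin X Y k))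
  e_inj := by
    rintro ((e | e) | k) ((e' | e') | k') h
    · simpa using h
    · cases h
    · obtain ⟨s | s, rfl⟩ := (splitFin X Y).symm.surjective k' <;> simp at h
    · cases h
    · simpa using h
    · obtain ⟨s | s, rfl⟩ := (splitFin X Y).symm.surjective k' <;> simp at h
    · obtain ⟨s | s, rfl⟩ := (splitFin X Y).symm.surjective k <;> simp at h
    · obtain ⟨s | s, rfl⟩ := (splitFin X Y).symm.surjective k <;> simp at h
    · obtain ⟨s | s, rfl⟩ := (splitFin X Y).symm.surjective k <;>
        obtain ⟨s' | s', rfl⟩ := (splitFin X Y).symm.surjective k' <;> simp at h <;> rw [h]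
  rk := Sum.elim (fun _ => 0) (Sum.elim (Sum.elim (fun _ => 1) (fun _ => 2)) (fun _ => 0))
  root := Sum.elim Sum.inl (fun x => Sum.inr (Sum.inr x))
  src_e := by
    rintro ((e | e) | k)
    · rfl
    · rfl
    · obtain ⟨s | s, rfl⟩ := (splitFin X Y).symm.surjective k <;> dsimp only [Sum.elim_inr] <;>
        rw [Equiv.apply_symm_apply]
      · exact (congrArg (fun x => slideRight F G (Sum.inr x)) (tensor_c (pseudoId B) G (Sum.inr s))).trans
          (slide_traceOut_x F G s).symm
      · exact (slide_traceOut_y F G s).symm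
  tgt_e := by
    rintro ((e | e) | k)
    · rfl
    · rfl
    · obtain ⟨s | s, rfl⟩ := (splitFin X Y).symm.surjective k <;> dsimp only [Sum.elim_inr] <;>
        rw [Equiv.apply_symm_apply]
      · exact (slide_traceIn_x F G s).symm
      · exact (congrArg (fun x => slideRight F G (Sum.inr x)) (tensor_d (pseudoId B) G (Sum.inr s))).trans
          (slide_traceIn_y F G s).symm
  τ_v := by
    rintro (x | (b | b) | x)
    · rfl
    · exact (F.c.τ_v _).trans (congrArg Sum.inl (get_splitFin_symm B Y (Sum.inl b)))
    · exact (F.c.τ_v _).trans (congrArg Sum.inl (get_splitFin_symm B Y (Sum.inl b)))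
    · rfl
  τ_e := by
    rintro ((e | e) | k)
    · rfl
    · rfl
    · obtain ⟨s | s, rfl⟩ := (splitFin X Y).symm.surjective k <;> dsimp only [Sum.elim_inr] <;>
        rw [Equiv.apply_symm_apply]
      · exact (congrArg TypeEdge.mid (get_splitFin_symm X Y (Sum.inl s))).symm
      · exact (congrArg TypeEdge.mid (get_splitFin_symm B Y (Sum.inr s))).trans
          (congrArg TypeEdge.mid (get_splitFin_symm X Y (Sum.inr s))).symm
  v_eq := by
    rintro (((e | b | e) | i) | k) h
    · exact absurd ⟨Sum.inl (Sum.inl e), rfl⟩ h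
    · rfl
    · exact absurd ⟨Sum.inl (Sum.inr e), rfl⟩ h
    · induction i using splitFin_cases B Y with
      | h b =>
        refine Eq.trans ?_ (congrArg (fun x => slideRight F G (Sum.inr x)) (tensor_d (pseudoId B) G (Sum.inl b))).symm
        rfl
      | h' y =>
        refine absurd ⟨Sum.inr ((splitFin X Y).symm (Sum.inr y)), ?_⟩ h
        dsimp only [Sum.elim_inr]
        rw [Equiv.apply_symm_apply]
        rfl
    · refine absurd ⟨Sum.inr ((splitFin X Y).symm (Sum.inl k)), ?_⟩ h
      dsimp only [Sum.elim_inr]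
      rw [Equiv.apply_symm_apply]
      rfl
  rk_lt := by
    rintro (((e | b | e) | i) | k) h
    · exact absurd ⟨Sum.inl (Sum.inl e), rfl⟩ h
    · exact Nat.one_lt_two
    · exact absurd ⟨Sum.inl (Sum.inr e), rfl⟩ h
    · induction i using splitFin_cases B Y with
      | h b =>
        refine Nat.zero_lt_one.trans_eq ?_
        exact congrArg (Sum.elim (fun _ => 0) (Sum.elim (Sum.elim (fun _ => 1) (fun _ => 2)) (fun _ => 0)))
          (congrArg Sum.inr (tensor_d (pseudoId B) G (Sum.inl b))).symm
      | h' y =>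
        refine absurd ⟨Sum.inr ((splitFin X Y).symm (Sum.inr y)), ?_⟩ h
        dsimp only [Sum.elim_inr]
        rw [Equiv.apply_symm_apply]
        rfl
    · refine absurd ⟨Sum.inr ((splitFin X Y).symm (Sum.inl k)), ?_⟩ h
      dsimp only [Sum.elim_inr]
      rw [Equiv.apply_symm_apply]
      rfl
  v_root := by rintro (x | x) <;> rfl
  root_or := by
    have hsplit : ∀ (k : Fin X.length ⊕ Fin Y.length) (s : (((F.E ⊕ (Fin B.length ⊕ G.E))) ⊕ Fin (B ++ Y).length)),
        Sum.elim Sum.inr (fun y => Sum.inl (Sum.inr ((splitFin B Y).symm (Sum.inr y)))) k =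
        (Sum.inl s : ((F.E ⊕ (Fin B.length ⊕ G.E)) ⊕ Fin (B ++ Y).length) ⊕ Fin X.length) →
        ∃ x, s = Sum.inr ((splitFin B Y).symm (Sum.inr x)) := by
      rintro (k | k) s h
      · cases h
      · exact ⟨k, (Sum.inl_injective h).symm⟩
    rintro (x | (b | b) | x)
    · exact Or.inl rfl
    · refine Or.inr ⟨Sum.inl (Sum.inr ((splitFin B Y).symm (Sum.inl b))), ?_,
        congrArg Sum.inr (tensor_d (pseudoId B) G (Sum.inl b))⟩
      rintro ⟨(e | e) | e, h⟩
      · cases h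
      · cases h
      · obtain ⟨x, hx⟩ := hsplit _ _ h
        have := (splitFin B Y).symm.injective (Sum.inr_injective hx)
        cases this
    · refine Or.inr ⟨Sum.inl (Sum.inl (Sum.inr (Sum.inl b))), ?_, rfl⟩
      rintro ⟨(e | e) | e, h⟩
      · cases h
      · cases h
      · obtain ⟨x, hx⟩ := hsplit _ _ h
        cases hx
    · exact Or.inl rfl
  d_v a := (slide_d F G a).symm
  c_v b := (congrArg (fun x => slideRight F G (Sum.inr x)) (tensor_c (pseudoId B) G (Sum.inl b))).trans
    (slide_c F G b).symm

/-- Both sides are `F` and `G` joined in a circle by wires along `X` and along `Y`, together with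
superfluous identity wires. Collapsing the latter leaves the same graph `slide F G` twice. -/
theorem cls_trace_sliding :
    cls (((pseudoId A).tensor G).link F).trace = cls (F.link ((pseudoId B).tensor G)).trace :=
  (collapseSlideLeft F G).mk_eq.trans (collapseSlideRight F G).mk_eq.symm

end sliding

end FramedCospan

/-! ### The hexagon law, and verification of the axioms -/

namespace FramedCospan

variable {T : MonoidalSignature.{u, v}} {A B D X Y A' B' D' A'' B'' : List T.Obj}

theorem cls_castWords_congr (hA : A = A') (hB : B = B') {G G' : FramedCospan (wordGraph A) (wordGraph B)}
    (h : cls G = cls G') : cls (G.castWords hA hB) = cls (G'.castWords hA hB) :=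
  (cast_mk (T := T) hA hB G).symm.trans ((congrArg (fun f : CospanClass (wordGraph A) (wordGraph B) =>
    Quiver.Hom.cast (U := FCspPlus T) hA hB f) h).trans (cast_mk (T := T) hA hB G'))

theorem get_sumCongr {π : Fin A.length ≃ Fin B.length} (hπ : ∀ i, B.get (π i) = A.get i)
    {σ : Fin A'.length ≃ Fin B'.length} (hσ : ∀ i, B'.get (σ i) = A'.get i) (i) :
    (B ++ B').get (((splitFin A A').trans ((Equiv.sumCongr π σ).trans (splitFin B B').symm)) i) =
      (A ++ A').get i := by
  rw [get_splitFin A A' i]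
  refine (get_splitFin_symm B B' _).trans ?_
  rcases splitFin A A' i with j | j
  exacts [hπ j, hσ j]

theorem get_castWords {π : Fin A.length ≃ Fin B.length} (hπ : ∀ i, B.get (π i) = A.get i)
    (hA : A = A') (hB : B = B') (i) :
    B'.get (((finCongr (congrArg List.length hA)).symm.trans
      (π.trans (finCongr (congrArg List.length hB)))) i) = A'.get i := by
  subst hA hB
  exact hπ i

/-- Both sides reduce to bundles of bare wires, so it is enough to compare two permutations on the
three blocks of positions. -/
theorem cls_hexagon (A B D : List T.Obj) :
    cls ((swap A (B ++ D)).castWords rfl (List.append_assoc B D A)) =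
      cls ((((swap A B).tensor (pseudoId D)).castWords (List.append_assoc A B D) (List.append_assoc B A D)).link
        ((pseudoId B).tensor (swap A D))) := by
  rw [cls_castWords_wires _ _ _ _ (get_castWords (get_swapFin A (B ++ D)) rfl (List.append_assoc B D A))]
  refine Eq.trans ?_ (cls_link_congr (cls_castWords_congr _ _ (cls_wires_tensor_wires _ _ _ _
    (get_sumCongr (get_swapFin A B) (fun _ => rfl))))
    (cls_wires_tensor_wires _ _ _ _ (get_sumCongr (fun _ => rfl) (get_swapFin A D)))).symm
  refine Eq.trans ?_ (cls_link_congr (cls_castWords_wires _ _ _ _ (get_castWords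
    (get_sumCongr (get_swapFin A B) (fun _ => rfl)) (List.append_assoc A B D) (List.append_assoc B A D))) rfl).symm
  rw [cls_wires_link_wires]
  refine cls_wires_congr (Equiv.ext fun i => ?_) _ _
  induction i using splitFin_cases A (B ++ D) with
  | h i =>
    simp only [Equiv.trans_apply, finCongr_symm, finCongr_assoc_inl, finCongr_assoc_mid', finCongr_assoc_inr',
      Equiv.apply_symm_apply, Equiv.refl_symm, finCongr_refl, Equiv.refl_apply, Equiv.sumCongr_apply, Sum.map_inl,
      Sum.map_inr, Equiv.sumComm_apply, Sum.swap_inl]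
  | h' i =>
    induction i using splitFin_cases B D <;>
    simp only [Equiv.trans_apply, finCongr_symm, finCongr_assoc_mid, finCongr_assoc_inr, finCongr_assoc_inl',
      finCongr_assoc_mid', finCongr_assoc_inr', Equiv.apply_symm_apply, Equiv.refl_symm, finCongr_refl,
      Equiv.refl_apply, Equiv.sumCongr_apply, Sum.map_inl, Sum.map_inr, Equiv.sumComm_apply, Sum.swap_inr]

end FramedCospan

-- Each law is translated by `cls_comp` from plugging to linking and by `cast_mk` from casts to
-- renumberings; it is then one of the isomorphisms or collapses above.
open FramedCospan in
instance FCspPlus.isStrictSymmetricTraced (T : MonoidalSignature.{u, v}) :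
    IsStrictSymmetricTraced (FCspPlus T) where
  id_comp := by
    rintro A B ⟨G⟩
    exact (cls_comp _ _).trans ((cls_wires_link _ _ _).trans (cls_relabel_refl G))
  comp_id := by
    rintro A B ⟨G⟩
    exact (cls_comp _ _).trans ((cls_link_wires G (Equiv.refl _) (fun _ => rfl) (fun _ => rfl)).trans
      (cls_relabel_refl G))
  assoc := by
    rintro A B D E ⟨F⟩ ⟨G⟩ ⟨H⟩
    refine (cls_comp (F.comp G) H).trans ((cls_link_congr (cls_comp F G) rfl).trans ((cls_link_assoc F G H).trans ?_))
    exact (cls_link_congr rfl (cls_comp G H).symm).trans (cls_comp F (G.comp H)).symm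
  tensor_assoc := List.append_assoc
  unit_tensor := List.nil_append
  tensor_unit := List.append_nil
  id_tensorHom_id A B := by
    refine (cls_wires_tensor_wires _ _ _ _ (get_sumCongr (fun _ => rfl) (fun _ => rfl))).trans ?_
    refine cls_wires_congr (Equiv.ext fun i => ?_) _ _
    exact Eq.trans (by simp) (Equiv.refl_apply i).symm
  comp_tensorHom_comp := by
    rintro A B D A' B' D' ⟨F⟩ ⟨G⟩ ⟨F'⟩ ⟨G'⟩
    refine (cls_tensor_congr (cls_comp F G) (cls_comp F' G')).trans ((cls_tensor_link_tensor F G F' G').trans ?_)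
    exact (cls_comp (F.tensor F') (G.tensor G')).symm
  tensorHom_assoc := by
    rintro A B A' B' A'' B'' ⟨F⟩ ⟨G⟩ ⟨H⟩
    exact (cast_mk (T := T) _ _ ((F.tensor G).tensor H)).trans (cls_tensor_assoc F G H)
  unit_tensorHom := by
    rintro A B ⟨G⟩
    exact (cast_mk (T := T) _ _ ((pseudoId []).tensor G)).trans (cls_unit_tensor G)
  tensorHom_unit := by
    rintro A B ⟨G⟩
    exact (cast_mk (T := T) _ _ (G.tensor (pseudoId []))).trans (cls_tensor_unit G)
  braid_naturality := by
    rintro A B A' B' ⟨F⟩ ⟨G⟩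
    exact (cls_comp (F.tensor G) (swap B B')).trans ((cls_tensor_link_swap F G).trans
      (cls_comp (swap A A') (G.tensor F)).symm)
  braid_braid A B := by
    refine (cls_comp (swap A B) (swap B A)).trans ((cls_wires_link_wires _ _ _ _).trans ?_)
    refine cls_wires_congr (Equiv.ext fun i => ?_) _ _
    exact Eq.trans (by simp) (Equiv.refl_apply i).symm
  hexagon A B D := by
    refine (cast_mk (T := T) _ _ (swap A (List.append B D))).trans ((cls_hexagon A B D).trans ?_)
    refine (cls_comp _ _).symm.trans ?_
    exact congrArg (fun f : ((A ⊙ (B ⊙ D) : FCspPlus T) ⟶ B ⊙ (A ⊙ D)) =>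
      f ≫ (𝟙 B ⊙ₘ TracedStruct.braid A D)) (cast_mk (T := T) (List.append_assoc A B D) (List.append_assoc B A D)
        ((swap A B).tensor (pseudoId D))).symm
  trace_naturality := by
    rintro A A' B B' X ⟨H⟩ ⟨F⟩ ⟨G⟩
    refine (cls_trace_congr ((cls_comp (H.tensor (pseudoId X)) (F.comp (G.tensor (pseudoId X)))).trans
      (cls_link_congr rfl (cls_comp F (G.tensor (pseudoId X)))))).trans ?_
    refine (collapseTraceLeft H (F.link (G.tensor (pseudoId X)))).mk_eq.trans ?_
    refine (cls_link_congr rfl (collapseTraceRight F G).mk_eq).trans ?_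
    exact (cls_link_congr rfl (cls_comp F.trace G).symm).trans (cls_comp H (F.trace.comp G)).symm
  trace_sliding := by
    rintro A B X Y ⟨F⟩ ⟨G⟩
    refine (cls_trace_congr (cls_comp ((pseudoId A).tensor G) F)).trans ((cls_trace_sliding F G).trans ?_)
    exact (cls_trace_congr (cls_comp F ((pseudoId B).tensor G))).symm
  trace_unit := by
    rintro A B ⟨F⟩
    exact (cls_trace_unit F).trans (cast_mk (T := T) _ _ F).symm
  trace_tensor := by
    rintro A B X Y ⟨F⟩
    refine (cls_trace_append F).trans ?_
    exact congrArg (fun f : ((A ⊙ X) ⊙ Y : FCspPlus T) ⟶ (B ⊙ X) ⊙ Y =>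
      TracedStruct.trace X (TracedStruct.trace Y f))
      (cast_mk (T := T) (List.append_assoc A X Y).symm (List.append_assoc B X Y).symm F).symm
  trace_superposing := by
    rintro A B A' B' X ⟨G⟩ ⟨F⟩
    refine Eq.trans ?_ (cls_superposing G F)
    exact congrArg (fun f : ((A' ⊙ A) ⊙ X : FCspPlus T) ⟶ (B' ⊙ B) ⊙ X =>
      TracedStruct.trace X f)
      (cast_mk (T := T) (List.append_assoc A' A X).symm (List.append_assoc B' B X).symm (G.tensor F))
  trace_yanking X := (collapseYanking X).mk_eq

/-! ## Calculus of contractions -/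

namespace Arr

variable {C : Type u} [TracedStruct.{u, v} C] [IsStrictSymmetricTraced C]

attribute [local instance] TracedStruct.objMonoid

variable {ι κ ε ι' κ' ε' : Type*} {obI : ι → C} {obJ : κ → C} {s : ε → ι} {t : ε → κ}
variable {I I₂ : List ι} {J J₂ : List κ} {f : Arr C} {I' : List ι} {J' : List κ} {es es₁ es₂ : List ε}

/-- A contraction uses names only to tell ports apart. This transports values along isomorphisms and
along inclusions into disjoint unions. -/
theorem ctr_map {obI' : ι' → C} {obJ' : κ' → C} {s' : ε' → ι'} {t' : ε' → κ'} {p : ι → ι'} {q : κ → κ'}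
    {r : ε → ε'} (hp : Function.Injective p) (hq : Function.Injective q) (hob : ∀ i, obI' (p i) = obI i)
    (hob' : ∀ i, obJ' (q i) = obJ i) (hs : ∀ e ∈ es, s' (r e) = p (s e)) (ht : ∀ e ∈ es, t' (r e) = q (t e)) :
    ctr obI' obJ' s' t' (I.map p) (J.map q) f (I'.map p) (J'.map q) (es.map r) =
      ctr obI obJ s t I J f I' J' es := by
  obtain rfl : obI' ∘ p = obI := funext hob
  obtain rfl : obJ' ∘ q = obJ := funext hob'
  have e1 : (es.map r).map s' = (es.map s).map p := by
    rw [List.map_map, List.map_map]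
    exact List.map_congr_left hs
  have e2 : (es.map r).map t' = (es.map t).map q := by
    rw [List.map_map, List.map_map]
    exact List.map_congr_left ht
  unfold ctr
  rw [e1, e2, ← List.map_append, ← List.map_append, perm_map p hp, perm_map q hq, wordObj_map, wordObj_map,
    wordObj_map obI' p]

namespace IsCtr

theorem boundary (h : IsCtr obI obJ s t I J f I' J' es) (hI : I₂.Perm I') (hJ : J'.Perm J₂) :
    IsCtr obI obJ s t I J f I₂ J₂ es :=
  { h with
    permI := (hI.append_right _).trans h.permI
    permJ := h.permJ.trans (hJ.append_right _) }

/-- Permuting the surviving names acts beside the traced word, so naturality of the trace moves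
these symmetries outside. -/
theorem ctr_boundary (h : IsCtr obI obJ s t I J f I' J' es) (hI : I₂.Perm I') (hJ : J'.Perm J₂) :
    ctr obI obJ s t I J f I₂ J₂ es = perm obI I₂ I' ⨟ ctr obI obJ s t I J f I' J' es ⨟ perm obJ J' J₂ := by
  have h1 : (I₂ ++ es.map s).Perm (I' ++ es.map s) := hI.append_right _
  have h2 : (J' ++ es.map t).Perm (J₂ ++ es.map t) := hJ.append_right _
  have h3 : (J₂ ++ es.map t).Nodup := (h.permJ.trans h2).nodup_iff.1 h.nodupJ
  unfold ctr
  rw [← tr_nat (dom_perm hI) (cod_perm hI) h.dom_inner h.cod_inner (dom_perm hJ) (cod_perm hJ)]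
  congr 1
  rw [← perm_comp_perm h1 h.permI h.nodupI, ← perm_comp_perm h.permJ h2 h3, ← perm_mul_perm hI (List.Perm.refl _),
    ← perm_mul_perm hJ (List.Perm.refl _), perm_self, perm_self, h.wordObj_eq]
  have e1 := h.permI
  have e2 := h.permJ
  rw [assoc (f := perm obI I₂ I' * _), assoc (f := perm obI I₂ I' * _), assoc (f := perm obI I₂ I' * _),
    assoc (f := perm obI (I' ++ _) I), assoc (f := perm obI (I' ++ _) I), assoc (f := perm obI (I' ++ _) I),
    assoc (f := f)]
  all_goals simp (maxDischargeDepth := 6) [h.dom, h.cod, e1, e2, hI, hJ, h.wordObj_eq]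

theorem append_nodup {I₁ I₂ I₁' I₂' K₁ K₂ : List ι} (h₁ : (I₁' ++ K₁).Perm I₁) (h₂ : (I₂' ++ K₂).Perm I₂) :
    (I₁' ++ I₂' ++ (K₁ ++ K₂)).Perm (I₁ ++ I₂) := by
  refine List.Perm.trans ?_ (h₁.append h₂)
  simp only [List.append_assoc]
  refine List.Perm.append_left _ ?_
  simp only [← List.append_assoc]
  exact List.Perm.append_right _ List.perm_append_comm

theorem mul {I₁ : List ι} {J₁ : List κ} {g : Arr C} {I₁' I₂' : List ι} {J₁' J₂' : List κ}
    (h₁ : IsCtr obI obJ s t I₁ J₁ f I₁' J₁' es₁) (h₂ : IsCtr obI obJ s t I₂ J₂ g I₂' J₂' es₂)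
    (hI : (I₁ ++ I₂).Nodup) (hJ : (J₁ ++ J₂).Nodup) :
    IsCtr obI obJ s t (I₁ ++ I₂) (J₁ ++ J₂) (f * g) (I₁' ++ I₂') (J₁' ++ J₂') (es₁ ++ es₂) where
  obj := h₁.obj
  nodupI := hI
  nodupJ := hJ
  permI := by
    rw [List.map_append]
    exact append_nodup h₁.permI h₂.permI
  permJ := by
    rw [List.map_append]
    exact (append_nodup h₁.permJ.symm h₂.permJ.symm).symm
  dom := by simp [h₁.dom, h₂.dom]
  cod := by simp [h₁.cod, h₂.cod]
  s_inj := h₁.s_inj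
  t_inj := h₁.t_inj

/-- The symmetry that collects two traced words in `tr_mul_tr` is again canonical, so coherence
applies to it. -/
theorem perm_interchange {K₁ K₂ I₁' I₂' : List ι} (h : (I₁' ++ I₂' ++ (K₁ ++ K₂)).Nodup) :
    id (wordObj obI I₁') * br (wordObj obI I₂') (wordObj obI K₁) * id (wordObj obI K₂) =
      perm obI (I₁' ++ I₂' ++ (K₁ ++ K₂)) ((I₁' ++ K₁) ++ (I₂' ++ K₂)) := by
  have h' : (I₁' ++ ((I₂' ++ K₁) ++ K₂)).Nodup := by simpa using h
  have h1 : (I₂' ++ K₁).Nodup := (List.nodup_append.1 (List.nodup_append.1 h').2.1).1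
  rw [← perm_self, ← perm_self, ← perm_swap h1, perm_mul_perm (List.Perm.refl _) List.perm_append_comm,
    perm_mul_perm (List.perm_append_comm.append_left _) (List.Perm.refl _)]
  simp only [List.append_assoc]

/-- The product of two traces is one trace by `tr_mul_tr`. The symmetries that occur on the two
sides relate the same words of distinct names and hence agree by coherence. -/
theorem ctr_mul_ctr {I₁ : List ι} {J₁ : List κ} {g : Arr C} {I₁' I₂' : List ι} {J₁' J₂' : List κ}
    (h₁ : IsCtr obI obJ s t I₁ J₁ f I₁' J₁' es₁) (h₂ : IsCtr obI obJ s t I₂ J₂ g I₂' J₂' es₂)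
    (hI : (I₁ ++ I₂).Nodup) (hJ : (J₁ ++ J₂).Nodup) :
    ctr obI obJ s t I₁ J₁ f I₁' J₁' es₁ * ctr obI obJ s t I₂ J₂ g I₂' J₂' es₂ =
      ctr obI obJ s t (I₁ ++ I₂) (J₁ ++ J₂) (f * g) (I₁' ++ I₂') (J₁' ++ J₂') (es₁ ++ es₂) := by
  have h := h₁.mul h₂ hI hJ
  unfold ctr
  rw [tr_mul_tr h₁.dom_inner h₁.cod_inner h₂.dom_inner h₂.cod_inner, wordObj_append, wordObj_append,
    List.map_append, wordObj_append, List.map_append]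
  congr 1
  have p1 : (I₁' ++ I₂' ++ (es₁.map s ++ es₂.map s)).Perm ((I₁' ++ es₁.map s) ++ (I₂' ++ es₂.map s)) :=
    append_nodup (List.Perm.refl _) (List.Perm.refl _)
  have p2 : ((I₁' ++ es₁.map s) ++ (I₂' ++ es₂.map s)).Perm (I₁ ++ I₂) := h₁.permI.append h₂.permI
  have q1 : ((J₁' ++ es₁.map t) ++ (J₂' ++ es₂.map t)).Perm (J₁' ++ J₂' ++ (es₁.map t ++ es₂.map t)) :=
    (append_nodup (List.Perm.refl _) (List.Perm.refl _)).symm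
  have q2 : (J₁ ++ J₂).Perm ((J₁' ++ es₁.map t) ++ (J₂' ++ es₂.map t)) := h₁.permJ.append h₂.permJ
  have hI' : (I₁' ++ I₂' ++ (es₁.map s ++ es₂.map s)).Nodup := (p1.trans p2).nodup_iff.2 hI
  have hJ' : (J₁' ++ J₂' ++ (es₁.map t ++ es₂.map t)).Nodup := (q2.trans q1).nodup_iff.1 hJ
  have e2 : id (wordObj obJ J₁') * br (wordObj obI (es₁.map s)) (wordObj obJ J₂') * id (wordObj obI (es₂.map s)) =
      perm obJ ((J₁' ++ es₁.map t) ++ (J₂' ++ es₂.map t)) (J₁' ++ J₂' ++ (es₁.map t ++ es₂.map t)) := by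
    have h3 : (J₁' ++ ((J₂' ++ es₁.map t) ++ es₂.map t)).Nodup := by simpa using hJ'
    have h4 : (es₁.map t ++ J₂').Nodup := List.perm_append_comm.nodup_iff.1
      (List.nodup_append.1 (List.nodup_append.1 h3).2.1).1
    rw [← h₁.wordObj_eq, ← h₁.wordObj_eq, ← perm_self, ← perm_self, ← perm_swap h4,
      perm_mul_perm (List.Perm.refl _) List.perm_append_comm,
      perm_mul_perm (List.perm_append_comm.append_left _) (List.Perm.refl _)]
    simp only [List.append_assoc]
  rw [perm_interchange hI', e2, ← perm_comp_perm p1 p2 hI, ← perm_comp_perm q2 q1 hJ',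
    ← perm_mul_perm h₁.permI h₂.permI, ← perm_mul_perm h₁.permJ h₂.permJ, comp_mul_comp, comp_mul_comp]
  · have a1 := h₁.permI
    have a2 := h₂.permI
    have a3 := h₁.permJ
    have a4 := h₂.permJ
    rw [assoc (f := perm obI (I₁' ++ I₂' ++ _) _ ⨟ _), assoc (f := perm obI (I₁' ++ I₂' ++ _) _),
      assoc (f := perm obI (I₁' ++ I₂' ++ _) _), assoc (f := perm obI _ _ * perm obI _ _),
      assoc (f := perm obI _ _ * perm obI _ _), assoc (f := f * g)]
    all_goals
      simp (maxDischargeDepth := 6) [h₁.dom, h₂.dom, h₁.cod, h₂.cod, a1, a2, a3, a4, h₁.wordObj_eq, p1, q1,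
        mul_assoc, -List.append_assoc]
  all_goals simp (maxDischargeDepth := 6) [h₁.dom, h₂.dom, h₁.cod, h₂.cod, h₁.permI, h₂.permI, h₁.permJ, h₂.permJ]

/-- After contracting the tail, the names of `es₁` already stand at the end in the right order; the
remaining contraction is a bare trace without symmetries. -/
theorem ctr_trace (h : IsCtr obI obJ s t I J f I' J' (es₁ ++ es₂)) :
    ctr obI obJ s t I J f I' J' (es₁ ++ es₂) = tr (wordObj obI I') (wordObj obJ J') (wordObj obI (es₁.map s))
      (ctr obI obJ s t I J f (I' ++ es₁.map s) (J' ++ es₁.map t) es₂) := by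
  have h' : IsCtr obI obJ s t I J f (I' ++ es₁.map s) (J' ++ es₁.map t) es₂ :=
    { h with
      permI := by simpa using h.permI
      permJ := by simpa using h.permJ }
  rw [h.ctr_append]
  conv_lhs => rw [ctr]
  rw [perm_self, perm_self, id_comp h'.dom_ctr, comp_id h'.cod_ctr]

/-- The effect of an inserted wire-vertex, a new identity with input `w` and output `w'`: the pair
`c` is replaced by `a`, which leads from `t c` to `w`, and by `b`, which leads from `w'` to `s c`.
Tracing over the additional factor is exactly the situation of `tr_br_comp`, so the identity
disappears by yanking. -/
theorem ctr_insert {c : ε} (h : IsCtr obI obJ s t I J f I' J' (es ++ [c])) {s' : ε' → ι} {t' : ε' → κ}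
    {es' : List ε'} {a b : ε'} {w : ι} {w' : κ} (hs : es'.map s' = es.map s) (ht : es'.map t' = es.map t)
    (ha : s' a = w) (hb : s' b = s c) (ha' : t' a = t c) (hb' : t' b = w') (hw : w ∉ I) (hw' : w' ∉ J)
    (hob : obI w = obI (s c)) (hob' : obJ w' = obI (s c)) :
    ctr obI obJ s' t' (I ++ [w]) (J ++ [w']) (f * id (obI w)) I' J' (es' ++ [a, b]) =
      ctr obI obJ s t I J f I' J' (es ++ [c]) := by
  have hI := h.permI
  have hJ := h.permJ
  have hd := h.dom_inner
  have hc := h.cod_inner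
  have nI : (I ++ [w]).Nodup := by
    exact List.nodup_append.2 ⟨h.nodupI, List.nodup_singleton _, fun x hx y hy e =>
      hw (List.mem_singleton.1 hy ▸ e ▸ hx)⟩
  have nJ : (J ++ [w']).Nodup := by
    exact List.nodup_append.2 ⟨h.nodupJ, List.nodup_singleton _, fun x hx y hy e =>
      hw' (List.mem_singleton.1 hy ▸ e ▸ hx)⟩
  unfold ctr
  simp only [List.map_append, List.map_cons, List.map_nil, hs, ht, ha, hb, ha', hb'] at hI hJ hd hc ⊢
  set g := perm obI (I' ++ (es.map s ++ [s c])) I ⨟ f ⨟ perm obJ J (J' ++ (es.map t ++ [t c])) with hg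
  have p1 : (I' ++ es.map s ++ [w, s c]).Perm (I' ++ es.map s ++ [s c, w]) :=
    (List.Perm.swap _ _ _).append_left _
  have p2 : (I' ++ es.map s ++ [s c, w]).Perm (I ++ [w]) := by
    have := hI.append_right [w]
    simpa using this
  -- In the order of the pairs `w` precedes `s c`, but among the inputs the new name `w` comes last.
  -- This produces the crossing to be yanked. On the output side `w'` is last in both words, and no
  -- crossing arises.
  have e1 : perm obI (I' ++ (es.map s ++ [w, s c])) (I ++ [w]) =
      id (wordObj obI (I' ++ es.map s)) * br (obI (s c)) (obI (s c)) ⨟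
        perm obI (I' ++ (es.map s ++ [s c])) I * id (obI (s c)) := by
    have n1 : ([w] ++ [s c]).Nodup := (List.nodup_append.1 ((p1.trans p2).nodup_iff.2 nI)).2.1
    have e3 := perm_mul_perm (ob := obI) hI (List.Perm.refl [w])
    have e4 := perm_swap (ob := obI) n1
    rw [perm_self] at e3
    simp only [wordObj_cons, wordObj_nil, mul_one, hob, List.cons_append, List.nil_append] at e3 e4
    rw [e3, ← e4, ← perm_self, perm_mul_perm (List.Perm.refl _) (List.Perm.swap _ _ _)]
    have := perm_comp_perm (ob := obI) p1 p2 nI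
    simpa using this.symm
  have e2 : perm obJ (J ++ [w']) (J' ++ (es.map t ++ [t c, w'])) =
      perm obJ J (J' ++ (es.map t ++ [t c])) * id (obI (s c)) := by
    have e3 := perm_mul_perm (ob := obJ) hJ (List.Perm.refl [w'])
    rw [perm_self] at e3
    simp only [wordObj_cons, wordObj_nil, mul_one, hob'] at e3
    rw [e3]
    simp
  have e5 : perm obI (I' ++ (es.map s ++ [w, s c])) (I ++ [w]) ⨟ f * id (obI w) ⨟
      perm obJ (J ++ [w']) (J' ++ (es.map t ++ [t c, w'])) =
      id (wordObj obI (I' ++ es.map s)) * br (obI (s c)) (obI (s c)) ⨟ g * id (obI (s c)) := by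
    rw [e1, e2, hob, hg, assoc (f := id _ * br _ _), assoc (f := id _ * br _ _), mul_id_comp, mul_id_comp]
    all_goals simp (maxDischargeDepth := 6) [h.dom, h.cod, hI, hJ, mul_assoc]
  -- Splitting off the last traced letter lets vanishing trace it first.
  have e6 : wordObj obI (es.map s ++ [w, s c]) = wordObj obI (es.map s ++ [s c]) * obI (s c) := by
    simp [hob, mul_assoc]
  rw [e5, e6, tr_mul]
  · congr 1
    refine Eq.trans ?_ (tr_br_comp (Z := wordObj obI (I' ++ es.map s)) (B := wordObj obJ J' * wordObj obI (es.map s))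
      (X := obI (s c)) (g := g) ?_ ?_)
    · simp [mul_assoc]
    · rw [hd]
      simp [mul_assoc]
    · rw [hc]
      simp [mul_assoc]
  · simp [mul_assoc]
  · rw [cod_comp]
    · simp [hc, mul_assoc]
    · simp [hd, mul_assoc]

end IsCtr

end Arr

/-! ## Ports -/

section Ports

variable {V W α : Type*} (a : V → List α)

/-- The positions of the words `a v`, for `v` in a list. -/
def ports (vs : List V) : List (V × ℕ) := vs.flatMap fun v => (List.range (a v).length).map (Prod.mk v)

theorem mem_ports {vs : List V} {p : V × ℕ} : p ∈ ports a vs ↔ p.1 ∈ vs ∧ p.2 < (a p.1).length := by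
  obtain ⟨v, k⟩ := p
  simp only [ports, List.mem_flatMap, List.mem_map, List.mem_range, Prod.mk.injEq]
  exact ⟨by rintro ⟨w, hw, j, hj, rfl, rfl⟩; exact ⟨hw, hj⟩, fun ⟨h, h'⟩ => ⟨v, h, k, h', rfl, rfl⟩⟩

theorem ports_cons (v : V) (vs : List V) :
    ports a (v :: vs) = (List.range (a v).length).map (Prod.mk v) ++ ports a vs := by
  simp [ports]

@[simp] theorem ports_nil : ports a [] = [] := rfl

@[simp] theorem ports_append (vs ws : List V) : ports a (vs ++ ws) = ports a vs ++ ports a ws := by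
  simp [ports]

theorem nodup_ports {vs : List V} (h : vs.Nodup) : (ports a vs).Nodup := by
  induction vs with
  | nil => simp
  | cons v vs ih =>
    rw [List.nodup_cons] at h
    rw [ports_cons]
    refine List.nodup_append.2 ⟨List.nodup_range.map (Prod.mk_right_injective v), ih h.2, ?_⟩
    rintro p hp q hq rfl
    obtain ⟨k, -, rfl⟩ := List.mem_map.1 hp
    exact h.1 ((mem_ports a).1 hq).1

theorem ports_map (f : V → W) (b : W → List α) {vs : List V} (h : ∀ v ∈ vs, (b (f v)).length = (a v).length) :
    ports b (vs.map f) = (ports a vs).map (Prod.map f _root_.id) := by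
  induction vs with
  | nil => rfl
  | cons v vs ih =>
    rw [List.map_cons, ports_cons, ports_cons, ih (fun w hw => h w (by simp [hw])), List.map_append, List.map_map,
      h v (by simp)]
    rfl

theorem ports_of_length_eq_one {vs : List V} (h : ∀ v ∈ vs, (a v).length = 1) :
    ports a vs = vs.map (·, 0) := by
  induction vs with
  | nil => rfl
  | cons v vs ih =>
    rw [ports_cons, ih (fun w hw => h w (by simp [hw])), h v (by simp)]
    rfl

variable {a}

theorem ports_perm {vs ws : List V} (h : vs.Perm ws) : (ports a vs).Perm (ports a ws) := h.flatMap_right _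

end Ports

/-! ### Tensor products over lists of vertices -/

namespace Arr

variable {C : Type u} [TracedStruct.{u, v} C] [IsStrictSymmetricTraced C]

attribute [local instance] TracedStruct.objMonoid

variable {V : Type*} (a b : V → List C) (φ : V → Arr C)

/-- The object at a position of the words `a v`. -/
def portOb (p : V × ℕ) : C := (a p.1).getD p.2 1

theorem wordObj_range_map (v : V) :
    wordObj (portOb a) ((List.range (a v).length).map (Prod.mk v)) = (a v).prod := by
  rw [wordObj, List.map_map]
  congr 1
  refine List.ext_getElem (by simp) fun i h1 h2 => ?_
  simp [portOb, h2]

theorem wordObj_ports (vs : List V) : wordObj (portOb a) (ports a vs) = (vs.map fun v => (a v).prod).prod := by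
  induction vs with
  | nil => rfl
  | cons v vs ih => rw [ports_cons, wordObj_append, wordObj_range_map, ih, List.map_cons, List.prod_cons]

/-- The monoidal product of the arrows of a list of vertices. -/
def tensorOf (vs : List V) : Arr C := (vs.map φ).prod

@[simp] theorem tensorOf_nil : tensorOf φ [] = 1 := rfl

@[simp] theorem tensorOf_cons (v : V) (vs : List V) : tensorOf φ (v :: vs) = φ v * tensorOf φ vs := by
  simp [tensorOf]

@[simp] theorem tensorOf_append (vs ws : List V) : tensorOf φ (vs ++ ws) = tensorOf φ vs * tensorOf φ ws := by
  simp [tensorOf]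

variable {a b φ}

theorem dom_tensorOf (ha : ∀ v, (φ v).dom = (a v).prod) (vs : List V) :
    (tensorOf φ vs).dom = wordObj (portOb a) (ports a vs) := by
  induction vs with
  | nil => rfl
  | cons v vs ih => rw [tensorOf_cons, dom_mul, ih, ha, ports_cons, wordObj_append, wordObj_range_map]

theorem cod_tensorOf (hb : ∀ v, (φ v).cod = (b v).prod) (vs : List V) :
    (tensorOf φ vs).cod = wordObj (portOb b) (ports b vs) := by
  induction vs with
  | nil => rfl
  | cons v vs ih => rw [tensorOf_cons, cod_mul, ih, hb, ports_cons, wordObj_append, wordObj_range_map]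

/-- Exchanging two neighbouring factors is naturality of the symmetry; general reorderings are
composed of such exchanges, and coherence identifies the resulting symmetries with the canonical
ones between the words of ports. Vertices without repetitions have ports without repetitions. -/
theorem tensorOf_perm (ha : ∀ v, (φ v).dom = (a v).prod) (hb : ∀ v, (φ v).cod = (b v).prod) {vs ws : List V}
    (h : ws.Perm vs) (hn : vs.Nodup) :
    tensorOf φ ws = perm (portOb a) (ports a ws) (ports a vs) ⨟ tensorOf φ vs ⨟
      perm (portOb b) (ports b vs) (ports b ws) := by
  have hd := fun l : List V => dom_tensorOf ha l
  have hc := fun l : List V => cod_tensorOf hb l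
  induction h with
  | nil => rw [perm_self, perm_self, id_comp (hd _), comp_id (hc _)]
  | @cons v ws vs h ih =>
    have hn' := List.nodup_cons.1 hn
    have h1 : (ports a ws).Perm (ports a vs) := ports_perm h
    have h2 : (ports b vs).Perm (ports b ws) := ports_perm h.symm
    rw [tensorOf_cons, tensorOf_cons, ih hn'.2, ports_cons, ports_cons, ports_cons, ports_cons,
      ← perm_mul_perm (List.Perm.refl _) h1, ← perm_mul_perm (List.Perm.refl _) h2, perm_self, perm_self,
      wordObj_range_map, wordObj_range_map, ← comp_mul_comp (by simp [ha]) (by simp [h1, hd]),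
      ← comp_mul_comp (by simp [ha, hb]) (by rw [cod_comp] <;> simp [h1, h2, hd, hc]), id_comp (ha v), comp_id (hb v)]
  | swap x y l =>
    have hn' : (ports a [y] ++ ports a [x]).Nodup ∧ (ports b [x] ++ ports b [y]).Nodup := by
      rw [← ports_append, ← ports_append]
      refine ⟨nodup_ports a ?_, nodup_ports b ?_⟩ <;> simp at hn ⊢ <;> tauto
    have e : ∀ (c : V → List C) (x y : V) (l : List V), ports c (x :: y :: l) = ports c [x] ++ ports c [y] ++
        ports c l := by
      intro c x y l
      rw [← ports_append, ← ports_append]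
      rfl
    have e' : ∀ (c : V → List C) (x : V), wordObj (portOb c) (ports c [x]) = (c x).prod := by
      intro c x
      simp [wordObj_ports]
    rw [e a, e a, e b, e b, ← perm_mul_perm List.perm_append_comm (List.Perm.refl _), perm_self,
      ← perm_mul_perm List.perm_append_comm (List.Perm.refl _), perm_self, perm_swap hn'.1, perm_swap hn'.2,
      tensorOf_cons, tensorOf_cons, tensorOf_cons, tensorOf_cons, ← mul_assoc, ← mul_assoc, e', e', e', e',
      ← comp_mul_comp (by simp [ha]) (by simp [hd]), ← comp_mul_comp (by simp [ha, hb]) (by simp [hc, hd]),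
      id_comp (hd _), comp_id (hc _)]
    congr 1
    have := br_nat (φ y) (φ x)
    rw [ha, ha, hb, hb] at this
    rw [← this, assoc (by simp [hb]) (by simp), br_br, comp_id (by simp [hb])]
  | @trans l₁ l₂ l₃ h1 h2 ih1 ih2 =>
    have n2 := h2.nodup_iff.2 hn
    have n1 := h1.nodup_iff.2 n2
    rw [ih1 n2, ih2 hn, ← perm_comp_perm (ports_perm h1) (ports_perm h2) (nodup_ports a hn),
      ← perm_comp_perm (ports_perm h2.symm) (ports_perm h1.symm) (nodup_ports b n1)]
    have p1 : (ports a l₁).Perm (ports a l₂) := ports_perm h1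
    have p2 : (ports a l₂).Perm (ports a l₃) := ports_perm h2
    have p3 : (ports b l₃).Perm (ports b l₂) := ports_perm h2.symm
    have p4 : (ports b l₂).Perm (ports b l₁) := ports_perm h1.symm
    rw [assoc (f := perm _ (ports a l₁) _) (h := tensorOf φ l₃), assoc (f := perm _ (ports a l₁) _),
      ← assoc (g := perm _ (ports b l₃) _), assoc (f := perm _ (ports a l₁) _),
      assoc (g := perm _ (ports a l₂) _ ⨟ tensorOf φ l₃ ⨟ _)]
    all_goals simp (maxDischargeDepth := 6) [p1, p2, p3, p4, hd, hc]

end Arr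

/-! ## The value of a string graph -/

section Names

variable {T : MonoidalSignature.{u₁, v₁}}

/-- The input of its target that an edge is connected to. -/
def TypeEdge.inIdx : TypeEdge T → ℕ
  | mid _ => 0
  | inp _ i => i
  | out _ _ => 0

/-- The output of its source that an edge is connected to. -/
def TypeEdge.outIdx : TypeEdge T → ℕ
  | mid _ => 0
  | inp _ _ => 0
  | out _ j => j

namespace TypedGraph

/-- The name of the input that an edge is connected to. -/
def inName (G : TypedGraph T) (e : G.E) : G.V × ℕ := (G.tgt e, (G.τ.e e).inIdx)

/-- The name of the output that an edge is connected to. -/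
def outName (G : TypedGraph T) (e : G.E) : G.V × ℕ := (G.src e, (G.τ.e e).outIdx)

theorem edgeNames_eq (G : TypedGraph T) (e : G.E) : edgeNames G e = (G.inName e, G.outName e) := by
  unfold edgeNames inName outName
  cases G.τ.e e <;> rfl

theorem isWire_or_isBox (G : TypedGraph T) (x : G.V) : G.IsWire x ∨ G.IsBox x := by
  rcases h : G.τ.v x with Z | m
  exacts [Or.inl ⟨Z, h⟩, Or.inr ⟨m, h⟩]

theorem inIdx_of_isWire (G : TypedGraph T) {e : G.E} (h : G.IsWire (G.tgt e)) : (G.τ.e e).inIdx = 0 := by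
  obtain ⟨Z, hZ⟩ := h
  rw [← G.τ.tgt_e] at hZ
  cases hx : G.τ.e e <;> rw [hx] at hZ
  · rfl
  · cases hZ
  · rfl

theorem outIdx_of_isWire (G : TypedGraph T) {e : G.E} (h : G.IsWire (G.src e)) : (G.τ.e e).outIdx = 0 := by
  obtain ⟨Z, hZ⟩ := h
  rw [← G.τ.src_e] at hZ
  cases hx : G.τ.e e <;> rw [hx] at hZ
  · rfl
  · rfl
  · cases hZ

end TypedGraph

namespace StringGraph

/-- At a wire-vertex there is at most one incoming edge. At a box-vertex the index of the port
determines the type of the edge, and the typing is injective on its neighbourhood. -/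
theorem inName_injective (G : StringGraph T) : Function.Injective G.inName := by
  intro e e' h
  have h1 : G.tgt e = G.tgt e' := congrArg Prod.fst h
  have h2 : (G.τ.e e).inIdx = (G.τ.e e').inIdx := congrArg Prod.snd h
  rcases G.isWire_or_isBox (G.tgt e) with hw | hb
  · exact G.in_unique e e' hw h1
  · refine (G.local_iso _ hb).injOn (Or.inr rfl) (Or.inr h1.symm) ?_
    obtain ⟨m, hm⟩ := hb
    have hm' := hm
    rw [h1] at hm'
    rw [← G.τ.tgt_e] at hm hm'
    cases hx : G.τ.e e <;> rw [hx] at hm h2 <;> cases hm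
    cases hx' : G.τ.e e' <;> rw [hx'] at hm' h2 <;> cases hm'
    exact congrArg (TypeEdge.inp m) (Fin.ext h2)

theorem outName_injective (G : StringGraph T) : Function.Injective G.outName := by
  intro e e' h
  have h1 : G.src e = G.src e' := congrArg Prod.fst h
  have h2 : (G.τ.e e).outIdx = (G.τ.e e').outIdx := congrArg Prod.snd h
  rcases G.isWire_or_isBox (G.src e) with hw | hb
  · exact G.out_unique e e' hw h1
  · refine (G.local_iso _ hb).injOn (Or.inl rfl) (Or.inl h1.symm) ?_
    obtain ⟨m, hm⟩ := hb
    have hm' := hm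
    rw [h1] at hm'
    rw [← G.τ.src_e] at hm hm'
    cases hx : G.τ.e e <;> rw [hx] at hm h2 <;> cases hm
    cases hx' : G.τ.e e' <;> rw [hx'] at hm' h2 <;> cases hm'
    exact congrArg (TypeEdge.out m) (Fin.ext h2)

/-- `d` enumerates the inputs and `c` enumerates the outputs of a string graph. -/
structure Framing (G : StringGraph T) (d c : List G.V) : Prop where
  nodup_d : d.Nodup
  nodup_c : c.Nodup
  mem_d : ∀ x, x ∈ d ↔ x ∈ G.inputs
  mem_c : ∀ x, x ∈ c ↔ x ∈ G.outputs

end StringGraph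

/-- A list enumerates a type. -/
structure Enumerates {α : Type*} (l : List α) : Prop where
  nodup : l.Nodup
  mem : ∀ x, x ∈ l

theorem Enumerates.perm {α : Type*} {l l' : List α} (h : Enumerates l) (h' : Enumerates l') : l.Perm l' :=
  (List.perm_ext_iff_of_nodup h.nodup h'.nodup).2 fun x => iff_of_true (h.mem x) (h'.mem x)

theorem exists_enumerates (α : Type*) [Finite α] : ∃ l : List α, Enumerates l := by
  have := Fintype.ofFinite α
  exact ⟨Finset.univ.toList, Finset.nodup_toList _, by simp⟩

theorem Enumerates.map {α β : Type*} {l : List α} (h : Enumerates l) {f : α → β} (hf : Function.Bijective f) :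
    Enumerates (l.map f) :=
  ⟨h.nodup.map hf.1, fun y => (hf.2 y).elim fun x hx => List.mem_map.2 ⟨x, h.mem x, hx⟩⟩

theorem Enumerates.sum {α β : Type*} {l : List α} {l' : List β} (h : Enumerates l) (h' : Enumerates l') :
    Enumerates (l.map Sum.inl ++ l'.map Sum.inr) where
  nodup := by
    refine List.nodup_append.2 ⟨h.nodup.map Sum.inl_injective, h'.nodup.map Sum.inr_injective, ?_⟩
    rintro x hx y hy rfl
    obtain ⟨i, -, rfl⟩ := List.mem_map.1 hx
    simp at hy
  mem := by rintro (x | x) <;> simp [h.mem, h'.mem]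

theorem enumerates_ofFn {α : Type*} {n : ℕ} {f : Fin n → α} (hf : Function.Bijective f) : Enumerates (List.ofFn f) :=
  ⟨List.nodup_ofFn.2 hf.1, fun y => List.mem_ofFn.2 (hf.2 y)⟩

end Names

section Value

variable {T : MonoidalSignature.{u₁, v₁}} {C : Type u} [TracedStruct.{u, v} C]
  (F : T.Hom (underlyingSignature C))

/-- The word of inputs of a vertex of a given type. -/
def inWord : T.Obj ⊕ T.Mor → List C := Sum.elim (fun Z => [F.obj Z]) (fun m => (F.mor m).src)

/-- The word of outputs of a vertex of a given type. -/
def outWord : T.Obj ⊕ T.Mor → List C := Sum.elim (fun Z => [F.obj Z]) (fun m => (F.mor m).tgt)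

/-- The arrow of a vertex of a given type. -/
def genArr : T.Obj ⊕ T.Mor → Arr C :=
  Sum.elim (fun Z => Arr.id (F.obj Z)) (fun m => ⟨_, _, (F.mor m).hom⟩)

theorem src_mor (m : T.Mor) : (F.mor m).src = (T.dom m).map F.obj := F.dom_mor m

theorem tgt_mor (m : T.Mor) : (F.mor m).tgt = (T.cod m).map F.obj := F.cod_mor m

theorem inIdx_lt (x : TypeEdge T) : x.inIdx < (inWord F ((typegraph T).tgt x)).length := by
  rcases x with X | ⟨m, i⟩ | ⟨m, j⟩
  · exact Nat.one_pos
  · simp [typegraph, inWord, TypeEdge.inIdx, src_mor F]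
  · exact Nat.one_pos

theorem outIdx_lt (x : TypeEdge T) : x.outIdx < (outWord F ((typegraph T).src x)).length := by
  rcases x with X | ⟨m, i⟩ | ⟨m, j⟩
  · exact Nat.one_pos
  · exact Nat.one_pos
  · simp [typegraph, outWord, TypeEdge.outIdx, tgt_mor F]

/-- The words of inputs of the vertices. -/
abbrev TypedGraph.ins (G : TypedGraph T) (x : G.V) : List C := inWord F (G.τ.v x)

/-- The words of outputs of the vertices. -/
abbrev TypedGraph.outs (G : TypedGraph T) (x : G.V) : List C := outWord F (G.τ.v x)

/-- The arrows of the vertices. -/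
abbrev TypedGraph.arr (G : TypedGraph T) (x : G.V) : Arr C := genArr F (G.τ.v x)

theorem TypedGraph.length_ins_of_isWire (G : TypedGraph T) {x : G.V} (h : G.IsWire x) :
    (TypedGraph.ins F G x).length = 1 := by
  obtain ⟨Z, hZ⟩ := h
  rw [TypedGraph.ins, hZ]
  rfl

theorem TypedGraph.length_outs_of_isWire (G : TypedGraph T) {x : G.V} (h : G.IsWire x) :
    (TypedGraph.outs F G x).length = 1 := by
  obtain ⟨Z, hZ⟩ := h
  rw [TypedGraph.outs, hZ]
  rfl

namespace StringGraph

variable (G : StringGraph T)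

theorem inName_lt (e : G.E) : (G.inName e).2 < (G.ins F (G.inName e).1).length := by
  have := inIdx_lt F (G.τ.e e)
  rwa [G.τ.tgt_e] at this

theorem outName_lt (e : G.E) : (G.outName e).2 < (G.outs F (G.outName e).1).length := by
  have := outIdx_lt F (G.τ.e e)
  rwa [G.τ.src_e] at this

/-- A wire-vertex that is not an input has an incoming edge, and at a box-vertex the typing is
surjective on the neighbourhood. So the inputs of the graph are the only open input ports. -/
theorem exists_inName {x : G.V} {k : ℕ} (hk : k < (G.ins F x).length) (hx : x ∉ G.inputs) :
    ∃ e, G.inName e = (x, k) := by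
  rcases G.isWire_or_isBox x with hw | hb
  · rw [TypedGraph.length_ins_of_isWire F _ hw, Nat.lt_one_iff] at hk
    by_contra! h
    refine hx ⟨hw, fun e he => h e ?_⟩
    subst he
    rw [TypedGraph.inName, TypedGraph.inIdx_of_isWire _ hw, hk]
  · obtain ⟨m, hm⟩ := id hb
    have hk' : k < (T.dom m).length := by simpa [TypedGraph.ins, hm, inWord, src_mor F] using hk
    obtain ⟨e, he, h⟩ := (G.local_iso x hb).surjOn (a := TypeEdge.inp m ⟨k, hk'⟩) (by
      rw [hm]
      exact Or.inr rfl)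
    refine ⟨e, ?_⟩
    have h1 : G.tgt e = x := by
      refine he.resolve_left fun h' => ?_
      rw [← h', ← G.τ.src_e, h] at hm
      cases hm
    rw [TypedGraph.inName, h, h1]
    rfl

theorem exists_outName {x : G.V} {k : ℕ} (hk : k < (G.outs F x).length) (hx : x ∉ G.outputs) :
    ∃ e, G.outName e = (x, k) := by
  rcases G.isWire_or_isBox x with hw | hb
  · rw [TypedGraph.length_outs_of_isWire F _ hw, Nat.lt_one_iff] at hk
    by_contra! h
    refine hx ⟨hw, fun e he => h e ?_⟩
    subst he
    rw [TypedGraph.outName, TypedGraph.outIdx_of_isWire _ hw, hk]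
  · obtain ⟨m, hm⟩ := id hb
    have hk' : k < (T.cod m).length := by simpa [TypedGraph.outs, hm, outWord, tgt_mor F] using hk
    obtain ⟨e, he, h⟩ := (G.local_iso x hb).surjOn (a := TypeEdge.out m ⟨k, hk'⟩) (by
      rw [hm]
      exact Or.inl rfl)
    refine ⟨e, ?_⟩
    have h1 : G.src e = x := by
      refine he.resolve_right fun h' => ?_
      rw [← h', ← G.τ.tgt_e, h] at hm
      cases hm
    rw [TypedGraph.outName, h, h1]
    rfl

end StringGraph

variable [IsStrictSymmetricTraced C]

attribute [local instance] TracedStruct.objMonoid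

theorem dom_genArr (x : T.Obj ⊕ T.Mor) : (genArr F x).dom = (inWord F x).prod := by
  rcases x with Z | m
  · exact (mul_one _).symm
  · rfl

theorem cod_genArr (x : T.Obj ⊕ T.Mor) : (genArr F x).cod = (outWord F x).prod := by
  rcases x with Z | m
  · exact (mul_one _).symm
  · rfl

theorem getD_inWord (x : TypeEdge T) :
    (inWord F ((typegraph T).tgt x)).getD x.inIdx 1 = F.obj x.wire := by
  rcases x with X | ⟨m, i⟩ | ⟨m, j⟩
  · rfl
  · simp [typegraph, inWord, TypeEdge.inIdx, TypeEdge.wire, src_mor F]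
  · rfl

theorem getD_outWord (x : TypeEdge T) :
    (outWord F ((typegraph T).src x)).getD x.outIdx 1 = F.obj x.wire := by
  rcases x with X | ⟨m, i⟩ | ⟨m, j⟩
  · rfl
  · rfl
  · simp [typegraph, outWord, TypeEdge.outIdx, TypeEdge.wire, tgt_mor F]

namespace StringGraph

open Arr

variable (G : StringGraph T) {d c : List G.V} {vs : List G.V} {es : List G.E}

theorem portOb_inName (e : G.E) : portOb (G.ins F) (G.inName e) = F.obj (G.τ.e e).wire := by
  have := getD_inWord F (G.τ.e e)
  rwa [G.τ.tgt_e] at this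

theorem portOb_outName (e : G.E) : portOb (G.outs F) (G.outName e) = F.obj (G.τ.e e).wire := by
  have := getD_outWord F (G.τ.e e)
  rwa [G.τ.src_e] at this

/-- The value of a string graph, given enumerations of its inputs, outputs, vertices and edges. -/
noncomputable def value (d c vs : List G.V) (es : List G.E) : Arr C :=
  ctr (portOb (G.ins F)) (portOb (G.outs F)) G.inName G.outName (ports (G.ins F) vs) (ports (G.outs F) vs)
    (tensorOf (G.arr F) vs) (d.map (·, 0)) (c.map (·, 0)) es

variable {G}

/-- Every input port is either an input of the graph or the end of exactly one edge, and likewise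
for output ports. Therefore contracting all edges is meaningful and leaves precisely the boundary.
-/
theorem Framing.isCtr (h : G.Framing d c) (hv : Enumerates vs) (he : Enumerates es) :
    IsCtr (portOb (G.ins F)) (portOb (G.outs F)) G.inName G.outName (ports (G.ins F) vs) (ports (G.outs F) vs)
    (tensorOf (G.arr F) vs) (d.map (·, 0)) (c.map (·, 0)) es where
  obj e := (portOb_inName F G e).trans (portOb_outName F G e).symm
  nodupI := nodup_ports _ hv.nodup
  nodupJ := nodup_ports _ hv.nodup
  permI := by
    refine (List.perm_ext_iff_of_nodup ?_ (nodup_ports _ hv.nodup)).2 ?_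
    · refine List.nodup_append.2 ⟨h.nodup_d.map (Prod.mk_left_injective 0), he.nodup.map G.inName_injective, ?_⟩
      rintro p hp q hq rfl
      obtain ⟨x, hx, rfl⟩ := List.mem_map.1 hp
      obtain ⟨e, -, h1⟩ := List.mem_map.1 hq
      exact ((h.mem_d x).1 hx).2 e (congrArg Prod.fst h1)
    · rintro ⟨x, k⟩
      simp only [List.mem_append, List.mem_map, Prod.mk.injEq, mem_ports, hv.mem, he.mem, true_and]
      constructor
      · rintro (⟨y, hy, rfl, rfl⟩ | ⟨e, h1⟩)
        · rw [TypedGraph.length_ins_of_isWire F _ ((h.mem_d y).1 hy).1]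
          exact Nat.one_pos
        · have := inName_lt F G e
          rwa [h1] at this
      · intro hk
        by_cases hx : x ∈ G.inputs
        · rw [TypedGraph.length_ins_of_isWire F _ hx.1, Nat.lt_one_iff] at hk
          exact Or.inl ⟨x, (h.mem_d x).2 hx, rfl, hk.symm⟩
        · exact Or.inr (exists_inName F G hk hx)
  permJ := by
    refine ((List.perm_ext_iff_of_nodup ?_ (nodup_ports _ hv.nodup)).2 ?_).symm
    · refine List.nodup_append.2 ⟨h.nodup_c.map (Prod.mk_left_injective 0), he.nodup.map G.outName_injective, ?_⟩
      rintro p hp q hq rfl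
      obtain ⟨x, hx, rfl⟩ := List.mem_map.1 hp
      obtain ⟨e, -, h1⟩ := List.mem_map.1 hq
      exact ((h.mem_c x).1 hx).2 e (congrArg Prod.fst h1)
    · rintro ⟨x, k⟩
      simp only [List.mem_append, List.mem_map, Prod.mk.injEq, mem_ports, hv.mem, he.mem, true_and]
      constructor
      · rintro (⟨y, hy, rfl, rfl⟩ | ⟨e, h1⟩)
        · rw [TypedGraph.length_outs_of_isWire F _ ((h.mem_c y).1 hy).1]
          exact Nat.one_pos
        · have := outName_lt F G e
          rwa [h1] at this
      · intro hk
        by_cases hx : x ∈ G.outputs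
        · rw [TypedGraph.length_outs_of_isWire F _ hx.1, Nat.lt_one_iff] at hk
          exact Or.inl ⟨x, (h.mem_c x).2 hx, rfl, hk.symm⟩
        · exact Or.inr (exists_outName F G hk hx)
  dom := dom_tensorOf (fun _ => dom_genArr F _) _
  cod := cod_tensorOf (fun _ => cod_genArr F _) _
  s_inj := G.inName_injective
  t_inj := G.outName_injective

/-- Reordering the vertices conjugates their tensor product with symmetries, which `ctr_congr`
absorbs; reordering the edges is harmless by `ctr_perm`. -/
theorem Framing.value_eq (h : G.Framing d c) {vs' : List G.V} {es' : List G.E} (hv : Enumerates vs)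
    (he : Enumerates es) (hv' : Enumerates vs') (he' : Enumerates es') :
    value F G d c vs es = value F G d c vs' es' := by
  have h1 := hv.perm hv'
  have h2 := h.isCtr F hv' he
  unfold value
  rw [tensorOf_perm (a := G.ins F) (b := G.outs F) (φ := G.arr F) (fun _ => dom_genArr F _)
      (fun _ => cod_genArr F _) h1 hv'.nodup,
    h2.ctr_congr (ports_perm h1) (ports_perm h1.symm), (h.isCtr F hv' he').ctr_perm (he.perm he')]

open Classical in
/-- The value of a string graph, given enumerations of its inputs and its outputs. -/
noncomputable def eval (G : StringGraph T) (d c : List G.V) : Arr C :=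
  value F G d c (@exists_enumerates G.V G.finite_V).choose (@exists_enumerates G.E G.finite_E).choose

theorem Framing.eval_eq (h : G.Framing d c) (hv : Enumerates vs) (he : Enumerates es) :
    eval F G d c = value F G d c vs es :=
  h.value_eq F (Exists.choose_spec _) (Exists.choose_spec _) hv he

end StringGraph

end Value

/-! ## The value respects wire-homeomorphism -/

namespace Arr

variable {C : Type u} [TracedStruct.{u, v} C] [IsStrictSymmetricTraced C]

attribute [local instance] TracedStruct.objMonoid

theorem IsCtr.map {ι κ ε ι' κ' ε' : Type*} {obI : ι → C} {obJ : κ → C} {s : ε → ι} {t : ε → κ}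
    {I : List ι} {J : List κ} {f : Arr C} {I' : List ι} {J' : List κ} {es : List ε}
    {obI' : ι' → C} {obJ' : κ' → C} {s' : ε' → ι'} {t' : ε' → κ'} {p : ι → ι'} {q : κ → κ'} {r : ε → ε'}
    (h : IsCtr obI obJ s t I J f I' J' es)
    (hp : Function.Injective p) (hq : Function.Injective q) (hob : ∀ i, obI' (p i) = obI i)
    (hob' : ∀ i, obJ' (q i) = obJ i) (hs : ∀ e ∈ es, s' (r e) = p (s e)) (ht : ∀ e ∈ es, t' (r e) = q (t e))
    (hobj : ∀ e, obI' (s' e) = obJ' (t' e)) (hs' : Function.Injective s') (ht' : Function.Injective t') :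
    IsCtr obI' obJ' s' t' (I.map p) (J.map q) f (I'.map p) (J'.map q) (es.map r) where
  obj := hobj
  nodupI := h.nodupI.map hp
  nodupJ := h.nodupJ.map hq
  permI := by
    have : (es.map r).map s' = (es.map s).map p := by
      rw [List.map_map, List.map_map]
      exact List.map_congr_left hs
    rw [this, ← List.map_append]
    exact h.permI.map p
  permJ := by
    have : (es.map r).map t' = (es.map t).map q := by
      rw [List.map_map, List.map_map]
      exact List.map_congr_left ht
    rw [this, ← List.map_append]
    exact h.permJ.map q
  dom := by
    rw [h.dom, wordObj_map]
    exact congrArg (wordObj · I) (funext hob).symm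
  cod := by
    rw [h.cod, wordObj_map]
    exact congrArg (wordObj · J) (funext hob').symm
  s_inj := hs'
  t_inj := ht'

theorem id_mul_id_word {α : Type*} (ob : α → C) (L : List α) :
    (L.map fun x => id (ob x)).prod = id (wordObj ob L) := by
  induction L with
  | nil => rfl
  | cons x L ih => rw [List.map_cons, List.prod_cons, ih, id_mul_id, wordObj_cons]

end Arr

section Value

variable {T : MonoidalSignature.{u₁, v₁}} {C : Type u} [TracedStruct.{u, v} C]
  (F : T.Hom (underlyingSignature C))

namespace StringGraph

variable {G H : StringGraph T} {v : G.V → H.V}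

theorem ports_ins_map (hτ : ∀ x, H.τ.v (v x) = G.τ.v x) (vs : List G.V) :
    ports (H.ins F) (vs.map v) = (ports (G.ins F) vs).map (Prod.map v id) :=
  ports_map _ _ _ fun x _ => congrArg (fun y => (inWord F y).length) (hτ x)

theorem ports_outs_map (hτ : ∀ x, H.τ.v (v x) = G.τ.v x) (vs : List G.V) :
    ports (H.outs F) (vs.map v) = (ports (G.outs F) vs).map (Prod.map v id) :=
  ports_map _ _ _ fun x _ => congrArg (fun y => (outWord F y).length) (hτ x)

end StringGraph

variable [IsStrictSymmetricTraced C]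

attribute [local instance] TracedStruct.objMonoid

namespace TypedGraph

variable {G H : TypedGraph T} {v : G.V → H.V}

theorem inName_map {e : G.E} {e' : H.E} (h : H.tgt e' = v (G.tgt e))
    (hτ : (H.τ.e e').inIdx = (G.τ.e e).inIdx) : H.inName e' = Prod.map v id (G.inName e) := by
  rw [inName, h, hτ]
  rfl

theorem outName_map {e : G.E} {e' : H.E} (h : H.src e' = v (G.src e))
    (hτ : (H.τ.e e').outIdx = (G.τ.e e).outIdx) : H.outName e' = Prod.map v id (G.outName e) := by
  rw [outName, h, hτ]
  rfl

end TypedGraph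

namespace StringGraph

open Arr

variable {G H : StringGraph T} {v : G.V → H.V}

theorem portOb_ins_map (hτ : ∀ x, H.τ.v (v x) = G.τ.v x) (p : G.V × ℕ) :
    portOb (H.ins F) (Prod.map v id p) = portOb (G.ins F) p :=
  congrArg (fun y => (inWord F y).getD p.2 1) (hτ p.1)

theorem portOb_outs_map (hτ : ∀ x, H.τ.v (v x) = G.τ.v x) (p : G.V × ℕ) :
    portOb (H.outs F) (Prod.map v id p) = portOb (G.outs F) p :=
  congrArg (fun y => (outWord F y).getD p.2 1) (hτ p.1)

theorem tensorOf_arr_map (hτ : ∀ x, H.τ.v (v x) = G.τ.v x) (vs : List G.V) :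
    tensorOf (H.arr F) (vs.map v) = tensorOf (G.arr F) vs := by
  rw [tensorOf, List.map_map]
  exact congrArg List.prod (List.map_congr_left fun x _ => congrArg (genArr F) (hτ x))

theorem map_zero (l : List G.V) : (l.map v).map (·, 0) = (l.map ((·, 0) : G.V → G.V × ℕ)).map (Prod.map v id) := by
  rw [List.map_map, List.map_map]
  rfl

/-- The vertex map need not be surjective, so this covers the two summands of a disjoint union as
well as isomorphisms. -/
theorem value_map {d c vs : List G.V} {es : List G.E} {e : G.E → H.E} (hv : Function.Injective v)
    (hτ : ∀ x, H.τ.v (v x) = G.τ.v x) (hs : ∀ x ∈ es, H.inName (e x) = Prod.map v id (G.inName x))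
    (ht : ∀ x ∈ es, H.outName (e x) = Prod.map v id (G.outName x)) :
    value F H (d.map v) (c.map v) (vs.map v) (es.map e) = value F G d c vs es := by
  have hv' : Function.Injective (Prod.map v (id : ℕ → ℕ)) := hv.prodMap Function.injective_id
  unfold value
  rw [ports_ins_map F hτ, ports_outs_map F hτ, tensorOf_arr_map F hτ, map_zero, map_zero,
    ctr_map hv' hv' (portOb_ins_map F hτ) (portOb_outs_map F hτ) hs ht]

theorem isCtr_map {d c vs : List G.V} {es : List G.E} {e : G.E → H.E} (hv : Function.Injective v)
    (hτ : ∀ x, H.τ.v (v x) = G.τ.v x) (hs : ∀ x ∈ es, H.inName (e x) = Prod.map v id (G.inName x))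
    (ht : ∀ x ∈ es, H.outName (e x) = Prod.map v id (G.outName x)) (hf : G.Framing d c) (h₁ : Enumerates vs)
    (h₂ : Enumerates es) :
    IsCtr (portOb (H.ins F)) (portOb (H.outs F)) H.inName H.outName (ports (H.ins F) (vs.map v))
      (ports (H.outs F) (vs.map v)) (tensorOf (H.arr F) (vs.map v)) ((d.map v).map (·, 0)) ((c.map v).map (·, 0))
      (es.map e) := by
  have hv' : Function.Injective (Prod.map v (id : ℕ → ℕ)) := hv.prodMap Function.injective_id
  rw [ports_ins_map F hτ, ports_outs_map F hτ, tensorOf_arr_map F hτ, map_zero, map_zero]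
  exact (hf.isCtr F h₁ h₂).map hv' hv' (portOb_ins_map F hτ) (portOb_outs_map F hτ) hs ht
    (fun e => (portOb_inName F H e).trans (portOb_outName F H e).symm) H.inName_injective H.outName_injective

/-- Both factors are first renamed into the ports of the disjoint union; with names in common words,
`ctr_mul_ctr` applies. -/
theorem value_sum {d c : List G.V} {d' c' : List H.V} (h : G.Framing d c) (h' : H.Framing d' c')
    {vs es} {vs' es'} (h₁ : Enumerates vs) (h₂ : Enumerates es) (h₁' : Enumerates vs') (h₂' : Enumerates es') :
    value F (FramedCospan.sumGraph G H) (d.map Sum.inl ++ d'.map Sum.inr) (c.map Sum.inl ++ c'.map Sum.inr)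
      (vs.map Sum.inl ++ vs'.map Sum.inr) (es.map Sum.inl ++ es'.map Sum.inr) =
    value F G d c vs es * value F H d' c' vs' es' := by
  have i₁ := isCtr_map (H := FramedCospan.sumGraph G H) F (v := Sum.inl) (e := Sum.inl) Sum.inl_injective
    (fun _ => rfl) (fun _ _ => rfl) (fun _ _ => rfl) h h₁ h₂
  have i₂ := isCtr_map (H := FramedCospan.sumGraph G H) F (v := Sum.inr) (e := Sum.inr) Sum.inr_injective
    (fun _ => rfl) (fun _ _ => rfl) (fun _ _ => rfl) h' h₁' h₂'
  rw [← value_map (H := FramedCospan.sumGraph G H) F (v := Sum.inl) (e := Sum.inl) Sum.inl_injective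
    (fun _ => rfl) (fun _ _ => rfl) (fun _ _ => rfl), ← value_map (H := FramedCospan.sumGraph G H) F (v := Sum.inr)
    (e := Sum.inr) Sum.inr_injective (fun _ => rfl) (fun _ _ => rfl) (fun _ _ => rfl)]
  have hvs := (h₁.sum h₁').nodup
  have n1 := nodup_ports ((FramedCospan.sumGraph G H).ins F) hvs
  have n2 := nodup_ports ((FramedCospan.sumGraph G H).outs F) hvs
  rw [ports_append] at n1 n2
  unfold value
  rw [i₁.ctr_mul_ctr i₂ n1 n2, ports_append, ports_append, tensorOf_append, List.map_append, List.map_append]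

/-- New edges from the outputs `c₁` to the inputs `d₁` amount to a trace. They are listed first
because the front of the list is contracted last. This serves both for the trace of one graph and
for linking, where the graph is a disjoint union. -/
theorem value_trace {d c d₁ c₁ vs : List G.V} {es : List G.E} {e : G.E → H.E} {es₁ : List H.E}
    (hv : Function.Injective v)
    (hτ : ∀ x, H.τ.v (v x) = G.τ.v x) (hs : ∀ x ∈ es, H.inName (e x) = Prod.map v id (G.inName x))
    (ht : ∀ x ∈ es, H.outName (e x) = Prod.map v id (G.outName x))
    (hs₁ : es₁.map H.inName = (d₁.map v).map (·, 0)) (ht₁ : es₁.map H.outName = (c₁.map v).map (·, 0))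
    (hf : H.Framing (d.map v) (c.map v)) (hvs : Enumerates (vs.map v)) (hes : Enumerates (es₁ ++ es.map e)) :
    value F H (d.map v) (c.map v) (vs.map v) (es₁ ++ es.map e) =
      tr (wordObj (portOb (G.ins F)) (d.map (·, 0))) (wordObj (portOb (G.outs F)) (c.map (·, 0)))
        (wordObj (portOb (G.ins F)) (d₁.map (·, 0))) (value F G (d ++ d₁) (c ++ c₁) vs es) := by
  have e1 : ∀ l : List G.V, wordObj (portOb (H.ins F)) ((l.map v).map (·, 0)) =
      wordObj (portOb (G.ins F)) (l.map (·, 0)) := fun l => by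
    rw [map_zero, wordObj_map]
    exact congrArg (wordObj · _) (funext (portOb_ins_map F hτ))
  have e2 : ∀ l : List G.V, wordObj (portOb (H.outs F)) ((l.map v).map (·, 0)) =
      wordObj (portOb (G.outs F)) (l.map (·, 0)) := fun l => by
    rw [map_zero, wordObj_map]
    exact congrArg (wordObj · _) (funext (portOb_outs_map F hτ))
  rw [← value_map F hv hτ hs ht]
  unfold value
  rw [(hf.isCtr F hvs hes).ctr_trace, hs₁, ht₁, e1, e1, e2, List.map_append, List.map_append, List.map_append,
    List.map_append]

theorem Framing.value_boundary {d c d' c' vs : List G.V} {es : List G.E} (h : G.Framing d c) (hv : Enumerates vs)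
    (he : Enumerates es) (hd : d'.Perm d) (hc : c.Perm c') : value F G d' c' vs es =
      perm (portOb (G.ins F)) (d'.map (·, 0)) (d.map (·, 0)) ⨟ value F G d c vs es ⨟
        perm (portOb (G.outs F)) (c.map (·, 0)) (c'.map (·, 0)) :=
  (h.isCtr F hv he).ctr_boundary (hd.map _) (hc.map _)

end StringGraph

/-! ### Values of framed cospans and their invariance -/

open Arr StringGraph

variable {A B : List T.Obj}

theorem wordObj_ins {G : TypedGraph T} {d : Fin A.length → G.V} (hd : ∀ i, G.τ.v (d i) = Sum.inl (A.get i)) :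
    wordObj (portOb (G.ins F)) ((List.ofFn d).map (·, 0)) = wordObj F.obj A := by
  have : (fun i => portOb (G.ins F) (d i, 0)) = fun i => F.obj (A.get i) := by
    funext i
    rw [portOb, TypedGraph.ins, hd]
    rfl
  rw [wordObj, List.map_map, List.map_ofFn]
  refine congrArg List.prod ((congrArg List.ofFn this).trans ?_)
  exact (List.map_ofFn (f := A.get) (g := F.obj)).symm.trans (congrArg _ (List.ofFn_get A))

theorem wordObj_outs {G : TypedGraph T} {d : Fin A.length → G.V} (hd : ∀ i, G.τ.v (d i) = Sum.inl (A.get i)) :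
    wordObj (portOb (G.outs F)) ((List.ofFn d).map (·, 0)) = wordObj F.obj A := by
  have : (fun i => portOb (G.outs F) (d i, 0)) = fun i => F.obj (A.get i) := by
    funext i
    rw [portOb, TypedGraph.outs, hd]
    rfl
  rw [wordObj, List.map_map, List.map_ofFn]
  refine congrArg List.prod ((congrArg List.ofFn this).trans ?_)
  exact (List.map_ofFn (f := A.get) (g := F.obj)).symm.trans (congrArg _ (List.ofFn_get A))

namespace FramedCospan

/-- The inputs of a framed cospan. -/
abbrev dList (G : FramedCospan (wordGraph A) (wordGraph B)) : List G.V := List.ofFn fun i : Fin A.length => G.d.v i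

/-- The outputs of a framed cospan. -/
abbrev cList (G : FramedCospan (wordGraph A) (wordGraph B)) : List G.V := List.ofFn fun i : Fin B.length => G.c.v i

theorem framing (G : FramedCospan (wordGraph A) (wordGraph B)) : G.Framing G.dList G.cList where
  nodup_d := List.nodup_ofFn.2 G.d_injective
  nodup_c := List.nodup_ofFn.2 G.c_injective
  mem_d x := List.mem_ofFn.trans (by rw [← G.range_d]; exact Iff.rfl)
  mem_c x := List.mem_ofFn.trans (by rw [← G.range_c]; exact Iff.rfl)

/-- The value of a framed cospan. -/
noncomputable def value (G : FramedCospan (wordGraph A) (wordGraph B)) : Arr C := G.eval F G.dList G.cList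

theorem value_eq (G : FramedCospan (wordGraph A) (wordGraph B)) {vs es} (hv : Enumerates vs) (he : Enumerates es) :
    G.value F = G.toStringGraph.value F G.dList G.cList vs es := G.framing.eval_eq F hv he

theorem exists_enum (G : FramedCospan (wordGraph A) (wordGraph B)) :
    ∃ (vs : List G.V) (es : List G.E), Enumerates vs ∧ Enumerates es := by
  have := G.finite_V
  have := G.finite_E
  obtain ⟨vs, hv⟩ := exists_enumerates G.V
  obtain ⟨es, he⟩ := exists_enumerates G.E
  exact ⟨vs, es, hv, he⟩

theorem dom_value (G : FramedCospan (wordGraph A) (wordGraph B)) : (G.value F).dom = wordObj F.obj A := by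
  obtain ⟨vs, es, hv, he⟩ := G.exists_enum
  rw [G.value_eq F hv he]
  exact (G.framing.isCtr F hv he).dom_ctr.trans (wordObj_ins F G.d.τ_v)

theorem cod_value (G : FramedCospan (wordGraph A) (wordGraph B)) : (G.value F).cod = wordObj F.obj B := by
  obtain ⟨vs, es, hv, he⟩ := G.exists_enum
  rw [G.value_eq F hv he]
  exact (G.framing.isCtr F hv he).cod_ctr.trans (wordObj_outs F G.c.τ_v)

theorem value_iso {G H : FramedCospan (wordGraph A) (wordGraph B)} (α : CospanIso G H) : G.value F = H.value F := by
  obtain ⟨vs, es, hv, he⟩ := G.exists_enum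
  have ed : H.dList = G.dList.map α.v := by
    exact (congrArg List.ofFn (funext α.d_v)).trans (List.map_ofFn (f := fun i : Fin A.length => G.d.v i)).symm
  have ec : H.cList = G.cList.map α.v := by
    exact (congrArg List.ofFn (funext α.c_v)).trans (List.map_ofFn (f := fun i : Fin B.length => G.c.v i)).symm
  rw [G.value_eq F hv he, H.value_eq F (hv.map α.v.bijective) (he.map α.e.bijective), ed, ec]
  refine (StringGraph.value_map F α.v.injective α.τ_v (fun x _ => ?_) (fun x _ => ?_)).symm
  · exact TypedGraph.inName_map (α.tgt_e x) (by rw [α.τ_e])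
  · exact TypedGraph.outName_map (α.src_e x) (by rw [α.τ_e])

theorem inIdx_firstHalf (x : TypeEdge T) : x.firstHalf.inIdx = 0 := by cases x <;> rfl

theorem outIdx_firstHalf (x : TypeEdge T) : x.firstHalf.outIdx = x.outIdx := by cases x <;> rfl

theorem inIdx_secondHalf (x : TypeEdge T) : x.secondHalf.inIdx = x.inIdx := by cases x <;> rfl

theorem outIdx_secondHalf (x : TypeEdge T) : x.secondHalf.outIdx = 0 := by cases x <;> rfl

/-- The new wire-vertex contributes an identity, and the subdivided edge is replaced by its two
halves. This is the situation of `ctr_insert`. -/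
theorem value_subdivision {G H : FramedCospan (wordGraph A) (wordGraph B)} (σ : Subdivision G H) :
    G.value F = H.value F := by
  classical
  obtain ⟨vs, es₀, hv, he₀⟩ := G.exists_enum
  -- The subdivided edge is put at the end of the enumeration, where `ctr_insert` expects it.
  obtain ⟨es, hes, hne⟩ : ∃ es : List G.E, Enumerates (es ++ [σ.e₀]) ∧ ∀ x ∈ es, x ≠ σ.e₀ := by
    refine ⟨es₀.erase σ.e₀, ⟨?_, fun x => ?_⟩, fun x hx => ?_⟩
    · exact ((List.perm_cons_erase (he₀.mem σ.e₀)).trans (List.perm_append_comm (l₁ := [σ.e₀]))).nodup_iff.1 he₀.nodup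
    · exact ((List.perm_cons_erase (he₀.mem σ.e₀)).trans (List.perm_append_comm (l₁ := [σ.e₀]))).subset (he₀.mem x)
    · rintro rfl
      exact he₀.nodup.not_mem_erase hx
  have vinj : Function.Injective σ.v := fun x y h =>
    Option.some_injective _ (σ.v_bijective.1 (a₁ := some x) (a₂ := some y) h)
  have vw : ∀ x, σ.v x ≠ σ.w := fun x h => by
    have := σ.v_bijective.1 (a₁ := some x) (a₂ := none) h
    cases this
  have einj : Function.Injective σ.e := fun x y h =>
    Option.some_injective _ (σ.e_bijective.1 (a₁ := some x) (a₂ := some y) h)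
  have ee : ∀ x, σ.e x ≠ σ.e₁ := fun x h => by
    have := σ.e_bijective.1 (a₁ := some x) (a₂ := none) h
    cases this
  have hvH : Enumerates (vs.map σ.v ++ [σ.w]) := by
    refine ⟨List.nodup_append.2 ⟨hv.nodup.map vinj, List.nodup_singleton _, ?_⟩, fun x => ?_⟩
    · intro x hx y hy
      obtain ⟨z, -, rfl⟩ := List.mem_map.1 hx
      rw [List.mem_singleton.1 hy]
      exact vw z
    · obtain ⟨o, rfl⟩ := σ.v_bijective.2 x
      rcases o with _ | x
      · simp
      · exact List.mem_append_left _ (List.mem_map.2 ⟨x, hv.mem x, rfl⟩)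
  have heH : Enumerates (es.map σ.e ++ [σ.e σ.e₀, σ.e₁]) := by
    have e1 : es.map σ.e ++ [σ.e σ.e₀, σ.e₁] = (es ++ [σ.e₀]).map σ.e ++ [σ.e₁] := by simp
    rw [e1]
    refine ⟨List.nodup_append.2 ⟨hes.nodup.map einj, List.nodup_singleton _, ?_⟩, fun x => ?_⟩
    · intro x hx y hy
      obtain ⟨z, -, rfl⟩ := List.mem_map.1 hx
      rw [List.mem_singleton.1 hy]
      exact ee z
    · obtain ⟨o, rfl⟩ := σ.e_bijective.2 x
      rcases o with _ | x
      · simp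
      · exact List.mem_append_left _ (List.mem_map.2 ⟨x, hes.mem x, rfl⟩)
  have ed : H.dList = G.dList.map σ.v := by
    exact (congrArg List.ofFn (funext σ.d_v)).trans (List.map_ofFn (f := fun i : Fin A.length => G.d.v i)).symm
  have ec : H.cList = G.cList.map σ.v := by
    exact (congrArg List.ofFn (funext σ.c_v)).trans (List.map_ofFn (f := fun i : Fin B.length => G.c.v i)).symm
  have hv' : Function.Injective (Prod.map σ.v (id : ℕ → ℕ)) := vinj.prodMap Function.injective_id
  have pin := portOb_ins_map (H := H.toStringGraph) F σ.τ_v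
  have pout := portOb_outs_map (H := H.toStringGraph) F σ.τ_v
  -- The ports are renamed into those of `H`, but the edges remain those of `G`. The edge `σ.e₀` has
  -- no counterpart in `H` with both of its ends, so its two names have to be kept for the
  -- comparison.
  have i := (G.framing.isCtr F hv hes).map (ε' := G.E) (r := id)
    (s' := fun e => Prod.map σ.v id (G.inName e)) (t' := fun e => Prod.map σ.v id (G.outName e)) hv' hv'
    pin pout (fun _ _ => rfl) (fun _ _ => rfl)
    (fun e => (pin _).trans (((portOb_inName F G.toStringGraph e).trans
        (portOb_outName F G.toStringGraph e).symm).trans (pout _).symm))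
    (hv'.comp G.inName_injective) (hv'.comp G.outName_injective)
  have hw : H.IsWire σ.w := ⟨_, σ.τ_w⟩
  have hwob : portOb (H.ins F) (σ.w, 0) = F.obj (G.τ.e σ.e₀).wire := by
    rw [portOb, TypedGraph.ins, σ.τ_w]
    rfl
  have hwob' : portOb (H.outs F) (σ.w, 0) = F.obj (G.τ.e σ.e₀).wire := by
    rw [portOb, TypedGraph.outs, σ.τ_w]
    rfl
  have harr : H.arr F σ.w = Arr.id (portOb (H.ins F) (σ.w, 0)) := by
    rw [hwob, TypedGraph.arr, σ.τ_w]
    rfl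
  have nin : ∀ l : List (G.V × ℕ), (σ.w, 0) ∉ l.map (Prod.map σ.v id) := by
    intro l h
    obtain ⟨p, -, hp⟩ := List.mem_map.1 h
    exact vw p.1 (congrArg Prod.fst hp)
  rw [List.map_id] at i
  have key := i.ctr_insert (s' := H.inName) (t' := H.outName) (es' := es.map σ.e) (a := σ.e σ.e₀) (b := σ.e₁)
    (w := (σ.w, 0)) (w' := (σ.w, 0)) ?_ ?_ ?_ ?_ ?_ ?_ (nin _) (nin _) ?_ ?_
  · rw [H.value_eq F hvH heH, StringGraph.value, ports_append, ports_append, tensorOf_append, ports_ins_map F σ.τ_v,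
      ports_outs_map F σ.τ_v, tensorOf_arr_map F σ.τ_v, ed, ec, map_zero, map_zero, tensorOf_cons, tensorOf_nil,
          mul_one,
      ports_of_length_eq_one _ (vs := [σ.w]), ports_of_length_eq_one _ (vs := [σ.w]), List.map_cons, List.map_nil,
      harr, key, G.value_eq F hv hes, StringGraph.value]
    · have e2 := ctr_map (obI' := portOb (H.ins F)) (obJ' := portOb (H.outs F)) (s := G.inName) (t := G.outName)
        (I := ports (G.ins F) vs) (J := ports (G.outs F) vs) (f := tensorOf (G.arr F) vs)
        (I' := G.dList.map (·, 0)) (J' := G.cList.map (·, 0)) (es := es ++ [σ.e₀]) (r := id)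
        (s' := fun e => Prod.map σ.v id (G.inName e)) (t' := fun e => Prod.map σ.v id (G.outName e)) hv' hv'
        pin pout (fun _ _ => rfl) (fun _ _ => rfl)
      rw [List.map_id] at e2
      exact e2.symm
    · intro x hx
      rw [List.mem_singleton.1 hx]
      exact TypedGraph.length_outs_of_isWire F _ hw
    · intro x hx
      rw [List.mem_singleton.1 hx]
      exact TypedGraph.length_ins_of_isWire F _ hw
  · rw [List.map_map]
    exact List.map_congr_left fun x hx => TypedGraph.inName_map (σ.tgt_e x (hne x hx)) (by rw [σ.τ_e x (hne x hx)])
  · rw [List.map_map]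
    exact List.map_congr_left fun x hx => TypedGraph.outName_map (σ.src_e x) (by rw [σ.τ_e x (hne x hx)])
  · exact Prod.ext σ.tgt_e₀ ((congrArg TypeEdge.inIdx σ.τ_e₀).trans (inIdx_firstHalf _))
  · exact TypedGraph.inName_map σ.tgt_e₁ ((congrArg TypeEdge.inIdx σ.τ_e₁).trans (inIdx_secondHalf _))
  · exact TypedGraph.outName_map (σ.src_e _) ((congrArg TypeEdge.outIdx σ.τ_e₀).trans (outIdx_firstHalf _))
  · exact Prod.ext σ.src_e₁ ((congrArg TypeEdge.outIdx σ.τ_e₁).trans (outIdx_secondHalf _))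
  · rw [hwob, pin]
    exact (portOb_inName F G.toStringGraph σ.e₀).symm
  · rw [hwob', pin]
    exact (portOb_inName F G.toStringGraph σ.e₀).symm

theorem value_wireStep {G H : FramedCospan (wordGraph A) (wordGraph B)} (h : WireStep G H) :
    G.value F = H.value F := by
  rcases h with α | σ
  exacts [value_iso F α, value_subdivision F σ]

end FramedCospan

end Value

/-! ## The value is functorial -/

theorem ofFn_append {α β : Type*} (A B : List α) (f : Fin (A ++ B).length → β) :
    List.ofFn f = List.ofFn (fun i => f ((splitFin A B).symm (Sum.inl i))) ++
      List.ofFn (fun i => f ((splitFin A B).symm (Sum.inr i))) := by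
  have h : (A ++ B).length = A.length + B.length := List.length_append
  rw [List.ofFn_congr h, List.ofFn_add]
  rfl

section Value

variable {T : MonoidalSignature.{u₁, v₁}} {C : Type u} [TracedStruct.{u, v} C]
  (F : T.Hom (underlyingSignature C)) [IsStrictSymmetricTraced C]

attribute [local instance] TracedStruct.objMonoid

open Arr StringGraph

variable {A B D A' B' X : List T.Obj}

namespace FramedCospan

theorem value_tensor (G : FramedCospan (wordGraph A) (wordGraph B)) (H : FramedCospan (wordGraph A') (wordGraph B')) :
    (G.tensor H).value F = G.value F * H.value F := by
  obtain ⟨vs, es, hv, he⟩ := G.exists_enum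
  obtain ⟨vs', es', hv', he'⟩ := H.exists_enum
  have ed : (G.tensor H).dList = G.dList.map Sum.inl ++ H.dList.map Sum.inr := by
    rw [List.map_ofFn, List.map_ofFn]
    refine (ofFn_append A A' _).trans
        (congrArg₂ _ (congrArg _ (funext fun i => ?_)) (congrArg _ (funext fun i => ?_)))
    exacts [tensor_d G H (Sum.inl i), tensor_d G H (Sum.inr i)]
  have ec : (G.tensor H).cList = G.cList.map Sum.inl ++ H.cList.map Sum.inr := by
    rw [List.map_ofFn, List.map_ofFn]
    refine (ofFn_append B B' _).trans
        (congrArg₂ _ (congrArg _ (funext fun i => ?_)) (congrArg _ (funext fun i => ?_)))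
    exacts [tensor_c G H (Sum.inl i), tensor_c G H (Sum.inr i)]
  rw [G.value_eq F hv he, H.value_eq F hv' he', (G.tensor H).value_eq F (hv.sum hv') (he.sum he'), ed, ec]
  exact value_sum F G.framing H.framing hv he hv' he'

theorem _root_.Enumerates.sum_symm {α β : Type*} {l : List α} {l' : List β} (h : Enumerates l) (h' : Enumerates l') :
    Enumerates (l'.map Sum.inr ++ l.map Sum.inl) :=
  ⟨List.perm_append_comm.nodup_iff.1 (h.sum h').nodup, fun x => List.perm_append_comm.subset ((h.sum h').mem x)⟩

theorem value_trace (G : FramedCospan (wordGraph (A ++ X)) (wordGraph (B ++ X))) :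
    G.trace.value F = tr (wordObj F.obj A) (wordObj F.obj B) (wordObj F.obj X) (G.value F) := by
  obtain ⟨vs, es, hv, he⟩ := G.exists_enum
  have hX : Enumerates (List.ofFn (fun i : Fin X.length => i)) := enumerates_ofFn Function.bijective_id
  have h := StringGraph.value_trace (G := G.toStringGraph) (H := G.trace.toStringGraph) F (v := fun x => x)
    (e := Sum.inl) (d := G.trace.dList) (c := G.trace.cList) (d₁ := List.ofFn G.traceIn) (c₁ := List.ofFn G.traceOut)
    (vs := vs) (es := es) (es₁ := (List.ofFn (fun i : Fin X.length => i)).map Sum.inr) Function.injective_id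
        (fun _ => rfl)
    (fun _ _ => rfl) (fun _ _ => rfl) (by simp only [List.map_ofFn]; rfl) (by simp only [List.map_ofFn]; rfl)
    (by simpa only [List.map_id'] using G.trace.framing) (by simpa only [List.map_id'] using hv) (he.sum_symm hX)
  simp only [List.map_id'] at h
  rw [G.trace.value_eq F hv (he.sum_symm hX), h, G.value_eq F hv he]
  have e1 : G.dList = G.trace.dList ++ List.ofFn G.traceIn := ofFn_append A X _
  have e2 : G.cList = G.trace.cList ++ List.ofFn G.traceOut := ofFn_append B X _
  rw [e1, e2]
  congr 1
  · exact wordObj_ins F G.trace.d.τ_v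
  · exact wordObj_outs F G.trace.c.τ_v
  · exact wordObj_ins F (d := G.traceIn) fun i =>
      (G.d.τ_v _).trans (congrArg Sum.inl (get_splitFin_symm A X (Sum.inr i)))

/-- The link is the disjoint union with `B` fed back. The outputs of `G` come before those of `H` in
the union, so bringing `B` to the end costs a symmetry, and `tr_mul_comp_br` turns the trace into a
composite. -/
theorem value_link (G : FramedCospan (wordGraph A) (wordGraph B)) (H : FramedCospan (wordGraph B) (wordGraph D)) :
    (G.link H).value F = G.value F ⨟ H.value F := by
  obtain ⟨vs, es, hv, he⟩ := G.exists_enum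
  obtain ⟨vs', es', hv', he'⟩ := H.exists_enum
  have hX : Enumerates (List.ofFn (fun i : Fin B.length => i)) := enumerates_ofFn Function.bijective_id
  have hE := (he.sum he').sum_symm hX
  have hV := hv.sum hv'
  have f₁ := (G.tensor H).framing
  have ed : (G.tensor H).dList = G.dList.map Sum.inl ++ H.dList.map Sum.inr := by
    rw [List.map_ofFn, List.map_ofFn]
    refine (ofFn_append A B _).trans (congrArg₂ _ (congrArg _ (funext fun i => ?_)) (congrArg _ (funext fun i => ?_)))
    exacts [tensor_d G H (Sum.inl i), tensor_d G H (Sum.inr i)]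
  have ec : (G.tensor H).cList = G.cList.map Sum.inl ++ H.cList.map Sum.inr := by
    rw [List.map_ofFn, List.map_ofFn]
    refine (ofFn_append B D _).trans (congrArg₂ _ (congrArg _ (funext fun i => ?_)) (congrArg _ (funext fun i => ?_)))
    exacts [tensor_c G H (Sum.inl i), tensor_c G H (Sum.inr i)]
  rw [ed, ec] at f₁
  have h := StringGraph.value_trace (G := sumGraph G.toStringGraph H.toStringGraph) (H := (G.link H).toStringGraph) F
    (v := fun x => x)
    (e := Sum.inl) (d := (G.link H).dList) (c := (G.link H).cList) (d₁ := H.dList.map Sum.inr)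
        (c₁ := G.cList.map Sum.inl)
    (es₁ := (List.ofFn (fun i : Fin B.length => i)).map Sum.inr) Function.injective_id (fun _ => rfl)
    (fun _ _ => rfl) (fun _ _ => rfl) (by simp only [List.map_ofFn]; rfl) (by simp only [List.map_ofFn]; rfl)
    (by simpa only [List.map_id'] using (G.link H).framing) (by simpa only [List.map_id'] using hV) hE
  simp only [List.map_id'] at h
  rw [(G.link H).value_eq F hV hE, h]
  have e1 : (G.link H).dList = G.dList.map Sum.inl := by
    rw [List.map_ofFn]
    rfl
  have e2 : (G.link H).cList = H.cList.map Sum.inr := by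
    rw [List.map_ofFn]
    rfl
  have w1 : wordObj (portOb ((sumGraph G.toStringGraph H.toStringGraph).ins F))
      ((G.link H).dList.map (·, 0)) = wordObj F.obj A := wordObj_ins F (G.link H).d.τ_v
  have w2 : wordObj (portOb ((sumGraph G.toStringGraph H.toStringGraph).outs F))
      ((G.link H).cList.map (·, 0)) = wordObj F.obj D := wordObj_outs F (G.link H).c.τ_v
  have w3 : wordObj (portOb ((sumGraph G.toStringGraph H.toStringGraph).ins F))
      ((H.dList.map Sum.inr).map (·, 0)) = wordObj F.obj B := by
    rw [List.map_ofFn]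
    exact wordObj_ins (G := (sumGraph G.toStringGraph H.toStringGraph).toTypedGraph) F
        (d := fun i => Sum.inr (H.d.v i)) H.d.τ_v
  have w4 : wordObj (portOb ((sumGraph G.toStringGraph H.toStringGraph).outs F))
      ((G.cList.map Sum.inl).map (·, 0)) = wordObj F.obj B := by
    rw [List.map_ofFn]
    exact wordObj_outs (G := (sumGraph G.toStringGraph H.toStringGraph).toTypedGraph) F
        (d := fun i => Sum.inl (G.c.v i)) G.c.τ_v
  have n1 : ((G.cList.map Sum.inl).map (·, 0) ++ (H.cList.map Sum.inr).map (·, 0) :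
      List ((G.V ⊕ H.V) × ℕ)).Nodup := by
    rw [← List.map_append]
    exact f₁.nodup_c.map (Prod.mk_left_injective 0)
  have hdom : (StringGraph.value F (sumGraph G.toStringGraph H.toStringGraph)
      (G.dList.map Sum.inl ++ H.dList.map Sum.inr)
      (G.cList.map Sum.inl ++ H.cList.map Sum.inr) (vs.map Sum.inl ++ vs'.map Sum.inr)
      (es.map Sum.inl ++ es'.map Sum.inr)).dom = _ := (f₁.isCtr F hV (he.sum he')).dom_ctr
  rw [w1, w2, w3, e1, e2, f₁.value_boundary F hV (he.sum he') (List.Perm.refl _) List.perm_append_comm, perm_self,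
    id_comp hdom, List.map_append, List.map_append, perm_swap n1, w4, ← e2, w2, e2,
    value_sum F G.framing H.framing hv he hv' he', ← G.value_eq F hv he, ← H.value_eq F hv' he',
    tr_mul_comp_br (G.dom_value F) (G.cod_value F) (H.dom_value F) (H.cod_value F)]

/-- All vertices are identities, and the value is the trace of a symmetry. It is of the form of
`tr_mul_comp_br`, the composite of the desired permutation with an identity. The positions of `A`
serve as distinct names, since letters may be repeated. -/
theorem value_wires (π : Fin A.length ≃ Fin B.length) (hπ : ∀ i, B.get (π i) = A.get i) :
    (wires π hπ).value F = perm (fun i => F.obj (A.get i)) (List.ofFn fun i => i) (List.ofFn fun i => π.symm i) := by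
  have hA : Enumerates (List.ofFn (fun i : Fin A.length => i)) := enumerates_ofFn Function.bijective_id
  have hB : Enumerates (List.ofFn (fun i : Fin B.length => i)) := enumerates_ofFn Function.bijective_id
  -- Listing the edges in the order of their targets makes the symmetry on the input side trivial;
  -- the permutation appears on the output side only.
  have hE : Enumerates (List.ofFn (fun i : Fin B.length => π.symm i)) := enumerates_ofFn π.symm.bijective
  have hV := hA.sum hB
  rw [value_eq F _ hV hE]
  have hw : ∀ x, (wires π hπ).IsWire x := by rintro (x | x) <;> exact ⟨_, rfl⟩
  have hi := ((wires π hπ).framing.isCtr F hV hE)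
  have p1 : ∀ l, ports ((wires π hπ).ins F) l = l.map (·, 0) := fun l =>
    ports_of_length_eq_one _ fun x _ => TypedGraph.length_ins_of_isWire F _ (hw x)
  have p2 : ∀ l, ports ((wires π hπ).outs F) l = l.map (·, 0) := fun l =>
    ports_of_length_eq_one _ fun x _ => TypedGraph.length_outs_of_isWire F _ (hw x)
  have hI : (List.ofFn fun i => π.symm i).map (wires π hπ).inName =
      ((List.ofFn (fun i : Fin B.length => i)).map Sum.inr).map (·, 0) := by
    rw [List.map_ofFn, List.map_ofFn, List.map_ofFn]
    refine congrArg List.ofFn (funext fun i => ?_)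
    exact Prod.ext (congrArg Sum.inr (π.apply_symm_apply i)) rfl
  have hO : (List.ofFn fun i => π.symm i).map (wires π hπ).outName =
      ((List.ofFn fun i => π.symm i).map Sum.inl).map (·, 0) := by
    rw [List.map_ofFn, List.map_ofFn, List.map_ofFn]
    rfl
  have hd : (wires π hπ).dList = (List.ofFn (fun i : Fin A.length => i)).map Sum.inl := by
    rw [List.map_ofFn]
    rfl
  have hc : (wires π hπ).cList = (List.ofFn (fun i : Fin B.length => i)).map Sum.inr := by
    rw [List.map_ofFn]
    rfl
  have hf : ∀ l, tensorOf ((wires π hπ).arr F) l = Arr.id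
      (wordObj (portOb ((wires π hπ).outs F)) (l.map (·, 0))) := by
    intro l
    rw [wordObj_map, ← id_mul_id_word, tensorOf]
    refine congrArg List.prod (List.map_congr_left fun x _ => ?_)
    rcases x with x | x <;> rfl
  have wa : wordObj (portOb ((wires π hπ).ins F)) ((wires π hπ).dList.map (·, 0)) = wordObj F.obj A :=
      wordObj_ins F (wires π hπ).d.τ_v
  have wb : wordObj (portOb ((wires π hπ).ins F)) ((wires π hπ).cList.map (·, 0)) = wordObj F.obj B :=
      wordObj_ins F (wires π hπ).c.τ_v
  have wc : wordObj (portOb ((wires π hπ).outs F)) ((wires π hπ).cList.map (·, 0)) = wordObj F.obj B :=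
      wordObj_outs F (wires π hπ).c.τ_v
  have hP : (List.ofFn (fun i : Fin A.length => i)).Perm (List.ofFn fun i => π.symm i) := hA.perm hE
  set K := (((List.ofFn fun i => π.symm i).map Sum.inl).map (·, 0) : List ((wires π hπ).V × ℕ)) with hK
  have hP' : ((wires π hπ).dList.map (·, 0)).Perm K := by
    rw [hd, hK]
    exact (hP.map _).map _
  have hn : (K ++ (wires π hπ).cList.map (·, 0)).Nodup := by
    have := hi.nodupJ
    have h1 := hi.permJ
    rw [hO] at h1
    exact List.perm_append_comm.nodup_iff.1 (h1.nodup_iff.1 this)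
  have hKw : wordObj (portOb ((wires π hπ).outs F)) K = wordObj F.obj B := by
    have := hi.wordObj_eq (List.ofFn fun i => π.symm i)
    rw [hO, hI, ← hc, wb] at this
    exact this
  have hPob : perm (portOb ((wires π hπ).outs F)) ((wires π hπ).dList.map (·, 0)) K =
      perm (fun i => F.obj (A.get i)) (List.ofFn fun i => i) (List.ofFn fun i => π.symm i) := by
    rw [hd, hK, List.map_map, List.map_map, perm_map _ ((Prod.mk_left_injective 0).comp Sum.inl_injective)]
    rfl
  have hn' : (((wires π hπ).dList ++ (wires π hπ).cList).map (·, 0) : List ((wires π hπ).V × ℕ)).Nodup :=  by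
    rw [List.map_append]
    exact ((hP'.append_right _).nodup_iff).2 hn
  rw [StringGraph.value, ctr, p1, p2, hf, hI, hO, ← hd, ← hc, wa, wb, wc, ← List.map_append, perm_self]
  have wf : wordObj (portOb ((wires π hπ).ins F)) (((wires π hπ).dList ++ (wires π hπ).cList).map (·, 0)) =
      wordObj (portOb ((wires π hπ).outs F)) (((wires π hπ).dList ++ (wires π hπ).cList).map (·, 0)) := by
    rw [List.map_append, wordObj_append, wordObj_append, wa, wb, wc]
    congr 1
    exact (wordObj_outs F (wires π hπ).d.τ_v).symm
  have hQ : perm (portOb ((wires π hπ).outs F)) (((wires π hπ).dList ++ (wires π hπ).cList).map (·, 0))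
      ((wires π hπ).cList.map (·, 0) ++ K) =
      perm (portOb ((wires π hπ).outs F)) ((wires π hπ).dList.map (·, 0)) K * Arr.id (wordObj F.obj B) ⨟
        br (wordObj F.obj B) (wordObj F.obj B) := by
    have := perm_swap (ob := portOb ((wires π hπ).outs F)) hn
    rw [hKw, wc] at this
    rw [← this, ← wc, ← perm_self, perm_mul_perm hP' (List.Perm.refl _), List.map_append,
      perm_comp_perm (hP'.append_right _) List.perm_append_comm (List.perm_append_comm.nodup_iff.1 hn)]
  have hdom : (perm (portOb ((wires π hπ).outs F)) ((wires π hπ).dList.map (·, 0)) K).dom = wordObj F.obj A := by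
    rw [dom_perm hP']
    exact wordObj_outs F (wires π hπ).d.τ_v
  have hcod : (perm (portOb ((wires π hπ).outs F)) ((wires π hπ).dList.map (·, 0)) K).cod = wordObj F.obj B := by
    rw [cod_perm hP', hKw]
  rw [wf, id_comp (dom_id _), hQ, id_comp, tr_mul_comp_br hdom hcod (dom_id _) (cod_id _), comp_id hcod, hPob]
  rw [dom_comp, dom_mul, hdom, dom_id, List.map_append, wordObj_append, wc]
  congr 1
  exact (wordObj_outs F (wires π hπ).d.τ_v).symm

theorem value_pseudoId (A : List T.Obj) : (pseudoId A).value F = Arr.id (wordObj F.obj A) := by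
  rw [value_wires F (Equiv.refl _) fun _ => rfl]
  refine (perm_self _).trans (congrArg Arr.id ?_)
  exact congrArg List.prod ((List.map_ofFn).trans ((List.map_ofFn (f := A.get) (g := F.obj)).symm.trans
    (congrArg _ (List.ofFn_get A))))

theorem value_swap (A B : List T.Obj) : (swap A B).value F = br (wordObj F.obj A) (wordObj F.obj B) := by
  have e0 : ∀ (D : List T.Obj) (f : Fin D.length → Fin (A ++ B).length)
      (_ : ∀ i, (A ++ B).get (f i) = D.get i),
      wordObj (fun i => F.obj ((A ++ B).get i)) (List.ofFn f) = wordObj F.obj D := by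
    intro D f hf
    refine congrArg List.prod ((List.map_ofFn).trans ?_)
    refine Eq.trans (congrArg List.ofFn (funext fun i => congrArg F.obj (hf i))) ?_
    exact (List.map_ofFn (f := D.get) (g := F.obj)).symm.trans (congrArg _ (List.ofFn_get D))
  rw [value_wires, ofFn_append A B, ofFn_append B A]
  have e1 : ∀ i, (swapFin A B).symm ((splitFin B A).symm (Sum.inl i)) = (splitFin A B).symm (Sum.inr i) := by
    intro i
    simp [swapFin]
  have e2 : ∀ i, (swapFin A B).symm ((splitFin B A).symm (Sum.inr i)) = (splitFin A B).symm (Sum.inl i) := by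
    intro i
    simp [swapFin]
  have e3 : ∀ i, (((splitFin A B).trans ((Equiv.sumComm _ _).trans (splitFin B A).symm)).symm
      ((splitFin B A).symm (Sum.inl i))) = (splitFin A B).symm (Sum.inr i) := e1
  have e4 : ∀ i, (((splitFin A B).trans ((Equiv.sumComm _ _).trans (splitFin B A).symm)).symm
      ((splitFin B A).symm (Sum.inr i))) = (splitFin A B).symm (Sum.inl i) := e2
  simp only [e3, e4]
  have hn : (List.ofFn (fun i : Fin (A ++ B).length => i)).Nodup := List.nodup_ofFn.2 Function.injective_id
  rw [ofFn_append A B] at hn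
  rw [perm_swap hn, e0 A _ fun i => get_splitFin_symm A B (Sum.inl i), e0 B _ fun i => get_splitFin_symm A B
      (Sum.inr i)]

/-- With a suitable order of the vertices and of the edges the value takes the form of
`tr_generator`. -/
theorem value_box (m : T.Mor) : (box m).value F = ⟨_, _, (F.mor m).hom⟩ := by
  have hA : Enumerates (List.ofFn (fun i : Fin (T.dom m).length => i)) := enumerates_ofFn Function.bijective_id
  have hB : Enumerates (List.ofFn (fun i : Fin (T.cod m).length => i)) := enumerates_ofFn Function.bijective_id
  set G := box m with hG
  have hE : Enumerates (α := G.E) ((List.ofFn (fun i : Fin (T.dom m).length => i)).map Sum.inl ++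
    (List.ofFn (fun i : Fin (T.cod m).length => i)).map Sum.inr) := hA.sum hB
  -- Inputs, box, outputs: the edges into the box followed by those out of it then list the input
  -- ports in order, and on the output side the ports of the output vertices only have to cross all
  -- the others.
  have hV : Enumerates (G.dList ++ [Sum.inl ()] ++ G.cList : List G.V) := by
    have e : Enumerates (α := G.V)
        ([()].map Sum.inl ++ ((List.ofFn (fun i : Fin (T.dom m).length => i)).map Sum.inl ++
      (List.ofFn (fun i : Fin (T.cod m).length => i)).map Sum.inr).map Sum.inr) :=
      Enumerates.sum ⟨by simp, by simp⟩ (hA.sum hB)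
    have p : (G.dList ++ [Sum.inl ()] ++ G.cList : List G.V).Perm
      ([()].map Sum.inl ++ ((List.ofFn (fun i : Fin (T.dom m).length => i)).map Sum.inl ++
      (List.ofFn (fun i : Fin (T.cod m).length => i)).map Sum.inr).map Sum.inr) := by
      rw [List.map_append, ← List.append_assoc]
      simp only [List.map_ofFn]
      exact List.perm_append_comm.append_right _
    exact ⟨p.nodup_iff.2 e.nodup, fun x => p.symm.subset (e.mem x)⟩
  have hi := G.framing.isCtr F hV hE
  have hdw : ∀ x ∈ G.dList, G.IsWire x := fun x hx => ((G.framing.mem_d x).1 hx).1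
  have hcw : ∀ x ∈ G.cList, G.IsWire x := fun x hx => ((G.framing.mem_c x).1 hx).1
  have p1 : ports (G.ins F) G.dList = G.dList.map (·, 0) :=
    ports_of_length_eq_one _ fun x hx => TypedGraph.length_ins_of_isWire F _ (hdw x hx)
  have p2 : ports (G.ins F) G.cList = G.cList.map (·, 0) :=
    ports_of_length_eq_one _ fun x hx => TypedGraph.length_ins_of_isWire F _ (hcw x hx)
  have p3 : ports (G.outs F) G.dList = G.dList.map (·, 0) :=
    ports_of_length_eq_one _ fun x hx => TypedGraph.length_outs_of_isWire F _ (hdw x hx)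
  have p4 : ports (G.outs F) G.cList = G.cList.map (·, 0) :=
    ports_of_length_eq_one _ fun x hx => TypedGraph.length_outs_of_isWire F _ (hcw x hx)
  have hr : ∀ {n : ℕ} {α : Type} (f : ℕ → α), (List.range n).map f = List.ofFn fun i : Fin n => f i := by
    intro n α f
    exact List.ext_getElem (by simp) fun i h1 h2 => by simp
  have p5 : ports (G.ins F) [Sum.inl ()] = List.ofFn fun i : Fin (T.dom m).length => ((Sum.inl (), i) : G.V × ℕ) := by
    rw [ports_cons, ports_nil, List.append_nil, hr]
    have : (G.ins F (Sum.inl ())).length = (T.dom m).length := by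
      refine (congrArg List.length (src_mor F m)).trans (by simp)
    rw [this]
  have p6 : ports (G.outs F) [Sum.inl ()] = List.ofFn fun i : Fin (T.cod m).length =>
      ((Sum.inl (), i) : G.V × ℕ) := by
    rw [ports_cons, ports_nil, List.append_nil, hr]
    have : (G.outs F (Sum.inl ())).length = (T.cod m).length := by
      refine (congrArg List.length (tgt_mor F m)).trans (by simp)
    rw [this]
  have hI : ((List.ofFn (fun i : Fin (T.dom m).length => i)).map Sum.inl ++
      (List.ofFn (fun i : Fin (T.cod m).length => i)).map Sum.inr).map G.inName =
      ports (G.ins F) [Sum.inl ()] ++ G.cList.map (·, 0) := by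
    rw [p5, List.map_append]
    simp only [List.map_ofFn]
    rfl
  have hO : ((List.ofFn (fun i : Fin (T.dom m).length => i)).map Sum.inl ++
      (List.ofFn (fun i : Fin (T.cod m).length => i)).map Sum.inr).map G.outName =
      G.dList.map (·, 0) ++ ports (G.outs F) [Sum.inl ()] := by
    rw [p6, List.map_append]
    simp only [List.map_ofFn]
    rfl
  have hf : tensorOf (G.arr F) (G.dList ++ [Sum.inl ()] ++ G.cList) =
      Arr.id (wordObj F.obj (T.dom m)) * ⟨_, _, (F.mor m).hom⟩ * Arr.id (wordObj F.obj (T.cod m)) := by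
    rw [tensorOf_append, tensorOf_append]
    have e1 : tensorOf (G.arr F) G.dList = Arr.id (wordObj F.obj (T.dom m)) := by
      rw [← wordObj_ins F G.d.τ_v, wordObj_map, ← id_mul_id_word, tensorOf]
      rw [List.map_ofFn, List.map_ofFn]
      rfl
    have e2 : tensorOf (G.arr F) G.cList = Arr.id (wordObj F.obj (T.cod m)) := by
      rw [← wordObj_ins F G.c.τ_v, wordObj_map, ← id_mul_id_word, tensorOf]
      rw [List.map_ofFn, List.map_ofFn]
      rfl
    rw [e1, e2, tensorOf_cons, tensorOf_nil, mul_one]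
    rfl
  have wd : wordObj (portOb (G.outs F)) (G.dList.map (·, 0)) = wordObj F.obj (T.dom m) := wordObj_outs F G.d.τ_v
  have wd' : wordObj (portOb (G.ins F)) (G.dList.map (·, 0)) = wordObj F.obj (T.dom m) := wordObj_ins F G.d.τ_v
  have wc : wordObj (portOb (G.outs F)) (G.cList.map (·, 0)) = wordObj F.obj (T.cod m) := wordObj_outs F G.c.τ_v
  have wc' : wordObj (portOb (G.ins F)) (G.cList.map (·, 0)) = wordObj F.obj (T.cod m) := wordObj_ins F G.c.τ_v
  have wp : wordObj (portOb (G.ins F)) (ports (G.ins F) [Sum.inl ()]) = wordObj F.obj (T.dom m) := by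
    rw [wordObj_ports]
    refine (mul_one _).trans (congrArg List.prod (src_mor F m))
  have wp' : wordObj (portOb (G.outs F)) (ports (G.outs F) [Sum.inl ()]) = wordObj F.obj (T.cod m) := by
    rw [wordObj_ports]
    refine (mul_one _).trans (congrArg List.prod (tgt_mor F m))
  have hn := hi.nodupJ
  rw [ports_append, ports_append, p3, p4] at hn
  rw [G.value_eq F hV hE, StringGraph.value, ctr, hI, hO, hf, ports_append, ports_append, ports_append, ports_append,
    p1, p2, p3, p4, ← List.append_assoc, perm_self, perm_swap hn]
  simp only [wordObj_append, wd, wd', wc, wc', wp, wp']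
  have hd : (⟨_, _, (F.mor m).hom⟩ : Arr C).dom = wordObj F.obj (T.dom m) := congrArg List.prod (src_mor F m)
  have hc : (⟨_, _, (F.mor m).hom⟩ : Arr C).cod = wordObj F.obj (T.cod m) := congrArg List.prod (tgt_mor F m)
  rw [id_comp (by rw [dom_mul, dom_mul, hd]; rfl), tr_generator hd hc]

end FramedCospan

end Value

/-! ## The value functor -/

theorem UnderlyingMor.ext_arr {C : Type u} [TracedStruct.{u, v} C] {f g : UnderlyingMor C} (h : f.src = g.src)
    (h' : f.tgt = g.tgt) (e : Arr.mk _ _ f.hom = Arr.mk _ _ g.hom) : f = g := by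
  obtain ⟨s, t, f⟩ := f
  obtain ⟨s', t', g⟩ := g
  dsimp only at h h'
  subst h h'
  exact congrArg (UnderlyingMor.mk s t) (Arr.mk_inj e)

theorem MonoidalSignature.Hom.ext_of_eq {S : MonoidalSignature.{u₁, v₁}} {T : MonoidalSignature.{u₂, v₂}}
    {f g : S.Hom T}
    (h : f.obj = g.obj) (h' : f.mor = g.mor) : f = g := by
  obtain ⟨f, f', _, _⟩ := f
  obtain ⟨g, g', _, _⟩ := g
  dsimp only at h h'
  subst h h'
  rfl

theorem Arr.mk_map_cast {C : Type u₁} [TracedStruct.{u₁, v₁} C] {D : Type u₂} [TracedStruct.{u₂, v₂} D]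
    (E : StrictTracedFunctor C D) {A B A' B' : C} (h : A = A') (h' : B = B') (f : A ⟶ B) :
    Arr.mk (E.obj A') (E.obj B') (E.map (f.cast h h')) = Arr.mk (E.obj A) (E.obj B) (E.map f) := by
  subst h h'
  rfl

section Functor

variable {T : MonoidalSignature.{u₁, v₁}} {C : Type u} [TracedStruct.{u, v} C]
  [IsStrictSymmetricTraced C] (F : T.Hom (underlyingSignature C))

attribute [local instance] TracedStruct.objMonoid

open Arr

namespace FramedCospan

variable {A B D : List T.Obj}

theorem value_congr {G G' : FramedCospan (wordGraph A) (wordGraph B)} (h : cls G = cls G') : G.value F = G'.value F :=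
  congrArg (Quot.lift (fun G : FramedCospan (wordGraph A) (wordGraph B) => G.value F)
    fun _ _ h => value_wireStep F h) h

end FramedCospan

namespace FCspPlus

open FramedCospan

/-- The morphism given by the values of framed cospans. -/
noncomputable def valueMap {A B : FCspPlus T} (f : A ⟶ B) :
    (tensorList (List.map F.obj A) ⟶ tensorList (List.map F.obj B)) :=
  Quot.lift (fun G : FramedCospan (wordGraph A) (wordGraph B) => (G.value F).hom.cast (G.dom_value F) (G.cod_value F))
    (fun _ _ h => cast_eq_of_mk _ _ ((value_wireStep F h).trans (mk_cast _ _ _).symm)) f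

theorem mk_valueMap {A B : FCspPlus T} (G : FramedCospan (wordGraph A) (wordGraph B)) :
    Arr.mk _ _ (valueMap F (FCspPlus.mk G)) = G.value F := mk_cast _ _ _

/-- The strict symmetric traced functor given by the values of framed cospans. -/
noncomputable def valueFunctor : StrictTracedFunctor (FCspPlus T) C where
  obj A := tensorList (List.map F.obj A)
  map f := valueMap F f
  map_id A := mk_inj ((mk_valueMap F _).trans (value_pseudoId F A))
  map_comp := by
    rintro A B D ⟨G⟩ ⟨H⟩
    refine mk_inj ((mk_valueMap F (G.comp H)).trans ?_)
    refine (value_congr F (cls_comp G H)).trans ((value_link F G H).trans (Eq.trans ?_ (mk_comp _ _)))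
    exact congrArg₂ _ (mk_valueMap F G).symm (mk_valueMap F H).symm
  obj_unit := rfl
  obj_tensor A B := (congrArg tensorList List.map_append).trans (tensorList_append _ _)
  map_tensorHom := by
    rintro A B A' B' ⟨G⟩ ⟨H⟩
    refine cast_eq_of_mk _ _ ((mk_valueMap F (G.tensor H)).trans ?_)
    refine (value_tensor F G H).trans (Eq.trans ?_ (mk_mul _ _))
    exact congrArg₂ _ (mk_valueMap F G).symm (mk_valueMap F H).symm
  map_braid A B := cast_eq_of_mk _ _ ((mk_valueMap F (swap A B)).trans (value_swap F A B))
  map_trace := by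
    rintro A B X ⟨G⟩
    refine mk_inj ((mk_valueMap F G.trace).trans ?_)
    refine (value_trace F G).trans (Eq.trans ?_ (tr_mk _))
    exact congrArg _ ((mk_valueMap F G).symm.trans (mk_cast _ _ _).symm)

theorem generators_valueFunctor : (generators T).comp (valueFunctor F).underlying = F := by
  have ho : ∀ Z, tensorList (List.map F.obj [Z]) = F.obj Z := fun Z => mul_one _
  have hw : ∀ L : List T.Obj, List.map (valueFunctor F).obj (L.map of) = L.map F.obj := fun L => by
    rw [List.map_map]
    exact List.map_congr_left fun Z _ => ho Z
  refine MonoidalSignature.Hom.ext_of_eq (funext ho) (funext fun m => ?_)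
  refine UnderlyingMor.ext_arr ((hw _).trans (src_mor F m).symm) ((hw _).trans (tgt_mor F m).symm) ?_
  refine (mk_cast _ _ _).trans ((mk_map_cast (valueFunctor F) _ _ _).trans ?_)
  exact (mk_valueMap F (box m)).trans (value_box F m)

end FCspPlus

end Functor

/-! ## Contraction normal forms -/

/-- A sublist of a list without repetitions is determined by its members. This pins down the order
of the names that survive all contractions. -/
theorem List.Nodup.eq_of_perm_of_sublist {α : Type*} {l l₁ l₂ : List α} (h : l.Nodup) (h₁ : l₁.Sublist l)
    (h₂ : l₂.Sublist l) (hp : l₁.Perm l₂) : l₁ = l₂ := by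
  induction h₁ generalizing l₂ with
  | slnil => exact hp.nil_eq
  | @cons l₁ l a h₁ ih =>
    rw [List.nodup_cons] at h
    cases h₂ with
    | cons _ h₂ => exact ih h.2 h₂ hp
    | cons_cons _ h₂ => exact absurd (h₁.subset (hp.symm.subset (by simp))) h.1
  | @cons_cons l₁ l a h₁ ih =>
    rw [List.nodup_cons] at h
    cases h₂ with
    | cons _ h₂ => exact absurd (h₂.subset (hp.subset (by simp))) h.1
    | cons_cons _ h₂ => rw [ih h.2 h₂ (List.perm_cons a |>.1 hp)]

section NormalForms

variable {C : Type u} [TracedStruct.{u, v} C] [IsStrictSymmetricTraced C]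

attribute [local instance] TracedStruct.objMonoid

open Arr

namespace IndexedMor

variable {ι : Type} {ε : Type*} {obI obJ : ι → C}

/-- An indexed morphism represents an arrow between two words of names. -/
structure Represents (obI obJ : ι → C) (g : IndexedMor ι C) (I J : List ι) (f : Arr C) : Prop where
  inNames : g.inNames = I
  outNames : g.outNames = J
  src : g.src = I.map obI
  tgt : g.tgt = J.map obJ
  hom : Arr.mk _ _ g.hom = f

theorem arr_fromEnd (L₁ : List C) (X : C) (L₂ : List C) :
    Arr.mk _ _ (fromEnd L₁ X L₂) = Arr.id L₁.prod * br L₂.prod X := mk_cast _ _ _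

theorem arr_toEnd (L₁ : List C) (X : C) (L₂ : List C) :
    Arr.mk _ _ (toEnd L₁ X L₂) = Arr.id L₁.prod * br X L₂.prod := mk_cast _ _ _

theorem Represents.exists_contraction {g : IndexedMor ι C} {I₁ I₂ J₁ J₂ : List ι} {i j : ι} {f : Arr C}
    (h : Represents obI obJ g (I₁ ++ i :: I₂) (J₁ ++ j :: J₂) f) (hij : obI i = obJ j) :
    ∃ g', Contraction g i j g' ∧ Represents obI obJ g' (I₁ ++ I₂) (J₁ ++ J₂)
      (tr (wordObj obI (I₁ ++ I₂)) (wordObj obJ (J₁ ++ J₂)) (obI i)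
        (Arr.id (wordObj obI I₁) * br (wordObj obI I₂) (obI i) ⨟ (f ⨟
          Arr.id (wordObj obJ J₁) * br (obI i) (wordObj obJ J₂)))) := by
  obtain ⟨I, J, S, R, f'⟩ := g
  obtain ⟨h1, h2, h3, h4, h5⟩ := h
  dsimp only at h1 h2 h3 h4 f' h5
  have h3' : S = I₁.map obI ++ obI i :: I₂.map obI := by rw [h3, List.map_append, List.map_cons]
  have h4' : R = J₁.map obJ ++ obI i :: J₂.map obJ := by rw [h4, List.map_append, List.map_cons, hij]
  clear h3 h4
  subst h1 h2 h3' h4' h5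
  refine ⟨_, .mk I₁ I₂ J₁ J₂ i j (I₁.map obI) (I₂.map obI) (J₁.map obJ) (J₂.map obJ) (obI i) (by simp) (by simp) f',
    ⟨rfl, rfl, by simp, by simp, ?_⟩⟩
  refine (tr_mk _).symm.trans ?_
  rw [wordObj, wordObj, List.map_append, List.map_append]
  refine congrArg _ ((mk_comp _ _).symm.trans ?_)
  refine congrArg₂ _ (arr_fromEnd _ _ _) ((mk_comp _ _).symm.trans ?_)
  exact congrArg _ (arr_toEnd _ _ _)

variable {s t : ε → ι}

/-- For one pair the canonical symmetries are those that move a single letter to the end or back, so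
the contraction agrees with one step of the normal form. -/
theorem _root_.Arr.IsCtr.ctr_singleton {I₁ I₂ J₁ J₂ : List ι} {e : ε} {f : Arr C}
    (h : IsCtr obI obJ s t (I₁ ++ s e :: I₂) (J₁ ++ t e :: J₂) f (I₁ ++ I₂) (J₁ ++ J₂) [e]) :
    ctr obI obJ s t (I₁ ++ s e :: I₂) (J₁ ++ t e :: J₂) f (I₁ ++ I₂) (J₁ ++ J₂) [e] =
      tr (wordObj obI (I₁ ++ I₂)) (wordObj obJ (J₁ ++ J₂)) (obI (s e))
        (Arr.id (wordObj obI I₁) * br (wordObj obI I₂) (obI (s e)) ⨟ (f ⨟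
          Arr.id (wordObj obJ J₁) * br (obI (s e)) (wordObj obJ J₂))) := by
  have n1 : (I₂ ++ [s e]).Nodup := (List.perm_append_comm (l₁ := [s e])).nodup_iff.1
      (List.nodup_append.1 h.nodupI).2.1
  have n2 : ([t e] ++ J₂).Nodup := (List.nodup_append.1 h.nodupJ).2.1
  have e1 : perm obI (I₁ ++ I₂ ++ [e].map s) (I₁ ++ s e :: I₂) = Arr.id (wordObj obI I₁) * br (wordObj obI I₂)
      (obI (s e)) := by
    have := perm_swap (ob := obI) n1
    rw [← perm_self, List.append_assoc]
    simp only [wordObj_cons, wordObj_nil, mul_one] at this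
    rw [← this, perm_mul_perm (List.Perm.refl _) List.perm_append_comm]
    rfl
  have e2 : perm obJ (J₁ ++ t e :: J₂) (J₁ ++ J₂ ++ [e].map t) = Arr.id (wordObj obJ J₁) * br (obI (s e))
      (wordObj obJ J₂) := by
    have := perm_swap (ob := obJ) n2
    rw [← perm_self, List.append_assoc]
    simp only [wordObj_cons, wordObj_nil, mul_one] at this
    rw [h.obj e, ← this, perm_mul_perm (List.Perm.refl _) List.perm_append_comm]
    rfl
  have d1 := h.permI
  have d2 := h.permJ
  rw [ctr, e1, e2, assoc]
  · simp
  · rw [← e1, cod_perm d1, h.dom]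
  · rw [← e2, dom_perm d2, h.cod]

theorem _root_.Arr.IsCtr.ctr_nil {I J : List ι} {f : Arr C} (hf : f.dom = wordObj obI I)
    (hf' : f.cod = wordObj obJ J) :
    ctr obI obJ s t I J f I J [] = f := by
  unfold ctr
  simp only [List.map_nil, List.append_nil, perm_self]
  rw [id_comp hf, comp_id hf']
  exact tr_one (by rw [hf]) (by rw [hf'])

/-- One contraction after the other realises the contraction along all pairs. The surviving names
keep their relative order, so the final words are sublists of the original ones. They need not equal
`I'` and `J'`, but are permutations of them. -/
theorem Represents.exists_contractions {g : IndexedMor ι C} {I J I' J' : List ι} {f : Arr C} {es : List ε}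
    (hg : Represents obI obJ g I J f) (h : IsCtr obI obJ s t I J f I' J' es) :
    ∃ I₀ J₀ g', Contractions g (es.map fun e => (s e, t e)) g' ∧
      Represents obI obJ g' I₀ J₀ (ctr obI obJ s t I J f I₀ J₀ es) ∧ I₀.Sublist I ∧ J₀.Sublist J ∧
      I₀.Perm I' ∧ J₀.Perm J' := by
  induction es generalizing g I J f with
  | nil =>
    refine ⟨I, J, g, .nil g, ?_, List.Sublist.refl _, List.Sublist.refl _, ?_, ?_⟩
    · rw [IsCtr.ctr_nil h.dom h.cod]
      exact hg
    · simpa using h.permI.symm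
    · simpa using h.permJ
  | cons e es ih =>
    obtain ⟨I₁, I₂, rfl⟩ := List.append_of_mem (h.permI.subset (by simp : s e ∈ I' ++ (e :: es).map s))
    obtain ⟨J₁, J₂, rfl⟩ := List.append_of_mem (h.permJ.symm.subset (by simp : t e ∈ J' ++ (e :: es).map t))
    have hI : (I' ++ es.map s).Perm (I₁ ++ I₂) := by
      have := (List.perm_middle.symm.trans h.permI).trans List.perm_middle
      exact this.cons_inv
    have hJ : (J₁ ++ J₂).Perm (J' ++ es.map t) := by
      have := (List.perm_middle.symm.trans h.permJ).trans List.perm_middle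
      exact this.cons_inv
    have h1 : IsCtr obI obJ s t (I₁ ++ s e :: I₂) (J₁ ++ t e :: J₂) f (I₁ ++ I₂) (J₁ ++ J₂) [e] :=
      { h with
        permI := by
          simp only [List.map_cons, List.map_nil, List.append_assoc]
          exact List.perm_append_comm.append_left I₁
        permJ := by
          simp only [List.map_cons, List.map_nil, List.append_assoc]
          exact (List.perm_append_comm (l₁ := [t e])).append_left J₁ }
    obtain ⟨g₁, c₁, r₁⟩ := hg.exists_contraction (h.obj e)
    rw [← h1.ctr_singleton] at r₁
    have h2 : IsCtr obI obJ s t (I₁ ++ I₂) (J₁ ++ J₂)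
        (ctr obI obJ s t (I₁ ++ s e :: I₂) (J₁ ++ t e :: J₂) f (I₁ ++ I₂) (J₁ ++ J₂) [e]) I' J' es :=
      { h with
        nodupI := h.nodupI.sublist (by simp)
        nodupJ := h.nodupJ.sublist (by simp)
        permI := hI
        permJ := hJ
        dom := h1.dom_ctr
        cod := h1.cod_ctr }
    obtain ⟨I₀, J₀, g', c₂, r₂, s₁, s₂, p₁, p₂⟩ := ih r₁ h2
    refine ⟨I₀, J₀, g', .cons c₁ c₂, ?_, s₁.trans (by simp), s₂.trans (by simp), p₁, p₂⟩
    have h3 := h.boundary p₁ p₂.symm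
    -- The normal form contracts `e` first, while `ctr_append` contracts the end of the list first;
    -- so `e` is moved to the end.
    have hp : (e :: es).Perm (es ++ [e]) := List.perm_append_comm (l₁ := [e])
    have h4 : IsCtr obI obJ s t (I₁ ++ s e :: I₂) (J₁ ++ t e :: J₂) f I₀ J₀ (es ++ [e]) :=
      { h3 with
        permI := ((hp.symm.map s).append_left _).trans h3.permI
        permJ := h3.permJ.trans ((hp.map t).append_left _) }
    have h5 := h2.boundary p₁ p₂.symm
    rw [h4.ctr_perm hp, h4.ctr_append, h1.ctr_boundary h5.permI h5.permJ, h5.ctr_congr h5.permI h5.permJ]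
    exact r₂

end IndexedMor

end NormalForms

section

variable {T : MonoidalSignature.{u₁, v₁}} {C : Type u} [TracedStruct.{u, v} C]
  (F : T.Hom (underlyingSignature C)) [IsStrictSymmetricTraced C]

attribute [local instance] TracedStruct.objMonoid

open Arr IndexedMor

theorem map_portOb_range {V : Type*} (a : V → List C) (x : V) :
    ((List.range (a x).length).map (Prod.mk x)).map (portOb a) = a x := by
  rw [List.map_map]
  refine List.ext_getElem (by simp) fun i h1 h2 => ?_
  simp [portOb, h2]

theorem represents_vertexValue (G : TypedGraph T) (x : G.V) :
    Represents (portOb (G.ins F)) (portOb (G.outs F)) (vertexValue F G x)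
      ((List.range (G.ins F x).length).map (Prod.mk x)) ((List.range (G.outs F x).length).map (Prod.mk x))
          (G.arr F x) := by
  -- The objects at the ports depend on the typing of all vertices. Restated with words that depend
  -- only on the type of `x`, the claim allows this type to be generalized.
  have h : Represents (portOb (G.ins F)) (portOb (G.outs F)) (vertexValue F G x)
      ((List.range (inWord F (G.τ.v x)).length).map (Prod.mk x))
      ((List.range (outWord F (G.τ.v x)).length).map (Prod.mk x)) (genArr F (G.τ.v x)) ↔
      ((vertexValue F G x).inNames = (List.range (inWord F (G.τ.v x)).length).map (Prod.mk x) ∧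
      (vertexValue F G x).outNames = (List.range (outWord F (G.τ.v x)).length).map (Prod.mk x) ∧
      (vertexValue F G x).src = inWord F (G.τ.v x) ∧ (vertexValue F G x).tgt = outWord F (G.τ.v x) ∧
      Arr.mk _ _ (vertexValue F G x).hom = genArr F (G.τ.v x)) := by
    have e1 := map_portOb_range (G.ins F) x
    have e2 := map_portOb_range (G.outs F) x
    constructor
    · rintro ⟨a, b, c, d, e⟩
      exact ⟨a, b, c.trans e1, d.trans e2, e⟩
    · rintro ⟨a, b, c, d, e⟩
      exact ⟨a, b, c.trans e1.symm, d.trans e2.symm, e⟩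
  refine h.2 ?_
  unfold vertexValue
  generalize G.τ.v x = y
  rcases y with Z | m
  · refine ⟨rfl, rfl, rfl, rfl, ?_⟩
    exact congrArg Arr.id (mul_one (F.obj Z))
  · refine ⟨?_, ?_, rfl, rfl, rfl⟩
    · refine congrArg (fun n => (List.range n).map (Prod.mk x)) ?_
      simp [inWord, src_mor F]
    · refine congrArg (fun n => (List.range n).map (Prod.mk x)) ?_
      simp [outWord, tgt_mor F]

theorem represents_tensorAll (G : TypedGraph T) (vs : List G.V) :
    Represents (portOb (G.ins F)) (portOb (G.outs F)) (tensorAll (vs.map (vertexValue F G)))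
      (ports (G.ins F) vs) (ports (G.outs F) vs) (tensorOf (G.arr F) vs) := by
  induction vs with
  | nil => exact ⟨rfl, rfl, rfl, rfl, rfl⟩
  | cons x vs ih =>
    have h := represents_vertexValue F G x
    rw [ports_cons, ports_cons, tensorOf_cons]
    refine ⟨?_, ?_, ?_, ?_, ?_⟩
    · exact congrArg₂ _ h.inNames ih.inNames
    · exact congrArg₂ _ h.outNames ih.outNames
    · rw [List.map_append]
      exact congrArg₂ _ h.src ih.src
    · rw [List.map_append]
      exact congrArg₂ _ h.tgt ih.tgt
    · exact (mk_cast _ _ _).trans ((mk_mul _ _).symm.trans (congrArg₂ _ h.hom ih.hom))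

/-- The value may be computed with any enumerations, in particular with the vertices ordered as
boundary points followed by the others, and edge by edge. It remains to see that the boundary names
come out in the order of the words. -/
theorem hasNormalForm_of_value {A B : List T.Obj} (G : FramedCospan (wordGraph A) (wordGraph B))
    (f : tensorList (A.map F.obj) ⟶ tensorList (B.map F.obj)) (hf : Arr.mk _ _ f = G.value F) :
    HasNormalForm F G f := by
  intro zs es hzs hz hes he
  have hE : Enumerates es := ⟨hes, he⟩
  have hV : Enumerates (G.dList ++ G.cList ++ zs) := by
    refine ⟨?_, fun x => ?_⟩
    · refine List.nodup_append.2 ⟨List.nodup_append.2 ⟨G.framing.nodup_d, G.framing.nodup_c, ?_⟩, hzs, ?_⟩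
      · rintro x hx y hy rfl
        exact G.no_isolated x ⟨(G.framing.mem_d x).1 hx, (G.framing.mem_c x).1 hy⟩
      · rintro x hx y hy rfl
        rw [List.mem_append, G.framing.mem_d, G.framing.mem_c, ← G.range_d, ← G.range_c] at hx
        exact hx.elim ((hz x).1 hy).1 ((hz x).1 hy).2
    · by_cases hx : x ∈ zs
      · exact List.mem_append_right _ hx
      · refine List.mem_append_left _ (List.mem_append.2 ?_)
        rw [hz, not_and_or, not_not, not_not, G.range_d, G.range_c] at hx
        exact hx.imp (G.framing.mem_d x).2 (G.framing.mem_c x).2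
  have hi := G.framing.isCtr F hV hE
  obtain ⟨I₀, J₀, g', hc, r, s₁, s₂, p₁, p₂⟩ := (represents_tensorAll F G.toTypedGraph _).exists_contractions hi
  have hdw : ports (G.ins F) G.dList = G.dList.map (·, 0) :=
    ports_of_length_eq_one _ fun x hx => TypedGraph.length_ins_of_isWire F _ ((G.framing.mem_d x).1 hx).1
  have hcw : ports (G.outs F) G.cList = G.cList.map (·, 0) :=
    ports_of_length_eq_one _ fun x hx => TypedGraph.length_outs_of_isWire F _ ((G.framing.mem_c x).1 hx).1
  -- The surviving names form a sublist of all ports and are a permutation of the boundary names.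
  -- The boundary names are themselves a sublist, as the boundary vertices are listed first and each
  -- has one port on either side.
  obtain rfl : I₀ = G.dList.map (·, 0) := by
    refine hi.nodupI.eq_of_perm_of_sublist s₁ ?_ p₁
    rw [ports_append, ports_append, hdw, List.append_assoc]
    exact List.sublist_append_left _ _
  obtain rfl : J₀ = G.cList.map (·, 0) := by
    refine hi.nodupJ.eq_of_perm_of_sublist s₂ ?_ p₂
    rw [ports_append, ports_append, hcw, List.append_assoc]
    exact (List.sublist_append_left _ _).trans (List.sublist_append_right _ _)
  refine ⟨G.dList.map (·, 0), G.cList.map (·, 0), ?_⟩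
  have hn : (es.map fun e => (G.inName e, G.outName e)) = es.map (edgeNames G.toTypedGraph) :=
    List.map_congr_left fun e _ => (TypedGraph.edgeNames_eq _ e).symm
  rw [hn] at hc
  have hg : g' = ⟨G.dList.map (·, 0), G.cList.map (·, 0), A.map F.obj, B.map F.obj, f⟩ := by
    have e1 : (G.dList.map (·, 0)).map (portOb (G.ins F)) = A.map F.obj := by
      rw [List.map_map, List.map_ofFn]
      refine Eq.trans (congrArg List.ofFn (funext fun i => ?_)) ((List.map_ofFn (f := A.get) (g := F.obj)).symm.trans
        (congrArg _ (List.ofFn_get A)))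
      have := G.d.τ_v i
      exact congrArg (fun y => (inWord F y).getD 0 1) this
    have e2 : (G.cList.map (·, 0)).map (portOb (G.outs F)) = B.map F.obj := by
      rw [List.map_map, List.map_ofFn]
      refine Eq.trans (congrArg List.ofFn (funext fun i => ?_)) ((List.map_ofFn (f := B.get) (g := F.obj)).symm.trans
        (congrArg _ (List.ofFn_get B)))
      have := G.c.τ_v i
      exact congrArg (fun y => (outWord F y).getD 0 1) this
    obtain ⟨I, J, S, R, h⟩ := g'
    obtain ⟨r1, r2, r3, r4, r5⟩ := r
    dsimp only at r1 r2 r3 r4 h r5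
    rw [e1] at r3
    rw [e2] at r4
    subst r1 r2 r3 r4
    exact congrArg _ (mk_inj (r5.trans ((G.value_eq F hV hE).symm.trans hf.symm)))
  rw [hg] at hc
  exact hc

end

/-! ## Framed cospans generated by boxes -/

namespace FramedCospan

variable {T : MonoidalSignature.{u, v}} {A B D X A' B' : List T.Obj}

/-- The framed cospans that arise from boxes by the operations of a strict symmetric traced category, up to
wire-homeomorphism. -/
inductive Generated : ∀ {A B : List T.Obj}, FramedCospan (wordGraph A) (wordGraph B) → Prop
  | pseudoId (A : List T.Obj) : Generated (pseudoId A)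
  | swap (A B : List T.Obj) : Generated (swap A B)
  | box (m : T.Mor) : Generated (box m)
  | link {A B D : List T.Obj} {G : FramedCospan (wordGraph A) (wordGraph B)}
      {H : FramedCospan (wordGraph B) (wordGraph D)} (hG : Generated G) (hH : Generated H) :
      Generated (G.link H)
  | tensor {A B A' B' : List T.Obj} {G : FramedCospan (wordGraph A) (wordGraph B)}
      {H : FramedCospan (wordGraph A') (wordGraph B')} (hG : Generated G) (hH : Generated H) :
      Generated (G.tensor H)
  | trace {A B X : List T.Obj} {G : FramedCospan (wordGraph (A ++ X)) (wordGraph (B ++ X))}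
      (hG : Generated G) : Generated G.trace
  | congr {A B : List T.Obj} {G H : FramedCospan (wordGraph A) (wordGraph B)} (h : cls G = cls H)
      (hG : Generated G) : Generated H

/-- Lists of names parallel to the words of types record which permutation of positions a bundle of
wires realises, even if types are repeated. -/
theorem getElem?_splitFin_symm {α β : Type*} (A B : List α) {L : List β} (M : List β) (h : L.length = A.length)
    (s : Fin A.length ⊕ Fin B.length) :
    (L ++ M)[((splitFin A B).symm s).1]? = s.elim (fun i => L[i.1]?) (fun i => M[i.1]?) := by
  rcases s with i | i
  · have hi : i.1 < L.length := lt_of_lt_of_eq i.2 h.symm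
    simp [splitFin, List.getElem?_append_left hi]
  · simp [splitFin, ← h, List.getElem?_append_right]

theorem getElem?_sumCongr {α β : Type*} {A B A' B' : List α} {L M L' M' : List β} {π : Fin A.length ≃ Fin B.length}
    {σ : Fin A'.length ≃ Fin B'.length} (hL : L.length = A.length) (hM : M.length = B.length)
    (h : ∀ i, M[(π i).1]? = L[i.1]?) (h' : ∀ i, M'[(σ i).1]? = L'[i.1]?) (i : Fin (A ++ A').length) :
    (M ++ M')[(((splitFin A A').trans ((Equiv.sumCongr π σ).trans (splitFin B B').symm)) i).1]? =
        (L ++ L')[i.1]? := by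
  refine (getElem?_splitFin_symm B B' M' hM _).trans ?_
  obtain ⟨s, rfl⟩ := (splitFin A A').symm.surjective i
  rw [getElem?_splitFin_symm A A' L' hL, Equiv.apply_symm_apply]
  rcases s with s | s
  exacts [h s, h' s]

theorem getElem?_swapFin {α β : Type*} {A B : List α} {L M : List β} (hL : L.length = A.length)
    (hM : M.length = B.length)
    (i : Fin (A ++ B).length) : (M ++ L)[(swapFin A B i).1]? = (L ++ M)[i.1]? := by
  refine (getElem?_splitFin_symm B A L hM _).trans ?_
  obtain ⟨s, rfl⟩ := (splitFin A B).symm.surjective i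
  rw [getElem?_splitFin_symm A B M hL, Equiv.apply_symm_apply]
  rcases s with s | s <;> rfl

/-- A reordering of lists is built from exchanges of neighbours, which are symmetries tensored with
identities. The condition on entries keeps track of the permutation obtained. -/
theorem exists_generated_wires {ι : Type*} (ob : ι → T.Obj) {L M : List ι} (h : L.Perm M) :
    ∃ (π : Fin (L.map ob).length ≃ Fin (M.map ob).length) (hπ : ∀ i, (M.map ob).get (π i) = (L.map ob).get i),
      (∀ i, M[(π i).1]? = L[i.1]?) ∧ Generated (wires π hπ) := by
  induction h with
  | nil => exact ⟨Equiv.refl _, fun _ => rfl, fun _ => rfl, .pseudoId []⟩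
  | @cons a L M _ ih =>
    obtain ⟨π, hπ, hn, hg⟩ := ih
    exact ⟨_, get_sumCongr (A := [ob a]) (B := [ob a]) (π := Equiv.refl _) (fun _ => rfl) hπ,
      getElem?_sumCongr (A := [ob a]) (B := [ob a]) (L := [a]) (M := [a]) (π := Equiv.refl _) rfl rfl
          (fun _ => rfl) hn,
      .congr (cls_wires_tensor_wires _ _ _ _ _) (.tensor (.pseudoId [ob a]) hg)⟩
  | swap x y L =>
    exact ⟨_, get_sumCongr (A := [ob y] ++ [ob x]) (B := [ob x] ++ [ob y]) (π := swapFin [ob y] [ob x])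
        (get_swapFin _ _) (A' := L.map ob) (B' := L.map ob) (σ := Equiv.refl _) (fun _ => rfl),
      getElem?_sumCongr (A := [ob y] ++ [ob x]) (B := [ob x] ++ [ob y]) (L := [y] ++ [x]) (M := [x] ++ [y]) rfl rfl
        (getElem?_swapFin (A := [ob y]) (B := [ob x]) (L := [y]) (M := [x]) rfl rfl) (fun _ => rfl),
      .congr (cls_wires_tensor_wires _ _ _ _ _) (.tensor (.swap [ob y] [ob x]) (.pseudoId (L.map ob)))⟩
  | trans _ _ ih ih' =>
    obtain ⟨π, hπ, hn, hg⟩ := ih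
    obtain ⟨σ, hσ, hn', hg'⟩ := ih'
    exact ⟨π.trans σ, fun i => (hσ _).trans (hπ i), fun i => (hn' _).trans (hn i),
      .congr (cls_wires_link_wires _ _ _ _) (.link hg hg')⟩

/-- The positions of `A` are taken as names. They are distinct, so the entries determine the
permutation that has been generated. -/
theorem generated_wires (π : Fin A.length ≃ Fin B.length) (hπ : ∀ i, B.get (π i) = A.get i) :
    Generated (wires π hπ) := by
  have hp : (List.ofFn fun i : Fin A.length => i).Perm (List.ofFn fun i : Fin B.length => π.symm i) :=
    (enumerates_ofFn Function.bijective_id).perm (enumerates_ofFn π.symm.bijective)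
  have hA : (List.ofFn fun i : Fin A.length => i).map A.get = A := by
    rw [List.map_ofFn]
    exact List.ofFn_get A
  have hB : (List.ofFn fun i : Fin B.length => π.symm i).map A.get = B := by
    rw [List.map_ofFn]
    refine Eq.trans (congrArg List.ofFn (funext fun i => ?_)) (List.ofFn_get B)
    exact (hπ _).symm.trans (congrArg B.get (π.apply_symm_apply i))
  obtain ⟨σ, hσ, hn, hg⟩ := exists_generated_wires A.get hp
  -- The words obtained from the names equal `A` and `B` only propositionally; abstracting them
  -- allows the equalities to be eliminated.
  suffices h : ∀ (A' B' : List T.Obj) (hA : A' = A) (hB : B' = B) (σ : Fin A'.length ≃ Fin B'.length)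
      (hσ : ∀ i, B'.get (σ i) = A'.get i)
      (hn : ∀ i, (List.ofFn fun i : Fin B.length => π.symm i)[(σ i).1]? =
          (List.ofFn fun i : Fin A.length => i)[i.1]?),
      Generated (wires σ hσ) → Generated (wires π hπ) from h _ _ hA hB σ hσ hn hg
  rintro _ _ rfl rfl σ hσ hn hg
  refine .congr (cls_wires_congr (Equiv.ext fun i => ?_) _ _) hg
  have := hn i
  simp at this
  exact (Equiv.symm_apply_eq π).1 this

/-- Relabelling is linking with permuted wires on both sides. -/
theorem Generated.relabel {G : FramedCospan (wordGraph A) (wordGraph B)} (hG : Generated G)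
    (π : Fin A'.length ≃ Fin A.length) (hπ : ∀ i, A.get (π i) = A'.get i)
    (σ : Fin B'.length ≃ Fin B.length) (hσ : ∀ i, B.get (σ i) = B'.get i) :
    Generated (G.relabel π hπ σ hσ) := by
  refine .congr (cls_wires_link π hπ (G.relabel (Equiv.refl _) (fun _ => rfl) σ hσ)) (.link (generated_wires _ _) ?_)
  have h : ∀ i, B'.get (σ.symm i) = B.get i := fun i => by rw [← hσ, Equiv.apply_symm_apply]
  exact .congr (cls_link_wires G σ.symm h hσ) (.link hG (generated_wires _ _))

end FramedCospan

/-! ### Uniqueness on generated framed cospans -/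

section Uniqueness

variable {T : MonoidalSignature.{u₁, v₁}} {C : Type u} [TracedStruct.{u, v} C]
  [IsStrictSymmetricTraced C] {F : T.Hom (underlyingSignature C)}

attribute [local instance] TracedStruct.objMonoid

open Arr FramedCospan

/-- A strict symmetric traced functor is determined on generated framed cospans. -/
theorem StrictTracedFunctor.map_eq_value (E : StrictTracedFunctor (FCspPlus T) C)
    (hE : (FCspPlus.generators T).comp E.underlying = F) {A B : List T.Obj}
    {G : FramedCospan (wordGraph A) (wordGraph B)} (hG : Generated G) :
    Arr.mk (E.obj A) (E.obj B) (E.map (FCspPlus.mk G)) = G.value F := by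
  induction hG with
  | pseudoId A =>
    refine Eq.trans ?_ (value_pseudoId F A).symm
    exact (congrArg (Arr.mk _ _) (E.map_id A)).trans (congrArg Arr.id (E.obj_word hE A))
  | swap A B =>
    refine Eq.trans ?_ (value_swap F A B).symm
    refine (mk_cast _ _ _).symm.trans ((congrArg (Arr.mk _ _) (E.map_braid A B)).trans ?_)
    exact congrArg₂ br (E.obj_word hE A) (E.obj_word hE B)
  | box m =>
    subst hE
    refine Eq.trans ?_ (value_box _ m).symm
    exact ((mk_cast _ _ _).trans (mk_map_cast E _ _ _)).symm
  | @link A B D G H _ _ hG hH =>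
    refine Eq.trans ?_ (value_link F G H).symm
    refine (congrArg (fun f => Arr.mk (E.obj A) (E.obj D) (E.map f)) (cls_comp G H).symm).trans ?_
    refine (congrArg (Arr.mk _ _) (E.map_comp (FCspPlus.mk G) (FCspPlus.mk H))).trans ?_
    refine (mk_comp (E.map (FCspPlus.mk G)) (E.map (FCspPlus.mk H))).symm.trans ?_
    exact congrArg₂ (· ⨟ ·) hG hH
  | @tensor A B A' B' G H _ _ hG hH =>
    refine Eq.trans ?_ (value_tensor F G H).symm
    refine (mk_cast _ _ _).symm.trans ((congrArg (Arr.mk _ _)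
      (E.map_tensorHom (FCspPlus.mk G) (FCspPlus.mk H))).trans ?_)
    exact congrArg₂ (· * ·) hG hH
  | @trace A B X G _ hG =>
    refine Eq.trans ?_ (value_trace F _).symm
    refine (congrArg (Arr.mk _ _) (E.map_trace (A := A) (B := B) X (FCspPlus.mk G))).trans ((tr_mk _).symm.trans ?_)
    refine (congrArg _ ((mk_cast _ _ _).trans hG)).trans ?_
    rw [E.obj_word hE A, E.obj_word hE B, E.obj_word hE X]
    rfl
  | congr h _ hG =>
    refine Eq.trans ?_ (hG.trans (value_congr F h))
    exact congrArg (fun f => Arr.mk _ _ (E.map f)) h.symm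

end Uniqueness

/-! ## Cutting a string graph into boxes and bare wires -/

namespace FramedCospan

variable {T : MonoidalSignature.{u, v}} {A B A' B' : List T.Obj}

/-- A disjoint union of boxes and bare wires that maps onto the part of a string graph with box-vertices `S`
and edges `U`. -/
structure Explosion (H G : TypedGraph T) (S : Set G.V) (U : Set G.E) extends toTypedHom : H.Hom G where
  mem_boundary : ∀ x, H.IsWire x → x ∈ H.boundary
  bijOn_box : Set.BijOn v {x | H.IsBox x} S
  e_injective : Function.Injective e
  range_e : Set.range e = U

/-- A part of a string graph arises from generated framed cospans. -/
def Exploded (G : TypedGraph T) (S : Set G.V) (U : Set G.E) : Prop :=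
  ∃ (A B : List T.Obj) (H : FramedCospan (wordGraph A) (wordGraph B)),
    Generated H ∧ Nonempty (Explosion H.toTypedGraph G S U)

theorem tensor_boundary {H : FramedCospan (wordGraph A) (wordGraph B)}
    {H' : FramedCospan (wordGraph A') (wordGraph B')}
    (h : ∀ x, H.IsWire x → x ∈ H.boundary) (h' : ∀ x, H'.IsWire x → x ∈ H'.boundary) (x)
        (hx : (H.tensor H').IsWire x) :
    x ∈ (H.tensor H').boundary := by
  rcases x with x | x
  · exact (h x hx).imp (sumGraph_inputs _ _ (Sum.inl x)).2 (sumGraph_outputs _ _ (Sum.inl x)).2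
  · exact (h' x hx).imp (sumGraph_inputs _ _ (Sum.inr x)).2 (sumGraph_outputs _ _ (Sum.inr x)).2

/-- Only boxes and edges have to be disjoint. A wire-vertex may be hit from both parts: this is
where the graph has been cut. -/
theorem Exploded.union {G : TypedGraph T} {S S' : Set G.V} {U U' : Set G.E} (h : Exploded G S U)
    (h' : Exploded G S' U')
    (hS : ∀ x ∈ S, x ∉ S') (hU : ∀ e ∈ U, e ∉ U') : Exploded G (S ∪ S') (U ∪ U') := by
  obtain ⟨A, B, H, hH, ⟨p⟩⟩ := h
  obtain ⟨A', B', H', hH', ⟨q⟩⟩ := h'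
  refine ⟨_, _, _, hH.tensor hH', ⟨
    { v := Sum.elim p.v q.v
      e := Sum.elim p.e q.e
      src_e := ?_, tgt_e := ?_, τ_v := ?_, τ_e := ?_
      mem_boundary := tensor_boundary p.mem_boundary q.mem_boundary
      bijOn_box := ⟨?_, ?_, ?_⟩
      e_injective := ?_
      range_e := by rw [Set.Sum.elim_range, p.range_e, q.range_e] }⟩⟩
  · rintro (e | e)
    exacts [p.src_e e, q.src_e e]
  · rintro (e | e)
    exacts [p.tgt_e e, q.tgt_e e]
  · rintro (e | e)
    exacts [p.τ_v e, q.τ_v e]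
  · rintro (e | e)
    exacts [p.τ_e e, q.τ_e e]
  · rintro (x | x) hx
    exacts [Or.inl (p.bijOn_box.mapsTo hx), Or.inr (q.bijOn_box.mapsTo hx)]
  · rintro (x | x) hx (y | y) hy hxy
    · exact congrArg _ (p.bijOn_box.injOn hx hy hxy)
    · exact absurd (q.bijOn_box.mapsTo hy) (by rw [← show p.v x = q.v y from hxy]; exact hS _ (p.bijOn_box.mapsTo hx))
    · exact absurd (q.bijOn_box.mapsTo hx) (by rw [show q.v x = p.v y from hxy]; exact hS _ (p.bijOn_box.mapsTo hy))
    · exact congrArg _ (q.bijOn_box.injOn hx hy hxy)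
  · rintro x (hx | hx)
    · obtain ⟨y, hy, rfl⟩ := p.bijOn_box.surjOn hx
      exact ⟨Sum.inl y, hy, rfl⟩
    · obtain ⟨y, hy, rfl⟩ := q.bijOn_box.surjOn hx
      exact ⟨Sum.inr y, hy, rfl⟩
  · refine p.e_injective.sumElim q.e_injective fun x y hxy => ?_
    refine hU (p.e x) (p.range_e.subset ⟨x, rfl⟩) ?_
    rw [hxy]
    exact q.range_e.subset ⟨y, rfl⟩

theorem pseudoId_boundary (A : List T.Obj) (x) : x ∈ (pseudoId A).boundary := by
  rw [← (pseudoId A).range]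
  rcases x with x | x
  exacts [⟨Sum.inl x, rfl⟩, ⟨Sum.inr x, rfl⟩]

theorem pseudoId_not_isBox (A : List T.Obj) (x) : ¬ (pseudoId A).IsBox x := by
  rcases x with x | x <;> rintro ⟨f, hf⟩ <;> cases hf

theorem exploded_empty (G : TypedGraph T) : Exploded G ∅ ∅ := by
  refine ⟨[], [], _, .pseudoId [], ⟨
    { v := Sum.elim (fun i => i.elim0) (fun i => i.elim0)
      e := fun i => i.elim0
      src_e := fun i => i.elim0, tgt_e := fun i => i.elim0, τ_v := ?_, τ_e := fun i => i.elim0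
      mem_boundary := fun x _ => pseudoId_boundary _ x
      bijOn_box := ⟨fun x hx => absurd hx (pseudoId_not_isBox _ x), fun x hx => absurd hx (pseudoId_not_isBox _ x),
        fun x hx => hx.elim⟩
      e_injective := fun i => i.elim0
      range_e := Set.eq_empty_of_forall_notMem fun _ ⟨i, _⟩ => i.elim0 }⟩⟩
  rintro (i | i) <;> exact i.elim0

theorem exploded_wire (G : TypedGraph T) {e : G.E} {Z : T.Obj} (he : G.τ.e e = .mid Z) : Exploded G ∅ {e} := by
  have hs := G.τ.src_e e
  have ht := G.τ.tgt_e e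
  rw [he] at hs ht
  have h0 : ∀ i : Fin ([Z] : List T.Obj).length, ([Z] : List T.Obj).get i = Z := fun i => by
    obtain ⟨i, hi⟩ := i
    obtain rfl : i = 0 := Nat.lt_one_iff.1 hi
    rfl
  refine ⟨[Z], [Z], _, .pseudoId [Z], ⟨
    { v := Sum.elim (fun _ => G.src e) (fun _ => G.tgt e)
      e := fun _ => e
      src_e := fun _ => rfl, tgt_e := fun _ => rfl, τ_v := ?_
      τ_e := fun i => he.trans (congrArg TypeEdge.mid (h0 i).symm)
      mem_boundary := fun x _ => pseudoId_boundary _ x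
      bijOn_box := ⟨fun x hx => absurd hx (pseudoId_not_isBox _ x), fun x hx => absurd hx (pseudoId_not_isBox _ x),
        fun x hx => hx.elim⟩
      e_injective := fun i j _ => Subsingleton.elim (α := Fin 1) i j
      range_e := Set.eq_singleton_iff_unique_mem.2 ⟨⟨(0 : Fin 1), rfl⟩, fun _ ⟨_, h⟩ => h.symm⟩ }⟩⟩
  rintro (i | i)
  · exact hs.symm.trans (congrArg Sum.inl (h0 i).symm)
  · exact ht.symm.trans (congrArg Sum.inl (h0 i).symm)

/-- The local isomorphism supplies exactly one edge for each port of the box, with the other end of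
the edge as image of the corresponding boundary vertex. Some of these ends may coincide, for
instance if an output is fed back into the same box through one wire-vertex. -/
theorem exploded_box (G : StringGraph T) {x : G.V} (hx : G.IsBox x) : Exploded G.toTypedGraph {x} (G.nbhd x) := by
  have hl := G.local_iso x hx
  obtain ⟨m, hm⟩ := hx
  rw [hm] at hl
  have hi : ∀ i, ∃ e, G.tgt e = x ∧ G.τ.e e = .inp m i := fun i => by
    obtain ⟨e, he, h⟩ := hl.surjOn (show TypeEdge.inp m i ∈ _ from Or.inr rfl)
    refine ⟨e, he.resolve_left fun h' => ?_, h⟩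
    have := G.τ.src_e e
    rw [h, h', hm] at this
    cases this
  have ho : ∀ j, ∃ e, G.src e = x ∧ G.τ.e e = .out m j := fun j => by
    obtain ⟨e, he, h⟩ := hl.surjOn (show TypeEdge.out m j ∈ _ from Or.inl rfl)
    refine ⟨e, he.resolve_right fun h' => ?_, h⟩
    have := G.τ.tgt_e e
    rw [h, h', hm] at this
    cases this
  choose a ha ha' using hi
  choose b hb hb' using ho
  refine ⟨_, _, _, .box m, ⟨
    { v := Sum.elim (fun _ => x) (Sum.elim (fun i => G.src (a i)) (fun j => G.tgt (b j)))
      e := Sum.elim a b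
      src_e := ?_, tgt_e := ?_, τ_v := ?_, τ_e := ?_, mem_boundary := ?_
      bijOn_box := ⟨?_, ?_, ?_⟩
      e_injective := ?_, range_e := ?_ }⟩⟩
  · rintro (i | j)
    exacts [rfl, hb j]
  · rintro (i | j)
    exacts [ha i, rfl]
  · rintro (_ | i | j)
    · exact hm
    · exact (G.τ.src_e (a i)).symm.trans (congrArg (typegraph T).src (ha' i))
    · exact (G.τ.tgt_e (b j)).symm.trans (congrArg (typegraph T).tgt (hb' j))
  · rintro (i | j)
    exacts [ha' i, hb' j]
  · rintro (_ | i | j) ⟨Z, hZ⟩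
    · cases hZ
    · rw [← (box m).range]
      exact ⟨Sum.inl i, rfl⟩
    · rw [← (box m).range]
      exact ⟨Sum.inr j, rfl⟩
  · rintro (_ | i | j) ⟨f, hf⟩
    · rfl
    · cases hf
    · cases hf
  · rintro (_ | i | j) ⟨f, hf⟩ (_ | i' | j') ⟨f', hf'⟩ h
    · rfl
    all_goals first | (cases hf; done) | cases hf'
  · rintro _ rfl
    exact ⟨Sum.inl (), ⟨m, rfl⟩, rfl⟩
  · rintro (i | i) (j | j) h
    · have := (ha' i).symm.trans ((congrArg G.τ.e h).trans (ha' j))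
      cases this
      rfl
    · cases (ha' i).symm.trans ((congrArg G.τ.e h).trans (hb' j))
    · cases (hb' i).symm.trans ((congrArg G.τ.e h).trans (ha' j))
    · have := (hb' i).symm.trans ((congrArg G.τ.e h).trans (hb' j))
      cases this
      rfl
  · ext e
    constructor
    · rintro ⟨i | j, rfl⟩
      exacts [Or.inr (ha i), Or.inl (hb j)]
    · intro he
      have ht := hl.mapsTo he
      cases h : G.τ.e e with
      | mid Z =>
        rw [h] at ht
        rcases ht with ht | ht <;> cases ht
      | inp f i =>
        rw [h] at ht
        rcases ht with ht | ht <;> cases ht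
        exact ⟨Sum.inl i, hl.injOn (Or.inr (ha i)) he ((ha' i).trans h.symm)⟩
      | out f j =>
        rw [h] at ht
        rcases ht with ht | ht <;> cases ht
        exact ⟨Sum.inr j, hl.injOn (Or.inl (hb j)) he ((hb' j).trans h.symm)⟩

/-- No edge of the typegraph joins two boxes, so the neighbourhoods of different boxes share no
edge. -/
theorem not_isBox_src_tgt (G : TypedGraph T) {e : G.E} (hs : G.IsBox (G.src e)) (ht : G.IsBox (G.tgt e)) : False := by
  obtain ⟨m, hm⟩ := hs
  obtain ⟨n, hn⟩ := ht
  have h1 := (G.τ.src_e e).trans hm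
  have h2 := (G.τ.tgt_e e).trans hn
  cases h : G.τ.e e <;> rw [h] at h1 h2 <;> first | (cases h1; done) | cases h2

/-- One box after the other is split off; their neighbourhoods are disjoint by `not_isBox_src_tgt`.
-/
theorem exploded_boxes (G : StringGraph T) : Exploded G.toTypedGraph {x | G.IsBox x}
    {e | G.IsBox (G.src e) ∨ G.IsBox (G.tgt e)} := by
  have := G.finite_V
  suffices h : ∀ S : Set G.V, S.Finite → (∀ x ∈ S, G.IsBox x) →
      Exploded G.toTypedGraph S {e | G.src e ∈ S ∨ G.tgt e ∈ S} from h _ (Set.toFinite _) fun _ => id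
  intro S hS
  induction S, hS using Set.Finite.induction_on with
  | empty =>
    intro _
    convert exploded_empty G.toTypedGraph
    simp
  | @insert x S hx _ ih =>
    intro hS
    have := (exploded_box G (hS x (Set.mem_insert _ _))).union (ih fun y hy => hS y (Set.mem_insert_of_mem _ hy))
      (fun y hy => by rwa [hy]) ?_
    · convert this using 1
      · exact Set.insert_eq _ _
      · ext e
        change (G.src e = x ∨ _) ∨ (G.tgt e = x ∨ _) ↔ (_ ∨ _) ∨ (_ ∨ _)
        tauto
    · rintro e (rfl | rfl) (h | h)
      · exact hx h
      · exact not_isBox_src_tgt G.toTypedGraph (hS _ (Set.mem_insert _ _)) (hS _ (Set.mem_insert_of_mem _ h))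
      · exact not_isBox_src_tgt G.toTypedGraph (hS _ (Set.mem_insert_of_mem _ h)) (hS _ (Set.mem_insert _ _))
      · exact hx h

/-- The edges that touch no box have type `mid`, and each of them is added as a bare wire. -/
theorem exploded_univ (G : StringGraph T) : Exploded G.toTypedGraph {x | G.IsBox x} Set.univ := by
  have := G.finite_E
  suffices h : ∀ U : Set G.E, U.Finite → (∀ e ∈ U, ¬ (G.IsBox (G.src e) ∨ G.IsBox (G.tgt e))) →
      Exploded G.toTypedGraph {x | G.IsBox x} ({e | G.IsBox (G.src e) ∨ G.IsBox (G.tgt e)} ∪ U) by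
    have := h {e | G.IsBox (G.src e) ∨ G.IsBox (G.tgt e)}ᶜ (Set.toFinite _) fun _ => id
    rwa [Set.union_compl_self] at this
  intro U hU
  induction U, hU using Set.Finite.induction_on with
  | empty =>
    intro _
    rw [Set.union_empty]
    exact exploded_boxes G
  | @insert e U he _ ih =>
    intro hU
    have hb := hU e (Set.mem_insert _ _)
    have hm : ∃ Z, G.τ.e e = .mid Z := by
      have h1 := G.τ.src_e e
      have h2 := G.τ.tgt_e e
      cases h : G.τ.e e with
      | mid Z => exact ⟨Z, rfl⟩
      | inp f i => exact absurd (Or.inr ⟨f, by rw [← h2, h]; rfl⟩) hb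
      | out f j => exact absurd (Or.inl ⟨f, by rw [← h1, h]; rfl⟩) hb
    obtain ⟨Z, hZ⟩ := hm
    have := (exploded_wire G.toTypedGraph hZ).union (ih fun y hy => hU y (Set.mem_insert_of_mem _ hy))
      (fun y hy => hy.elim) ?_
    · convert this using 1
      · rw [Set.empty_union]
      · rw [Set.union_left_comm, Set.insert_eq]
    · rintro _ rfl (h | h)
      exacts [hb h, he h]

end FramedCospan

/-! ## Every framed cospan is generated -/

theorem exists_word {α ι : Type*} [Finite α] (t : α → ι) :
    ∃ (X : List ι) (f : Fin X.length → α), Function.Bijective f ∧ ∀ k, t (f k) = X.get k := by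
  obtain ⟨n, ⟨e⟩⟩ := Finite.exists_equiv_fin α
  have h : (List.ofFn fun k => t (e.symm k)).length = n := List.length_ofFn
  exact ⟨List.ofFn fun k => t (e.symm k), fun k => e.symm (finCongr h k),
    ((finCongr h).trans e.symm).bijective, fun k => (List.get_ofFn _ k).symm⟩

theorem Set.BijOn.exists_lift {α β γ : Type*} {f : α → β} {I : Set α} {J : Set β} (h : Set.BijOn f I J) {D : γ → β}
    (hD : Function.Injective D) (hr : Set.range D = J) :
    ∃ d : γ → α, Function.Injective d ∧ Set.range d = I ∧ ∀ i, f (d i) = D i := by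
  have hd : ∀ i, ∃ y ∈ I, f y = D i := fun i => h.surjOn (hr.subset ⟨i, rfl⟩)
  choose d hd hf using hd
  refine ⟨d, fun i j hij => hD (by rw [← hf, hij, hf]), Set.Subset.antisymm (by rintro _ ⟨i, rfl⟩; exact hd i) ?_, hf⟩
  intro y hy
  obtain ⟨i, hi⟩ := hr.superset (h.mapsTo hy)
  exact ⟨i, h.injOn (hd i) hy ((hf i).trans hi)⟩

/-- Used to order the boundary of the cut graph by lifting an enumeration from the original graph:
first its own boundary points, then the interior wire-vertices. -/
theorem Set.BijOn.exists_frame {α β ι : Type*} {f : α → β} {I : Set α} {J : Set β} (h : Set.BijOn f I J)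
    {A X : List ι} {g : Fin A.length → β} {k : Fin X.length → β} (hg : Function.Injective g)
    (hk : Function.Injective k) (hgk : ∀ i j, g i ≠ k j) (hr : Set.range g ∪ Set.range k = J) :
    ∃ d : Fin (A ++ X).length → α, Function.Injective d ∧ Set.range d = I ∧
      ∀ s, f (d ((splitFin A X).symm s)) = Sum.elim g k s := by
  obtain ⟨d, hd, hdr, hdf⟩ := h.exists_lift (D := Sum.elim g k ∘ splitFin A X)
    ((hg.sumElim hk hgk).comp (splitFin A X).injective)
    (by rw [EquivLike.range_comp, Set.Sum.elim_range, hr])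
  exact ⟨d, hd, hdr, fun s => by rw [hdf, Function.comp_apply, Equiv.apply_symm_apply]⟩

namespace FramedCospan

variable {T : MonoidalSignature.{u, v}} {A B A' B' X : List T.Obj}

/-- Two enumerations of the same boundary differ by a permutation of positions, so this is a
relabelling. -/
theorem Generated.reframe {H : FramedCospan (wordGraph A') (wordGraph B')} (hH : Generated H)
    (d : Fin A.length → H.V) (c : Fin B.length → H.V) (hd : ∀ i, H.τ.v (d i) = Sum.inl (A.get i))
    (hc : ∀ i, H.τ.v (c i) = Sum.inl (B.get i)) (hdi : Function.Injective d)
    (hci : Function.Injective c) (hdr : Set.range d = H.inputs) (hcr : Set.range c = H.outputs) :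
    Generated (ofWords H.toStringGraph d c hd hc hdi hci hdr hcr H.no_isolated) := by
  let π : Fin A.length ≃ Fin A'.length := (Equiv.ofInjective d hdi).trans
    ((Equiv.setCongr (hdr.trans H.range_d.symm)).trans
        (Equiv.ofInjective (α := Fin A'.length) H.d.v H.d_injective).symm)
  let σ : Fin B.length ≃ Fin B'.length := (Equiv.ofInjective c hci).trans
    ((Equiv.setCongr (hcr.trans H.range_c.symm)).trans
        (Equiv.ofInjective (α := Fin B'.length) H.c.v H.c_injective).symm)
  have hπ : ∀ i, H.d.v (π i) = d i := fun i =>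
    Equiv.apply_ofInjective_symm (α := Fin A'.length) H.d_injective _
  have hσ : ∀ i, H.c.v (σ i) = c i := fun i =>
    Equiv.apply_ofInjective_symm (α := Fin B'.length) H.c_injective _
  have hπ' : ∀ i, A'.get (π i) = A.get i := fun i => Sum.inl_injective (β := T.Mor)
    ((H.d.τ_v (π i)).symm.trans ((congrArg H.τ.v (hπ i)).trans (hd i)))
  have hσ' : ∀ i, B'.get (σ i) = B.get i := fun i => Sum.inl_injective (β := T.Mor)
    ((H.c.τ_v (σ i)).symm.trans ((congrArg H.τ.v (hσ i)).trans (hc i)))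
  exact .congr (cls_iso (G := H.relabel π hπ' σ hσ')
    { v := Equiv.refl _, e := Equiv.refl _, src_e := fun _ => rfl, tgt_e := fun _ => rfl
      τ_v := fun _ => rfl, τ_e := fun _ => rfl, d_v := fun i => (hπ i).symm, c_v := fun i => (hσ i).symm })
    (hH.relabel π hπ' σ hσ')

section explosion

variable {H : FramedCospan (wordGraph A') (wordGraph B')} {G : StringGraph T}
  (p : Explosion H.toTypedGraph G.toTypedGraph {x | G.IsBox x} Set.univ)

namespace Explosion

theorem isWire_iff (x : H.V) : G.IsWire (p.v x) ↔ H.IsWire x := by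
  simp only [TypedGraph.IsWire, p.τ_v]

theorem exists_e (e : G.E) : ∃ e', p.e e' = e := by
  have : e ∈ Set.range p.e := p.range_e.superset (Set.mem_univ e)
  exact this

/-- An input of the cut graph is the start of exactly one edge, and edges correspond bijectively. So
these inputs match the wire-vertices with an outgoing edge, that is, those that are not outputs. -/
theorem bijOn_inputs : Set.BijOn p.v H.inputs {x | G.IsWire x ∧ x ∉ G.outputs} := by
  have key : ∀ x ∈ H.inputs, ∃ e, H.src e = x := fun x hx => by
    by_contra! h
    exact H.no_isolated x ⟨hx, hx.1, h⟩
  refine ⟨fun x hx => ⟨(p.isWire_iff x).2 hx.1, fun h => ?_⟩, fun x hx y hy hxy => ?_, fun x hx => ?_⟩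
  · obtain ⟨e, rfl⟩ := key x hx
    exact h.2 (p.e e) (p.src_e e)
  · obtain ⟨e, rfl⟩ := key x hx
    obtain ⟨e', rfl⟩ := key y hy
    refine congrArg H.src (p.e_injective (G.out_unique _ _ ?_ ?_))
    · rw [p.src_e]
      exact (p.isWire_iff _).2 hx.1
    · rw [p.src_e, p.src_e]
      exact hxy
  · have : ∃ e, G.src e = x := by
      by_contra! h
      exact hx.2 ⟨hx.1, h⟩
    obtain ⟨e, rfl⟩ := this
    obtain ⟨e, rfl⟩ := p.exists_e e
    have hw := (p.isWire_iff (H.src e)).1 (p.src_e e ▸ hx.1)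
    exact ⟨H.src e, (p.mem_boundary _ hw).resolve_right fun h => h.2 e rfl, (p.src_e e).symm⟩

theorem bijOn_outputs : Set.BijOn p.v H.outputs {x | G.IsWire x ∧ x ∉ G.inputs} := by
  have key : ∀ x ∈ H.outputs, ∃ e, H.tgt e = x := fun x hx => by
    by_contra! h
    exact H.no_isolated x ⟨⟨hx.1, h⟩, hx⟩
  refine ⟨fun x hx => ⟨(p.isWire_iff x).2 hx.1, fun h => ?_⟩, fun x hx y hy hxy => ?_, fun x hx => ?_⟩
  · obtain ⟨e, rfl⟩ := key x hx
    exact h.2 (p.e e) (p.tgt_e e)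
  · obtain ⟨e, rfl⟩ := key x hx
    obtain ⟨e', rfl⟩ := key y hy
    refine congrArg H.tgt (p.e_injective (G.in_unique _ _ ?_ ?_))
    · rw [p.tgt_e]
      exact (p.isWire_iff _).2 hx.1
    · rw [p.tgt_e, p.tgt_e]
      exact hxy
  · have : ∃ e, G.tgt e = x := by
      by_contra! h
      exact hx.2 ⟨hx.1, h⟩
    obtain ⟨e, rfl⟩ := this
    obtain ⟨e, rfl⟩ := p.exists_e e
    have hw := (p.isWire_iff (H.tgt e)).1 (p.tgt_e e ▸ hx.1)
    exact ⟨H.tgt e, (p.mem_boundary _ hw).resolve_left fun h => h.2 e rfl, (p.tgt_e e).symm⟩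

/-- An interior wire-vertex is cut into an output and an input of `H`. The output is the
distinguished copy, because the wire that rejoins the two starts there. At inputs of `G` the only
copy is an input, and boxes have only one copy. -/
theorem existsUnique_root (hG : ∀ x, ¬ G.IsIsolated x) (x : G.V) :
    ∃! y, p.v y = x ∧ (y ∈ H.inputs → x ∈ G.inputs) := by
  rcases G.isWire_or_isBox x with hx | hx
  · by_cases hi : x ∈ G.inputs
    · obtain ⟨y, hy, rfl⟩ := p.bijOn_inputs.surjOn ⟨hx, fun h => hG x ⟨hi, h⟩⟩
      refine ⟨y, ⟨rfl, fun _ => hi⟩, fun z ⟨hz, _⟩ => p.bijOn_inputs.injOn ?_ hy hz⟩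
      refine (p.mem_boundary z ((p.isWire_iff z).1 (hz ▸ hx))).resolve_right fun h => ?_
      exact (p.bijOn_outputs.mapsTo h).2 (hz ▸ hi)
    · obtain ⟨y, hy, rfl⟩ := p.bijOn_outputs.surjOn ⟨hx, hi⟩
      refine ⟨y, ⟨rfl, fun h => absurd ⟨h, hy⟩ (H.no_isolated y)⟩, fun z ⟨hz, hz'⟩ => p.bijOn_outputs.injOn ?_ hy hz⟩
      exact (p.mem_boundary z ((p.isWire_iff z).1 (hz ▸ hx))).resolve_left fun h => hi (hz' h)
  · obtain ⟨y, hy, rfl⟩ := p.bijOn_box.surjOn hx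
    refine ⟨y, ⟨rfl, fun h => (not_box_and_wire _ hy h.1).elim⟩, fun z ⟨hz, _⟩ => p.bijOn_box.injOn ?_ hy hz⟩
    rcases H.isWire_or_isBox z with h | h
    · exact (not_box_and_wire _ hx (hz ▸ (p.isWire_iff z).2 h)).elim
    · exact h

/-- Joining the outputs of a cut string graph to its inputs collapses onto the string graph. -/
theorem nonempty_collapse {G : FramedCospan (wordGraph A) (wordGraph B)}
    {H : FramedCospan (wordGraph (A ++ X)) (wordGraph (B ++ X))}
    (p : Explosion H.toTypedGraph G.toTypedGraph {x | G.IsBox x} Set.univ)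
    (hd : ∀ i, p.v (H.d.v ((splitFin A X).symm (Sum.inl i))) = G.d.v i)
    (hc : ∀ i, p.v (H.c.v ((splitFin B X).symm (Sum.inl i))) = G.c.v i)
    (hk : ∀ k, p.v (traceOut H k) = p.v (traceIn H k)) : Nonempty (Collapse H.trace G) := by
  classical
  choose root hr hr' using p.existsUnique_root (G := G.toStringGraph) G.no_isolated
  let pe : H.E ≃ G.E := Equiv.ofBijective p.e ⟨p.e_injective, p.exists_e (G := G.toStringGraph)⟩
  have hpe : ∀ e, p.e (pe.symm e) = e := pe.apply_symm_apply
  refine ⟨{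
    v := p.v
    e := fun e => Sum.inl (pe.symm e)
    e_inj := fun _ _ h => pe.symm.injective (Sum.inl_injective h)
    -- Every contracted wire leads from an output of `H` to an input of `H`, so two ranks suffice.
    rk := fun y => if y ∈ H.inputs then 1 else 0
    root := root
    src_e := fun e => (p.src_e _).symm.trans (congrArg G.src (hpe e))
    tgt_e := fun e => (p.tgt_e _).symm.trans (congrArg G.tgt (hpe e))
    τ_v := p.τ_v
    τ_e := fun e => (p.τ_e _).symm.trans (congrArg G.τ.e (hpe e))
    v_eq := ?_, rk_lt := ?_
    v_root := fun x => (hr x).1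
    root_or := fun y => ?_
    d_v := hd, c_v := hc }⟩
  · rintro (e | k) h
    · exact absurd ⟨pe e, congrArg Sum.inl (pe.symm_apply_apply e)⟩ h
    · exact hk k
  · rintro (e | k) h
    · exact absurd ⟨pe e, congrArg Sum.inl (pe.symm_apply_apply e)⟩ h
    · change (if traceOut H k ∈ H.inputs then 1 else 0) < if traceIn H k ∈ H.inputs then 1 else 0
      rw [if_neg fun h => H.no_isolated _ ⟨h, traceOut_outputs H k⟩, if_pos (traceIn_inputs H k)]
      exact Nat.zero_lt_one
  · by_cases h : y ∈ H.inputs → p.v y ∈ G.inputs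
    · exact Or.inl (hr' (p.v y) y ⟨rfl, h⟩)
    · rw [Classical.not_imp] at h
      obtain ⟨h, h'⟩ := h
      rw [← H.range_d] at h
      obtain ⟨i, rfl⟩ := h
      induction i using splitFin_cases A X with
      | h i => exact absurd (hd i ▸ (G.d_in i).2 rfl) h'
      | h' k => exact Or.inr ⟨Sum.inr k, fun ⟨_, h⟩ => (by cases h), rfl⟩

end Explosion

end explosion

/-- The word `X` enumerates the interior wire-vertices of `G`. Each of them is at once an output and
an input of the cut graph, so the cut graph can be framed from `A ++ X` to `B ++ X`, and its trace
over `X` collapses onto `G`. -/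
theorem generated (G : FramedCospan (wordGraph A) (wordGraph B)) : Generated G := by
  obtain ⟨A', B', H, hH, ⟨p⟩⟩ := exploded_univ G.toStringGraph
  have := G.finite_V
  have hw : ∀ x : {x // G.IsWire x ∧ x ∉ G.boundary}, ∃ Z, G.τ.v x.1 = Sum.inl Z := fun x => x.2.1
  choose t ht using hw
  obtain ⟨X, f, hf, hft⟩ := exists_word t
  have hX : Set.range (fun k => (f k).1) = {x | G.IsWire x ∧ x ∉ G.boundary} := by
    refine (hf.surjective.range_comp Subtype.val).trans (Set.ext fun x => ⟨?_, fun h => ⟨⟨x, h⟩, rfl⟩⟩)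
    rintro ⟨y, rfl⟩
    exact y.2
  have hfi : Function.Injective (fun k => (f k).1) := Subtype.val_injective.comp hf.injective
  -- The wire-vertices that are not outputs are the inputs of `G` and the interior ones, because no
  -- wire-vertex is isolated.
  obtain ⟨d, hdi, hdr, hdv⟩ := p.bijOn_inputs.exists_frame (A := A) (X := X) (g := G.d.v) G.d_injective hfi
    (fun i k h => (f k).2.2 (h ▸ Or.inl ((G.d_in i).2 rfl))) (by
      refine (congrArg₂ _ G.range_d hX).trans (Set.ext fun x => ?_)
      have h1 : ¬ (x ∈ G.inputs ∧ x ∈ G.outputs) := G.no_isolated x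
      have h2 : x ∈ G.inputs → G.IsWire x := And.left
      change _ ∨ (G.IsWire x ∧ ¬ (_ ∨ _)) ↔ G.IsWire x ∧ ¬ _
      tauto)
  obtain ⟨c, hci, hcr, hcv⟩ := p.bijOn_outputs.exists_frame (A := B) (X := X) (g := G.c.v) G.c_injective hfi
    (fun i k h => (f k).2.2 (h ▸ Or.inr ((G.c_out i).2 rfl))) (by
      refine (congrArg₂ _ G.range_c hX).trans (Set.ext fun x => ?_)
      have h1 : ¬ (x ∈ G.inputs ∧ x ∈ G.outputs) := G.no_isolated x
      have h2 : x ∈ G.outputs → G.IsWire x := And.left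
      change _ ∨ (G.IsWire x ∧ ¬ (_ ∨ _)) ↔ G.IsWire x ∧ ¬ _
      tauto)
  have hft' : ∀ k, G.τ.v (f k).1 = Sum.inl (X.get k) := fun k => (ht (f k)).trans (congrArg Sum.inl (hft k))
  have hd : ∀ i, H.τ.v (d i) = Sum.inl ((A ++ X).get i) := fun i => by
    obtain ⟨s, rfl⟩ := (splitFin A X).symm.surjective i
    refine (p.τ_v _).symm.trans ((congrArg G.τ.v (hdv s)).trans ?_)
    rw [get_splitFin_symm]
    rcases s with i | k
    exacts [G.d.τ_v i, hft' k]
  have hc : ∀ i, H.τ.v (c i) = Sum.inl ((B ++ X).get i) := fun i => by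
    obtain ⟨s, rfl⟩ := (splitFin B X).symm.surjective i
    refine (p.τ_v _).symm.trans ((congrArg G.τ.v (hcv s)).trans ?_)
    rw [get_splitFin_symm]
    rcases s with i | k
    exacts [G.c.τ_v i, hft' k]
  obtain ⟨φ⟩ := Explosion.nonempty_collapse (G := G)
    (H := ofWords H.toStringGraph d c hd hc hdi hci hdr hcr H.no_isolated) p
    (fun i => hdv (Sum.inl i)) (fun i => hcv (Sum.inl i)) (fun k => (hcv (Sum.inr k)).trans (hdv (Sum.inr k)).symm)
  exact .congr φ.mk_eq (hH.reframe d c hd hc hdi hci hdr hcr).trace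

end FramedCospan


/-! ## The universal property -/

theorem StrictTracedFunctor.ext_of_cast {C : Type u₁} [TracedStruct.{u₁, v₁} C] {D : Type u₂}
    [TracedStruct.{u₂, v₂} D] {E E' : StrictTracedFunctor C D} (hobj : ∀ A, E.obj A = E'.obj A)
    (hmap : ∀ {A B : C} (f : A ⟶ B), (E.map f).cast (hobj A) (hobj B) = E'.map f) : E = E' := by
  obtain ⟨⟨o, m⟩, _⟩ := E
  obtain ⟨⟨o', m'⟩, _⟩ := E'
  obtain rfl : o = o' := funext hobj
  obtain rfl : @m = @m' := by
    funext A B f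
    exact hmap f
  rfl

theorem StrictTracedFunctor.mk_cast_map_eq_value {T : MonoidalSignature.{u₁, v₁}} {C : Type u}
    [TracedStruct.{u, v} C] [IsStrictSymmetricTraced C] {F : T.Hom (underlyingSignature C)}
    (E : StrictTracedFunctor (FCspPlus T) C) (hE : (FCspPlus.generators T).comp E.underlying = F)
    {A B : FCspPlus T} (G : FramedCospan (wordGraph A) (wordGraph B)) :
    Arr.mk _ _ ((E.map (FCspPlus.mk G)).cast (E.obj_word hE A) (E.obj_word hE B)) = G.value F :=
  (Arr.mk_cast _ _ _).trans (E.map_eq_value hE (FramedCospan.generated G))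

theorem StrictTracedFunctor.eq_valueFunctor {T : MonoidalSignature.{u₁, v₁}} {C : Type u}
    [TracedStruct.{u, v} C] [IsStrictSymmetricTraced C] {F : T.Hom (underlyingSignature C)}
    (E : StrictTracedFunctor (FCspPlus T) C) (hE : (FCspPlus.generators T).comp E.underlying = F) :
    E = FCspPlus.valueFunctor F := by
  refine StrictTracedFunctor.ext_of_cast (E.obj_word hE) ?_
  rintro A B ⟨G⟩
  exact Arr.mk_inj ((E.mk_cast_map_eq_value hE G).trans (FCspPlus.mk_valueMap F G).symm)

theorem mainTheorem1 (T : MonoidalSignature.{u₁, v₁}) :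
    IsStrictSymmetricTraced (FCspPlus T) ∧
    ∀ (C : Type u) [TracedStruct.{u, v} C] [IsStrictSymmetricTraced C]
      (F : T.Hom (underlyingSignature C)),
      (∃! E : StrictTracedFunctor (FCspPlus T) C,
        (FCspPlus.generators T).comp E.underlying = F) ∧
      ∀ (E : StrictTracedFunctor (FCspPlus T) C)
        (hE : (FCspPlus.generators T).comp E.underlying = F) (A B : FCspPlus T)
        (G : FramedCospan (wordGraph A) (wordGraph B)),
        HasNormalForm F G ((E.map (FCspPlus.mk G)).cast (E.obj_word hE A) (E.obj_word hE B)) :=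
  ⟨FCspPlus.isStrictSymmetricTraced T, fun _ _ _ F =>
    ⟨⟨FCspPlus.valueFunctor F, FCspPlus.generators_valueFunctor F, fun E hE => E.eq_valueFunctor hE⟩,
      fun E hE _ _ G => hasNormalForm_of_value F G _ (E.mk_cast_map_eq_value hE G)⟩⟩
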